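/- **Setting.** Let $M$ be a $C^\infty$ Finsler manifold of dimension $n\ge 1$ with compact boundary $\partial M$ ($M$ itself need not be compact), with Finsler metric $\varphi$ (smooth off the zero section, positive, positively $1$-homogeneous, with positive definite fibre Hessian of $\varphi^2/2$). Let $r$ be the geodesic vector field on $TM$ with flow $\Phi$, let $\pi:TM\to M$ be the projection, and let $\Gamma:\partial M\to TM$ be a smooth section pointing to the inside of $M$. Let $V=\{\Phi(t,\Gamma(x)): x\in\partial M,\ t\ge 0,\ (t,\Gamma(x))\in D(\Phi)\}$, parametrized by $(t,x)$, and $F=\pi|_V$; a point $y\in V$ is *focal* if $d_yF$ is singular, and $dF_y(r_y)$ is the vector $y$ itself, seen in $T_{F(y)}M$. For $X\in T_pM\setminus 0$ let $\hat X=\varphi(X)\,d\varphi_X\in T_p^*M$ be its dual one form: $\hat X(X)=\varphi(X)^2$ and $\hat X$ vanishes on the hyperplane tangent at $X$ to $\{\varphi=\varphi(X)\}$. For a subset $S$ of the interior of $M$ let $A(S)\subset TM$ be the union of all integral segments of $r$ with initial point in $\Gamma(\partial M)$ whose projections do not meet $S$. $S$ *splits* $M$ if $\pi$ is a bijection from $A(S)$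 onto $M\setminus S$. Then $R_q$, for $q\notin S$, denotes (the singleton of) the vector of $A(S)$ at $q$, and for $p\in S$, $R_p\subset T_pM$ is the set of all limits of sequences of vectors $R_{q_k}$, with $q_k\in M\setminus S$ and $q_k\to p$. $S$ is a *split locus* if it splits $M$ and $S=\overline{\{p\in S:\ \sharp R_p\ge 2\}}$ (closure in $M$). It is *balanced* if for every $p\in S$ and all sequences $p_k\to p$, $X_k\in R_{p_k}$ such that $X_k\to X_\infty\in R_p$ and the initial velocities $v_{p_k}(p)$ of the unit speed minimizing geodesics from $p_k$ to $p$ converge to $v\in T_pM$, one has $\hat X_\infty(v)=\max\{\hat Y(v): Y\in R_p\}$. A point $p\in S$ is a *cleave point* if $R_p$ consists of exactly two vectors $X^1\ne X^2$, both of which are non-focal points of $V$. Let $\mathcal C$ be the set of cleave points. **Proposition.** Let $S$ be a balanced split locus contained in the interior of $M$. Then $\mathcal C$, with the subspace topology, is a smooth $(n-1)$-dimensional manifold, smoothly immersed in $M$ by the inclusion (hence embedded), and $T_p\mathcal C=\ker(\hat X^1-\hat X^2)$ for every $p\in\mathcal C$ with $R_p=\{X^1,X^2\}$. Locally, let $p\in\mathcal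 C$ with $R_p=\{X^1,X^2\}$, in either order. Then $X^1$ and $X^2$ extend to smooth vector fields on an open neighborhood $U$ of $p$, again denoted $X^1,X^2$, whose values are non-focal vectors of $V$ with $\hat X^1_q\neq\hat X^2_q$ for all $q\in U$, and such that every $q\in S\cap U$ is a cleave point with $R_q=\{X^1_q,X^2_q\}$. If $(\hat X^1-\hat X^2)(X^1)\ne0$ at $p$, then for every smooth hypersurface germ $\Sigma$ through $p$ transversal to $X^1$, after shrinking $\Sigma$, there are $\delta>0$ and a smooth function $h:\Sigma\to(-\delta,\delta)$ such that following the integral curve of $X^1$ from $x\in\Sigma$ for time $t\in(-\delta,\delta)$ defines smooth coordinates $(x,t)\in\Sigma\times(-\delta,\delta)$ on an open neighborhood of $p$ in $U$, in which $\mathcal C$ is the graph $\{t=h(x)\}$. The condition $(\hat X^1-\hat X^2)(X^i)\neq 0$ at $p$ holds for at least one $i\in\{1,2\}$, and for both if $\varphi(\Gamma(x))=1$ for all $x\in\partial M$. -/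

import Mathlib

open Set Filter Topology MeasureTheory
open scoped Manifold ContDiff Bundle

noncomputable section

namespace BalancedSplit

variable {d : ℕ} {M : Type*} [TopologicalSpace M] [ChartedSpace (EuclideanHalfSpace (d + 1)) M]
  [IsManifold (𝓡∂ (d + 1)) ∞ M]

variable (d M) in
/-- A (not necessarily reversible) smooth Finsler metric on a manifold with boundary `M` of
dimension `d + 1`: a function on the tangent bundle, smooth off the zero section, positive off the
zero section, positively `1`-homogeneous on each tangent space, and such that the Hessian of half
its square along each tangent space is positive definite off the origin. -/
structure FinslerMetric where
  toFun : TangentBundle (𝓡∂ (d + 1)) M → ℝ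
  smooth' : ∀ y : TangentBundle (𝓡∂ (d + 1)) M, y.2 ≠ 0 →
    ContMDiffAt (𝓡∂ (d + 1)).tangent 𝓘(ℝ, ℝ) ∞ toFun y
  pos' : ∀ y : TangentBundle (𝓡∂ (d + 1)) M, y.2 ≠ 0 → 0 < toFun y
  homogeneous' : ∀ (a : M) (c : ℝ) (v : TangentSpace (𝓡∂ (d + 1)) a), 0 ≤ c →
    toFun ⟨a, c • v⟩ = c * toFun ⟨a, v⟩
  convex' : ∀ (a : M) (v w : EuclideanSpace ℝ (Fin (d + 1))), v ≠ 0 → w ≠ 0 →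
    0 < iteratedFDeriv ℝ 2
      (fun u : EuclideanSpace ℝ (Fin (d + 1)) ↦ toFun ⟨a, u⟩ ^ 2 / 2) v ![w, w]

/-- The dual one form `φ(V) dφ_V` of a tangent vector `V`. For `V ≠ 0` it is the unique covector
that takes the value `φ(V) ^ 2` at `V` and vanishes on the hyperplane tangent at `V` to the level
set of `φ` through `V` in the tangent space. -/
def FinslerMetric.dual (φ : FinslerMetric d M) {a : M} (V : TangentSpace (𝓡∂ (d + 1)) a) :
    TangentSpace (𝓡∂ (d + 1)) a →L[ℝ] ℝ :=
  φ.toFun ⟨a, V⟩ •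
    fderiv ℝ (fun u : EuclideanSpace ℝ (Fin (d + 1)) ↦ φ.toFun ⟨a, u⟩) V

/-- The Lagrangian `φ ^ 2 / 2`, read in the chart of the tangent bundle around `y`: the first
variable is the position, the second one the velocity. -/
def FinslerMetric.lagrangian (φ : FinslerMetric d M) (y : TangentBundle (𝓡∂ (d + 1)) M)
    (x v : EuclideanSpace ℝ (Fin (d + 1))) : ℝ :=
  φ.toFun ((extChartAt (𝓡∂ (d + 1)).tangent y).symm (x, v)) ^ 2 / 2

/-- `α` is on the interval `J` an integral curve of the geodesic vector field of `φ` on the tangent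
bundle: the velocity of its projection to `M` is `α` itself, and it solves the Euler-Lagrange
equation `d/dt L_v = L_x` of `L = φ ^ 2 / 2` (so that the geodesics have constant speed). -/
def IsGeodesicOn (φ : FinslerMetric d M) (α : ℝ → TangentBundle (𝓡∂ (d + 1)) M)
    (J : Set ℝ) : Prop :=
  ContinuousOn α J ∧ ∀ t ∈ J,
    let e := extChartAt (𝓡∂ (d + 1)).tangent (α t)
    HasDerivWithinAt (fun s ↦ (e (α s)).1) (e (α t)).2 J t ∧
    HasDerivWithinAt
      (fun s ↦ fderiv ℝ (fun w ↦ φ.lagrangian (α t) (e (α s)).1 w) (e (α s)).2)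
      (fderivWithin ℝ (fun x ↦ φ.lagrangian (α t) x (e (α t)).2) (range (𝓡∂ (d + 1)))
        (e (α t)).1) J t

/-- The length of a curve parametrized by `[0, 1]`. -/
def FinslerMetric.length (φ : FinslerMetric d M) (c : ℝ → M) : ℝ :=
  ∫ t in (0 : ℝ)..1, φ.toFun ⟨c t, mfderivWithin 𝓘(ℝ, ℝ) (𝓡∂ (d + 1)) c (Icc 0 1) t (1 : ℝ)⟩

/-- `v` is the initial velocity of a unit speed minimizing geodesic from `a` to `b ≠ a`. When `b`
lies in a convex neighborhood of `a` there is exactly one such vector. -/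
def IsDirection (φ : FinslerMetric d M) (a b : M) (v : TangentSpace (𝓡∂ (d + 1)) a) : Prop :=
  φ.toFun ⟨a, v⟩ = 1 ∧
  ∃ ℓ > 0, ∃ α : ℝ → TangentBundle (𝓡∂ (d + 1)) M,
    IsGeodesicOn φ α (Icc 0 ℓ) ∧ α 0 = ⟨a, v⟩ ∧ (α ℓ).proj = b ∧
    ∀ c : ℝ → M, ContMDiffOn 𝓘(ℝ, ℝ) (𝓡∂ (d + 1)) 1 c (Icc 0 1) → c 0 = a → c 1 = b →
      ℓ ≤ φ.length c

/-- `Γ` restricts to a smooth section of the tangent bundle over the boundary that points to the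
inside of `M` (the coordinate that is nonnegative on the half space has positive derivative along
`Γ`). The values of `Γ` off the boundary are irrelevant. -/
def IsInwardField (Γ : (x : M) → TangentSpace (𝓡∂ (d + 1)) x) : Prop :=
  ContMDiffOn (𝓡∂ (d + 1)) (𝓡∂ (d + 1)).tangent ∞
    (fun x ↦ (⟨x, Γ x⟩ : TangentBundle (𝓡∂ (d + 1)) M)) ((𝓡∂ (d + 1)).boundary M) ∧
  ∀ x ∈ (𝓡∂ (d + 1)).boundary M, 0 < (show EuclideanSpace ℝ (Fin (d + 1)) from Γ x) 0

variable (φ : FinslerMetric d M) (Γ : (x : M) → TangentSpace (𝓡∂ (d + 1)) x)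

/-- `α` is on `[0, T]` the integral segment of the geodesic vector field that starts at `Γ x`,
where `x` is a boundary point. -/
def IsRay (x : M) (T : ℝ) (α : ℝ → TangentBundle (𝓡∂ (d + 1)) M) : Prop :=
  x ∈ (𝓡∂ (d + 1)).boundary M ∧ 0 ≤ T ∧ IsGeodesicOn φ α (Icc 0 T) ∧ α 0 = ⟨x, Γ x⟩

/-- The pairs `(x, t)` that parametrize the set `V` of the vectors `Φ(t, Γ x)`, where `Φ` is the
geodesic flow, `x` a boundary point and `t ≥ 0`. -/
def rayDomain : Set (M × ℝ) := {z | ∃ α, IsRay φ Γ z.1 z.2 α}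

open Classical in
/-- The vector `Φ(t, Γ x)` for `(x, t)` in `rayDomain`, and the junk value `Γ x` elsewhere. -/
def rayFlow (x : M) (t : ℝ) : TangentBundle (𝓡∂ (d + 1)) M :=
  if h : ∃ α, IsRay φ Γ x t α then h.choose t else ⟨x, Γ x⟩

/-- The parametrization of the boundary by `ℝᵈ` given by the chart of `M` around `x`. -/
def boundaryParam (x : M) (u : EuclideanSpace ℝ (Fin d)) : M :=
  (extChartAt (𝓡∂ (d + 1)) x).symm (WithLp.toLp 2 (Fin.cons 0 fun i ↦ u i))

/-- The coordinates of `x` for `boundaryParam x`. -/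
def boundaryCoord (x : M) : EuclideanSpace ℝ (Fin d) :=
  WithLp.toLp 2 fun i ↦ extChartAt (𝓡∂ (d + 1)) x x i.succ

/-- `y` is a vector of `V` that is not focal: `y = Φ(T, Γ x)` and the differential at `y` of
`F : V → M`, `Φ(t, Γ x) ↦ π (Φ(t, Γ x))`, is non-singular. The differential is computed in the
coordinates `(u, t)` of `V`, where `u` are the boundary coordinates around `x`. Along the second
coordinate the geodesic vector field is the coordinate field, and `dF` maps it to `y` itself. -/
def IsNonfocal (y : TangentBundle (𝓡∂ (d + 1)) M) : Prop :=
  ∃ (x : M) (T : ℝ), (x, T) ∈ rayDomain φ Γ ∧ rayFlow φ Γ x T = y ∧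
    let f : EuclideanSpace ℝ (Fin d) × ℝ → M := fun z ↦ (rayFlow φ Γ (boundaryParam x z.1) z.2).proj
    ∃ L, HasMFDerivWithinAt 𝓘(ℝ, EuclideanSpace ℝ (Fin d) × ℝ) (𝓡∂ (d + 1)) f
        {z | (boundaryParam x z.1, z.2) ∈ rayDomain φ Γ} (boundaryCoord x, T) L ∧
      Function.Bijective L

variable (S : Set M)

/-- The set `A(S)`: the union of all integral segments of the geodesic vector field that start in
`Γ` and whose projections to `M` do not meet `S`. -/
def raysOff : Set (TangentBundle (𝓡∂ (d + 1)) M) :=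
  {y | ∃ x T α, IsRay φ Γ x T α ∧ (∀ t ∈ Icc 0 T, (α t).proj ∉ S) ∧ α T = y}

/-- `S` splits `M`: the projection is a bijection from `A(S)` onto the complement of `S`. -/
def Splits : Prop :=
  BijOn (fun y : TangentBundle (𝓡∂ (d + 1)) M ↦ y.proj) (raysOff φ Γ S) Sᶜ

open Classical in
/-- The set `R_p`. If `p ∉ S`, it consists of the vectors of `A(S)` at `p` (just one, if `S`
splits). If `p ∈ S`, it is the set of limits of vectors `R_q`, `q ∉ S`. -/
def limitSet (p : M) : Set (TangentSpace (𝓡∂ (d + 1)) p) :=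
  if p ∈ S then
    {X | ∃ y : ℕ → TangentBundle (𝓡∂ (d + 1)) M,
      (∀ k, y k ∈ raysOff φ Γ S) ∧ Tendsto y atTop (𝓝 ⟨p, X⟩)}
  else {X | (⟨p, X⟩ : TangentBundle (𝓡∂ (d + 1)) M) ∈ raysOff φ Γ S}

/-- A split locus: `S` splits `M` and is the closure of its points with at least two limit
vectors. -/
def IsSplitLocus : Prop :=
  Splits φ Γ S ∧ S = closure {p ∈ S | (limitSet φ Γ S p).Nontrivial}

/-- `S` is balanced at each of its points `p`: if `pₙ → p`, the directions from `pₙ` to `p`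
converge to `v` and `Xₙ ∈ R_{pₙ}` converge to `X ∈ R_p`, then the dual of `X` realizes the maximum
at `v` among the duals of the vectors of `R_p`. -/
def IsBalanced : Prop :=
  ∀ p ∈ S, ∀ (q : ℕ → M) (v X : ∀ n, TangentSpace (𝓡∂ (d + 1)) (q n))
    (v' X' : TangentSpace (𝓡∂ (d + 1)) p),
    Tendsto q atTop (𝓝 p) →
    (∀ n, IsDirection φ (q n) p (v n)) →
    (∀ n, X n ∈ limitSet φ Γ S (q n)) →
    Tendsto (fun n ↦ (⟨q n, v n⟩ : TangentBundle (𝓡∂ (d + 1)) M)) atTop (𝓝 ⟨p, v'⟩) →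
    Tendsto (fun n ↦ (⟨q n, X n⟩ : TangentBundle (𝓡∂ (d + 1)) M)) atTop (𝓝 ⟨p, X'⟩) →
    X' ∈ limitSet φ Γ S p →
    IsGreatest ((fun Y ↦ φ.dual Y v') '' limitSet φ Γ S p) (φ.dual X' v')

/-- `p` is a point of `S` at which `R_p` consists of two non-focal vectors `X₁ ≠ X₂`. -/
def IsCleavePair (p : M) (X₁ X₂ : TangentSpace (𝓡∂ (d + 1)) p) : Prop :=
  p ∈ S ∧ X₁ ≠ X₂ ∧ limitSet φ Γ S p = {X₁, X₂} ∧
    IsNonfocal φ Γ ⟨p, X₁⟩ ∧ IsNonfocal φ Γ ⟨p, X₂⟩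

/-- The set of cleave points. -/
def cleaveSet : Set M := {p | ∃ X₁ X₂, IsCleavePair φ Γ S p X₁ X₂}

/-- Near `σ 0`, the set `C` is a smooth graph `t = h(u)` in the coordinates `(u, t)` that assign to
`(u, t)` the point reached at time `t` by the integral curve of `Y` starting at the point `σ u` of
the hypersurface parametrized by `σ`. The coordinate domain is a cube inside `U`. -/
def IsFlowGraph (C U : Set M) (Y : (q : M) → TangentSpace (𝓡∂ (d + 1)) q)
    (σ : EuclideanSpace ℝ (Fin d) → M) : Prop :=
  ∃ (W : Set (EuclideanSpace ℝ (Fin d))) (δ : ℝ)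
    (Ψ : OpenPartialHomeomorph (EuclideanSpace ℝ (Fin d) × ℝ) M)
    (h : EuclideanSpace ℝ (Fin d) → ℝ),
    IsOpen W ∧ 0 ∈ W ∧ 0 < δ ∧ Ψ.source = W ×ˢ Ioo (-δ) δ ∧ Ψ.target ⊆ U ∧
    ContMDiffOn 𝓘(ℝ, EuclideanSpace ℝ (Fin d) × ℝ) (𝓡∂ (d + 1)) ∞ Ψ Ψ.source ∧
    ContMDiffOn (𝓡∂ (d + 1)) 𝓘(ℝ, EuclideanSpace ℝ (Fin d) × ℝ) ∞ Ψ.symm Ψ.target ∧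
    (∀ u ∈ W, Ψ (u, 0) = σ u) ∧
    (∀ u ∈ W, IsMIntegralCurveOn (I := 𝓡∂ (d + 1)) (fun t ↦ Ψ (u, t)) Y (Ioo (-δ) δ)) ∧
    ContDiffOn ℝ ∞ h W ∧ MapsTo h W (Ioo (-δ) δ) ∧
    C ∩ Ψ.target = (fun u ↦ Ψ (u, h u)) '' W

end BalancedSplit

end

/-!
Why the theorem is true.

*Rays.* The geodesic equation is solved in charts of the tangent bundle by smooth local flows. At the
boundary the rays that start in `Γ` are parametrized by a collar (`exists_collar`), so that the
vectors `Φ(t, Γ x)` depend smoothly on `(x, t)` along every ray that stays over the interior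
(`IsRay.exists_isRegularSet`). Around a non-focal vector that is a limit of vectors of `A(S)`, the
projection to `M` is therefore a local diffeomorphism, and the vectors form a *local field*: a smooth
vector field, defined on an open set, whose integral curves are projections of rays
(`exists_isLocalField_of_isNonfocal`).

*Near a cleave point.* The set of limits of vectors of `A(S)` over a compact set is compact, so that
over a neighborhood `U` of a cleave point every vector of `A(S)` belongs to one of the two local
fields `Y₁`, `Y₂` through the limit vectors. The points with several limit vectors are dense in `S`,
hence both fields consist of limit vectors over all of `S ∩ U`
(`IsCleavePair.exists_isCleaveNhd`). The complement of `S` in `U` is thus the disjoint union of the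
two open sets `A₁`, `A₂` of the points at which `Y₁`, respectively `Y₂`, belongs to `A(S)`. As the
earlier vectors of a ray of `A(S)` belong to `A(S)`, going backward along the integral curves of `Y₁`
one does not leave `A₁`.

*The balanced condition.* The minimizing geodesics from the points near `p` to `p` form a smooth
field of directions off `p`: this uses a backward exponential map (`exists_exponential`), the Gauss
lemma (`momentum_variation`) and a calibration (`exists_direction_field`). In a chart, the direction
from `q` to `p` differs little from the direction of `p - q`. By compactness of the directions, the
balanced condition says that at a point `p` of `S ∩ U` the covector `w = Ŷ₁ - Ŷ₂` satisfies
`w (q - p) ≤ o(|q - p|)` for `q` outside `A₂`, and `w (q - p) ≥ -o(|q - p|)` for `q` outside `A₁`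
(`IsBalanced.eventually_le_param`).

*The graph.* Suppose `w Y₁ ≠ 0` at the cleave point and use coordinates along the integral curves of
`Y₁` from a transversal hypersurface. As `A₁` is closed downwards along the vertical lines, `w` is
positive on the vertical direction, so each line passes from `A₁` to `A₂` through exactly one point
of `S`. The two estimates show that the resulting function is differentiable, with the kernel of
`w` as the tangent space to its graph; as `w` is smooth, so is the function
(`IsSeparated.exists_graph`, `IsCleaveNhd.exists_graph`). The function is also the one asked for by
the local statement, and the projections of the graphs along vertical lines are an atlas of the
cleave set.

*Which field.* The Legendre transform is strictly monotone, so `w (Y₁ - Y₂) > 0`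
(`dual_sub_pos`) and `w` cannot vanish on both fields. If `φ (Γ x) = 1` on the boundary, both
fields have norm one, and the strict fundamental inequality gives `w Y₁ > 0 > w Y₂`
(`dual_sub_self_pos`).
-/

namespace BalancedSplit

section ODE

/-! ### Smooth flows of vector fields -/

variable {E : Type*} [NormedAddCommGroup E] [NormedSpace ℝ E]

/-- Grönwall's inequality on both sides of the initial time `0`. -/
lemma norm_le_gronwallBound_abs {u u' : ℝ → E} {K ε δ : ℝ}
    (hu : ∀ s ∈ Ioo (-δ) δ, HasDerivAt u (u' s) s)
    (hb : ∀ s ∈ Ioo (-δ) δ, ‖u' s‖ ≤ K * ‖u s‖ + ε) {t : ℝ} (ht : t ∈ Ioo (-δ) δ) :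
    ‖u t‖ ≤ gronwallBound ‖u 0‖ K ε |t| := by
  rcases le_total 0 t with h0 | h0
  · have hsub : ∀ s ∈ Icc 0 t, s ∈ Ioo (-δ) δ := fun s hs ↦
      ⟨by linarith [hs.1, ht.2, ht.1], by linarith [hs.2, ht.2]⟩
    have := norm_le_gronwallBound_of_norm_deriv_right_le (f := u) (f' := u') (δ := ‖u 0‖) (K := K)
      (ε := ε) (a := 0) (b := t)
      (fun s hs ↦ (hu s (hsub s hs)).continuousAt.continuousWithinAt)
      (fun s hs ↦ (hu s (hsub s (Ico_subset_Icc_self hs))).hasDerivWithinAt) le_rfl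
      (fun s hs ↦ hb s (hsub s (Ico_subset_Icc_self hs))) t ⟨h0, le_rfl⟩
    simpa [abs_of_nonneg h0] using this
  · have hsub : ∀ s ∈ Icc 0 (-t), -s ∈ Ioo (-δ) δ := fun s hs ↦
      ⟨by linarith [hs.2, ht.1], by linarith [hs.1, ht.2, ht.1]⟩
    have hd : ∀ s ∈ Icc 0 (-t), HasDerivAt (fun s ↦ u (-s)) (-(u' (-s))) s := fun s hs ↦ by
      have := (hu (-s) (hsub s hs)).scomp s (hasDerivAt_neg s)
      simpa [Function.comp_def] using this
    have := norm_le_gronwallBound_of_norm_deriv_right_le (f := fun s ↦ u (-s))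
      (f' := fun s ↦ -(u' (-s))) (δ := ‖u 0‖) (K := K)
      (ε := ε) (a := 0) (b := -t)
      (fun s hs ↦ (hd s hs).continuousAt.continuousWithinAt)
      (fun s hs ↦ (hd s (Ico_subset_Icc_self hs)).hasDerivWithinAt) (by simp)
      (fun s hs ↦ by
        simpa using hb (-s) (hsub s (Ico_subset_Icc_self hs))) (-t) ⟨by linarith, le_rfl⟩
    simpa [abs_of_nonpos h0] using this

/-- Uniqueness of integral curves of an autonomous vector field that is Lipschitz on a set,
for curves in that set parametrized by an interval of any kind. -/
lemma eqOn_of_lipschitzOnWith {f : E → E} {s : Set E} {K : NNReal} (hf : LipschitzOnWith K f s)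
    {J : Set ℝ} (hJ : J.OrdConnected) {γ η : ℝ → E}
    (hγ : ∀ t ∈ J, γ t ∈ s ∧ HasDerivWithinAt γ (f (γ t)) J t)
    (hη : ∀ t ∈ J, η t ∈ s ∧ HasDerivWithinAt η (f (η t)) J t) {t₀ : ℝ} (ht₀ : t₀ ∈ J)
    (h : γ t₀ = η t₀) : EqOn γ η J := by
  intro t ht
  rcases le_total t₀ t with hle | hle
  · have hsub : Icc t₀ t ⊆ J := hJ.out ht₀ ht
    have key : ∀ ζ : ℝ → E, (∀ t ∈ J, ζ t ∈ s ∧ HasDerivWithinAt ζ (f (ζ t)) J t) →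
        ∀ r ∈ Ico t₀ t, HasDerivWithinAt ζ (f (ζ r)) (Ici r) r := fun ζ hζ r hr ↦
      ((hζ r (hsub (Ico_subset_Icc_self hr))).2).mono_of_mem_nhdsWithin
        (mem_of_superset (Icc_mem_nhdsGE hr.2)
          ((Icc_subset_Icc_left hr.1).trans hsub))
    exact ODE_solution_unique_of_mem_Icc_right (v := fun _ ↦ f) (s := fun _ ↦ s)
      (fun _ _ ↦ hf) (fun r hr ↦ ((hγ r (hsub hr)).2.continuousWithinAt).mono hsub) (key γ hγ)
      (fun r hr ↦ (hγ r (hsub (Ico_subset_Icc_self hr))).1)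
      (fun r hr ↦ ((hη r (hsub hr)).2.continuousWithinAt).mono hsub) (key η hη)
      (fun r hr ↦ (hη r (hsub (Ico_subset_Icc_self hr))).1) h ⟨hle, le_rfl⟩
  · have hsub : Icc t t₀ ⊆ J := hJ.out ht ht₀
    have key : ∀ ζ : ℝ → E, (∀ t ∈ J, ζ t ∈ s ∧ HasDerivWithinAt ζ (f (ζ t)) J t) →
        ∀ r ∈ Ioc t t₀, HasDerivWithinAt ζ (f (ζ r)) (Iic r) r := fun ζ hζ r hr ↦
      ((hζ r (hsub (Ioc_subset_Icc_self hr))).2).mono_of_mem_nhdsWithin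
        (mem_of_superset (Icc_mem_nhdsLE hr.1)
          ((Icc_subset_Icc_right hr.2).trans hsub))
    exact ODE_solution_unique_of_mem_Icc_left (v := fun _ ↦ f) (s := fun _ ↦ s)
      (fun _ _ ↦ hf) (fun r hr ↦ ((hγ r (hsub hr)).2.continuousWithinAt).mono hsub) (key γ hγ)
      (fun r hr ↦ (hγ r (hsub (Ioc_subset_Icc_self hr))).1)
      (fun r hr ↦ ((hη r (hsub hr)).2.continuousWithinAt).mono hsub) (key η hη)
      (fun r hr ↦ (hη r (hsub (Ioc_subset_Icc_self hr))).1) h ⟨le_rfl, hle⟩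

/-- On a preconnected set a property that propagates locally in both directions propagates. -/
lemma propagate_of_preconnected {X : Type*} [TopologicalSpace X] {s : Set X}
    (hs : IsPreconnected s) {P : X → Prop}
    (h : ∀ x ∈ s, ∃ U ∈ 𝓝[s] x, ∀ y ∈ U, ∀ z ∈ U, P y → P z) {x y : X} (hx : x ∈ s) (hy : y ∈ s)
    (hP : P x) : P y := by
  have key := hs.induction₂' (fun a b ↦ (P a → P b)) (fun a ha ↦ by
    obtain ⟨U, hU, hUP⟩ := h a ha
    have haU := mem_of_mem_nhdsWithin ha hU
    filter_upwards [hU] with b hb using ⟨hUP a haU b hb, hUP b hb a haU⟩)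
    (fun a b c _ _ _ hab hbc h ↦ hbc (hab h)) hx hy
  exact key hP

/-- Uniqueness of integral curves of an autonomous vector field that is locally Lipschitz on the
set where the curves live. -/
lemma eqOn_of_locally_lipschitz {f : E → E} {s : Set E}
    (hf : ∀ x ∈ s, ∃ K, ∃ U ∈ 𝓝[s] x, LipschitzOnWith K f U)
    {J : Set ℝ} (hJ : J.OrdConnected) {γ η : ℝ → E}
    (hγ : ∀ t ∈ J, γ t ∈ s ∧ HasDerivWithinAt γ (f (γ t)) J t)
    (hη : ∀ t ∈ J, η t ∈ s ∧ HasDerivWithinAt η (f (η t)) J t) {t₀ : ℝ} (ht₀ : t₀ ∈ J)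
    (h : γ t₀ = η t₀) : EqOn γ η J := by
  intro t ht
  -- the set where the curves agree is closed, so only points of agreement matter below
  have hcl : ∀ r ∈ J, (∃ᶠ r' in 𝓝[J] r, γ r' = η r') → γ r = η r := by
    intro r hr hfr
    have h1 := (hγ r hr).2.continuousWithinAt
    have h2 := (hη r hr).2.continuousWithinAt
    by_contra hne
    exact hfr ((h1.prodMk h2).eventually (isClosed_diagonal.isOpen_compl.mem_nhds
      (show (γ r, η r) ∈ (diagonal E)ᶜ from hne)))
  refine propagate_of_preconnected (P := fun r ↦ γ r = η r) hJ.isPreconnected ?_ ht₀ ht h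
  intro r hr
  by_cases hagree : γ r = η r
  · obtain ⟨K, U, hU, hK⟩ := hf (γ r) (hγ r hr).1
    have hwithin : ∀ ζ : ℝ → E, ζ r = γ r → (∀ t ∈ J, ζ t ∈ s ∧ HasDerivWithinAt ζ (f (ζ t)) J t) →
        ∀ᶠ r' in 𝓝[J] r, ζ r' ∈ U := fun ζ hζr hζ ↦ by
      have h1 := (hζ r hr).2.continuousWithinAt
      have : Tendsto ζ (𝓝[J] r) (𝓝[s] (ζ r)) :=
        tendsto_nhdsWithin_iff.2 ⟨h1, eventually_mem_nhdsWithin.mono fun x hx ↦ (hζ x hx).1⟩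
      rw [hζr] at this
      exact this hU
    obtain ⟨ε, hε, hball⟩ := Metric.mem_nhdsWithin_iff.1
      ((hwithin γ rfl hγ).and (hwithin η hagree.symm hη))
    refine ⟨Metric.ball r ε ∩ J, inter_comm J _ ▸ inter_mem_nhdsWithin J
        (Metric.ball_mem_nhds r hε), fun y hy z hz hyP ↦ ?_⟩
    have hJ' : (Metric.ball r ε ∩ J).OrdConnected :=
      ((convex_ball r ε).ordConnected).inter hJ
    exact eqOn_of_lipschitzOnWith hK hJ'
      (fun t ht ↦ ⟨(hball ht).1, (hγ t ht.2).2.mono inter_subset_right⟩)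
      (fun t ht ↦ ⟨(hball ht).2, (hη t ht.2).2.mono inter_subset_right⟩) hy hyP hz
  · have : ∀ᶠ r' in 𝓝[J] r, γ r' ≠ η r' := by
      by_contra hc
      exact hagree (hcl r hr hc)
    exact ⟨_, this, fun y hy z _ hyP ↦ absurd hyP hy⟩

/-- The vector field is locally Lipschitz on an open set where it is `C¹`. -/
lemma locally_lipschitz_of_contDiffOn {f : E → E} {s : Set E} (hs : IsOpen s)
    (hf : ContDiffOn ℝ ∞ f s) : ∀ x ∈ s, ∃ K, ∃ U ∈ 𝓝[s] x, LipschitzOnWith K f U := by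
  intro x hx
  obtain ⟨K, t, ht, hK⟩ := ((hf.contDiffAt (hs.mem_nhds hx)).of_le
    (by norm_cast : (1 : WithTop ℕ∞) ≤ ∞)).exists_lipschitzOnWith
  exact ⟨K, t, mem_nhdsWithin_of_mem_nhds ht, hK⟩

/-- The derivative of a flow with respect to the initial point solves the variational equation:
if `A` solves it along `Φ x` with `A 0 = id`, then `A t` is the derivative of `Φ · t` at `x`. The
curves are assumed to stay in a convex set where `f'` is bounded and Lipschitz. -/
lemma hasFDerivAt_flow {f : E → E} {f' : E → E →L[ℝ] E} {B : Set E} (hB : Convex ℝ B)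
    {K K₂ : NNReal} (hf' : ∀ z ∈ B, HasFDerivAt f (f' z) z) (hK : ∀ z ∈ B, ‖f' z‖ ≤ K)
    (hK₂ : LipschitzOnWith K₂ f' B) {δ : ℝ} {Φ : E → ℝ → E} {x : E} {A : ℝ → E →L[ℝ] E}
    (hΦ : ∀ᶠ y in 𝓝 x, Φ y 0 = y ∧
      ∀ t ∈ Ioo (-δ) δ, Φ y t ∈ B ∧ HasDerivAt (Φ y) (f (Φ y t)) t)
    (hA₀ : A 0 = ContinuousLinearMap.id ℝ E)
    (hA : ∀ t ∈ Ioo (-δ) δ, HasDerivAt A ((f' (Φ x t)).comp (A t)) t)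
    {t : ℝ} (ht : t ∈ Ioo (-δ) δ) : HasFDerivAt (fun y ↦ Φ y t) (A t) x := by
  have hKf : LipschitzOnWith K f B :=
    hB.lipschitzOnWith_of_nnnorm_hasFDerivWithin_le (fun z hz ↦ (hf' z hz).hasFDerivWithinAt) hK
  have hx := hΦ.self_of_nhds
  set M : ℝ := Real.exp (K * δ) with hM
  have hδ : 0 < δ := by linarith [ht.1, ht.2]
  have h0 : (0 : ℝ) ∈ Ioo (-δ) δ := ⟨by linarith, hδ⟩
  set C : ℝ := gronwallBound 0 K 1 |t| * (K₂ * M ^ 2) with hC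
  suffices hq : ∀ᶠ y in 𝓝 x, ‖Φ y t - Φ x t - A t (y - x)‖ ≤ C * ‖y - x‖ ^ 2 by
    have hO : (fun y ↦ Φ y t - Φ x t - A t (y - x)) =O[𝓝 x] fun y ↦ ‖y - x‖ ^ 2 :=
      Asymptotics.IsBigO.of_bound C (by simpa using hq)
    have h1 : HasFDerivAt (fun y ↦ Φ y t - Φ x t - A t (y - x)) (0 : E →L[ℝ] E) x :=
      hO.hasFDerivAt (by norm_num)
    have h2 : HasFDerivAt (fun y ↦ A t (y - x)) (A t) x := by
      simpa using (A t).hasFDerivAt.sub_const (A t x)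
    have h3 := (h1.add h2).add_const (Φ x t)
    simpa using h3
  filter_upwards [hΦ] with y hy
  -- the trajectories spread at most exponentially
  have hspread : ∀ s ∈ Ioo (-δ) δ, ‖Φ y s - Φ x s‖ ≤ M * ‖y - x‖ := by
    intro s hs
    have := norm_le_gronwallBound_abs (u := fun s ↦ Φ y s - Φ x s)
      (u' := fun s ↦ f (Φ y s) - f (Φ x s)) (K := K) (ε := 0) (δ := δ)
      (fun s hs ↦ (hy.2 s hs).2.sub (hx.2 s hs).2)
      (fun s hs ↦ by
        simpa using hKf.norm_sub_le (hy.2 s hs).1 (hx.2 s hs).1) hs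
    rw [gronwallBound_ε0, hy.1, hx.1, mul_comm] at this
    refine this.trans ?_
    exact mul_le_mul_of_nonneg_right (Real.exp_le_exp.2
      (mul_le_mul_of_nonneg_left (abs_lt.2 hs).le K.2)) (norm_nonneg _)
  have hw := norm_le_gronwallBound_abs (u := fun s ↦ Φ y s - Φ x s - A s (y - x))
      (u' := fun s ↦ f (Φ y s) - f (Φ x s) - (f' (Φ x s)) (A s (y - x))) (K := K)
      (ε := K₂ * M ^ 2 * ‖y - x‖ ^ 2) (δ := δ)
      (fun s hs ↦ ((hy.2 s hs).2.sub (hx.2 s hs).2).sub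
        (by simpa using (hA s hs).clm_apply (hasDerivAt_const s (y - x))))
      (fun s hs ↦ by
        have hyB := (hy.2 s hs).1
        have hxB := (hx.2 s hs).1
        have hseg := hB.segment_subset hxB hyB
        have hT : ‖f (Φ y s) - f (Φ x s) - f' (Φ x s) (Φ y s - Φ x s)‖ ≤
            (K₂ * ‖Φ y s - Φ x s‖) * ‖Φ y s - Φ x s‖ := by
          refine (convex_segment (Φ x s) (Φ y s)).norm_image_sub_le_of_norm_hasFDerivWithin_le'
            (fun z hz ↦ (hf' z (hseg hz)).hasFDerivWithinAt) (fun z hz ↦ ?_)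
            (left_mem_segment ℝ _ _) (right_mem_segment ℝ _ _)
          refine (hK₂.norm_sub_le (hseg hz) hxB).trans ?_
          gcongr
          obtain ⟨a, ha, rfl⟩ := (segment_eq_image' ℝ (Φ x s) (Φ y s) ▸ hz)
          simp only [add_sub_cancel_left, norm_smul, Real.norm_eq_abs, abs_of_nonneg ha.1]
          exact mul_le_of_le_one_left (norm_nonneg _) ha.2
        have hsp := hspread s hs
        calc ‖f (Φ y s) - f (Φ x s) - (f' (Φ x s)) (A s (y - x))‖
            = ‖(f (Φ y s) - f (Φ x s) - f' (Φ x s) (Φ y s - Φ x s)) +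
                f' (Φ x s) (Φ y s - Φ x s - A s (y - x))‖ := by
              congr 1; simp only [map_sub]; abel
          _ ≤ (K₂ * ‖Φ y s - Φ x s‖) * ‖Φ y s - Φ x s‖ +
                K * ‖Φ y s - Φ x s - A s (y - x)‖ := by
              refine (norm_add_le _ _).trans (add_le_add hT ?_)
              exact ((f' (Φ x s)).le_opNorm _).trans
                (mul_le_mul_of_nonneg_right (hK _ hxB) (norm_nonneg _))
          _ ≤ (K₂ * (M * ‖y - x‖)) * (M * ‖y - x‖) +
                K * ‖Φ y s - Φ x s - A s (y - x)‖ := by gcongr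
          _ = K * ‖Φ y s - Φ x s - A s (y - x)‖ + K₂ * M ^ 2 * ‖y - x‖ ^ 2 := by ring) ht
  have hlin : ∀ ε : ℝ, gronwallBound 0 K ε |t| = gronwallBound 0 K 1 |t| * ε := by
    intro ε
    by_cases hK0 : (K : ℝ) = 0
    · simp [gronwallBound, hK0, mul_comm]
    · simp only [gronwallBound, hK0, if_false]; ring
  have h00 : Φ y 0 - Φ x 0 - A 0 (y - x) = 0 := by simp [hy.1, hx.1, hA₀]
  rw [h00, norm_zero, hlin] at hw
  rw [hC]
  linarith

universe u in
/-- Local flows that are `C^n`, by induction on `n`: the derivative of the flow with respect to the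
initial point is a component of the flow of the first prolongation of the vector field. -/
lemma exists_flow_contDiffOn_nat (n : ℕ) : ∀ {E : Type u} [NormedAddCommGroup E] [NormedSpace ℝ E]
    [CompleteSpace E] {f : E → E} {Ω : Set E} (_ : IsOpen Ω) (_ : ContDiffOn ℝ ∞ f Ω) {x₀ : E}
    (_ : x₀ ∈ Ω), ∃ δ > 0, ∃ N : Set E, IsOpen N ∧ x₀ ∈ N ∧ ∃ Φ : E → ℝ → E,
      (∀ x ∈ N, Φ x 0 = x ∧ ∀ t ∈ Ioo (-δ) δ, Φ x t ∈ Ω ∧ HasDerivAt (Φ x) (f (Φ x t)) t) ∧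
      ContDiffOn ℝ n (Function.uncurry Φ) (N ×ˢ Ioo (-δ) δ) := by
  induction n with
  | zero =>
    intro E _ _ _ f Ω hΩ hf x₀ hx₀
    obtain ⟨ε, hε, a, r, L, K, hr, hpl⟩ := IsPicardLindelof.of_contDiffAt_one
      ((hf.contDiffAt (hΩ.mem_nhds hx₀)).of_le (by norm_cast : (1 : WithTop ℕ∞) ≤ ∞))
    obtain ⟨α, hα, hαc⟩ :=
      (hpl 0).exists_forall_mem_closedBall_eq_hasDerivWithinAt_continuousOn
    simp only [zero_sub, zero_add] at hα hαc
    have hr' : (0 : ℝ) < r := hr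
    have hnhds : Metric.closedBall x₀ (r : ℝ) ×ˢ Icc (-ε) ε ∈ 𝓝 (x₀, (0 : ℝ)) :=
      prod_mem_nhds (Metric.closedBall_mem_nhds x₀ hr') (Icc_mem_nhds (by linarith) hε)
    have hpre : ∀ᶠ z in 𝓝 (x₀, (0 : ℝ)), α z ∈ Ω := by
      refine (hαc.continuousAt hnhds).eventually_mem (hΩ.mem_nhds ?_)
      rw [(hα x₀ (Metric.mem_closedBall_self hr'.le)).1]; exact hx₀
    obtain ⟨N, hN, V, hV, hNV⟩ := mem_nhds_prod_iff.1 (inter_mem hpre hnhds)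
    obtain ⟨δ, hδ, hδV⟩ := Metric.mem_nhds_iff.1 hV
    rw [Real.ball_eq_Ioo, zero_sub, zero_add] at hδV
    have hsub : ∀ x ∈ interior N, ∀ t ∈ Ioo (-δ) δ,
        α (x, t) ∈ Ω ∧ x ∈ Metric.closedBall x₀ (r : ℝ) ∧ t ∈ Icc (-ε) ε := fun x hx t ht ↦
      hNV (mk_mem_prod (interior_subset hx) (hδV ht))
    have h00 : (0 : ℝ) ∈ Ioo (-δ) δ := ⟨by linarith, hδ⟩
    refine ⟨min δ ε, lt_min hδ hε, interior N, isOpen_interior, mem_interior_iff_mem_nhds.2 hN,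
      fun x t ↦ α (x, t), fun x hx ↦ ⟨(hα x (hsub x hx 0 h00).2.1).1, fun t ht ↦ ?_⟩, ?_⟩
    · have ht' : t ∈ Ioo (-δ) δ :=
        ⟨by linarith [ht.1, min_le_left δ ε], lt_of_lt_of_le ht.2 (min_le_left _ _)⟩
      obtain ⟨h1, h2, h3⟩ := hsub x hx t ht'
      refine ⟨h1, ((hα x h2).2 t h3).hasDerivAt (Icc_mem_nhds ?_ ?_)⟩
      · linarith [ht.1, min_le_right δ ε]
      · exact lt_of_lt_of_le ht.2 (min_le_right _ _)
    · rw [Nat.cast_zero, contDiffOn_zero]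
      refine hαc.mono fun z hz ↦ ?_
      have ht' : z.2 ∈ Ioo (-δ) δ :=
        ⟨by linarith [hz.2.1, min_le_left δ ε], lt_of_lt_of_le hz.2.2 (min_le_left _ _)⟩
      exact (hsub z.1 hz.1 z.2 ht').2
  | succ n ih =>
    intro E _ _ _ f Ω hΩ hf x₀ hx₀
    have hf1 : ContDiffOn ℝ ∞ (fderiv ℝ f) Ω := ((contDiffOn_infty_iff_fderiv_of_isOpen hΩ).1 hf).2
    -- a ball where the derivative is bounded and Lipschitz
    obtain ⟨K₂, t, ht, hK₂⟩ := ((hf1.contDiffAt (hΩ.mem_nhds hx₀)).of_le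
      (by norm_cast : (1 : WithTop ℕ∞) ≤ ∞)).exists_lipschitzOnWith
    have hbd : ∀ᶠ z in 𝓝 x₀, ‖fderiv ℝ f z‖ < ‖fderiv ℝ f x₀‖ + 1 :=
      ((hf1.continuousOn.continuousAt (hΩ.mem_nhds hx₀)).norm).eventually_lt_const (by linarith)
    obtain ⟨ρ, hρ, hρs⟩ := Metric.mem_nhds_iff.1 (inter_mem (inter_mem ht hbd) (hΩ.mem_nhds hx₀))
    set B := Metric.ball x₀ ρ with hBdef
    let F : E × (E →L[ℝ] E) → E × (E →L[ℝ] E) := fun z ↦ (f z.1, (fderiv ℝ f z.1).comp z.2)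
    have hBΩ : B ⊆ Ω := fun z hz ↦ (hρs hz).2
    have hF : ContDiffOn ℝ ∞ F (B ×ˢ univ) := by
      have h1 : ContDiffOn ℝ ∞ (fun z : E × (E →L[ℝ] E) ↦ f z.1) (B ×ˢ univ) :=
        hf.comp contDiff_fst.contDiffOn fun z hz ↦ hBΩ hz.1
      have h2 : ContDiffOn ℝ ∞ (fun z : E × (E →L[ℝ] E) ↦ fderiv ℝ f z.1) (B ×ˢ univ) :=
        hf1.comp contDiff_fst.contDiffOn fun z hz ↦ hBΩ hz.1
      exact h1.prodMk (h2.clm_comp contDiff_snd.contDiffOn)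
    obtain ⟨δ, hδ, N, hN, hxN, Ψ, hΨ, hΨc⟩ := ih (Metric.isOpen_ball.prod isOpen_univ) hF
      (x₀ := (x₀, ContinuousLinearMap.id ℝ E)) ⟨Metric.mem_ball_self hρ, mem_univ _⟩
    let ι : E → E × (E →L[ℝ] E) := fun x ↦ (x, ContinuousLinearMap.id ℝ E)
    have hι : ContDiff ℝ ∞ ι := contDiff_id.prodMk contDiff_const
    let Φ : E → ℝ → E := fun x t ↦ (Ψ (ι x) t).1
    let A : E → ℝ → E →L[ℝ] E := fun x t ↦ (Ψ (ι x) t).2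
    have hN' : IsOpen (ι ⁻¹' N) := hN.preimage hι.continuous
    have hΦ : ∀ x ∈ ι ⁻¹' N, Φ x 0 = x ∧ ∀ t ∈ Ioo (-δ) δ, Φ x t ∈ B ∧
        HasDerivAt (Φ x) (f (Φ x t)) t := fun x hx ↦
      ⟨by simp [Φ, (hΨ _ hx).1, ι], fun t ht ↦ ⟨((hΨ _ hx).2 t ht).1.1,
        ((hΨ _ hx).2 t ht).2.fst⟩⟩
    have hΨι : ContDiffOn ℝ n (fun z : E × ℝ ↦ Ψ (ι z.1) z.2) ((ι ⁻¹' N) ×ˢ Ioo (-δ) δ) := by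
      have : ContDiff ℝ n (fun z : E × ℝ ↦ (ι z.1, z.2)) :=
        ((hι.of_le (by exact_mod_cast le_top)).comp contDiff_fst).prodMk contDiff_snd
      exact ContDiffOn.comp (g := Function.uncurry Ψ) (f := fun z : E × ℝ ↦ (ι z.1, z.2)) hΨc
        (this.contDiffOn (s := (ι ⁻¹' N) ×ˢ Ioo (-δ) δ)) fun z hz ↦ ⟨hz.1, hz.2⟩
    have hΦc : ContDiffOn ℝ n (Function.uncurry Φ) ((ι ⁻¹' N) ×ˢ Ioo (-δ) δ) := hΨι.fst
    have hAc : ContDiffOn ℝ n (Function.uncurry A) ((ι ⁻¹' N) ×ˢ Ioo (-δ) δ) := hΨι.snd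
    have hopen : IsOpen ((ι ⁻¹' N) ×ˢ Ioo (-δ) δ) := hN'.prod isOpen_Ioo
    have hspace : ∀ z ∈ (ι ⁻¹' N) ×ˢ Ioo (-δ) δ,
        HasFDerivAt (fun y ↦ Φ y z.2) (A z.1 z.2) z.1 := by
      intro z hz
      refine hasFDerivAt_flow (f := f) (f' := fderiv ℝ f) (convex_ball x₀ ρ)
        (K := ⟨‖fderiv ℝ f x₀‖ + 1, by positivity⟩) (K₂ := K₂) (δ := δ) (fun w hw ↦ ?_)
        (fun w hw ↦ (hρs hw).1.2.le) (hK₂.mono fun w hw ↦ (hρs hw).1.1)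
        (Filter.eventually_of_mem (hN'.mem_nhds hz.1) hΦ) (A := A z.1) ?_ (fun t ht ↦ ?_) hz.2
      · exact ((hf.contDiffAt (hΩ.mem_nhds (hBΩ hw))).differentiableAt (by simp)).hasFDerivAt
      · simp [A, (hΨ _ hz.1).1, ι]
      · exact ((hΨ _ hz.1).2 t ht).2.snd
    let D₂ : E → ℝ → ℝ →L[ℝ] E := fun x t ↦ ContinuousLinearMap.toSpanSingleton ℝ (f (Φ x t))
    have hfΦ : ContDiffOn ℝ n (fun z : E × ℝ ↦ f (Φ z.1 z.2)) ((ι ⁻¹' N) ×ˢ Ioo (-δ) δ) :=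
      (hf.of_le (by exact_mod_cast le_top)).comp hΦc fun z hz ↦ hBΩ ((hΦ _ hz.1).2 _ hz.2).1
    have hD₂ : ContDiffOn ℝ n (Function.uncurry D₂) ((ι ⁻¹' N) ×ˢ Ioo (-δ) δ) :=
      (ContinuousLinearMap.toSpanSingletonCLE (𝕜 := ℝ) (E := E)).contDiff.comp_contDiffOn hfΦ
    refine ⟨δ, hδ, ι ⁻¹' N, hN', hxN, Φ, fun x hx ↦ ⟨(hΦ x hx).1, fun t ht ↦
      ⟨hBΩ ((hΦ x hx).2 t ht).1, ((hΦ x hx).2 t ht).2⟩⟩, ?_⟩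
    have hder : ∀ z ∈ (ι ⁻¹' N) ×ˢ Ioo (-δ) δ, HasFDerivAt (Function.uncurry Φ)
        ((Function.uncurry A z).coprod (Function.uncurry D₂ z)) z := fun z hz ↦
      (hasStrictFDerivAt_uncurry_coprod (f := Φ) (f₁ := A) (f₂ := D₂)
        (Filter.eventually_of_mem (hopen.mem_nhds hz) hspace)
        (Filter.eventually_of_mem (hopen.mem_nhds hz) fun w hw ↦
          ((hΦ w.1 hw.1).2 w.2 hw.2).2.hasFDerivAt)
        (hAc.continuousOn.continuousAt (hopen.mem_nhds hz))
        (hD₂.continuousOn.continuousAt (hopen.mem_nhds hz))).hasFDerivAt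
    rw [Nat.cast_succ, contDiffOn_succ_iff_hasFDerivWithinAt_of_uniqueDiffOn hopen.uniqueDiffOn]
    refine ⟨by simp, fun z ↦ (Function.uncurry A z).coprod (Function.uncurry D₂ z), ?_,
      fun z hz ↦ (hder z hz).hasFDerivWithinAt⟩
    have : ContDiffOn ℝ n (fun z ↦ (Function.uncurry A z).comp (ContinuousLinearMap.fst ℝ E ℝ) +
        (Function.uncurry D₂ z).comp (ContinuousLinearMap.snd ℝ E ℝ))
        ((ι ⁻¹' N) ×ˢ Ioo (-δ) δ) :=
      (hAc.clm_comp contDiffOn_const).add (hD₂.clm_comp contDiffOn_const)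
    refine this.congr fun z hz ↦ ?_
    ext <;> simp

/-- A smooth vector field has a smooth local flow. -/
theorem exists_smooth_flow [CompleteSpace E] {f : E → E} {Ω : Set E} (hΩ : IsOpen Ω)
    (hf : ContDiffOn ℝ ∞ f Ω) {x₀ : E} (hx₀ : x₀ ∈ Ω) :
    ∃ δ > 0, ∃ N : Set E, IsOpen N ∧ x₀ ∈ N ∧ ∃ Φ : E → ℝ → E,
      (∀ x ∈ N, Φ x 0 = x ∧ ∀ t ∈ Ioo (-δ) δ, Φ x t ∈ Ω ∧ HasDerivAt (Φ x) (f (Φ x t)) t) ∧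
      ContDiffOn ℝ ∞ (Function.uncurry Φ) (N ×ˢ Ioo (-δ) δ) := by
  obtain ⟨δ, hδ, N, hN, hxN, Φ, hΦ, hΦc⟩ := exists_flow_contDiffOn_nat 0 hΩ hf hx₀
  refine ⟨δ, hδ, N, hN, hxN, Φ, hΦ, contDiffOn_infty.2 fun n ↦ ?_⟩
  have hopen : IsOpen (N ×ˢ Ioo (-δ) δ) := hN.prod isOpen_Ioo
  have hΦ0 : ContinuousOn (Function.uncurry Φ) (N ×ˢ Ioo (-δ) δ) := hΦc.continuousOn
  have h00 : (0 : ℝ) ∈ Ioo (-δ) δ := ⟨by linarith, hδ⟩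
  have hlip := locally_lipschitz_of_contDiffOn hΩ hf
  -- near every time the flow is the composition of an earlier time map and a `C^n` local flow
  have hlocal : ∀ x ∈ N, ∀ t ∈ Ioo (-δ) δ, ∃ U ∈ 𝓝[Ioo (-δ) δ] t, ∀ r ∈ U, ∀ s ∈ U,
      ContDiffAt ℝ n (fun y ↦ Φ y r) x → ContDiffAt ℝ n (Function.uncurry Φ) (x, s) := by
    intro x hx t ht
    obtain ⟨η, hη, N', hN', hxN', Ψ, hΨ, hΨc⟩ :=
      exists_flow_contDiffOn_nat n hΩ hf ((hΦ x hx).2 t ht).1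
    have hnear : ∀ᶠ r in 𝓝[Ioo (-δ) δ] t, Φ x r ∈ N' :=
      (((hΦ x hx).2 t ht).2.continuousAt.eventually_mem (hN'.mem_nhds hxN')).filter_mono
        nhdsWithin_le_nhds
    refine ⟨Ioo (-δ) δ ∩ {r | Φ x r ∈ N'} ∩ Metric.ball t (η / 2),
      inter_mem (inter_mem self_mem_nhdsWithin hnear)
        (mem_nhdsWithin_of_mem_nhds (Metric.ball_mem_nhds t (by positivity))), ?_⟩
    rintro r ⟨⟨hr, hrN⟩, hrt⟩ s ⟨⟨hs, -⟩, hst⟩ hC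
    rw [Real.ball_eq_Ioo] at hrt hst
    have hsr : s - r ∈ Ioo (-η) η := ⟨by linarith [hst.1, hrt.2], by linarith [hst.2, hrt.1]⟩
    have hopen' : IsOpen (N' ×ˢ Ioo (-η) η) := hN'.prod isOpen_Ioo
    have hcomp : ContDiffAt ℝ n (fun z : E × ℝ ↦ Ψ (Φ z.1 r) (z.2 - r)) (x, s) := by
      have h1 : ContDiffAt ℝ n (Function.uncurry Ψ) (Φ x r, s - r) :=
        hΨc.contDiffAt (hopen'.mem_nhds ⟨hrN, hsr⟩)
      have h2 : ContDiffAt ℝ n (fun z : E × ℝ ↦ (Φ z.1 r, z.2 - r)) (x, s) :=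
        (ContDiffAt.comp (x, s) (g := fun y ↦ Φ y r) (f := Prod.fst) hC contDiffAt_fst).prodMk
          (contDiffAt_snd.sub contDiffAt_const)
      exact ContDiffAt.comp (x, s) (g := Function.uncurry Ψ)
        (f := fun z : E × ℝ ↦ (Φ z.1 r, z.2 - r)) h1 h2
    refine hcomp.congr_of_eventuallyEq ?_
    have e1 : ∀ᶠ z : E × ℝ in 𝓝 (x, s), z.1 ∈ N ∧ Φ z.1 r ∈ N' := by
      have : ContinuousAt (fun y ↦ Φ y r) x := hC.continuousAt
      exact (continuousAt_fst (p := (x, s))).eventually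
        ((hN.eventually_mem hx).and (this.eventually_mem (hN'.mem_nhds hrN)))
    have e2 : ∀ᶠ z : E × ℝ in 𝓝 (x, s), z.2 ∈ Ioo (-δ) δ ∧ z.2 - r ∈ Ioo (-η) η :=
      (continuousAt_snd (p := (x, s))).eventually ((isOpen_Ioo.eventually_mem hs).and
        ((continuous_id.sub continuous_const).continuousAt.eventually_mem
          (isOpen_Ioo.mem_nhds hsr)))
    filter_upwards [e1, e2] with z hz1 hz2
    have hJ : (Ioo (-δ) δ ∩ Ioo (r - η) (r + η)).OrdConnected :=
      ordConnected_Ioo.inter ordConnected_Ioo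
    refine eqOn_of_locally_lipschitz hlip hJ (γ := Φ z.1) (η := fun u ↦ Ψ (Φ z.1 r) (u - r))
      (fun u hu ↦ ⟨((hΦ _ hz1.1).2 u hu.1).1, ((hΦ _ hz1.1).2 u hu.1).2.hasDerivWithinAt⟩)
      (fun u hu ↦ ?_) (t₀ := r) ⟨hr, by constructor <;> linarith⟩ (by simp [(hΨ _ hz1.2).1])
      ⟨hz2.1, by constructor <;> linarith [hz2.2.1, hz2.2.2]⟩
    have hu' : u - r ∈ Ioo (-η) η := ⟨by linarith [hu.2.1], by linarith [hu.2.2]⟩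
    have := (hΨ _ hz1.2).2 _ hu'
    refine ⟨this.1, HasDerivAt.hasDerivWithinAt ?_⟩
    simpa [Function.comp_def] using this.2.scomp u ((hasDerivAt_id u).sub_const r)
  rintro ⟨x, t⟩ ⟨hx, ht⟩
  refine ContDiffAt.contDiffWithinAt ?_
  have hslice : ∀ s, ContDiffAt ℝ n (Function.uncurry Φ) (x, s) →
      ContDiffAt ℝ n (fun y ↦ Φ y s) x := fun s hs ↦
    ContDiffAt.comp x (g := Function.uncurry Φ) (f := fun y ↦ (y, s)) hs
      (contDiffAt_id.prodMk contDiffAt_const)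
  have hall : ContDiffAt ℝ n (fun y ↦ Φ y t) x := by
    refine propagate_of_preconnected (P := fun s ↦ ContDiffAt ℝ n (fun y ↦ Φ y s) x)
      isPreconnected_Ioo (fun s hs ↦ ?_) h00 ht ?_
    · obtain ⟨U, hU, hUP⟩ := hlocal x hx s hs
      exact ⟨U, hU, fun a ha b hb h ↦ hslice b (hUP a ha b hb h)⟩
    · refine (contDiffAt_id (𝕜 := ℝ) (E := E)).congr_of_eventuallyEq
        (Filter.eventually_of_mem (hN.mem_nhds hx) fun y hy ↦ (hΦ y hy).1)
  obtain ⟨U, hU, hUP⟩ := hlocal x hx t ht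
  have htU := mem_of_mem_nhdsWithin ht hU
  exact hUP t htU t htU hall

end ODE
section LocalLagrangian

/-! ### Lagrangians on a half space and the Euler-Lagrange equation -/

variable {E : Type*} [NormedAddCommGroup E] [NormedSpace ℝ E]

/-- A Finsler Lagrangian `L` on a relatively open part `D` of a (closed half) space `H`: the first
variable is the position, the second one the velocity. -/
structure LocalLagrangian (H D : Set E) (L : E → E → ℝ) : Prop where
  uniqueDiffOn : UniqueDiffOn ℝ H
  closure_interior : H ⊆ closure (interior H)
  subset : D ⊆ H
  mem_nhdsWithin : ∀ x ∈ D, D ∈ 𝓝[H] x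
  smooth : ContDiffOn ℝ ∞ (Function.uncurry L) (D ×ˢ {0}ᶜ)
  homog : ∀ x ∈ D, ∀ c : ℝ, 0 ≤ c → ∀ v, L x (c • v) = c ^ 2 * L x v
  pos : ∀ x ∈ D, ∀ v, v ≠ 0 → 0 < L x v
  convex : ∀ x ∈ D, ∀ v, v ≠ 0 → ∀ w, w ≠ 0 → 0 < fderiv ℝ (fderiv ℝ (L x)) v w w

/-- The momentum of a Lagrangian. -/
noncomputable def momentum (L : E → E → ℝ) (z : E × E) : E →L[ℝ] ℝ := fderiv ℝ (L z.1) z.2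

/-- The partial derivative of a Lagrangian with respect to the position. -/
noncomputable def force (H : Set E) (L : E → E → ℝ) (z : E × E) : E →L[ℝ] ℝ :=
  fderivWithin ℝ (fun x ↦ L x z.2) H z.1

/-- The acceleration of the geodesics of a Lagrangian, obtained by solving the Euler-Lagrange
equation for the second derivative. -/
noncomputable def geodAccel (H D : Set E) (L : E → E → ℝ) (z : E × E) : E :=
  (fderiv ℝ (fderiv ℝ (L z.1)) z.2).inverse
    (force H L z - fderivWithin ℝ (momentum L) (D ×ˢ {0}ᶜ) z (z.2, 0))

namespace LocalLagrangian

variable {H D : Set E} {L : E → E → ℝ} (hL : LocalLagrangian H D L)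
include hL

lemma uniqueDiffOn_dom : UniqueDiffOn ℝ D := fun x hx ↦
  (hL.uniqueDiffOn x (hL.subset hx)).mono_nhds (nhdsWithin_le_iff.2 (hL.mem_nhdsWithin x hx))

lemma uniqueDiffOn_prod : UniqueDiffOn ℝ (D ×ˢ ({0}ᶜ : Set E)) :=
  hL.uniqueDiffOn_dom.prod isOpen_compl_singleton.uniqueDiffOn

lemma hasFDerivWithinAt {z : E × E} (hz : z ∈ D ×ˢ ({0}ᶜ : Set E)) :
    HasFDerivWithinAt (Function.uncurry L)
      (fderivWithin ℝ (Function.uncurry L) (D ×ˢ {0}ᶜ) z) (D ×ˢ {0}ᶜ) z :=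
  ((hL.smooth z hz).differentiableWithinAt (by simp)).hasFDerivWithinAt

lemma hasFDerivAt_velocity {z : E × E} (hz : z ∈ D ×ˢ ({0}ᶜ : Set E)) :
    HasFDerivAt (L z.1) ((fderivWithin ℝ (Function.uncurry L) (D ×ˢ {0}ᶜ) z).comp
      (ContinuousLinearMap.inr ℝ E E)) z.2 := by
  have h1 : HasFDerivWithinAt (fun v : E ↦ (z.1, v)) (ContinuousLinearMap.inr ℝ E E) {0}ᶜ z.2 :=
    (hasFDerivAt_prodMk_right z.1 z.2).hasFDerivWithinAt
  have h2 := HasFDerivWithinAt.comp (t := D ×ˢ ({0}ᶜ : Set E)) z.2 (hL.hasFDerivWithinAt hz) h1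
    (fun v hv ↦ ⟨hz.1, hv⟩)
  exact h2.hasFDerivAt (isOpen_compl_singleton.mem_nhds hz.2)

lemma momentum_eq {z : E × E} (hz : z ∈ D ×ˢ ({0}ᶜ : Set E)) :
    momentum L z = (fderivWithin ℝ (Function.uncurry L) (D ×ˢ {0}ᶜ) z).comp
      (ContinuousLinearMap.inr ℝ E E) := (hL.hasFDerivAt_velocity hz).fderiv

lemma hasFDerivAt_momentum {x v : E} (hx : x ∈ D) (hv : v ≠ 0) :
    HasFDerivAt (L x) (momentum L (x, v)) v := by
  have hz : (x, v) ∈ D ×ˢ ({0}ᶜ : Set E) := ⟨hx, hv⟩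
  rw [hL.momentum_eq hz]
  exact hL.hasFDerivAt_velocity hz

lemma hasFDerivWithinAt_position {z : E × E} (hz : z ∈ D ×ˢ ({0}ᶜ : Set E)) :
    HasFDerivWithinAt (fun x ↦ L x z.2) ((fderivWithin ℝ (Function.uncurry L) (D ×ˢ {0}ᶜ) z).comp
      (ContinuousLinearMap.inl ℝ E E)) H z.1 := by
  have h1 : HasFDerivWithinAt (fun x : E ↦ (x, z.2)) (ContinuousLinearMap.inl ℝ E E) D z.1 :=
    (hasFDerivAt_prodMk_left z.1 z.2).hasFDerivWithinAt
  have h2 := HasFDerivWithinAt.comp (t := D ×ˢ ({0}ᶜ : Set E)) z.1 (hL.hasFDerivWithinAt hz) h1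
    (fun v hv ↦ ⟨hv, hz.2⟩)
  exact h2.mono_of_mem_nhdsWithin (hL.mem_nhdsWithin _ hz.1)

lemma force_eq {z : E × E} (hz : z ∈ D ×ˢ ({0}ᶜ : Set E)) :
    force H L z = (fderivWithin ℝ (Function.uncurry L) (D ×ˢ {0}ᶜ) z).comp
      (ContinuousLinearMap.inl ℝ E E) :=
  (hL.hasFDerivWithinAt_position hz).fderivWithin (hL.uniqueDiffOn _ (hL.subset hz.1))

lemma fderivWithin_eq {z : E × E} (hz : z ∈ D ×ˢ ({0}ᶜ : Set E)) :
    fderivWithin ℝ (Function.uncurry L) (D ×ˢ {0}ᶜ) z = (force H L z).coprod (momentum L z) := by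
  rw [hL.force_eq hz, hL.momentum_eq hz]
  ext <;> simp

lemma contDiffOn_fderivWithin :
    ContDiffOn ℝ ∞ (fderivWithin ℝ (Function.uncurry L) (D ×ˢ {0}ᶜ)) (D ×ˢ ({0}ᶜ : Set E)) :=
  hL.smooth.fderivWithin hL.uniqueDiffOn_prod (by simp)

lemma contDiffOn_momentum : ContDiffOn ℝ ∞ (momentum L) (D ×ˢ ({0}ᶜ : Set E)) :=
  (hL.contDiffOn_fderivWithin.clm_comp contDiffOn_const).congr fun _ hz ↦ hL.momentum_eq hz

lemma contDiffOn_force : ContDiffOn ℝ ∞ (force H L) (D ×ˢ ({0}ᶜ : Set E)) :=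
  (hL.contDiffOn_fderivWithin.clm_comp contDiffOn_const).congr fun _ hz ↦ hL.force_eq hz

lemma hasFDerivWithinAt_momentum {z : E × E} (hz : z ∈ D ×ˢ ({0}ᶜ : Set E)) :
    HasFDerivWithinAt (momentum L) (fderivWithin ℝ (momentum L) (D ×ˢ {0}ᶜ) z) (D ×ˢ {0}ᶜ) z :=
  ((hL.contDiffOn_momentum z hz).differentiableWithinAt (by simp)).hasFDerivWithinAt

lemma hasFDerivAt_hessian {z : E × E} (hz : z ∈ D ×ˢ ({0}ᶜ : Set E)) :
    HasFDerivAt (fderiv ℝ (L z.1))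
      ((fderivWithin ℝ (momentum L) (D ×ˢ {0}ᶜ) z).comp (ContinuousLinearMap.inr ℝ E E)) z.2 := by
  have h1 : HasFDerivWithinAt (fun v : E ↦ (z.1, v)) (ContinuousLinearMap.inr ℝ E E) {0}ᶜ z.2 :=
    (hasFDerivAt_prodMk_right z.1 z.2).hasFDerivWithinAt
  have h2 := HasFDerivWithinAt.comp (t := D ×ˢ ({0}ᶜ : Set E)) z.2
    (hL.hasFDerivWithinAt_momentum hz) h1 (fun v hv ↦ ⟨hz.1, hv⟩)
  exact h2.hasFDerivAt (isOpen_compl_singleton.mem_nhds hz.2)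

lemma hessian_eq {z : E × E} (hz : z ∈ D ×ˢ ({0}ᶜ : Set E)) :
    fderiv ℝ (fderiv ℝ (L z.1)) z.2 =
      (fderivWithin ℝ (momentum L) (D ×ˢ {0}ᶜ) z).comp (ContinuousLinearMap.inr ℝ E E) :=
  (hL.hasFDerivAt_hessian hz).fderiv

lemma contDiffOn_hessian :
    ContDiffOn ℝ ∞ (fun z : E × E ↦ fderiv ℝ (fderiv ℝ (L z.1)) z.2) (D ×ˢ ({0}ᶜ : Set E)) :=
  ((hL.contDiffOn_momentum.fderivWithin hL.uniqueDiffOn_prod (by simp)).clm_comp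
    contDiffOn_const).congr fun _ hz ↦ hL.hessian_eq hz

/-- The Legendre condition: a positive definite Hessian is non-degenerate. -/
lemma hessian_isInvertible [FiniteDimensional ℝ E] {z : E × E} (hz : z ∈ D ×ˢ ({0}ᶜ : Set E)) :
    (fderiv ℝ (fderiv ℝ (L z.1)) z.2).IsInvertible := by
  set A := fderiv ℝ (fderiv ℝ (L z.1)) z.2
  have hinj : Function.Injective A := by
    rw [injective_iff_map_eq_zero]
    intro w hw
    by_contra hne
    have := hL.convex z.1 hz.1 z.2 hz.2 w hne
    rw [show fderiv ℝ (fderiv ℝ (L z.1)) z.2 w = 0 from hw] at this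
    simp at this
  have hdim : Module.finrank ℝ E = Module.finrank ℝ (E →L[ℝ] ℝ) := by
    rw [← (LinearMap.toContinuousLinearMap (𝕜 := ℝ) (E := E) (F' := ℝ)).finrank_eq]
    exact (Subspace.dual_finrank_eq (K := ℝ) (V := E)).symm
  exact ⟨(LinearEquiv.ofInjectiveOfFinrankEq (A : E →ₗ[ℝ] (E →L[ℝ] ℝ)) hinj
    hdim).toContinuousLinearEquiv, by ext; rfl⟩

lemma hessian_geodAccel [FiniteDimensional ℝ E] {z : E × E} (hz : z ∈ D ×ˢ ({0}ᶜ : Set E)) :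
    fderiv ℝ (fderiv ℝ (L z.1)) z.2 (geodAccel H D L z) =
      force H L z - fderivWithin ℝ (momentum L) (D ×ˢ {0}ᶜ) z (z.2, 0) := by
  obtain ⟨e, he⟩ := hL.hessian_isInvertible hz
  rw [geodAccel, ← he, ContinuousLinearMap.inverse_equiv]
  simp

lemma fderivWithin_momentum_geodAccel [FiniteDimensional ℝ E] {z : E × E}
    (hz : z ∈ D ×ˢ ({0}ᶜ : Set E)) :
    fderivWithin ℝ (momentum L) (D ×ˢ {0}ᶜ) z (z.2, geodAccel H D L z) = force H L z := by
  have h := hL.hessian_geodAccel hz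
  rw [hL.hessian_eq hz] at h
  simp only [ContinuousLinearMap.comp_apply, ContinuousLinearMap.inr_apply] at h
  have : (z.2, geodAccel H D L z) = (z.2, (0 : E)) + (0, geodAccel H D L z) := by simp
  rw [this, map_add, h]; abel

lemma contDiffOn_geodAccel [FiniteDimensional ℝ E] :
    ContDiffOn ℝ ∞ (geodAccel H D L) (D ×ˢ ({0}ᶜ : Set E)) := by
  have hcomplete : CompleteSpace E := FiniteDimensional.complete ℝ E
  intro z hz
  have h1 : ContDiffWithinAt ℝ ∞
      (fun z : E × E ↦ (fderiv ℝ (fderiv ℝ (L z.1)) z.2).inverse) (D ×ˢ ({0}ᶜ : Set E)) z :=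
    ContDiffAt.comp_contDiffWithinAt (g := ContinuousLinearMap.inverse) z
      ((hL.hessian_isInvertible hz).contDiffAt_map_inverse) (hL.contDiffOn_hessian z hz)
  have h2 : ContDiffWithinAt ℝ ∞ (fderivWithin ℝ (momentum L) (D ×ˢ ({0}ᶜ : Set E)))
      (D ×ˢ ({0}ᶜ : Set E)) z :=
    hL.contDiffOn_momentum.fderivWithin hL.uniqueDiffOn_prod (by simp) z hz
  exact h1.clm_apply ((hL.contDiffOn_force z hz).sub
    (h2.clm_apply (contDiffWithinAt_snd.prodMk contDiffWithinAt_const)))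

/-- A curve solving the second order equation solves the Euler-Lagrange equation. -/
lemma eulerLagrange_of_ode [FiniteDimensional ℝ E] {J : Set ℝ} {t : ℝ} {z : ℝ → E × E}
    (hz : z t ∈ D ×ˢ ({0}ᶜ : Set E)) (hzJ : ∀ᶠ s in 𝓝[J] t, z s ∈ D ×ˢ ({0}ᶜ : Set E))
    (h : HasDerivWithinAt z ((z t).2, geodAccel H D L (z t)) J t) :
    HasDerivWithinAt (fun s ↦ momentum L (z s)) (force H L (z t)) J t := by
  set J' := J ∩ z ⁻¹' (D ×ˢ ({0}ᶜ : Set E))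
  have hJ' : J' ∈ 𝓝[J] t := inter_mem self_mem_nhdsWithin hzJ
  have h1 := HasFDerivWithinAt.comp_hasDerivWithinAt (t := D ×ˢ ({0}ᶜ : Set E)) (s := J') t
    (hL.hasFDerivWithinAt_momentum hz) (h.mono inter_subset_left) (fun s hs ↦ hs.2)
  rw [hL.fderivWithin_momentum_geodAccel hz] at h1
  exact h1.mono_of_mem_nhdsWithin hJ'

/-- A continuous solution of the Euler-Lagrange equation is differentiable and solves the second
order equation. -/
lemma ode_of_eulerLagrange [FiniteDimensional ℝ E] {J : Set ℝ} {t : ℝ} {x v : ℝ → E}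
    (hz : (x t, v t) ∈ D ×ˢ ({0}ᶜ : Set E))
    (hzJ : ∀ᶠ s in 𝓝[J] t, (x s, v s) ∈ D ×ˢ ({0}ᶜ : Set E))
    (hv : ContinuousWithinAt v J t) (hx : HasDerivWithinAt x (v t) J t)
    (h : HasDerivWithinAt (fun s ↦ momentum L (x s, v s)) (force H L (x t, v t)) J t) :
    HasDerivWithinAt v (geodAccel H D L (x t, v t)) J t := by
  set g := geodAccel H D L (x t, v t) with hg
  set P' := fderivWithin ℝ (momentum L) (D ×ˢ {0}ᶜ) (x t, v t) with hP'
  have hcont : Tendsto (fun s ↦ (x s, v s)) (𝓝[J] t) (𝓝[D ×ˢ ({0}ᶜ : Set E)] (x t, v t)) :=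
    tendsto_nhdsWithin_iff.2 ⟨hx.continuousWithinAt.prodMk hv, hzJ⟩
  have o1 := (hasFDerivWithinAt_iff_isLittleO.1 (hL.hasFDerivWithinAt_momentum hz)).comp_tendsto
    hcont
  have o2 := hasDerivWithinAt_iff_isLittleO.1 h
  have o3 := hasDerivWithinAt_iff_isLittleO.1 hx
  rw [hasDerivWithinAt_iff_isLittleO]
  -- the deviation `η` of `v` from its expected first order expansion
  set η : ℝ → E := fun s ↦ v s - v t - (s - t) • g with hη
  obtain ⟨e, he⟩ := hL.hessian_isInvertible hz
  have hkey : ∀ s, e (η s) = (momentum L (x s, v s) - momentum L (x t, v t) -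
      (s - t) • force H L (x t, v t)) - P' (x s - x t - (s - t) • v t, 0) -
      (momentum L (x s, v s) - momentum L (x t, v t) - P' ((x s, v s) - (x t, v t))) := by
    intro s
    have e1 : e (η s) = P' (0, η s) := by
      have : e (η s) = (e : E →L[ℝ] (E →L[ℝ] ℝ)) (η s) := rfl
      rw [this, he, hL.hessian_eq hz]; rfl
    have e2 : P' ((x s, v s) - (x t, v t)) = P' (x s - x t - (s - t) • v t, 0) +
        (s - t) • P' (v t, g) + P' (0, η s) := by
      rw [← map_smul, ← map_add, ← map_add]
      congr 1
      ext <;> simp [hη]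
    have e3 : P' (v t, g) = force H L (x t, v t) := hL.fderivWithin_momentum_geodAccel hz
    rw [e1, e2, e3]
    abel
  have hst : (fun s : ℝ ↦ s - t) =O[𝓝[J] t] fun s ↦ ‖s - t‖ + ‖η s‖ :=
    Asymptotics.IsBigO.of_bound 1 (Eventually.of_forall fun s ↦ by
      have := norm_nonneg (η s)
      rw [Real.norm_of_nonneg (r := ‖s - t‖ + ‖η s‖) (by positivity)]; linarith)
  have oz : (fun s ↦ (x s, v s) - (x t, v t)) =O[𝓝[J] t] fun s ↦ ‖s - t‖ + ‖η s‖ := by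
    have hxO : (fun s ↦ x s - x t) =O[𝓝[J] t] fun s ↦ ‖s - t‖ + ‖η s‖ :=
      (HasFDerivWithinAt.isBigO_sub hx.hasFDerivWithinAt).trans hst
    have hvO : (fun s ↦ v s - v t) =O[𝓝[J] t] fun s ↦ ‖s - t‖ + ‖η s‖ := by
      refine Asymptotics.IsBigO.of_bound (‖g‖ + 1) (Eventually.of_forall fun s ↦ ?_)
      have h1 : v s - v t = (s - t) • g + η s := by simp [hη]
      rw [h1, Real.norm_of_nonneg (by positivity)]
      refine (norm_add_le _ _).trans ?_
      rw [norm_smul]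
      nlinarith [norm_nonneg (η s), norm_nonneg (s - t), norm_nonneg g]
    exact hxO.prod_left hvO
  have oη : η =o[𝓝[J] t] fun s ↦ ‖s - t‖ + ‖η s‖ := by
    have hO : η =O[𝓝[J] t] fun s ↦ e (η s) := by
      refine Asymptotics.IsBigO.of_bound ‖(e.symm : (E →L[ℝ] ℝ) →L[ℝ] E)‖
        (Eventually.of_forall fun s ↦ ?_)
      simpa using (e.symm : (E →L[ℝ] ℝ) →L[ℝ] E).le_opNorm (e (η s))
    refine hO.trans_isLittleO ?_
    simp_rw [hkey]
    refine ((o2.trans_isBigO hst).sub ?_).sub (o1.trans_isBigO oz)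
    have : (fun s ↦ P' (x s - x t - (s - t) • v t, 0)) =O[𝓝[J] t]
        fun s ↦ x s - x t - (s - t) • v t := by
      refine (P'.isBigO_comp _ _).trans (Asymptotics.IsBigO.of_bound 1
        (Eventually.of_forall fun s ↦ by simp))
    exact this.trans_isLittleO (o3.trans_isBigO hst)
  rw [Asymptotics.isLittleO_iff] at oη ⊢
  intro c hc
  filter_upwards [oη (c := min (c / 2) (1 / 2)) (by positivity)] with s hs
  rw [Real.norm_of_nonneg (r := ‖s - t‖ + ‖η s‖) (by positivity)] at hs
  have h1 : min (c / 2) (1 / 2) ≤ c / 2 := min_le_left _ _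
  have h2 : min (c / 2) (1 / 2 : ℝ) ≤ 1 / 2 := min_le_right _ _
  have := norm_nonneg (η s); have := norm_nonneg (s - t)
  nlinarith

/-- Euler's identity for the `2`-homogeneous Lagrangian. -/
lemma momentum_self {x v : E} (hx : x ∈ D) (hv : v ≠ 0) : momentum L (x, v) v = 2 * L x v := by
  have h1 : HasDerivAt (fun c : ℝ ↦ L x (c • v)) (momentum L (x, v) v) 1 := by
    have h2 := hL.hasFDerivAt_momentum hx hv
    rw [← one_smul ℝ v] at h2
    have h3 := h2.comp_hasDerivAt (1 : ℝ) ((hasDerivAt_id (1 : ℝ)).smul_const v)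
    simpa [Function.comp_def] using h3
  have h2 : HasDerivAt (fun c : ℝ ↦ c ^ 2 * L x v) (2 * L x v) 1 := by
    simpa using ((hasDerivAt_id (1 : ℝ)).pow 2).mul_const (L x v)
  refine h1.unique (h2.congr_of_eventuallyEq ?_)
  filter_upwards [lt_mem_nhds one_pos] with c hc using hL.homog x hx c hc.le v

lemma momentum_smul {x : E} (hx : x ∈ D) {c : ℝ} (hc : 0 < c) {v : E} (hv : v ≠ 0) :
    momentum L (x, c • v) = c • momentum L (x, v) := by
  have h1 : fderiv ℝ (fun v ↦ L x (c • v)) v = fderiv ℝ (fun v ↦ c ^ 2 • L x v) v := by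
    congr 1; ext w; simpa using hL.homog x hx c hc.le w
  rw [fderiv_comp_smul, fderiv_fun_const_smul (hL.hasFDerivAt_momentum hx hv).differentiableAt,
    pow_two, mul_smul] at h1
  exact (smul_right_injective _ hc.ne') h1

lemma force_smul {x : E} (hx : x ∈ D) {c : ℝ} (hc : 0 < c) {v : E} (hv : v ≠ 0) :
    force H L (x, c • v) = c ^ 2 • force H L (x, v) := by
  have hev : (fun y ↦ L y (c • v)) =ᶠ[𝓝[H] x] fun y ↦ c ^ 2 • L y v := by
    filter_upwards [hL.mem_nhdsWithin x hx] with y hy using hL.homog y hy c hc.le v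
  rw [force, hev.fderivWithin_eq (hL.homog x hx c hc.le v),
    fderivWithin_fun_const_smul (hL.uniqueDiffOn _ (hL.subset hx))
      (hL.hasFDerivWithinAt_position (z := (x, v)) ⟨hx, hv⟩).differentiableWithinAt]
  rfl

lemma hessian_smul {x : E} (hx : x ∈ D) {c : ℝ} (hc : 0 < c) {v : E} (hv : v ≠ 0) :
    fderiv ℝ (fderiv ℝ (L x)) (c • v) = fderiv ℝ (fderiv ℝ (L x)) v := by
  have h1 : fderiv ℝ (fun v ↦ fderiv ℝ (L x) (c • v)) v =
      fderiv ℝ (fun v ↦ c • fderiv ℝ (L x) v) v := by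
    refine Filter.EventuallyEq.fderiv_eq ?_
    filter_upwards [isOpen_compl_singleton.mem_nhds hv] with w hw using hL.momentum_smul hx hc hw
  rw [fderiv_comp_smul, fderiv_fun_const_smul
    (hL.hasFDerivAt_hessian (z := (x, v)) ⟨hx, hv⟩).differentiableAt] at h1
  simpa [smul_smul, hc.ne'] using congrArg (fun A ↦ c⁻¹ • A) h1

/-- The Lagrangian is constant along solutions of the second order equation. -/
lemma hasDerivWithinAt_energy [FiniteDimensional ℝ E] {J : Set ℝ} {t : ℝ} {z : ℝ → E × E}
    (hz : z t ∈ D ×ˢ ({0}ᶜ : Set E)) (hzJ : ∀ᶠ s in 𝓝[J] t, z s ∈ D ×ˢ ({0}ᶜ : Set E))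
    (h : HasDerivWithinAt z ((z t).2, geodAccel H D L (z t)) J t) :
    HasDerivWithinAt (fun s ↦ L (z s).1 (z s).2) 0 J t := by
  set J' := J ∩ z ⁻¹' (D ×ˢ ({0}ᶜ : Set E))
  have hJ' : J' ∈ 𝓝[J] t := inter_mem self_mem_nhdsWithin hzJ
  have h1 := HasFDerivWithinAt.comp_hasDerivWithinAt (t := D ×ˢ ({0}ᶜ : Set E)) (s := J') t
    (hL.hasFDerivWithinAt hz) (h.mono inter_subset_left) (fun s hs ↦ hs.2)
  have h2 : HasDerivWithinAt (fun s ↦ L (z s).1 (z s).2)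
      (force H L (z t) (z t).2 + momentum L (z t) (geodAccel H D L (z t))) J t := by
    rw [hL.fderivWithin_eq hz] at h1
    exact h1.mono_of_mem_nhdsWithin hJ'
  have h3 := (hL.eulerLagrange_of_ode hz hzJ h).clm_apply h.snd
  have h4 : HasDerivWithinAt (fun s ↦ momentum L (z s) (z s).2 - L (z s).1 (z s).2) 0 J t := by
    exact (h3.sub h2).congr_deriv (by ring)
  refine h4.congr_of_eventuallyEq ?_ ?_
  · filter_upwards [hzJ] with s hs
    have := hL.momentum_self hs.1 hs.2
    simp only [Prod.mk.eta] at this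
    rw [this]; ring
  · have := hL.momentum_self hz.1 hz.2
    simp only [Prod.mk.eta] at this
    rw [this]; ring

end LocalLagrangian

/-- The Euler-Lagrange equation is invariant under changes of the position coordinates. -/
lemma eulerLagrange_coordChange {H₁ D₁ H₂ D₂ : Set E} {L₁ L₂ : E → E → ℝ}
    (h₁ : LocalLagrangian H₁ D₁ L₁) (h₂ : LocalLagrangian H₂ D₂ L₂) {ψ : E → E} {D : Set E}
    (hD : ∀ x ∈ D, D ∈ 𝓝[H₁] x) (hD₁ : D ⊆ D₁) (hψD : MapsTo ψ D D₂)
    (hψ : ∀ x ∈ D, ContDiffWithinAt ℝ ∞ ψ H₁ x)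
    (hinj : ∀ x ∈ D, ∀ v, v ≠ 0 → fderivWithin ℝ ψ H₁ x v ≠ 0)
    (hL : ∀ x ∈ D, ∀ v, L₁ x v = L₂ (ψ x) (fderivWithin ℝ ψ H₁ x v))
    {J : Set ℝ} {t : ℝ} (htJ : t ∈ J) {x v : ℝ → E} (hx : ∀ᶠ s in 𝓝[J] t, x s ∈ D)
    (hv : ∀ᶠ s in 𝓝[J] t, v s ≠ 0) (hd : HasDerivWithinAt x (v t) J t)
    (h : HasDerivWithinAt (fun s ↦ momentum L₂ (ψ (x s), fderivWithin ℝ ψ H₁ (x s) (v s)))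
      (force H₂ L₂ (ψ (x t), fderivWithin ℝ ψ H₁ (x t) (v t))) J t) :
    HasDerivWithinAt (fun s ↦ momentum L₁ (x s, v s)) (force H₁ L₁ (x t, v t)) J t := by
  have hxt : x t ∈ D := hx.self_of_nhdsWithin htJ
  have hvt : v t ≠ 0 := hv.self_of_nhdsWithin htJ
  set T : E → E →L[ℝ] E := fderivWithin ℝ ψ H₁ with hT
  have hxH : x t ∈ H₁ := h₁.subset (hD₁ hxt)
  -- the momentum transforms by the transpose of the derivative
  have hmom : ∀ y ∈ D, ∀ w, w ≠ 0 → momentum L₁ (y, w) = (momentum L₂ (ψ y, T y w)).comp (T y) := by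
    intro y hy w hw
    have e1 : (L₁ y) = fun w ↦ L₂ (ψ y) (T y w) := by ext w; exact hL y hy w
    have e2 := (h₂.hasFDerivAt_momentum (hψD hy) (hinj y hy w hw)).comp w (T y).hasFDerivAt
    rw [momentum, e1]
    exact e2.fderiv
  -- the second derivative of the coordinate change
  have hψT : HasFDerivWithinAt ψ (T (x t)) H₁ (x t) :=
    ((hψ _ hxt).differentiableWithinAt (by simp)).hasFDerivWithinAt
  have hTd : HasFDerivWithinAt T (fderivWithin ℝ T H₁ (x t)) H₁ (x t) :=
    (((hψ _ hxt).fderivWithin_right h₁.uniqueDiffOn (m := 1) (by norm_cast) hxH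
      ).differentiableWithinAt (by simp)).hasFDerivWithinAt
  set T' := fderivWithin ℝ T H₁ (x t) with hT'
  have hsymm : ∀ a b, T' a b = T' b a := fun a b ↦
    ((hψ _ hxt).of_le (by norm_cast : (2 : WithTop ℕ∞) ≤ ∞)).isSymmSndFDerivWithinAt
      (by simp) h₁.uniqueDiffOn (h₁.closure_interior hxH) hxH a b
  -- the force of the first Lagrangian
  have hforce : force H₁ L₁ (x t, v t) = (force H₂ L₂ (ψ (x t), T (x t) (v t))).comp (T (x t)) +
      (momentum L₂ (ψ (x t), T (x t) (v t))).comp (T'.flip (v t)) := by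
    have e1 : (fun y ↦ L₁ y (v t)) =ᶠ[𝓝[H₁] (x t)] fun y ↦ L₂ (ψ y) (T y (v t)) := by
      filter_upwards [hD _ hxt] with y hy using hL y hy _
    have hin : HasFDerivWithinAt (fun y ↦ (ψ y, T y (v t)))
        ((T (x t)).prod (T'.flip (v t))) D (x t) := by
      refine HasFDerivWithinAt.mono ?_ (hD₁.trans h₁.subset)
      refine hψT.prodMk ?_
      have := hTd.clm_apply (hasFDerivWithinAt_const (v t) (x t) H₁)
      simpa using this
    have hzt : (ψ (x t), T (x t) (v t)) ∈ D₂ ×ˢ ({0}ᶜ : Set E) := ⟨hψD hxt, hinj _ hxt _ hvt⟩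
    have e2 := HasFDerivWithinAt.comp (t := D₂ ×ˢ ({0}ᶜ : Set E)) (x t)
      (h₂.hasFDerivWithinAt hzt) hin (fun y hy ↦ ⟨hψD hy, hinj _ hy _ hvt⟩)
    rw [h₂.fderivWithin_eq hzt] at e2
    have e3 := (e2.mono_of_mem_nhdsWithin (hD _ hxt)).congr_of_eventuallyEq e1 (hL _ hxt _)
    rw [force, e3.fderivWithin (h₁.uniqueDiffOn _ hxH)]
    ext w
    simp
  -- differentiate the transformed momentum
  have hTx : HasDerivWithinAt (fun s ↦ T (x s)) (T' (v t)) J t := by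
    set J' := J ∩ x ⁻¹' D
    have hJ' : J' ∈ 𝓝[J] t := inter_mem self_mem_nhdsWithin hx
    have hd' : HasDerivWithinAt x (v t) J' t := hd.mono inter_subset_left
    exact (HasFDerivWithinAt.comp_hasDerivWithinAt (s := J') t hTd hd'
      (fun s hs ↦ h₁.subset (hD₁ hs.2))).mono_of_mem_nhdsWithin hJ'
  have hfin := h.clm_comp hTx
  have hval : force H₁ L₁ (x t, v t) = (force H₂ L₂ (ψ (x t), T (x t) (v t))).comp (T (x t)) +
      (momentum L₂ (ψ (x t), T (x t) (v t))).comp (T' (v t)) := by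
    rw [hforce]; ext w; simp [hsymm]
  rw [hval]
  refine hfin.congr_of_eventuallyEq ?_ (hmom _ hxt _ hvt)
  filter_upwards [hx, hv] with s hs hs' using hmom _ hs _ hs'

end LocalLagrangian
section Charts

/-! ### Charts of the tangent bundle -/

set_option linter.unusedSectionVars false

variable {d : ℕ} {M : Type*} [TopologicalSpace M] [ChartedSpace (EuclideanHalfSpace (d + 1)) M]
  [IsManifold (𝓡∂ (d + 1)) ∞ M]

/-- The model space of the manifold and of its tangent spaces. -/
abbrev Vec (d : ℕ) := EuclideanSpace ℝ (Fin (d + 1))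

/-- The tangent vector at `a` with coordinates `v` in the preferred chart at `a`. -/
def tmk (a : M) (v : Vec d) : TangentBundle (𝓡∂ (d + 1)) M := ⟨a, v⟩

/-- The coordinates of a tangent vector in the preferred chart at its base point. -/
def vel (y : TangentBundle (𝓡∂ (d + 1)) M) : Vec d := y.2

/-- The chart of the tangent bundle over the preferred chart of `M` at `a`. -/
noncomputable def tChart (a : M) : PartialEquiv (TangentBundle (𝓡∂ (d + 1)) M) (Vec d × Vec d) :=
  extChartAt (𝓡∂ (d + 1)).tangent (⟨a, 0⟩ : TangentBundle (𝓡∂ (d + 1)) M)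

lemma mem_tChart_source {a : M} {y : TangentBundle (𝓡∂ (d + 1)) M} :
    y ∈ (tChart a).source ↔ y.proj ∈ (extChartAt (𝓡∂ (d + 1)) a).source := by
  rw [tChart, extChartAt_source, extChartAt_source, TangentBundle.mem_chart_source_iff]

lemma tChart_apply (a : M) (y : TangentBundle (𝓡∂ (d + 1)) M) :
    tChart a y = (extChartAt (𝓡∂ (d + 1)) a y.proj,
      tangentCoordChange (𝓡∂ (d + 1)) y.proj a y.proj y.2) := rfl

lemma tChart_fst (a : M) (y : TangentBundle (𝓡∂ (d + 1)) M) :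
    (tChart a y).1 = extChartAt (𝓡∂ (d + 1)) a y.proj := rfl

lemma tChart_tmk_coordChange {a : M} {z : Vec d × Vec d}
    (hz : z.1 ∈ (extChartAt (𝓡∂ (d + 1)) a).target) :
    tChart a (tmk ((extChartAt (𝓡∂ (d + 1)) a).symm z.1)
      (tangentCoordChange (𝓡∂ (d + 1)) a ((extChartAt (𝓡∂ (d + 1)) a).symm z.1)
        ((extChartAt (𝓡∂ (d + 1)) a).symm z.1) z.2)) = z := by
  set q := (extChartAt (𝓡∂ (d + 1)) a).symm z.1 with hq
  have hqs : q ∈ (extChartAt (𝓡∂ (d + 1)) a).source := (extChartAt (𝓡∂ (d + 1)) a).map_target hz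
  rw [tChart_apply]
  refine Prod.ext ((extChartAt (𝓡∂ (d + 1)) a).right_inv hz) ?_
  change tangentCoordChange (𝓡∂ (d + 1)) q a q (tangentCoordChange (𝓡∂ (d + 1)) a q q z.2) = z.2
  rw [tangentCoordChange_comp ⟨⟨hqs, mem_extChartAt_source q⟩, hqs⟩, tangentCoordChange_self hqs]

lemma mem_tChart_target {a : M} {z : Vec d × Vec d} :
    z ∈ (tChart (d := d) (M := M) a).target ↔ z.1 ∈ (extChartAt (𝓡∂ (d + 1)) a).target := by
  constructor
  · intro hz
    have h1 := (tChart a).map_target hz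
    rw [mem_tChart_source] at h1
    have h2 := congrArg Prod.fst ((tChart a).right_inv hz)
    rw [tChart_fst] at h2
    rw [← h2]
    exact (extChartAt (𝓡∂ (d + 1)) a).map_source h1
  · intro hz
    set q := (extChartAt (𝓡∂ (d + 1)) a).symm z.1 with hq
    have hqs : q ∈ (extChartAt (𝓡∂ (d + 1)) a).source := (extChartAt (𝓡∂ (d + 1)) a).map_target hz
    have h1 : tmk q (tangentCoordChange (𝓡∂ (d + 1)) a q q z.2) ∈ (tChart a).source :=
      mem_tChart_source.2 hqs
    rw [← tChart_tmk_coordChange hz]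
    exact (tChart a).map_source h1

lemma tChart_symm_proj (a : M) (z : Vec d × Vec d) :
    ((tChart a).symm z).proj = (extChartAt (𝓡∂ (d + 1)) a).symm z.1 := rfl

lemma tChart_symm_apply {a : M} {z : Vec d × Vec d}
    (hz : z.1 ∈ (extChartAt (𝓡∂ (d + 1)) a).target) :
    (tChart a).symm z = tmk ((extChartAt (𝓡∂ (d + 1)) a).symm z.1)
      (tangentCoordChange (𝓡∂ (d + 1)) a ((extChartAt (𝓡∂ (d + 1)) a).symm z.1)
        ((extChartAt (𝓡∂ (d + 1)) a).symm z.1) z.2) := by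
  have h1 : tmk ((extChartAt (𝓡∂ (d + 1)) a).symm z.1)
      (tangentCoordChange (𝓡∂ (d + 1)) a ((extChartAt (𝓡∂ (d + 1)) a).symm z.1)
        ((extChartAt (𝓡∂ (d + 1)) a).symm z.1) z.2) ∈ (tChart a).source :=
    mem_tChart_source.2 ((extChartAt (𝓡∂ (d + 1)) a).map_target hz)
  rw [← (tChart a).left_inv h1, tChart_tmk_coordChange hz]

/-- The chart at `a` reads the tangent vectors at `a` as they are. -/
lemma tChart_self (a : M) (v : Vec d) :
    tChart a (tmk a v) = (extChartAt (𝓡∂ (d + 1)) a a, v) := by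
  rw [tChart_apply]
  refine Prod.ext rfl ?_
  exact tangentCoordChange_self (mem_extChartAt_source a)

lemma isOpen_tChart_source (a : M) : IsOpen (tChart (d := d) (M := M) a).source :=
    isOpen_extChartAt_source _

lemma contMDiffOn_tChart (a : M) : ContMDiffOn (𝓡∂ (d + 1)).tangent 𝓘(ℝ, Vec d × Vec d) ∞
    (tChart (d := d) (M := M) a) (tChart (d := d) (M := M) a).source := by
  have := contMDiffOn_extChartAt (I := (𝓡∂ (d + 1)).tangent) (n := ∞)
    (x := (⟨a, 0⟩ : TangentBundle (𝓡∂ (d + 1)) M))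
  rw [← extChartAt_source (I := (𝓡∂ (d + 1)).tangent)] at this
  exact this

lemma contMDiffOn_tChart_symm (a : M) : ContMDiffOn 𝓘(ℝ, Vec d × Vec d) (𝓡∂ (d + 1)).tangent ∞
    (tChart (d := d) (M := M) a).symm (tChart (d := d) (M := M) a).target :=
  contMDiffOn_extChartAt_symm (I := (𝓡∂ (d + 1)).tangent) (n := ∞)
    (⟨a, 0⟩ : TangentBundle (𝓡∂ (d + 1)) M)

lemma continuousOn_tChart (a : M) : ContinuousOn (tChart (d := d) a) (tChart (d := d) a).source :=
  continuousOn_extChartAt _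

lemma continuousOn_tChart_symm (a : M) :
    ContinuousOn (tChart (d := d) a).symm (tChart (d := d) a).target :=
  continuousOn_extChartAt_symm _

lemma continuous_proj : Continuous (fun y : TangentBundle (𝓡∂ (d + 1)) M ↦ y.proj) :=
  FiberBundle.continuous_proj (Vec d) (TangentSpace (𝓡∂ (d + 1)))

/-- The change of coordinates as a linear isomorphism between a tangent space and the model. -/
noncomputable def coordEquiv {a q : M} (hq : q ∈ (extChartAt (𝓡∂ (d + 1)) a).source) :
    Vec d ≃L[ℝ] Vec d :=
  ContinuousLinearEquiv.equivOfInverse (tangentCoordChange (𝓡∂ (d + 1)) a q q)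
    (tangentCoordChange (𝓡∂ (d + 1)) q a q)
    (fun v ↦ by
      rw [tangentCoordChange_comp ⟨⟨hq, mem_extChartAt_source q⟩, hq⟩, tangentCoordChange_self hq])
    (fun v ↦ by
      rw [tangentCoordChange_comp ⟨⟨mem_extChartAt_source q, hq⟩, mem_extChartAt_source q⟩,
        tangentCoordChange_self (mem_extChartAt_source q)])

lemma coordEquiv_apply {a q : M} (hq : q ∈ (extChartAt (𝓡∂ (d + 1)) a).source) (v : Vec d) :
    coordEquiv hq v = tangentCoordChange (𝓡∂ (d + 1)) a q q v := rfl

lemma tChart_symm_eq {a q : M} (hq : q ∈ (extChartAt (𝓡∂ (d + 1)) a).source) (v : Vec d) :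
    (tChart a).symm (extChartAt (𝓡∂ (d + 1)) a q, v) =
      tmk q (coordEquiv hq v) := by
  rw [tChart_symm_apply ((extChartAt (𝓡∂ (d + 1)) a).map_source hq)]
  simp only [(extChartAt (𝓡∂ (d + 1)) a).left_inv hq]
  rfl

lemma tChart_eq {a q : M} (hq : q ∈ (extChartAt (𝓡∂ (d + 1)) a).source)
    (v : Vec d) : tChart a (tmk q v) = (extChartAt (𝓡∂ (d + 1)) a q, (coordEquiv hq).symm v) := rfl

lemma tChart_snd_ne_zero {a : M} {y : TangentBundle (𝓡∂ (d + 1)) M} (hy : y ∈ (tChart a).source) :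
    (tChart a y).2 ≠ 0 ↔ y.2 ≠ 0 := by
  exact (coordEquiv (mem_tChart_source.1 hy)).symm.map_ne_zero_iff

lemma tChart_symm_snd_ne_zero {a : M} {z : Vec d × Vec d}
    (hz : z.1 ∈ (extChartAt (𝓡∂ (d + 1)) a).target) :
    ((tChart a).symm z).2 ≠ 0 ↔ z.2 ≠ 0 := by
  have h := tChart_snd_ne_zero ((tChart a).map_target (mem_tChart_target.2 hz))
  rw [(tChart a).right_inv (mem_tChart_target.2 hz)] at h
  exact h.symm

/-- The Lagrangian in the chart at `a`. -/
noncomputable def chartLag (φ : FinslerMetric d M) (a : M) : Vec d → Vec d → ℝ :=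
  φ.lagrangian (⟨a, 0⟩ : TangentBundle (𝓡∂ (d + 1)) M)

lemma chartLag_eq (φ : FinslerMetric d M) (a : M) (x v : Vec d) :
    chartLag φ a x v = φ.toFun ((tChart a).symm (x, v)) ^ 2 / 2 := rfl

lemma chartLag_tChart (φ : FinslerMetric d M) {a : M} {y : TangentBundle (𝓡∂ (d + 1)) M}
    (hy : y ∈ (tChart a).source) :
    chartLag φ a (tChart a y).1 (tChart a y).2 = φ.toFun y ^ 2 / 2 := by
  rw [chartLag_eq, Prod.mk.eta, (tChart a).left_inv hy]

lemma FinslerMetric.toFun_tmk_smul (φ : FinslerMetric d M) (a : M) {c : ℝ} (hc : 0 ≤ c)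
    (v : Vec d) : φ.toFun (tmk a (c • v)) = c * φ.toFun (tmk a v) := φ.homogeneous' a c v hc

lemma FinslerMetric.toFun_zero (φ : FinslerMetric d M) (a : M) : φ.toFun ⟨a, 0⟩ = 0 := by
  have := φ.homogeneous' a 0 0 le_rfl
  simpa using this

lemma FinslerMetric.toFun_nonneg (φ : FinslerMetric d M) (y : TangentBundle (𝓡∂ (d + 1)) M) :
    0 ≤ φ.toFun y := by
  obtain ⟨a, v⟩ := y
  by_cases h : v = 0
  · rw [h, φ.toFun_zero]
  · exact (φ.pos' ⟨a, v⟩ h).le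

lemma FinslerMetric.toFun_pos_iff (φ : FinslerMetric d M) (y : TangentBundle (𝓡∂ (d + 1)) M) :
    0 < φ.toFun y ↔ y.2 ≠ 0 := by
  refine ⟨fun h h0 ↦ ?_, φ.pos' y⟩
  obtain ⟨a, v⟩ := y
  simp only at h0
  rw [h0, φ.toFun_zero] at h
  exact lt_irrefl _ h

lemma contDiffOn_toFun_tChart_symm (φ : FinslerMetric d M) (a : M) :
    ContDiffOn ℝ ∞ (fun z ↦ φ.toFun ((tChart a).symm z))
      ((extChartAt (𝓡∂ (d + 1)) a).target ×ˢ {0}ᶜ) := by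
  intro z hz
  have h1 := (contMDiffOn_tChart_symm a z (mem_tChart_target.2 hz.1)).mono
    (show (extChartAt (𝓡∂ (d + 1)) a).target ×ˢ ({0}ᶜ : Set (Vec d)) ⊆
      (tChart (d := d) (M := M) a).target from fun w hw ↦ mem_tChart_target.2 hw.1)
  have h2 := (φ.smooth' ((tChart a).symm z)
    ((tChart_symm_snd_ne_zero hz.1).2 hz.2)).comp_contMDiffWithinAt z h1
  exact h2.contDiffWithinAt

lemma range_model : range (𝓡∂ (d + 1)) = {x : Vec d | 0 ≤ x 0} :=
  range_modelWithCornersEuclideanHalfSpace _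

/-- The Lagrangian of a Finsler metric, read in a chart. -/
lemma localLagrangian (φ : FinslerMetric d M) (a : M) :
    LocalLagrangian (range (𝓡∂ (d + 1))) (extChartAt (𝓡∂ (d + 1)) a).target (chartLag φ a) where
  uniqueDiffOn := (𝓡∂ (d + 1)).uniqueDiffOn
  closure_interior := (𝓡∂ (d + 1)).range_subset_closure_interior
  subset := extChartAt_target_subset_range a
  mem_nhdsWithin x hx := extChartAt_target_mem_nhdsWithin_of_mem hx
  smooth := by
    exact ((contDiffOn_toFun_tChart_symm φ a).pow 2).div_const 2
  homog x hx c hc v := by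
    rw [chartLag_eq, chartLag_eq, tChart_symm_apply hx, tChart_symm_apply hx]
    rw [map_smul, φ.toFun_tmk_smul _ hc]
    ring
  pos x hx v hv := by
    rw [chartLag_eq]
    have := φ.pos' _ ((tChart_symm_snd_ne_zero (z := (x, v)) hx).2 hv)
    positivity
  convex x hx v hv w hw := by
    set q := (extChartAt (𝓡∂ (d + 1)) a).symm x with hq
    have hqs : q ∈ (extChartAt (𝓡∂ (d + 1)) a).source := (extChartAt (𝓡∂ (d + 1)) a).map_target hx
    set A := coordEquiv hqs with hA
    have e1 : chartLag φ a x = (fun u : Vec d ↦ φ.toFun ⟨q, u⟩ ^ 2 / 2) ∘ A := by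
      ext u
      rw [chartLag_eq, tChart_symm_apply hx]; rfl
    have e2 : fderiv ℝ (fderiv ℝ (chartLag φ a x)) v w w =
        iteratedFDeriv ℝ 2 (chartLag φ a x) v ![w, w] := by
      rw [iteratedFDeriv_two_apply]; rfl
    rw [e2, e1, ← iteratedFDerivWithin_univ, ← preimage_univ (f := A),
      A.iteratedFDerivWithin_comp_right _ uniqueDiffOn_univ (mem_univ _), iteratedFDerivWithin_univ]
    have := φ.convex' q (A v) (A w) (A.map_ne_zero_iff.2 hv) (A.map_ne_zero_iff.2 hw)
    rw [ContinuousMultilinearMap.compContinuousLinearMap_apply]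
    have e3 : (fun i : Fin 2 ↦ (A : Vec d →L[ℝ] Vec d) ((![w, w] : Fin 2 → Vec d) i)) =
        ![A w, A w] := by
      ext i; fin_cases i <;> rfl
    rw [e3]
    exact this

end Charts
section Geodesics

/-! ### The geodesic equation in charts -/

set_option linter.unusedSectionVars false

variable {d : ℕ} {M : Type*} [TopologicalSpace M] [ChartedSpace (EuclideanHalfSpace (d + 1)) M]
  [IsManifold (𝓡∂ (d + 1)) ∞ M]

/-- Derivatives on `M` need only a manifold of class `C¹`. -/
lemma isManifold_one : IsManifold (𝓡∂ (d + 1)) 1 M := IsManifold.of_le (n := ∞) (by norm_cast)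

/-- The tangent bundle of a Hausdorff manifold is Hausdorff. -/
instance [T2Space M] : T2Space (TangentBundle (𝓡∂ (d + 1)) M) where
  t2 := by
    intro x y hxy
    by_cases h : x.proj = y.proj
    · have hx : x ∈ (tChart x.proj).source := mem_tChart_source.2 (mem_extChartAt_source _)
      have hy : y ∈ (tChart x.proj).source := mem_tChart_source.2 (h ▸ mem_extChartAt_source _)
      have hne : tChart x.proj x ≠ tChart x.proj y := fun h ↦ hxy ((tChart x.proj).injOn hx hy h)
      obtain ⟨u, v, hu, hv, hxu, hyv, huv⟩ := t2_separation hne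
      refine ⟨_, _, (continuousOn_tChart x.proj).isOpen_inter_preimage (isOpen_tChart_source _) hu,
        (continuousOn_tChart x.proj).isOpen_inter_preimage (isOpen_tChart_source _) hv, ⟨hx, hxu⟩,
        ⟨hy, hyv⟩, ?_⟩
      exact (huv.preimage _).mono inter_subset_right inter_subset_right
    · obtain ⟨u, v, hu, hv, hxu, hyv, huv⟩ := t2_separation h
      exact ⟨_, _, hu.preimage continuous_proj, hv.preimage continuous_proj, hxu, hyv,
        huv.preimage _⟩

/-- The tangent bundle is first countable, as it is locally homeomorphic to subsets of a normed
space. -/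
instance : FirstCountableTopology (TangentBundle (𝓡∂ (d + 1)) M) where
  nhds_generated_countable y := by
    rw [← map_extChartAt_symm_nhdsWithin_range (I := (𝓡∂ (d + 1)).tangent) y]
    infer_instance

/-- The change of coordinates between the charts of the manifold at `a` and at `b`. -/
noncomputable def chartChange (M : Type*) [TopologicalSpace M]
    [ChartedSpace (EuclideanHalfSpace (d + 1)) M]
    (a b : M) : Vec d → Vec d :=
  extChartAt (𝓡∂ (d + 1)) b ∘ (extChartAt (𝓡∂ (d + 1)) a).symm

lemma chartChange_apply {a b q : M} (hq : q ∈ (extChartAt (𝓡∂ (d + 1)) a).source) :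
    chartChange (d := d) M a b (extChartAt (𝓡∂ (d + 1)) a q) = extChartAt (𝓡∂ (d + 1)) b q := by
  rw [chartChange, Function.comp_apply, (extChartAt (𝓡∂ (d + 1)) a).left_inv hq]

/-- The domain of the change of coordinates. -/
def chartDom (d : ℕ) {M : Type*} [TopologicalSpace M] [ChartedSpace (EuclideanHalfSpace (d + 1)) M]
    (a b : M) : Set (Vec d) :=
  (extChartAt (𝓡∂ (d + 1)) a).target ∩
    (extChartAt (𝓡∂ (d + 1)) a).symm ⁻¹' (extChartAt (𝓡∂ (d + 1)) b).source

lemma mem_chartDom {a b q : M} (hqa : q ∈ (extChartAt (𝓡∂ (d + 1)) a).source)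
    (hqb : q ∈ (extChartAt (𝓡∂ (d + 1)) b).source) :
    extChartAt (𝓡∂ (d + 1)) a q ∈ chartDom d a b :=
  ⟨(extChartAt (𝓡∂ (d + 1)) a).map_source hqa, by
    rwa [mem_preimage, (extChartAt (𝓡∂ (d + 1)) a).left_inv hqa]⟩

lemma exists_of_mem_chartDom {a b : M} {x : Vec d} (hx : x ∈ chartDom d a b) :
    ∃ q ∈ (extChartAt (𝓡∂ (d + 1)) a).source, q ∈ (extChartAt (𝓡∂ (d + 1)) b).source ∧
      extChartAt (𝓡∂ (d + 1)) a q = x :=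
  ⟨_, (extChartAt (𝓡∂ (d + 1)) a).map_target hx.1, hx.2, (extChartAt (𝓡∂ (d + 1)) a).right_inv hx.1⟩

lemma contDiffWithinAt_chartChange {a b : M} {x : Vec d} (hx : x ∈ chartDom d a b) :
    ContDiffWithinAt ℝ ∞ (chartChange (d := d) M a b) (range (𝓡∂ (d + 1))) x := by
  apply contDiffWithinAt_ext_coord_change
  rwa [PartialEquiv.trans_source, PartialEquiv.symm_source]

lemma chartDom_mem_nhdsWithin {a b : M} {x : Vec d} (hx : x ∈ chartDom d a b) :
    chartDom d a b ∈ 𝓝[range (𝓡∂ (d + 1))] x := by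
  have h1 := extChartAt_target_mem_nhdsWithin_of_mem hx.1
  refine inter_mem h1 ?_
  have h2 := (continuousOn_extChartAt_symm a x hx.1).mono_of_mem_nhdsWithin h1
  exact h2.preimage_mem_nhdsWithin ((isOpen_extChartAt_source b).mem_nhds hx.2)

lemma fderivWithin_chartChange {a b q : M} (_ : q ∈ (extChartAt (𝓡∂ (d + 1)) a).source) :
    fderivWithin ℝ (chartChange (d := d) M a b) (range (𝓡∂ (d + 1))) (extChartAt (𝓡∂ (d + 1)) a q) =
      tangentCoordChange (𝓡∂ (d + 1)) a b q := rfl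

/-- Change of coordinates of a tangent vector. -/
lemma tChart_change {a b : M} {y : TangentBundle (𝓡∂ (d + 1)) M} (hya : y ∈ (tChart a).source)
    (hyb : y ∈ (tChart b).source) :
    tChart b y = (chartChange M a b (tChart a y).1,
      fderivWithin ℝ (chartChange M a b) (range (𝓡∂ (d + 1))) (tChart a y).1 (tChart a y).2) := by
  have ha := mem_tChart_source.1 hya
  have hb := mem_tChart_source.1 hyb
  refine Prod.ext ?_ ?_
  · simp only [tChart_fst]
    rw [chartChange_apply ha]
  · simp only [tChart_fst]
    rw [fderivWithin_chartChange ha, tChart_apply, tChart_apply]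
    exact (tangentCoordChange_comp ⟨⟨mem_extChartAt_source _, ha⟩, hb⟩).symm

lemma fderivWithin_chartChange_ne_zero {a b : M} {x v : Vec d} (hx : x ∈ chartDom d a b)
    (hv : v ≠ 0) :
    fderivWithin ℝ (chartChange M a b) (range (𝓡∂ (d + 1))) x v ≠ 0 := by
  obtain ⟨q, hqa, hqb, rfl⟩ := exists_of_mem_chartDom hx
  rw [fderivWithin_chartChange hqa]
  intro h
  apply hv
  have := tangentCoordChange_comp (I := 𝓡∂ (d + 1)) (w := a) (x := b) (y := a) (v := v)
    ⟨⟨hqa, hqb⟩, hqa⟩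
  rw [h, map_zero, tangentCoordChange_self hqa] at this
  exact this.symm

lemma chartLag_change (φ : FinslerMetric d M) {a b : M} {x : Vec d} (hx : x ∈ chartDom d a b)
    (v : Vec d) :
    chartLag φ a x v = chartLag φ b (chartChange M a b x)
      (fderivWithin ℝ (chartChange M a b) (range (𝓡∂ (d + 1))) x v) := by
  set y := (tChart a).symm (x, v) with hy
  have hya : y ∈ (tChart a).source := (tChart a).map_target (mem_tChart_target.2 hx.1)
  have hyb : y ∈ (tChart b).source := mem_tChart_source.2 hx.2
  have h1 : tChart a y = (x, v) := (tChart a).right_inv (mem_tChart_target.2 hx.1)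
  have h2 := chartLag_tChart φ hyb
  rw [tChart_change hya hyb, h1] at h2
  rw [h2, ← chartLag_tChart φ hya, h1]

/-- The domain of the geodesic equation in the chart at `a`. -/
def geodDom (d : ℕ) {M : Type*} [TopologicalSpace M] [ChartedSpace (EuclideanHalfSpace (d + 1)) M]
    (a : M) : Set (Vec d × Vec d) := (extChartAt (𝓡∂ (d + 1)) a).target ×ˢ {0}ᶜ

lemma tChart_mem_geodDom {a : M} {y : TangentBundle (𝓡∂ (d + 1)) M} (hy : y ∈ (tChart a).source)
    (hv : y.2 ≠ 0) : tChart a y ∈ geodDom d a :=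
  ⟨mem_tChart_target.1 ((tChart a).map_source hy), (tChart_snd_ne_zero hy).2 hv⟩

/-- The vector field of the geodesic equation in the chart at `a`. -/
noncomputable def geodField (φ : FinslerMetric d M) (a : M) (z : Vec d × Vec d) : Vec d × Vec d :=
  (z.2, geodAccel (range (𝓡∂ (d + 1))) (extChartAt (𝓡∂ (d + 1)) a).target (chartLag φ a) z)

lemma contDiffOn_geodField (φ : FinslerMetric d M) (a : M) :
    ContDiffOn ℝ ∞ (geodField φ a) (geodDom d a) :=
  contDiffOn_snd.prodMk (localLagrangian φ a).contDiffOn_geodAccel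

/-- The Euler-Lagrange equation at time `t`, in the chart at `a`. -/
def ELAt (φ : FinslerMetric d M) (a : M) (α : ℝ → TangentBundle (𝓡∂ (d + 1)) M) (J : Set ℝ)
    (t : ℝ) : Prop :=
  HasDerivWithinAt (fun s ↦ (tChart a (α s)).1) (tChart a (α t)).2 J t ∧
  HasDerivWithinAt (fun s ↦ momentum (chartLag φ a) (tChart a (α s)))
    (force (range (𝓡∂ (d + 1))) (chartLag φ a) (tChart a (α t))) J t

lemma isGeodesicOn_iff_elAt {φ : FinslerMetric d M} {α : ℝ → TangentBundle (𝓡∂ (d + 1)) M}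
    {J : Set ℝ} : IsGeodesicOn φ α J ↔ ContinuousOn α J ∧ ∀ t ∈ J, ELAt φ (α t).proj α J t :=
        Iff.rfl

section Local

variable {φ : FinslerMetric d M} {a b : M} {α : ℝ → TangentBundle (𝓡∂ (d + 1)) M} {J : Set ℝ}
  {t : ℝ}

lemma isOpen_vel_ne_zero : IsOpen {y : TangentBundle (𝓡∂ (d + 1)) M | y.2 ≠ 0} := by
  rw [isOpen_iff_mem_nhds]
  intro y hy
  have hys : y ∈ (tChart y.proj).source := mem_tChart_source.2 (mem_extChartAt_source _)
  have h1 := (continuousOn_tChart y.proj).continuousAt ((isOpen_tChart_source _).mem_nhds hys)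
  have h2 : ∀ᶠ w in 𝓝 y, (tChart y.proj w).2 ≠ 0 :=
    h1.snd.eventually_ne ((tChart_snd_ne_zero hys).2 hy)
  filter_upwards [h2, (isOpen_tChart_source y.proj).mem_nhds hys] with w hw hws
  exact (tChart_snd_ne_zero hws).1 hw

lemma eventually_geodDom (hc : ContinuousWithinAt α J t) (ht : α t ∈ (tChart a).source)
    (hv : (α t).2 ≠ 0) : ∀ᶠ s in 𝓝[J] t, α s ∈ (tChart a).source ∧ (α s).2 ≠ 0 :=
  hc.eventually (inter_mem ((isOpen_tChart_source a).mem_nhds ht) (isOpen_vel_ne_zero.mem_nhds hv))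

lemma continuousWithinAt_tChart (hc : ContinuousWithinAt α J t) (ht : α t ∈ (tChart a).source) :
    ContinuousWithinAt (fun s ↦ tChart a (α s)) J t :=
  ((continuousOn_tChart a).continuousAt
      ((isOpen_tChart_source _).mem_nhds ht)).comp_continuousWithinAt hc

/-- In a chart, the Euler-Lagrange equation is the second order geodesic equation. -/
lemma elAt_iff (hc : ContinuousWithinAt α J t) (ht : α t ∈ (tChart a).source)
    (hv : (α t).2 ≠ 0) :
    ELAt φ a α J t ↔
      HasDerivWithinAt (fun s ↦ tChart a (α s)) (geodField φ a (tChart a (α t))) J t := by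
  have hL := localLagrangian φ a
  have hz := tChart_mem_geodDom ht hv
  have hzJ : ∀ᶠ s in 𝓝[J] t, tChart a (α s) ∈ geodDom d a :=
    (eventually_geodDom hc ht hv).mono fun s hs ↦ tChart_mem_geodDom hs.1 hs.2
  have hcz := continuousWithinAt_tChart hc ht
  constructor
  · rintro ⟨h1, h2⟩
    exact h1.prodMk (hL.ode_of_eulerLagrange (x := fun s ↦ (tChart a (α s)).1)
      (v := fun s ↦ (tChart a (α s)).2) hz hzJ hcz.snd h1 h2)
  · intro h
    exact ⟨h.fst, hL.eulerLagrange_of_ode (z := fun s ↦ tChart a (α s)) hz hzJ h⟩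

/-- The Euler-Lagrange equation does not depend on the chart. -/
lemma elAt_change (htJ : t ∈ J) (hc : ContinuousWithinAt α J t) (hta : α t ∈ (tChart a).source)
    (htb : α t ∈ (tChart b).source) (hv : (α t).2 ≠ 0) (h : ELAt φ b α J t) : ELAt φ a α J t := by
  have hea := eventually_geodDom hc hta hv
  have heb := eventually_geodDom hc htb hv
  have hd : HasDerivWithinAt (fun s ↦ (tChart a (α s)).1) (tChart a (α t)).2 J t := by
    have h0 : (tChart b (α t)).1 ∈ chartDom d b a :=
      mem_chartDom (mem_tChart_source.1 htb) (mem_tChart_source.1 hta)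
    have h1 := ((contDiffWithinAt_chartChange h0).differentiableWithinAt
        (by simp)).hasFDerivWithinAt
    have h2 := HasFDerivWithinAt.comp_hasDerivWithinAt (s := J ∩ {s | α s ∈ (tChart b).source}) t h1
      (h.1.mono inter_subset_left) (fun s hs ↦ by
        exact extChartAt_target_subset_range b ((mem_tChart_target.1 ((tChart b).map_source hs.2))))
    have h3 := h2.mono_of_mem_nhdsWithin (inter_mem self_mem_nhdsWithin (heb.mono fun s hs ↦ hs.1))
    rw [tChart_change htb hta]
    refine h3.congr_of_eventuallyEq ?_ (by
      simp only [Function.comp_apply]; rw [tChart_change htb hta])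
    filter_upwards [hea, heb] with s hs hs'
    simp only [Function.comp_apply]; rw [tChart_change hs'.1 hs.1]
  refine ⟨hd, ?_⟩
  have hab : ∀ {y : TangentBundle (𝓡∂ (d + 1)) M}, y ∈ (tChart a).source → y ∈ (tChart b).source →
    (tChart a y).1 ∈ chartDom d a b := fun h1 h2 ↦
      mem_chartDom (mem_tChart_source.1 h1) (mem_tChart_source.1 h2)
  refine eulerLagrange_coordChange (x := fun s ↦ (tChart a (α s)).1)
    (v := fun s ↦ (tChart a (α s)).2) (localLagrangian φ a) (localLagrangian φ b)
    (D := chartDom d a b) (ψ := chartChange M a b)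
    (fun x hx ↦ chartDom_mem_nhdsWithin hx) inter_subset_left ?_
    (fun x hx ↦ contDiffWithinAt_chartChange hx)
    (fun x hx v hv ↦ fderivWithin_chartChange_ne_zero hx hv)
    (fun x hx v ↦ chartLag_change φ hx v) htJ ?_ ?_ hd ?_
  · intro x hx
    obtain ⟨q, hqa, hqb, rfl⟩ := exists_of_mem_chartDom hx
    rw [chartChange_apply hqa]
    exact (extChartAt (𝓡∂ (d + 1)) b).map_source hqb
  · filter_upwards [hea, heb] with s hs hs' using hab hs.1 hs'.1
  · filter_upwards [hea] with s hs using (tChart_snd_ne_zero hs.1).2 hs.2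
  · have h2 := h.2
    rw [tChart_change hta htb] at h2
    refine h2.congr_of_eventuallyEq ?_ ?_
    · filter_upwards [hea, heb] with s hs hs'
      rw [tChart_change hs.1 hs'.1]
    · rw [tChart_change hta htb]

end Local

/-- A curve of non-zero vectors is a geodesic if and only if it solves the geodesic equation, each
time in some chart. -/
lemma isGeodesicOn_iff {φ : FinslerMetric d M} {α : ℝ → TangentBundle (𝓡∂ (d + 1)) M} {J : Set ℝ}
    (hv : ∀ t ∈ J, (α t).2 ≠ 0) :
    IsGeodesicOn φ α J ↔ ContinuousOn α J ∧ ∀ t ∈ J, ∃ a, α t ∈ (tChart a).source ∧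
      HasDerivWithinAt (fun s ↦ tChart a (α s)) (geodField φ a (tChart a (α t))) J t := by
  rw [isGeodesicOn_iff_elAt]
  refine and_congr_right fun hc ↦ forall₂_congr fun t ht ↦ ?_
  have hs : α t ∈ (tChart (α t).proj).source := mem_tChart_source.2 (mem_extChartAt_source _)
  constructor
  · intro h
    exact ⟨_, hs, (elAt_iff (hc t ht) hs (hv t ht)).1 h⟩
  · rintro ⟨a, ha, h⟩
    exact elAt_change ht (hc t ht) hs ha (hv t ht) ((elAt_iff (hc t ht) ha (hv t ht)).2 h)

namespace IsGeodesicOn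

variable {φ : FinslerMetric d M} {α β : ℝ → TangentBundle (𝓡∂ (d + 1)) M} {J J' : Set ℝ}

lemma mono (h : IsGeodesicOn φ α J) (hJ : J' ⊆ J) : IsGeodesicOn φ α J' :=
  ⟨h.1.mono hJ, fun t ht ↦ ⟨(h.2 t (hJ ht)).1.mono hJ, (h.2 t (hJ ht)).2.mono hJ⟩⟩

lemma congr (h : IsGeodesicOn φ α J) (hJ : EqOn β α J) : IsGeodesicOn φ β J := by
  refine ⟨h.1.congr hJ, fun t ht ↦ ?_⟩
  have := h.2 t ht
  simp only [← hJ ht] at this ⊢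
  exact ⟨this.1.congr (fun s hs ↦ by rw [hJ hs]) (by rw [hJ ht]), this.2.congr
      (fun s hs ↦ by rw [hJ hs]) (by rw [hJ ht])⟩

lemma hasDerivWithinAt (h : IsGeodesicOn φ α J) {t : ℝ} (ht : t ∈ J) {a : M}
    (ha : α t ∈ (tChart a).source) (hv : (α t).2 ≠ 0) :
    HasDerivWithinAt (fun s ↦ tChart a (α s)) (geodField φ a (tChart a (α t))) J t :=
  (elAt_iff (h.1 t ht) ha hv).1 (elAt_change ht (h.1 t ht) ha
    (mem_tChart_source.2 (mem_extChartAt_source _)) hv ((isGeodesicOn_iff_elAt.1 h).2 t ht))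

/-- Being a geodesic is a local property. -/
lemma of_local (h : ∀ t ∈ J, ∃ U ∈ 𝓝[J] t, t ∈ U ∧ IsGeodesicOn φ α U) : IsGeodesicOn φ α J := by
  refine ⟨fun t ht ↦ ?_, fun t ht ↦ ?_⟩
  · obtain ⟨U, hU, htU, hg⟩ := h t ht
    exact (hg.1 t htU).mono_of_mem_nhdsWithin hU
  · obtain ⟨U, hU, htU, hg⟩ := h t ht
    exact ⟨(hg.2 t htU).1.mono_of_mem_nhdsWithin hU, (hg.2 t htU).2.mono_of_mem_nhdsWithin hU⟩

end IsGeodesicOn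

end Geodesics
section Flow

/-! ### The geodesic flow over the interior -/

set_option linter.unusedSectionVars false

variable {d : ℕ} {M : Type*} [TopologicalSpace M] [ChartedSpace (EuclideanHalfSpace (d + 1)) M]
  [IsManifold (𝓡∂ (d + 1)) ∞ M]

lemma mem_tChart_self (y : TangentBundle (𝓡∂ (d + 1)) M) : y ∈ (tChart y.proj).source :=
  mem_tChart_source.2 (mem_extChartAt_source _)

lemma mem_interior_iff {a q : M} (hq : q ∈ (extChartAt (𝓡∂ (d + 1)) a).source) :
    q ∈ (𝓡∂ (d + 1)).interior M ↔ 0 < (extChartAt (𝓡∂ (d + 1)) a q) 0 := by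
  have hq' : q ∈ (chartAt (EuclideanHalfSpace (d + 1)) a).source := by
    rwa [extChartAt_source] at hq
  have h1 := ModelWithCorners.isInteriorPoint_iff_of_mem_atlas (I := 𝓡∂ (d + 1)) (n := ∞) (by simp)
    (chart_mem_atlas _ a) hq'
  have h2 := interior_range_modelWithCornersEuclideanHalfSpace (d + 1)
  refine h1.trans ⟨fun h ↦ ?_, fun h ↦ ?_⟩
  · have := OpenPartialHomeomorph.interior_extend_target_subset_interior_range _ h
    rwa [h2] at this
  · refine OpenPartialHomeomorph.mem_interior_extend_target _
      ((chartAt (EuclideanHalfSpace (d + 1)) a).map_source hq') ?_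
    rw [h2]; exact h

lemma mem_boundary_iff {a q : M} (hq : q ∈ (extChartAt (𝓡∂ (d + 1)) a).source) :
    q ∈ (𝓡∂ (d + 1)).boundary M ↔ (extChartAt (𝓡∂ (d + 1)) a q) 0 = 0 := by
  have h0 : 0 ≤ (extChartAt (𝓡∂ (d + 1)) a q) 0 := by
    have := extChartAt_target_subset_range a ((extChartAt (𝓡∂ (d + 1)) a).map_source hq)
    rwa [range_model] at this
  rw [← ModelWithCorners.compl_interior, mem_compl_iff, mem_interior_iff hq, not_lt]
  exact ⟨fun h ↦ le_antisymm h h0, fun h ↦ h.le⟩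

lemma isOpen_interior_manifold : IsOpen ((𝓡∂ (d + 1)).interior M) :=
  ModelWithCorners.isOpen_interior (n := ∞) (by simp)

lemma mem_interior_target_iff {a : M} {x : Vec d} (hx : x ∈ (extChartAt (𝓡∂ (d + 1)) a).target) :
    x ∈ interior (extChartAt (𝓡∂ (d + 1)) a).target ↔ 0 < x 0 := by
  have h2 := interior_range_modelWithCornersEuclideanHalfSpace (d + 1)
  constructor
  · intro h
    have := OpenPartialHomeomorph.interior_extend_target_subset_interior_range _ h
    rwa [h2] at this
  · intro h
    have h3 := extChartAt_target_mem_nhdsWithin_of_mem hx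
    rw [nhdsWithin_eq_nhds.2 (mem_interior_iff_mem_nhds.1 (by rw [h2]; exact h))] at h3
    exact mem_interior_iff_mem_nhds.2 h3

/-! ### Continuity and conservation of the norm -/

lemma toFun_tChart_symm_smul (φ : FinslerMetric d M) {a : M} {x : Vec d}
    (hx : x ∈ (extChartAt (𝓡∂ (d + 1)) a).target) {c : ℝ} (hc : 0 ≤ c) (v : Vec d) :
    φ.toFun ((tChart a).symm (x, c • v)) = c * φ.toFun ((tChart a).symm (x, v)) := by
  rw [tChart_symm_apply hx, tChart_symm_apply hx, map_smul, φ.toFun_tmk_smul _ hc]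

/-- In a chart, the norm is locally bounded by a multiple of the Euclidean norm. -/
lemma eventually_toFun_le (φ : FinslerMetric d M) (a : M) :
    ∃ C, 0 < C ∧ ∀ᶠ q in 𝓝 a, q ∈ (extChartAt (𝓡∂ (d + 1)) a).source ∧ ∀ v : Vec d,
      φ.toFun ((tChart a).symm (extChartAt (𝓡∂ (d + 1)) a q, v)) ≤ C * ‖v‖ := by
  set g : M × Vec d → ℝ := fun z ↦ φ.toFun ((tChart a).symm (extChartAt (𝓡∂ (d + 1)) a z.1, z.2))
    with hg
  have hcont : ∀ v : Vec d, v ≠ 0 → ContinuousAt g (a, v) := by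
    intro v hv
    have h1 : ContinuousWithinAt (fun z : M × Vec d ↦ (extChartAt (𝓡∂ (d + 1)) a z.1, z.2))
        ((extChartAt (𝓡∂ (d + 1)) a).source ×ˢ {0}ᶜ) (a, v) :=
      (((continuousAt_extChartAt (I := 𝓡∂ (d + 1)) a).comp (f := fun z : M × Vec d ↦ z.1)
        (x := (a, v)) continuousAt_fst).continuousWithinAt).prodMk continuousWithinAt_snd
    have h2 := ContinuousWithinAt.comp (x := (a, v))
      (f := fun z : M × Vec d ↦ (extChartAt (𝓡∂ (d + 1)) a z.1, z.2))
      ((contDiffOn_toFun_tChart_symm φ a).continuousOn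
      (extChartAt (𝓡∂ (d + 1)) a a, v) ⟨mem_extChartAt_target a, hv⟩) h1
      (fun z hz ↦ ⟨(extChartAt (𝓡∂ (d + 1)) a).map_source hz.1, hz.2⟩)
    exact h2.continuousAt (((isOpen_extChartAt_source a).prod isOpen_compl_singleton).mem_nhds
      ⟨mem_extChartAt_source a, hv⟩)
  have hne : ∀ v ∈ Metric.sphere (0 : Vec d) 1, v ≠ 0 := fun v hv h ↦ by simp [h] at hv
  obtain ⟨C, hC⟩ := (isCompact_sphere (0 : Vec d) 1).exists_bound_of_continuousOn
    (f := fun v ↦ g (a, v)) (fun v hv ↦ by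
      have h3 : ContinuousAt (fun v : Vec d ↦ g (a, v)) v :=
        (hcont v (hne v hv)).comp (f := fun v : Vec d ↦ (a, v)) (by fun_prop)
      exact h3.continuousWithinAt)
  have h4 := (isCompact_sphere (0 : Vec d) 1).eventually_forall_of_forall_eventually (x₀ := a)
    (P := fun q v ↦ g (q, v) < |C| + 1) (fun v hv ↦ (hcont v (hne v hv)).eventually_lt_const (by
      have := hC v hv
      have := le_abs_self C
      have := le_abs_self (g (a, v))
      simp only [Real.norm_eq_abs] at *
      linarith))
  refine ⟨|C| + 1, by positivity, ?_⟩
  filter_upwards [h4, (isOpen_extChartAt_source (I := 𝓡∂ (d + 1)) a).mem_nhds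
    (mem_extChartAt_source a)] with q hq hqs
  refine ⟨hqs, fun v ↦ ?_⟩
  have hqt := (extChartAt (𝓡∂ (d + 1)) a).map_source hqs
  by_cases hv : v = 0
  · have := toFun_tChart_symm_smul φ hqt le_rfl (0 : Vec d)
    simp only [smul_zero, zero_mul] at this
    rw [hv, this]; simp
  · have h5 := hq (‖v‖⁻¹ • v) (by simp [norm_smul, hv])
    have h6 := toFun_tChart_symm_smul φ hqt (norm_nonneg v) (‖v‖⁻¹ • v)
    rw [smul_smul, mul_inv_cancel₀ (norm_ne_zero_iff.2 hv), one_smul] at h6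
    rw [h6, mul_comm]
    exact mul_le_mul_of_nonneg_right h5.le (norm_nonneg v)

lemma FinslerMetric.continuous (φ : FinslerMetric d M) : Continuous φ.toFun := by
  rw [continuous_iff_continuousAt]
  intro y
  by_cases hy : y.2 = 0
  · have h0 : φ.toFun y = 0 := by
      obtain ⟨a, v⟩ := y
      simp only at hy
      rw [hy, φ.toFun_zero]
    obtain ⟨C, hC, hev⟩ := eventually_toFun_le φ y.proj
    have h1 := (continuousOn_tChart y.proj).continuousAt
      ((isOpen_tChart_source _).mem_nhds (mem_tChart_self y))
    have h2 : Tendsto (fun w ↦ C * ‖(tChart y.proj w).2‖) (𝓝 y) (𝓝 0) := by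
      have h3 : (tChart y.proj y).2 = 0 := by
        by_contra h
        exact (tChart_snd_ne_zero (mem_tChart_self y)).1 h hy
      have h4 := (h1.snd.norm.const_mul C)
      unfold ContinuousAt at h4
      simpa [h3] using h4
    unfold ContinuousAt
    rw [h0]
    refine squeeze_zero' (Eventually.of_forall φ.toFun_nonneg) ?_ h2
    filter_upwards [continuous_proj.continuousAt.eventually hev] with w hw
    have := hw.2 (tChart y.proj w).2
    rwa [← tChart_fst, Prod.mk.eta, (tChart y.proj).left_inv (mem_tChart_source.2 hw.1)] at this
  · exact (φ.smooth' y hy).continuousAt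

variable {φ : FinslerMetric d M} {α β : ℝ → TangentBundle (𝓡∂ (d + 1)) M} {J : Set ℝ}

/-- Geodesics have constant speed. -/
lemma IsGeodesicOn.toFun_eq (h : IsGeodesicOn φ α J) (hJ : J.OrdConnected) {s t : ℝ} (hs : s ∈ J)
    (ht : t ∈ J) (hv : (α s).2 ≠ 0) : φ.toFun (α t) = φ.toFun (α s) := by
  refine propagate_of_preconnected (s := J) (P := fun r ↦ φ.toFun (α r) = φ.toFun (α s))
    hJ.isPreconnected ?_ hs ht rfl
  intro r hr
  by_cases hP : φ.toFun (α r) = φ.toFun (α s)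
  · have hvr : (α r).2 ≠ 0 := by
      rw [← φ.toFun_pos_iff, hP, φ.toFun_pos_iff]; exact hv
    obtain ⟨ε, hε, hball⟩ := Metric.mem_nhdsWithin_iff.1
      (eventually_geodDom (h.1 r hr) (mem_tChart_self _) hvr)
    set a := (α r).proj
    refine ⟨Metric.ball r ε ∩ J, inter_comm J _ ▸ inter_mem_nhdsWithin J
        (Metric.ball_mem_nhds r hε),
      fun y hy z hz hyP ↦ ?_⟩
    have hconv : Convex ℝ (Metric.ball r ε ∩ J) := (convex_ball r ε).inter hJ.convex
    have hder : ∀ x ∈ Metric.ball r ε ∩ J, HasDerivWithinAt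
        (fun s ↦ chartLag φ a (tChart a (α s)).1 (tChart a (α s)).2) 0 (Metric.ball r ε ∩ J) x := by
      intro x hx
      have hxb := hball hx
      refine (localLagrangian φ a).hasDerivWithinAt_energy (z := fun s ↦ tChart a (α s))
        (tChart_mem_geodDom hxb.1 hxb.2) ?_
        ((h.hasDerivWithinAt hx.2 hxb.1 hxb.2).mono inter_subset_right)
      filter_upwards [self_mem_nhdsWithin] with w hw using
        tChart_mem_geodDom (hball hw).1 (hball hw).2
    have hc := hconv.norm_image_sub_le_of_norm_hasDerivWithin_le (C := 0) hder (by simp) hy hz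
    rw [zero_mul, norm_le_zero_iff, sub_eq_zero, chartLag_tChart φ (hball hy).1,
      chartLag_tChart φ (hball hz).1] at hc
    have h1 := φ.toFun_nonneg (α y)
    have h2 := φ.toFun_nonneg (α z)
    have : φ.toFun (α z) = φ.toFun (α y) := by
      rw [← sq_eq_sq₀ h2 h1]; linarith
    rw [this, hyP]
  · have : ∀ᶠ w in 𝓝[J] r, φ.toFun (α w) ≠ φ.toFun (α s) :=
      (φ.continuous.continuousAt.comp_continuousWithinAt (h.1 r hr)).eventually_ne hP
    exact ⟨_, this, fun y hy z _ hyP ↦ absurd hyP hy⟩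

lemma IsGeodesicOn.ne_zero (h : IsGeodesicOn φ α J) (hJ : J.OrdConnected) {s t : ℝ} (hs : s ∈ J)
    (ht : t ∈ J) (hv : (α s).2 ≠ 0) : (α t).2 ≠ 0 := by
  rw [← φ.toFun_pos_iff, h.toFun_eq hJ hs ht hv, φ.toFun_pos_iff]; exact hv

lemma geodField_locally_lipschitz (φ : FinslerMetric d M) (a : M) :
    ∀ x ∈ geodDom d a, ∃ K, ∃ U ∈ 𝓝[geodDom d a] x, LipschitzOnWith K (geodField φ a) U := by
  intro x hx
  set s' : Set (Vec d × Vec d) := range (𝓡∂ (d + 1)) ×ˢ univ with hs'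
  have hconv : Convex ℝ s' := by
    refine Convex.prod ?_ convex_univ
    exact (𝓡∂ (d + 1)).convex_range
  have hmem : geodDom d a ∈ 𝓝[s'] x := by
    rw [← Prod.mk.eta (p := x), hs', nhdsWithin_prod_eq, geodDom]
    exact prod_mem_prod (extChartAt_target_mem_nhdsWithin_of_mem hx.1)
      (by rw [nhdsWithin_univ]; exact isOpen_compl_singleton.mem_nhds hx.2)
  have hc : ContDiffWithinAt ℝ 1 (geodField φ a) s' x :=
    (((contDiffOn_geodField φ a) x hx).mono_of_mem_nhdsWithin hmem).of_le (by norm_cast)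
  obtain ⟨K, U, hU, hK⟩ := hc.exists_lipschitzOnWith hconv
  have hsub : geodDom d a ⊆ s' := fun z hz ↦ ⟨extChartAt_target_subset_range a hz.1, mem_univ _⟩
  exact ⟨K, U, nhdsWithin_mono x hsub hU, hK⟩

/-- Geodesics are determined by one of their vectors. -/
lemma IsGeodesicOn.eqOn [T2Space M] (hα : IsGeodesicOn φ α J) (hβ : IsGeodesicOn φ β J)
    (hJ : J.OrdConnected) {s : ℝ} (hs : s ∈ J) (hv : (α s).2 ≠ 0) (h : α s = β s) :
    EqOn α β J := by
  intro t ht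
  refine propagate_of_preconnected (P := fun r ↦ α r = β r) hJ.isPreconnected ?_ hs ht h
  intro r hr
  by_cases hP : α r = β r
  · have hvr := hα.ne_zero hJ hs hr hv
    set a := (α r).proj with ha
    have hra : α r ∈ (tChart a).source := mem_tChart_self _
    obtain ⟨ε, hε, hball⟩ := Metric.mem_nhdsWithin_iff.1
      ((eventually_geodDom (hα.1 r hr) hra hvr).and
        (eventually_geodDom (hβ.1 r hr) (hP ▸ hra) (hP ▸ hvr)))
    refine ⟨Metric.ball r ε ∩ J, inter_comm J _ ▸ inter_mem_nhdsWithin J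
        (Metric.ball_mem_nhds r hε),
      fun y hy z hz hyP ↦ ?_⟩
    have hJ' : (Metric.ball r ε ∩ J).OrdConnected := ((convex_ball r ε).ordConnected).inter hJ
    have := eqOn_of_locally_lipschitz (geodField_locally_lipschitz φ a) hJ'
      (γ := fun s ↦ tChart a (α s)) (η := fun s ↦ tChart a (β s))
      (fun t ht ↦ ⟨tChart_mem_geodDom (hball ht).1.1 (hball ht).1.2,
        (hα.hasDerivWithinAt ht.2 (hball ht).1.1 (hball ht).1.2).mono inter_subset_right⟩)
      (fun t ht ↦ ⟨tChart_mem_geodDom (hball ht).2.1 (hball ht).2.2,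
        (hβ.hasDerivWithinAt ht.2 (hball ht).2.1 (hball ht).2.2).mono inter_subset_right⟩)
      hy (by simp only [hyP]) hz
    exact (tChart a).injOn (hball hz).1.1 (hball hz).2.1 this
  · have : ∀ᶠ w in 𝓝[J] r, α w ≠ β w := by
      have := ((hα.1 r hr).prodMk (hβ.1 r hr)).eventually
        (isClosed_diagonal.isOpen_compl.mem_nhds (show (α r, β r) ∈ (diagonal _)ᶜ from hP))
      exact this
    exact ⟨_, this, fun y hy z _ hyP ↦ absurd hyP hy⟩

lemma IsGeodesicOn.comp_add (h : IsGeodesicOn φ α J) (c : ℝ) :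
    IsGeodesicOn φ (fun s ↦ α (s + c)) {s | s + c ∈ J} := by
  have hmap : MapsTo (fun s : ℝ ↦ s + c) {s | s + c ∈ J} J := fun s hs ↦ hs
  refine ⟨h.1.comp (by fun_prop) hmap, fun t ht ↦ ?_⟩
  have hd : HasDerivWithinAt (fun s : ℝ ↦ s + c) 1 {s | s + c ∈ J} t :=
    ((hasDerivAt_id t).add_const c).hasDerivWithinAt
  obtain ⟨h1, h2⟩ := h.2 (t + c) ht
  refine ⟨?_, ?_⟩
  · have := h1.scomp t hd hmap
    simp only [one_smul] at this
    exact this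
  · have := h2.scomp t hd hmap
    simp only [one_smul] at this
    exact this

/-- The geodesic flow near an interior vector: it is smooth, its orbits stay over the interior, and
they stay in a given neighborhood. -/
lemma exists_flowBox (φ : FinslerMetric d M) {y₀ : TangentBundle (𝓡∂ (d + 1)) M}
    (hy₀ : y₀.proj ∈ (𝓡∂ (d + 1)).interior M) (hv₀ : y₀.2 ≠ 0)
    {𝒪 : Set (TangentBundle (𝓡∂ (d + 1)) M)} (h𝒪 : IsOpen 𝒪) (hy𝒪 : y₀ ∈ 𝒪) :
    ∃ δ > 0, ∃ N : Set (TangentBundle (𝓡∂ (d + 1)) M), IsOpen N ∧ y₀ ∈ N ∧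
      ∃ Ψ : TangentBundle (𝓡∂ (d + 1)) M → ℝ → TangentBundle (𝓡∂ (d + 1)) M,
        (∀ y ∈ N, Ψ y 0 = y ∧ IsGeodesicOn φ (Ψ y) (Ioo (-δ) δ) ∧ ∀ t ∈ Ioo (-δ) δ,
          Ψ y t ∈ 𝒪 ∧ (Ψ y t).proj ∈ (𝓡∂ (d + 1)).interior M ∧ (Ψ y t).2 ≠ 0) ∧
        ContMDiffOn ((𝓡∂ (d + 1)).tangent.prod 𝓘(ℝ, ℝ)) (𝓡∂ (d + 1)).tangent ∞
          (Function.uncurry Ψ) (N ×ˢ Ioo (-δ) δ) := by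
  set a := y₀.proj with ha
  set e := tChart (d := d) (M := M) a with he
  set O := 𝒪 ∩ {y | y.2 ≠ 0} ∩ {y | y.proj ∈ (𝓡∂ (d + 1)).interior M} with hO
  have hOo : IsOpen O := (h𝒪.inter isOpen_vel_ne_zero).inter
    (isOpen_interior_manifold.preimage continuous_proj)
  set Ω' : Set (Vec d × Vec d) := interior (extChartAt (𝓡∂ (d + 1)) a).target ×ˢ {0}ᶜ with hΩ'
  have hΩ'o : IsOpen Ω' := isOpen_interior.prod isOpen_compl_singleton
  have hΩ't : Ω' ⊆ e.target := fun z hz ↦ mem_tChart_target.2 (interior_subset hz.1)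
  set Ω := Ω' ∩ e.symm ⁻¹' O with hΩ
  have hΩo : IsOpen Ω := ((continuousOn_tChart_symm a).mono hΩ't).isOpen_inter_preimage hΩ'o hOo
  have hf : ContDiffOn ℝ ∞ (geodField φ a) Ω := (contDiffOn_geodField φ a).mono
    fun z hz ↦ ⟨interior_subset hz.1.1, hz.1.2⟩
  have hz₀ : e y₀ ∈ Ω := by
    refine ⟨⟨?_, (tChart_snd_ne_zero (mem_tChart_self _)).2 hv₀⟩, ?_⟩
    · exact (mem_interior_target_iff (mem_extChartAt_target a)).2
        ((mem_interior_iff (mem_extChartAt_source a)).1 hy₀)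
    · rw [mem_preimage, e.left_inv (mem_tChart_self _)]
      exact ⟨⟨hy𝒪, hv₀⟩, hy₀⟩
  obtain ⟨δ, hδ, N', hN', hzN', Φ, hΦ, hΦs⟩ := exists_smooth_flow hΩo hf hz₀
  refine ⟨δ, hδ, e.source ∩ e ⁻¹' N',
    (continuousOn_tChart a).isOpen_inter_preimage (isOpen_tChart_source a) hN',
    ⟨mem_tChart_self _, hzN'⟩, fun y t ↦ e.symm (Φ (e y) t), ?_, ?_⟩
  · rintro y ⟨hys, hyN⟩
    obtain ⟨h0, hflow⟩ := hΦ _ hyN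
    have hin : ∀ t ∈ Ioo (-δ) δ, e.symm (Φ (e y) t) ∈ O := fun t ht ↦ (hflow t ht).1.2
    have htgt : ∀ t ∈ Ioo (-δ) δ, Φ (e y) t ∈ e.target := fun t ht ↦ hΩ't (hflow t ht).1.1
    refine ⟨by simp only [h0, e.left_inv hys], ?_, fun t ht ↦
        ⟨(hin t ht).1.1, (hin t ht).2, (hin t ht).1.2⟩⟩
    rw [isGeodesicOn_iff (fun t ht ↦ (hin t ht).1.2)]
    refine ⟨(continuousOn_tChart_symm a).comp
      (fun t ht ↦ (hflow t ht).2.continuousAt.continuousWithinAt) htgt, fun t ht ↦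
      ⟨a, e.map_target (htgt t ht), ?_⟩⟩
    change HasDerivWithinAt (fun s ↦ e (e.symm (Φ (e y) s)))
        (geodField φ a (e (e.symm (Φ (e y) t)))) _ _
    rw [e.right_inv (htgt t ht)]
    exact (hflow t ht).2.hasDerivWithinAt.congr (fun s hs ↦ e.right_inv (htgt s hs))
      (e.right_inv (htgt t ht))
  · have h1 : ContMDiffOn ((𝓡∂ (d + 1)).tangent.prod 𝓘(ℝ, ℝ)) 𝓘(ℝ, (Vec d × Vec d) × ℝ) ∞
        (fun z : TangentBundle (𝓡∂ (d + 1)) M × ℝ ↦ (e z.1, z.2))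
        ((e.source ∩ e ⁻¹' N') ×ˢ Ioo (-δ) δ) :=
      ((contMDiffOn_tChart a).comp contMDiffOn_fst (fun z hz ↦ hz.1.1)).prodMk_space contMDiffOn_snd
    have h2 := hΦs.contMDiffOn
    have h3 := h2.comp h1 (fun z hz ↦ ⟨hz.1.2, hz.2⟩)
    exact (contMDiffOn_tChart_symm a).comp h3 (fun z hz ↦ hΩ't ((hΦ _ hz.1.2).2 _ hz.2).1.1)

end Flow
section Reparam

/-! ### Functions of one real variable -/

/-- The inverse of a function of one real variable with positive derivative. -/
lemma exists_inverse_of_deriv_pos {τ τ' : ℝ → ℝ} {a b : ℝ} (hab : a ≤ b)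
    (hc : ContinuousOn τ (Icc a b)) (hd : ∀ s ∈ Ioo a b, HasDerivAt τ (τ' s) s)
    (hpos : ∀ s ∈ Ioo a b, 0 < τ' s) :
    StrictMonoOn τ (Icc a b) ∧
    ∃ g : ℝ → ℝ, ContinuousOn g (Icc (τ a) (τ b)) ∧ MapsTo g (Icc (τ a) (τ b)) (Icc a b) ∧
      (∀ s ∈ Icc a b, g (τ s) = s) ∧ (∀ t ∈ Icc (τ a) (τ b), τ (g t) = t) ∧
      ∀ t ∈ Ioo (τ a) (τ b), g t ∈ Ioo a b ∧ HasDerivAt g (τ' (g t))⁻¹ t := by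
  have hmono : StrictMonoOn τ (Icc a b) := by
    refine strictMonoOn_of_deriv_pos (convex_Icc a b) hc fun s hs ↦ ?_
    rw [interior_Icc] at hs
    rw [(hd s hs).deriv]
    exact hpos s hs
  refine ⟨hmono, ?_⟩
  have himg : τ '' Icc a b = Icc (τ a) (τ b) := by
    refine Subset.antisymm ?_ (intermediate_value_Icc hab hc)
    rintro _ ⟨s, hs, rfl⟩
    exact ⟨hmono.monotoneOn (left_mem_Icc.2 hab) hs hs.1,
      hmono.monotoneOn hs (right_mem_Icc.2 hab) hs.2⟩
  set g := Function.invFunOn τ (Icc a b) with hg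
  have hgl : ∀ s ∈ Icc a b, g (τ s) = s := fun s hs ↦ hmono.injOn.leftInvOn_invFunOn hs
  have hmaps : MapsTo g (Icc (τ a) (τ b)) (Icc a b) := by
    intro t ht
    rw [← himg] at ht
    exact Function.invFunOn_mem ht
  have hgr : ∀ t ∈ Icc (τ a) (τ b), τ (g t) = t := by
    intro t ht
    rw [← himg] at ht
    exact Function.invFunOn_eq ht
  have hcont : ContinuousOn g (Icc (τ a) (τ b)) := by
    rw [← himg]
    -- a closed set of the source has compact, hence closed, image
    refine continuousOn_iff_isClosed.2 fun F hF ↦ ⟨τ '' (Icc a b ∩ F),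
      ((isCompact_Icc.inter_right hF).image_of_continuousOn (hc.mono inter_subset_left)).isClosed,
          ?_⟩
    ext w
    constructor
    · rintro ⟨hw, s, hs, rfl⟩
      rw [mem_preimage, hgl s hs] at hw
      exact ⟨⟨s, ⟨hs, hw⟩, rfl⟩, s, hs, rfl⟩
    · rintro ⟨⟨s, ⟨hs, hsF⟩, rfl⟩, h⟩
      exact ⟨by rwa [mem_preimage, hgl s hs], h⟩
  refine ⟨g, hcont, hmaps, hgl, hgr, fun t ht ↦ ?_⟩
  have htI := Ioo_subset_Icc_self ht
  have hgt : g t ∈ Ioo a b := by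
    have h1 := hmaps htI
    refine ⟨lt_of_le_of_ne h1.1 fun h ↦ ?_, lt_of_le_of_ne h1.2 fun h ↦ ?_⟩
    · have := hgr t htI
      rw [← h] at this
      exact ht.1.ne this
    · have := hgr t htI
      rw [h] at this
      exact ht.2.ne this.symm
  refine ⟨hgt, HasDerivAt.of_local_left_inverse
    ((hcont t htI).continuousAt (Icc_mem_nhds ht.1 ht.2)) (hd _ hgt) (hpos _ hgt).ne' ?_⟩
  filter_upwards [Icc_mem_nhds ht.1 ht.2] with r hr using hgr r hr

/-- A derivative that extends continuously to the ends of an interval is also the derivative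
there. -/
lemma hasDerivWithinAt_Icc_of_Ioo {E : Type*} [NormedAddCommGroup E] [NormedSpace ℝ E] {z F : ℝ → E}
    {a b : ℝ} (hab : a < b) (hz : ContinuousOn z (Icc a b)) (hF : ContinuousOn F (Icc a b))
    (hd : ∀ t ∈ Ioo a b, HasDerivAt z (F t) t) : ∀ t ∈ Icc a b, HasDerivWithinAt z (F t)
        (Icc a b) t := by
  intro t ht
  have hderiv : ∀ t ∈ Ioo a b, deriv z t = F t := fun t ht ↦ (hd t ht).deriv
  rcases eq_or_lt_of_le ht.1 with rfl | h1
  · refine (hasDerivWithinAt_Ici_of_tendsto_deriv (s := Ioo a b)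
      (fun t ht ↦ (hd t ht).differentiableAt.differentiableWithinAt)
      ((hz a ht).mono Ioo_subset_Icc_self) (Ioo_mem_nhdsGT hab) ?_).mono Icc_subset_Ici_self
    have := ((hF a ht).mono (Ioo_subset_Icc_self (a := a) (b := b))).tendsto
    rw [nhdsWithin_Ioo_eq_nhdsGT hab] at this
    refine this.congr' ?_
    filter_upwards [Ioo_mem_nhdsGT hab] with t ht using (hderiv t ht).symm
  · rcases eq_or_lt_of_le ht.2 with rfl | h2
    · refine (hasDerivWithinAt_Iic_of_tendsto_deriv (s := Ioo a t)
        (fun t ht ↦ (hd t ht).differentiableAt.differentiableWithinAt)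
        ((hz t ht).mono Ioo_subset_Icc_self) (Ioo_mem_nhdsLT hab) ?_).mono Icc_subset_Iic_self
      have := ((hF t ht).mono (Ioo_subset_Icc_self (a := a) (b := t))).tendsto
      rw [nhdsWithin_Ioo_eq_nhdsLT hab] at this
      refine this.congr' ?_
      filter_upwards [Ioo_mem_nhdsLT hab] with t ht using (hderiv t ht).symm
    · exact (hd t ⟨h1, h2⟩).hasDerivWithinAt

end Reparam

section Rays

/-! ### The rays that start in the inward field -/

set_option linter.unusedSectionVars false

variable {d : ℕ} {M : Type*} [TopologicalSpace M] [ChartedSpace (EuclideanHalfSpace (d + 1)) M]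
  [IsManifold (𝓡∂ (d + 1)) ∞ M]

variable {φ : FinslerMetric d M} {Γ : (x : M) → TangentSpace (𝓡∂ (d + 1)) x} {x : M} {T : ℝ}
  {α β γ : ℝ → TangentBundle (𝓡∂ (d + 1)) M}

/-- The initial vector of the rays from `x`. -/
def initVec (Γ : (x : M) → TangentSpace (𝓡∂ (d + 1)) x) (x : M) : TangentBundle (𝓡∂ (d + 1)) M :=
  ⟨x, Γ x⟩

lemma IsInwardField.ne_zero (hΓ : IsInwardField Γ) (hx : x ∈ (𝓡∂ (d + 1)).boundary M) :
    (initVec Γ x).2 ≠ 0 := by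
  intro h
  have h1 := hΓ.2 x hx
  have h2 : (show EuclideanSpace ℝ (Fin (d + 1)) from Γ x) = 0 := h
  rw [h2] at h1
  simp at h1

/-- A geodesic is continued by the geodesic that starts at its last vector. -/
lemma IsGeodesicOn.extend [T2Space M] {t₁ δ τ : ℝ} (ht₁ : 0 ≤ t₁) (hα : IsGeodesicOn φ α (Icc 0 t₁))
    (hγ : IsGeodesicOn φ γ (Ioo (-δ) δ)) (h : γ 0 = α t₁) (hv : (α t₁).2 ≠ 0)
    (hτ : τ ∈ Ico 0 δ) :
    IsGeodesicOn φ (fun s ↦ if s ≤ t₁ then α s else γ (s - t₁)) (Icc 0 (t₁ + τ)) := by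
  have hδ : 0 < δ := hτ.1.trans_lt hτ.2
  have hγ' := hγ.comp_add (-t₁)
  have hagree : EqOn α (fun s ↦ γ (s + -t₁)) (Ioc (t₁ - δ) t₁ ∩ Ici 0) := by
    refine IsGeodesicOn.eqOn (hα.mono fun s hs ↦ ⟨hs.2, hs.1.2⟩) (hγ'.mono fun s hs ↦ ?_)
      (ordConnected_Ioc.inter ordConnected_Ici) (s := t₁) ⟨⟨by linarith, le_rfl⟩, ht₁⟩ hv
          (by simp [h])
    simp only [mem_ofPred_eq, mem_Ioo]
    constructor <;> linarith [hs.1.1, hs.1.2]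
  refine IsGeodesicOn.of_local fun t ht ↦ ?_
  rcases lt_or_ge t t₁ with hlt | hge
  · refine ⟨Icc 0 t₁, ?_, ⟨ht.1, hlt.le⟩, hα.congr fun s hs ↦ by simp [hs.2]⟩
    filter_upwards [self_mem_nhdsWithin, mem_nhdsWithin_of_mem_nhds
        (Iio_mem_nhds hlt)] with s hs hs'
    exact ⟨hs.1, le_of_lt hs'⟩
  · refine ⟨Ioo (t₁ - δ) (t₁ + δ) ∩ Icc 0 (t₁ + τ), ?_,
      ⟨⟨by linarith, by linarith [ht.2, hτ.2]⟩, ht⟩, ?_⟩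
    · exact inter_mem (mem_nhdsWithin_of_mem_nhds (Ioo_mem_nhds (by linarith)
        (by linarith [ht.2, hτ.2])))
        self_mem_nhdsWithin
    · refine IsGeodesicOn.congr (hγ'.mono fun s hs ↦ ?_) fun s hs ↦ ?_
      · simp only [mem_ofPred_eq, mem_Ioo]
        constructor <;> linarith [hs.1.1, hs.1.2]
      · by_cases hs1 : s ≤ t₁
        · simp only [hs1, if_true]
          exact hagree ⟨⟨hs.1.1, hs1⟩, hs.2.1⟩
        · simp [hs1, sub_eq_add_neg]

namespace IsRay

lemma mono (h : IsRay φ Γ x T α) {s : ℝ} (hs : s ∈ Icc 0 T) : IsRay φ Γ x s α :=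
  ⟨h.1, hs.1, h.2.2.1.mono (Icc_subset_Icc_right hs.2), h.2.2.2⟩

lemma apply_zero (h : IsRay φ Γ x T α) : α 0 = initVec Γ x := h.2.2.2

lemma ne_zero (h : IsRay φ Γ x T α) (hΓ : IsInwardField Γ) {t : ℝ} (ht : t ∈ Icc 0 T) :
    (α t).2 ≠ 0 :=
  h.2.2.1.ne_zero ordConnected_Icc (left_mem_Icc.2 h.2.1) ht (by
    rw [h.apply_zero]; exact hΓ.ne_zero h.1)

lemma toFun_eq (h : IsRay φ Γ x T α) (hΓ : IsInwardField Γ) {t : ℝ} (ht : t ∈ Icc 0 T) :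
    φ.toFun (α t) = φ.toFun (initVec Γ x) := by
  rw [← h.apply_zero]
  exact h.2.2.1.toFun_eq ordConnected_Icc (left_mem_Icc.2 h.2.1) ht (by
    rw [h.apply_zero]; exact hΓ.ne_zero h.1)

lemma eqOn [T2Space M] (h : IsRay φ Γ x T α) (hΓ : IsInwardField Γ) {T' : ℝ}
    (h' : IsRay φ Γ x T' β) : EqOn α β (Icc 0 (min T T')) := by
  have hm : 0 ≤ min T T' := le_min h.2.1 h'.2.1
  exact (h.mono ⟨hm, min_le_left _ _⟩).2.2.1.eqOn (h'.mono ⟨hm, min_le_right _ _⟩).2.2.1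
    ordConnected_Icc (left_mem_Icc.2 hm) (by rw [h.apply_zero]; exact hΓ.ne_zero h.1)
    (h.apply_zero.trans h'.apply_zero.symm)

lemma mem_rayDomain (h : IsRay φ Γ x T α) {t : ℝ} (ht : t ∈ Icc 0 T) : (x, t) ∈ rayDomain φ Γ :=
  ⟨α, h.mono ht⟩

lemma rayFlow_eq [T2Space M] (h : IsRay φ Γ x T α) (hΓ : IsInwardField Γ) {t : ℝ}
    (ht : t ∈ Icc 0 T) : rayFlow φ Γ x t = α t := by
  have hex : ∃ α, IsRay φ Γ x t α := ⟨α, h.mono ht⟩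
  rw [rayFlow, dif_pos hex]
  exact hex.choose_spec.eqOn hΓ (h.mono ht) ⟨ht.1, by simp⟩

end IsRay

lemma isRay_rayFlow [T2Space M] (hΓ : IsInwardField Γ) (h : (x, T) ∈ rayDomain φ Γ) :
    IsRay φ Γ x T (rayFlow φ Γ x) := by
  obtain ⟨α, hα⟩ := h
  simp only at hα
  refine ⟨hα.1, hα.2.1, hα.2.2.1.congr fun t ht ↦ hα.rayFlow_eq hΓ ht, ?_⟩
  rw [hα.rayFlow_eq hΓ (left_mem_Icc.2 hα.2.1)]
  exact hα.2.2.2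

/-- A ray follows each geodesic over the interior that meets it, in both directions. -/
lemma IsRay.follow [T2Space M] {t₁ δ τ : ℝ} (hα : IsRay φ Γ x t₁ α) (hΓ : IsInwardField Γ)
    (hγ : IsGeodesicOn φ γ (Ioo (-δ) δ))
    (hγi : ∀ t ∈ Ioo (-δ) δ, (γ t).proj ∈ (𝓡∂ (d + 1)).interior M) (h : γ 0 = α t₁)
    (hτ : τ ∈ Ioo (-δ) δ) :
    0 < t₁ + τ ∧ (x, t₁ + τ) ∈ rayDomain φ Γ ∧ rayFlow φ Γ x (t₁ + τ) = γ τ := by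
  have hδ : 0 < δ := by linarith [hτ.1, hτ.2]
  have hv := hα.ne_zero hΓ (right_mem_Icc.2 hα.2.1)
  have hγ' := hγ.comp_add (-t₁)
  have hagree : EqOn α (fun s ↦ γ (s + -t₁)) (Ioc (t₁ - δ) t₁ ∩ Ici 0) := by
    refine IsGeodesicOn.eqOn (hα.2.2.1.mono fun s hs ↦ ⟨hs.2, hs.1.2⟩) (hγ'.mono fun s hs ↦ ?_)
      (ordConnected_Ioc.inter ordConnected_Ici) (s := t₁) ⟨⟨by linarith, le_rfl⟩, hα.2.1⟩ hv
      (by simp [h])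
    simp only [mem_ofPred_eq, mem_Ioo]
    constructor <;> linarith [hs.1.1, hs.1.2]
  have hpos : δ ≤ t₁ := by
    by_contra hlt
    have h0 := hagree (x := 0) ⟨⟨by linarith, hα.2.1⟩, self_mem_Ici⟩
    simp only at h0
    have h1 := hγi (0 + -t₁) ⟨by linarith [hα.2.1], by linarith [hα.2.1]⟩
    rw [← h0, hα.apply_zero] at h1
    exact (ModelWithCorners.disjoint_interior_boundary).le_bot ⟨h1, hα.1⟩
  refine ⟨by linarith [hτ.1], ?_⟩
  rcases le_or_gt τ 0 with hτ0 | hτ0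
  · have hmem : t₁ + τ ∈ Icc 0 t₁ := ⟨by linarith [hτ.1], by linarith⟩
    refine ⟨hα.mem_rayDomain hmem, ?_⟩
    rw [hα.rayFlow_eq hΓ hmem, hagree ⟨⟨by linarith [hτ.1], hmem.2⟩, hmem.1⟩]
    simp
  · have hext := hα.2.2.1.extend hα.2.1 hγ h hv ⟨hτ0.le, hτ.2⟩
    have hray : IsRay φ Γ x (t₁ + τ) (fun s ↦ if s ≤ t₁ then α s else γ (s - t₁)) :=
      ⟨hα.1, by linarith [hα.2.1], hext, by simp [hα.2.1, hα.2.2.2]⟩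
    have hmem : t₁ + τ ∈ Icc 0 (t₁ + τ) := ⟨by linarith [hα.2.1], le_rfl⟩
    refine ⟨hray.mem_rayDomain hmem, ?_⟩
    rw [hray.rayFlow_eq hΓ hmem]
    simp [hτ0]

end Rays
section Collar

/-! ### A collar of the boundary made of rays -/

set_option linter.unusedSectionVars false

variable {d : ℕ} {M : Type*} [TopologicalSpace M] [ChartedSpace (EuclideanHalfSpace (d + 1)) M]
  [IsManifold (𝓡∂ (d + 1)) ∞ M]

/-- The model space of the boundary. -/
abbrev BVec (d : ℕ) := EuclideanSpace ℝ (Fin d)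

/-- The inclusion of the boundary of the half space. -/
noncomputable def bdryEmb (d : ℕ) : BVec d →L[ℝ] Vec d :=
  LinearMap.toContinuousLinearMap
    { toFun := fun u ↦ WithLp.toLp 2 (Fin.cons 0 fun i ↦ u i)
      map_add' := fun u v ↦ by ext i; refine Fin.cases ?_ (fun j ↦ ?_) i <;> simp
      map_smul' := fun c v ↦ by ext i; refine Fin.cases ?_ (fun j ↦ ?_) i <;> simp }

/-- The projection of the half space to its boundary. -/
noncomputable def bdryProj (d : ℕ) : Vec d →L[ℝ] BVec d :=
  LinearMap.toContinuousLinearMap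
    { toFun := fun v ↦ WithLp.toLp 2 fun i ↦ v i.succ
      map_add' := fun u v ↦ by ext i; simp
      map_smul' := fun c v ↦ by ext i; simp }

lemma bdryEmb_zero_apply (u : BVec d) : bdryEmb d u 0 = 0 := rfl

lemma bdryEmb_succ_apply (u : BVec d) (i : Fin d) : bdryEmb d u i.succ = u i := rfl

lemma bdryProj_apply (v : Vec d) (i : Fin d) : bdryProj d v i = v i.succ := rfl

lemma bdryProj_bdryEmb (u : BVec d) : bdryProj d (bdryEmb d u) = u := by
  ext i; rfl

lemma bdryEmb_bdryProj {v : Vec d} (hv : v 0 = 0) : bdryEmb d (bdryProj d v) = v := by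
  ext i
  refine Fin.cases ?_ (fun j ↦ ?_) i
  · rw [bdryEmb_zero_apply, hv]
  · rfl

lemma boundaryParam_eq (x : M) (u : BVec d) :
    boundaryParam x u = (extChartAt (𝓡∂ (d + 1)) x).symm (bdryEmb d u) := rfl

lemma bdryEmb_boundaryCoord {x : M} (hx : x ∈ (𝓡∂ (d + 1)).boundary M) :
    bdryEmb d (boundaryCoord x) = extChartAt (𝓡∂ (d + 1)) x x :=
  bdryEmb_bdryProj ((mem_boundary_iff (mem_extChartAt_source x)).1 hx)

lemma boundaryParam_boundaryCoord {x : M} (hx : x ∈ (𝓡∂ (d + 1)).boundary M) :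
    boundaryParam x (boundaryCoord (d := d) x) = x := by
  rw [boundaryParam_eq, bdryEmb_boundaryCoord hx, extChartAt_to_inv]

/-- The domain of the boundary coordinates around `x`. -/
def bdryDom (d : ℕ) {M : Type*} [TopologicalSpace M] [ChartedSpace (EuclideanHalfSpace (d + 1)) M]
    (x : M) : Set (BVec d) := {u | bdryEmb d u ∈ (extChartAt (𝓡∂ (d + 1)) x).target}

/-- An open set of the model space that cuts the target of a chart out of the half space. -/
lemma exists_isOpen_target (x : M) : ∃ O : Set (Vec d), IsOpen O ∧
    ∀ z, z ∈ (extChartAt (𝓡∂ (d + 1)) x).target ↔ z ∈ O ∧ 0 ≤ z 0 := by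
  refine ⟨(𝓡∂ (d + 1)).symm ⁻¹' (chartAt (EuclideanHalfSpace (d + 1)) x).target,
    (chartAt (EuclideanHalfSpace (d + 1)) x).open_target.preimage (𝓡∂ (d + 1)).continuous_symm,
    fun z ↦ ?_⟩
  rw [extChartAt_target, range_model]
  rfl

lemma isOpen_bdryDom (x : M) : IsOpen (bdryDom d x) := by
  obtain ⟨O, hO, h⟩ := exists_isOpen_target (d := d) x
  have : bdryDom d x = bdryEmb d ⁻¹' O := by
    ext u
    simp only [bdryDom, mem_ofPred_eq, h, mem_preimage, bdryEmb_zero_apply, le_refl, and_true]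
  rw [this]
  exact hO.preimage (bdryEmb d).continuous

lemma boundaryCoord_mem_bdryDom {x : M} (hx : x ∈ (𝓡∂ (d + 1)).boundary M) :
    boundaryCoord x ∈ bdryDom d x := by
  rw [bdryDom, mem_ofPred_eq, bdryEmb_boundaryCoord hx]
  exact mem_extChartAt_target x

lemma boundaryParam_mem_source {x : M} {u : BVec d} (hu : u ∈ bdryDom d x) :
    boundaryParam x u ∈ (extChartAt (𝓡∂ (d + 1)) x).source :=
  (extChartAt (𝓡∂ (d + 1)) x).map_target hu

lemma extChartAt_boundaryParam {x : M} {u : BVec d} (hu : u ∈ bdryDom d x) :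
    extChartAt (𝓡∂ (d + 1)) x (boundaryParam x u) = bdryEmb d u :=
  (extChartAt (𝓡∂ (d + 1)) x).right_inv hu

lemma boundaryParam_mem_boundary {x : M} {u : BVec d} (hu : u ∈ bdryDom d x) :
    boundaryParam x u ∈ (𝓡∂ (d + 1)).boundary M := by
  rw [mem_boundary_iff (boundaryParam_mem_source hu), extChartAt_boundaryParam hu,
      bdryEmb_zero_apply]

lemma contMDiffOn_boundaryParam (x : M) :
    ContMDiffOn (𝓡 d) (𝓡∂ (d + 1)) ∞ (boundaryParam (d := d) x) (bdryDom d x) :=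
  (contMDiffOn_extChartAt_symm (I := 𝓡∂ (d + 1)) (n := ∞) x).comp
    (bdryEmb d).contDiff.contMDiff.contMDiffOn (fun _ hu ↦ hu)

variable {φ : FinslerMetric d M} {Γ : (x : M) → TangentSpace (𝓡∂ (d + 1)) x} {x₀ : M}

/-- The initial velocities of the rays, in the chart at `x₀`. -/
noncomputable def initVel (Γ : (x : M) → TangentSpace (𝓡∂ (d + 1)) x) (x₀ : M) (u : BVec d) :
    Vec d :=
  (tChart x₀ (initVec Γ (boundaryParam x₀ u))).2

lemma contDiffOn_initVel (hΓ : IsInwardField Γ) (x₀ : M) :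
    ContDiffOn ℝ ∞ (initVel Γ x₀) (bdryDom d x₀) := by
  have h1 : ContMDiffOn (𝓡 d) (𝓡∂ (d + 1)).tangent ∞ (fun u ↦ initVec Γ (boundaryParam x₀ u))
      (bdryDom d x₀) :=
    hΓ.1.comp (contMDiffOn_boundaryParam x₀) (fun u hu ↦ boundaryParam_mem_boundary hu)
  have h2 := (contMDiffOn_tChart x₀).comp h1 (fun u hu ↦ by
    rw [mem_preimage, mem_tChart_source]; exact boundaryParam_mem_source hu)
  exact h2.contDiffOn.snd

lemma initVel_boundaryCoord (hx₀ : x₀ ∈ (𝓡∂ (d + 1)).boundary M) :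
    initVel Γ x₀ (boundaryCoord x₀) = vel (initVec Γ x₀) := by
  rw [initVel, boundaryParam_boundaryCoord hx₀]
  exact congrArg Prod.snd (tChart_self x₀ (vel (initVec Γ x₀)))

lemma tChart_symm_initVel {u : BVec d} (hu : u ∈ bdryDom d x₀) :
    (tChart x₀).symm (bdryEmb d u, initVel Γ x₀ u) = initVec Γ (boundaryParam x₀ u) := by
  have hs : initVec Γ (boundaryParam x₀ u) ∈ (tChart x₀).source :=
    mem_tChart_source.2 (boundaryParam_mem_source hu)
  rw [← (tChart x₀).left_inv hs]
  congr 1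
  refine Prod.ext ?_ rfl
  rw [tChart_fst]
  exact (extChartAt_boundaryParam hu).symm

/-- Coordinates near a boundary point adapted to the rays: the rays from the boundary points near
`x₀` are parametrized by the square root `σ` of the distance to the boundary in the chart at `x₀`.
In this parameter the equation of the rays extends smoothly across the boundary. -/
lemma exists_collar (hΓ : IsInwardField Γ) (hx₀ : x₀ ∈ (𝓡∂ (d + 1)).boundary M)
    {𝒩 : Set (TangentBundle (𝓡∂ (d + 1)) M)} (h𝒩 : IsOpen 𝒩) (hx₀𝒩 : initVec Γ x₀ ∈ 𝒩) {η : ℝ}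
    (hη : 0 < η) :
    ∃ W : Set (BVec d), IsOpen W ∧ boundaryCoord x₀ ∈ W ∧ W ⊆ bdryDom d x₀ ∧
      ∃ δ > 0, ∃ (Z : BVec d × ℝ → Vec d × Vec d) (τ : BVec d × ℝ → ℝ),
      ContDiffOn ℝ ∞ Z (W ×ˢ Ioo (-δ) δ) ∧ ContDiffOn ℝ ∞ τ (W ×ˢ Ioo (-δ) δ) ∧
      ∀ u ∈ W, (Z (u, 0)).1 = bdryEmb d u ∧ HasDerivAt (fun σ ↦ (Z (u, σ)).1) 0 0 ∧
        ∀ σ ∈ Ico 0 δ, (Z (u, σ)).1 0 = σ ^ 2 ∧ Z (u, σ) ∈ (tChart (d := d) (M := M) x₀).target ∧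
          τ (u, σ) < η ∧ (0 < σ → 0 < τ (u, σ)) ∧
          ∃ α, IsRay φ Γ (boundaryParam x₀ u) (τ (u, σ)) α ∧
            α (τ (u, σ)) = (tChart x₀).symm (Z (u, σ)) ∧
            (∀ t ∈ Icc 0 (τ (u, σ)), α t ∈ 𝒩) ∧
            ∀ t ∈ Ioc 0 (τ (u, σ)), (α t).proj ∈ (𝓡∂ (d + 1)).interior M := by
  obtain ⟨O, hO, hOt⟩ := exists_isOpen_target (d := d) x₀
  set D := (extChartAt (𝓡∂ (d + 1)) x₀).target with hD
  set e := tChart (d := d) (M := M) x₀ with he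
  set E := ℝ × Vec d × Vec d × ℝ
  set p0 : Vec d →L[ℝ] ℝ := EuclideanSpace.proj 0 with hp0
  have hp0a : ∀ v : Vec d, p0 v = v 0 := fun v ↦ rfl
  -- A state `(σ, x, v, t)` stands for the position `ρ`, which is `x` with its normal coordinate
  -- replaced by `σ ^ 2`. It stays in the half space for all `σ`, so that the equation is defined and
  -- smooth on both sides of `σ = 0`.
  set ρ : E → Vec d := fun w ↦ bdryEmb d (bdryProj d w.2.1) + w.1 ^ 2 • EuclideanSpace.single 0 1
    with hρ
  have hρ0 : ∀ w, ρ w 0 = w.1 ^ 2 := fun w ↦ by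
    simp [hρ, bdryEmb_zero_apply]
  have hρs : ∀ w (i : Fin d), ρ w i.succ = w.2.1 i.succ := fun w i ↦ by
    simp [hρ, bdryEmb_succ_apply, bdryProj_apply]
  have hρc : ContDiff ℝ ∞ ρ := by fun_prop
  have hρD : ∀ w, ρ w ∈ O → ρ w ∈ D := fun w hw ↦ (hOt _).2 ⟨hw, by rw [hρ0]; positivity⟩
  set G : Vec d × Vec d → Vec d := fun z ↦ (geodField φ x₀ z).2 with hG
  -- the domain of the equation
  set Ω' : Set E := {w | ρ w ∈ O ∧ 0 < p0 w.2.2.1 ∧ w.2.2.2 < η} with hΩ'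
  have hΩ'o : IsOpen Ω' := by
    refine (hO.preimage hρc.continuous).inter (IsOpen.inter ?_ ?_)
    · exact isOpen_lt continuous_const (p0.continuous.comp
        (by fun_prop : Continuous fun w : E ↦ w.2.2.1))
    · exact isOpen_lt (by fun_prop : Continuous fun w : E ↦ w.2.2.2) continuous_const
  have hne : ∀ w ∈ Ω', w.2.2.1 ≠ 0 := fun w hw h0 ↦ by
    have := hw.2.1
    rw [h0] at this
    simp at this
  have hmapt : MapsTo (fun w : E ↦ (ρ w, w.2.2.1)) Ω' e.target := fun w hw ↦
    mem_tChart_target.2 (hρD w hw.1)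
  have hmapg : MapsTo (fun w : E ↦ (ρ w, w.2.2.1)) Ω' (geodDom d x₀) := fun w hw ↦
    ⟨hρD w hw.1, hne w hw⟩
  have hzc : ContDiff ℝ ∞ (fun w : E ↦ (ρ w, w.2.2.1)) := hρc.prodMk (by fun_prop)
  set Ω := Ω' ∩ (fun w ↦ e.symm (ρ w, w.2.2.1)) ⁻¹' 𝒩 with hΩ
  have hΩo : IsOpen Ω := ((continuousOn_tChart_symm x₀).comp hzc.continuous.continuousOn
    hmapt).isOpen_inter_preimage hΩ'o h𝒩
  -- As the normal coordinate is to be `σ ^ 2`, the time satisfies `dt/dσ = 2 σ / v₀`, where `v₀` is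
  -- the normal velocity.
  set k : E → ℝ := fun w ↦ 2 * w.1 / p0 w.2.2.1 with hk
  set f : E → E := fun w ↦ (1, k w • w.2.2.1, k w • G (ρ w, w.2.2.1), k w) with hf
  have hkc : ContDiffOn ℝ ∞ k Ω := ContDiffOn.div (by fun_prop) (by fun_prop) fun w hw ↦
      hw.1.2.1.ne'
  have hGc : ContDiffOn ℝ ∞ (fun w : E ↦ G (ρ w, w.2.2.1)) Ω :=
    ((contDiffOn_geodField φ x₀).snd).comp hzc.contDiffOn fun w hw ↦ hmapg hw.1
  have hfc : ContDiffOn ℝ ∞ f Ω := contDiffOn_const.prodMk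
    ((hkc.smul (by fun_prop)).prodMk ((hkc.smul hGc).prodMk hkc))
  -- the initial states
  set w₀ : BVec d → E := fun u ↦ (0, bdryEmb d u, initVel Γ x₀ u, 0) with hw₀
  have hw₀c : ContDiffOn ℝ ∞ w₀ (bdryDom d x₀) :=
    contDiffOn_const.prodMk ((bdryEmb d).contDiff.contDiffOn.prodMk
      ((contDiffOn_initVel hΓ x₀).prodMk contDiffOn_const))
  have hρw₀ : ∀ u, ρ (w₀ u) = bdryEmb d u := fun u ↦ by
    simp [hρ, hw₀, bdryProj_bdryEmb]
  have hu₀ := boundaryCoord_mem_bdryDom hx₀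
  have hw₀Ω : w₀ (boundaryCoord x₀) ∈ Ω := by
    refine ⟨⟨?_, ?_, hη⟩, ?_⟩
    · rw [hρw₀]
      exact ((hOt _).1 hu₀).1
    · change 0 < p0 (initVel Γ x₀ (boundaryCoord x₀))
      rw [initVel_boundaryCoord hx₀]
      exact hΓ.2 x₀ hx₀
    · rw [mem_preimage, hρw₀]
      change e.symm (bdryEmb d _, initVel Γ x₀ (boundaryCoord x₀)) ∈ 𝒩
      rw [he, tChart_symm_initVel hu₀, boundaryParam_boundaryCoord hx₀]
      exact hx₀𝒩
  obtain ⟨δ, hδ, N, hN, hw₀N, Φ, hΦ, hΦs⟩ := exists_smooth_flow hΩo hfc hw₀Ω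
  set W := bdryDom d x₀ ∩ w₀ ⁻¹' N with hW
  have hWo : IsOpen W := hw₀c.continuousOn.isOpen_inter_preimage (isOpen_bdryDom x₀) hN
  have hflow : ContDiffOn ℝ ∞ (fun z : BVec d × ℝ ↦ Φ (w₀ z.1) z.2) (W ×ˢ Ioo (-δ) δ) :=
    hΦs.comp ((hw₀c.comp contDiffOn_fst (fun z hz ↦ hz.1.1)).prodMk contDiffOn_snd)
      (fun z hz ↦ ⟨hz.1.2, hz.2⟩)
  refine ⟨W, hWo, ⟨hu₀, hw₀N⟩, inter_subset_left, δ, hδ,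
    fun z ↦ ((Φ (w₀ z.1) z.2).2.1, (Φ (w₀ z.1) z.2).2.2.1), fun z ↦ (Φ (w₀ z.1) z.2).2.2.2,
    hflow.snd.fst.prodMk hflow.snd.snd.fst, hflow.snd.snd.snd, fun u hu ↦ ?_⟩
  obtain ⟨hc0, hc⟩ := hΦ _ hu.2
  set c : ℝ → E := Φ (w₀ u) with hcdef
  have h0 : (0 : ℝ) ∈ Ioo (-δ) δ := ⟨by linarith, hδ⟩
  have hc1 : ∀ s ∈ Ioo (-δ) δ, HasDerivAt (fun s ↦ (c s).1) 1 s := fun s hs ↦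
    (ContinuousLinearMap.fst ℝ ℝ (Vec d × Vec d × ℝ)).hasFDerivAt.comp_hasDerivAt s (hc s hs).2
  have hc2 : ∀ s ∈ Ioo (-δ) δ, HasDerivAt (fun s ↦ (c s).2.1) (k (c s) • (c s).2.2.1) s :=
    fun s hs ↦ ((ContinuousLinearMap.fst ℝ (Vec d) (Vec d × ℝ)).comp
      (ContinuousLinearMap.snd ℝ ℝ (Vec d × Vec d × ℝ))).hasFDerivAt.comp_hasDerivAt s (hc s hs).2
  have hc3 : ∀ s ∈ Ioo (-δ) δ, HasDerivAt (fun s ↦ (c s).2.2.1)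
      (k (c s) • G (ρ (c s), (c s).2.2.1)) s :=
    fun s hs ↦ ((ContinuousLinearMap.fst ℝ (Vec d) ℝ).comp ((ContinuousLinearMap.snd ℝ (Vec d)
      (Vec d × ℝ)).comp (ContinuousLinearMap.snd ℝ ℝ
          (Vec d × Vec d × ℝ)))).hasFDerivAt.comp_hasDerivAt
        s (hc s hs).2
  have hc4 : ∀ s ∈ Ioo (-δ) δ, HasDerivAt (fun s ↦ (c s).2.2.2) (k (c s)) s :=
    fun s hs ↦ ((ContinuousLinearMap.snd ℝ (Vec d) ℝ).comp ((ContinuousLinearMap.snd ℝ (Vec d)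
      (Vec d × ℝ)).comp (ContinuousLinearMap.snd ℝ ℝ
          (Vec d × Vec d × ℝ)))).hasFDerivAt.comp_hasDerivAt
        s (hc s hs).2
  have hconst : ∀ {g : ℝ → ℝ}, g 0 = 0 → (∀ s ∈ Ioo (-δ) δ, HasDerivAt g 0 s) →
      ∀ s ∈ Ioo (-δ) δ, g s = 0 := fun {g} hg0 hg s hs ↦ by
    have := (convex_Ioo (-δ) δ).norm_image_sub_le_of_norm_hasDerivWithin_le (C := 0)
      (fun s hs ↦ (hg s hs).hasDerivWithinAt) (by simp) h0 hs
    rw [zero_mul, norm_le_zero_iff, hg0, sub_zero] at this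
    exact this
  have hs : ∀ s ∈ Ioo (-δ) δ, (c s).1 = s := fun s hs ↦ by
    have := hconst (g := fun s ↦ (c s).1 - s) (by simp [hc0, hw₀]) (fun s hs ↦ by
      exact ((hc1 s hs).sub (hasDerivAt_id s)).congr_deriv (sub_self 1)) s hs
    linarith
  have hX0 : ∀ s ∈ Ioo (-δ) δ, (c s).2.1 0 = s ^ 2 := fun s hs' ↦ by
    have := hconst (g := fun s ↦ p0 (c s).2.1 - s ^ 2) (by
      simp [hc0, hw₀, hp0a, bdryEmb_zero_apply]) (fun s hs' ↦ by
      have h1 := p0.hasFDerivAt.comp_hasDerivAt s (hc2 s hs')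
      have h2 := h1.sub (hasDerivAt_pow 2 s)
      refine h2.congr_deriv ?_
      have h3 := (hc s hs').1.1.2.1
      simp only [hk, map_smul, smul_eq_mul, hs s hs']
      have h4 : p0 (c s).2.2.1 ≠ 0 := h3.ne'
      field_simp
      simp) s hs'
    rw [hp0a] at this
    linarith
  have hρX : ∀ s ∈ Ioo (-δ) δ, ρ (c s) = (c s).2.1 := fun s hs' ↦ by
    ext i
    refine Fin.cases ?_ (fun j ↦ ?_) i
    · rw [hρ0, hs s hs', hX0 s hs']
    · rw [hρs]
  refine ⟨?_, ?_, fun σ hσ ↦ ?_⟩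
  · change (c 0).2.1 = _
    rw [hc0]
  · refine (hc2 0 h0).congr_deriv ?_
    simp [hk, hs 0 h0]
  have hσ' : σ ∈ Ioo (-δ) δ := ⟨by linarith [hσ.1], hσ.2⟩
  -- the ray through the point with parameter `σ`
  obtain ⟨σ₁, hσ₁, hσ₁δ⟩ := exists_between hσ.2
  have hσ₁0 : 0 < σ₁ := hσ.1.trans_lt hσ₁
  have hsub : Icc 0 σ₁ ⊆ Ioo (-δ) δ := fun s hs ↦ ⟨by linarith [hs.1], hs.2.trans_lt hσ₁δ⟩
  set τ : ℝ → ℝ := fun s ↦ (c s).2.2.2 with hτ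
  have hccont : ContinuousOn c (Icc 0 σ₁) := fun s hs ↦
    (hc s (hsub hs)).2.continuousAt.continuousWithinAt
  have hkpos : ∀ s ∈ Ioo 0 σ₁, 0 < k (c s) := fun s hs' ↦ by
    have h3 := (hc s (hsub (Ioo_subset_Icc_self hs'))).1.1.2.1
    simp only [hk, hs s (hsub (Ioo_subset_Icc_self hs'))]
    have := hs'.1
    positivity
  -- The time increases with `σ`; reparametrized by its inverse `g`, the solution is a geodesic.
  obtain ⟨hτmono, g, hgc, hgm, hgl, hgr, hgd⟩ := exists_inverse_of_deriv_pos hσ₁0.le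
    (τ := τ) (τ' := fun s ↦ k (c s)) hccont.snd.snd.snd
    (fun s hs ↦ hc4 s (hsub (Ioo_subset_Icc_self hs))) hkpos
  have hτ0 : τ 0 = 0 := by simp [hτ, hc0, hw₀]
  rw [hτ0] at hgc hgm hgr hgd
  have hσI : σ ∈ Icc 0 σ₁ := ⟨hσ.1, hσ₁.le⟩
  have hτσ : τ σ ∈ Icc 0 (τ σ₁) := by
    rw [← hτ0]
    exact ⟨hτmono.monotoneOn (left_mem_Icc.2 hσ₁0.le) hσI hσ.1,
      hτmono.monotoneOn hσI (right_mem_Icc.2 hσ₁0.le) hσ₁.le⟩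
  have hτ₁ : 0 < τ σ₁ := by
    rw [← hτ0]
    exact hτmono (left_mem_Icc.2 hσ₁0.le) (right_mem_Icc.2 hσ₁0.le) hσ₁0
  have htgt : ∀ s ∈ Icc 0 σ₁, ((c s).2.1, (c s).2.2.1) ∈ geodDom d x₀ := fun s hs' ↦ by
    rw [← hρX s (hsub hs')]
    exact hmapg (hc s (hsub hs')).1.1
  have htgt' : ∀ s ∈ Icc 0 σ₁, ((c s).2.1, (c s).2.2.1) ∈ e.target := fun s hs' ↦
    mem_tChart_target.2 (htgt s hs').1
  set z : ℝ → Vec d × Vec d := fun t ↦ ((c (g t)).2.1, (c (g t)).2.2.1) with hz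
  have hcg : ContinuousOn (fun t ↦ c (g t)) (Icc 0 (τ σ₁)) := hccont.comp hgc hgm
  have hzcont : ContinuousOn z (Icc 0 (τ σ₁)) := hcg.snd.fst.prodMk hcg.snd.snd.fst
  have hzder : ∀ t ∈ Icc 0 (τ σ₁), HasDerivWithinAt z (geodField φ x₀ (z t)) (Icc 0 (τ σ₁)) t := by
    refine hasDerivWithinAt_Icc_of_Ioo hτ₁ hzcont
      ((contDiffOn_geodField φ x₀).continuousOn.comp hzcont fun t ht ↦ htgt _ (hgm ht))
      fun t ht ↦ ?_
    obtain ⟨hgt, hgd'⟩ := hgd t ht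
    have hgt' := hsub (Ioo_subset_Icc_self hgt)
    have h2 := ((hc2 (g t) hgt').scomp t hgd').prodMk ((hc3 (g t) hgt').scomp t hgd')
    refine HasDerivAt.congr_deriv h2 ?_
    have hkne := (hkpos _ hgt).ne'
    simp only [smul_smul, inv_mul_cancel₀ hkne, one_smul, hρX _ hgt']
    rfl
  have hray : IsRay φ Γ (boundaryParam x₀ u) (τ σ₁) (fun t ↦ e.symm (z t)) := by
    refine ⟨boundaryParam_mem_boundary hu.1, hτ₁.le, ?_, ?_⟩
    · rw [isGeodesicOn_iff]
      · refine ⟨(continuousOn_tChart_symm x₀).comp hzcont fun t ht ↦ htgt' _ (hgm ht),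
          fun t ht ↦ ⟨x₀, e.map_target (htgt' _ (hgm ht)), ?_⟩⟩
        have hr : ∀ t ∈ Icc 0 (τ σ₁), e (e.symm (z t)) = z t := fun t ht ↦
          e.right_inv (htgt' _ (hgm ht))
        rw [← he, hr t ht]
        exact (hzder t ht).congr hr (hr t ht)
      · intro t ht
        exact (tChart_symm_snd_ne_zero (htgt _ (hgm ht)).1).2 (htgt _ (hgm ht)).2
    · have : g 0 = 0 := by
        have := hgl 0 (left_mem_Icc.2 hσ₁0.le)
        rwa [hτ0] at this
      simp only [hz, this, hc0, hw₀]
      exact tChart_symm_initVel hu.1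
  refine ⟨hX0 σ hσ', htgt' σ hσI, (hc σ hσ').1.1.2.2, fun h ↦ ?_, _, hray.mono hτσ, ?_, ?_, ?_⟩
  · rw [← hτ0]
    exact hτmono (left_mem_Icc.2 hσ₁0.le) hσI h
  · simp only [hz]
    rw [hgl σ hσI]
  · intro t ht
    have ht' : t ∈ Icc 0 (τ σ₁) := ⟨ht.1, ht.2.trans hτσ.2⟩
    have := (hc (g t) (hsub (hgm ht'))).1.2
    rw [mem_preimage, hρX _ (hsub (hgm ht'))] at this
    exact this
  · intro t ht
    have ht' : t ∈ Icc 0 (τ σ₁) := ⟨ht.1.le, ht.2.trans hτσ.2⟩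
    have hsrc := e.map_target (htgt' _ (hgm ht'))
    rw [mem_interior_iff (mem_tChart_source.1 hsrc), ← tChart_fst]
    change 0 < (e (e.symm (z t))).1 0
    rw [e.right_inv (htgt' _ (hgm ht'))]
    simp only
    rw [hX0 _ (hsub (hgm ht'))]
    have : 0 < g t := by
      refine lt_of_le_of_ne (hgm ht').1 fun h ↦ ?_
      have h1 := hgr t ht'
      rw [← h, hτ0] at h1
      exact ht.1.ne h1
    positivity

end Collar
section RayAnalysis

/-! ### Uniqueness and stability of the rays -/

set_option linter.unusedSectionVars false

variable {d : ℕ} {M : Type*} [TopologicalSpace M] [ChartedSpace (EuclideanHalfSpace (d + 1)) M]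
  [IsManifold (𝓡∂ (d + 1)) ∞ M]
variable {φ : FinslerMetric d M} {Γ : (x : M) → TangentSpace (𝓡∂ (d + 1)) x} {x₀ : M} {S : Set M}
  {α β : ℝ → TangentBundle (𝓡∂ (d + 1)) M} {T : ℝ}

lemma not_interior_of_boundary {x : M} (hx : x ∈ (𝓡∂ (d + 1)).boundary M) :
    x ∉ (𝓡∂ (d + 1)).interior M := fun h ↦
  (ModelWithCorners.disjoint_interior_boundary).le_bot ⟨h, hx⟩

/-- A geodesic cannot arrive at the boundary with a velocity that points to the inside. -/
lemma IsGeodesicOn.ne_initVec (hα : IsGeodesicOn φ α (Icc 0 T)) (hΓ : IsInwardField Γ) {z : M}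
    (hz : z ∈ (𝓡∂ (d + 1)).boundary M) {s : ℝ} (hs : s ∈ Ioc 0 T) : α s ≠ initVec Γ z := by
  intro h
  have hv : (α s).2 ≠ 0 := by rw [h]; exact hΓ.ne_zero hz
  have hsrc : α s ∈ (tChart z).source := by
    rw [h]; exact mem_tChart_source.2 (mem_extChartAt_source z)
  have hαs := hα.mono (Icc_subset_Icc_right hs.2)
  have h1 : HasDerivWithinAt (fun t ↦ (tChart z (α t)).1) (tChart z (α s)).2 (Icc 0 s) s :=
    (ContinuousLinearMap.fst ℝ (Vec d) (Vec d)).hasFDerivAt.comp_hasDerivWithinAt s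
      (hαs.hasDerivWithinAt (right_mem_Icc.2 hs.1.le) hsrc hv)
  have h2 : HasDerivWithinAt (fun t ↦ (tChart z (α t)).1 0) ((tChart z (α s)).2 0) (Icc 0 s) s :=
    (EuclideanSpace.proj (𝕜 := ℝ) (0 : Fin (d + 1)) :
        Vec d →L[ℝ] ℝ).hasFDerivAt.comp_hasDerivWithinAt s h1
  have h3 : tChart z (α s) = (extChartAt (𝓡∂ (d + 1)) z z, vel (initVec Γ z)) := by
    rw [h]; exact tChart_self z (vel (initVec Γ z))
  have hpos : 0 < (tChart z (α s)).2 0 := by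
    rw [h3]; exact hΓ.2 z hz
  have hzero : (tChart z (α s)).1 0 = 0 := by
    rw [h3]; exact (mem_boundary_iff (mem_extChartAt_source z)).1 hz
  rw [hasDerivWithinAt_iff_tendsto_slope, Icc_sdiff_right, nhdsWithin_Ico_eq_nhdsLT hs.1] at h2
  refine absurd (le_of_tendsto h2 ?_) (not_le.2 hpos)
  have h4 : ∀ᶠ t in 𝓝[Icc 0 s] s, α t ∈ (tChart z).source :=
    (hαs.1 s (right_mem_Icc.2 hs.1.le)).eventually ((isOpen_tChart_source z).mem_nhds hsrc)
  have h5 : ∀ᶠ t in 𝓝[<] s, α t ∈ (tChart z).source := by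
    rw [← nhdsWithin_Ico_eq_nhdsLT hs.1]
    exact nhdsWithin_mono _ Ico_subset_Icc_self h4
  filter_upwards [h5, self_mem_nhdsWithin] with t ht hts
  have h6 : 0 ≤ (tChart z (α t)).1 0 := by
    have := extChartAt_target_subset_range z (mem_tChart_target.1 ((tChart z).map_source ht))
    rwa [range_model] at this
  rw [slope_def_field, hzero, sub_zero]
  exact div_nonpos_of_nonneg_of_nonpos h6 (by rw [sub_nonpos]; exact le_of_lt hts)

/-- Vectors of the rays determine the ray and the time. -/
lemma IsRay.eq_of_apply_eq [T2Space M] {x x' : M} {T T' : ℝ} (hα : IsRay φ Γ x T α)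
    (hΓ : IsInwardField Γ) (hβ : IsRay φ Γ x' T' β) (h : α T = β T') : T = T' ∧ x = x' := by
  wlog hle : T ≤ T' generalizing x x' T T' α β
  · exact (this hβ hα h.symm (le_of_not_ge hle)).imp Eq.symm Eq.symm
  have h1 : EqOn (fun s ↦ β (s + (T' - T))) α (Icc 0 T) := by
    refine IsGeodesicOn.eqOn ((hβ.2.2.1.comp_add (T' - T)).mono fun s hs ↦ ?_) hα.2.2.1
      ordConnected_Icc (right_mem_Icc.2 hα.2.1) ?_ ?_
    · simp only [mem_ofPred_eq, mem_Icc]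
      constructor <;> linarith [hs.1, hs.2]
    · rw [add_sub_cancel, ← h]
      exact hα.ne_zero hΓ (right_mem_Icc.2 hα.2.1)
    · simp [h]
  have h2 := h1 (left_mem_Icc.2 hα.2.1)
  simp only [zero_add] at h2
  rw [hα.apply_zero] at h2
  rcases eq_or_lt_of_le hle with rfl | hlt
  · rw [sub_self, hβ.apply_zero] at h2
    exact ⟨rfl, (congrArg (fun y ↦ y.proj) h2).symm⟩
  · exact absurd h2 (hβ.2.2.1.ne_initVec hΓ hα.1 ⟨by linarith, by linarith [hα.2.1]⟩)

/-- The rays that end near the last vector of a piece of ray over the interior follow that piece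
backward. -/
lemma IsRay.backward [T2Space M] (hα : IsRay φ Γ x₀ T α) (hΓ : IsInwardField Γ) {s₀ : ℝ}
    (hs₀ : 0 ≤ s₀) (hint : ∀ t ∈ Ioc s₀ T, (α t).proj ∈ (𝓡∂ (d + 1)).interior M) {s : ℝ}
    (hs : s ∈ Ioc s₀ T) : ∀ 𝒩 ∈ 𝓝 (α s), ∀ᶠ y in 𝓝 (α T), ∀ x' T', (x', T') ∈ rayDomain φ Γ →
      rayFlow φ Γ x' T' = y → T - s ≤ T' ∧ rayFlow φ Γ x' (T' - (T - s)) ∈ 𝒩 := by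
  have hT : T ∈ Ioc s₀ T := ⟨hs.1.trans_le hs.2, le_rfl⟩
  -- Backward motion along the ray is covered by flow boxes, each of which carries the claim from
  -- one vector of the ray to the nearby ones.
  refine propagate_of_preconnected (s := Ioc s₀ T) (P := fun s ↦ ∀ 𝒩 ∈ 𝓝 (α s), ∀ᶠ y in 𝓝 (α T),
    ∀ x' T', (x', T') ∈ rayDomain φ Γ → rayFlow φ Γ x' T' = y →
      T - s ≤ T' ∧ rayFlow φ Γ x' (T' - (T - s)) ∈ 𝒩) isPreconnected_Ioc ?_ hT hs ?_
  · intro r hr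
    have hr' : r ∈ Icc 0 T := ⟨hs₀.trans hr.1.le, hr.2⟩
    obtain ⟨δ, hδ, N, hN, hrN, Ψ, hΨ, hΨs⟩ := exists_flowBox φ (hint r hr) (hα.ne_zero hΓ hr')
      isOpen_univ (mem_univ _)
    have hc : ContinuousWithinAt α (Ioc s₀ T) r :=
      (hα.2.2.1.1 r hr').mono fun t ht ↦ ⟨hs₀.trans ht.1.le, ht.2⟩
    refine ⟨_, inter_mem (hc.preimage_mem_nhdsWithin (hN.mem_nhds hrN))
      (inter_mem self_mem_nhdsWithin (mem_nhdsWithin_of_mem_nhds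
          (Metric.ball_mem_nhds r (half_pos hδ)))),
      ?_⟩
    rintro s ⟨hsN, hsI, hsr⟩ s' ⟨hsN', hsI', hsr'⟩ hP 𝒩 h𝒩
    have hdiff : s' - s ∈ Ioo (-δ) δ := by
      rw [Metric.mem_ball, Real.dist_eq, abs_lt] at hsr hsr'
      constructor <;> linarith [hsr.1, hsr.2, hsr'.1, hsr'.2]
    have hs0 : s ∈ Icc 0 T := ⟨hs₀.trans hsI.1.le, hsI.2⟩
    have hs0' : s' ∈ Icc 0 T := ⟨hs₀.trans hsI'.1.le, hsI'.2⟩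
    obtain ⟨hb0, hbg, hbi⟩ := hΨ _ hsN
    have hval : Ψ (α s) (s' - s) = α s' := by
      have := ((hα.mono hs0).follow hΓ hbg (fun t ht ↦ (hbi t ht).2.1) hb0 hdiff).2.2
      rw [add_sub_cancel, hα.rayFlow_eq hΓ hs0'] at this
      exact this.symm
    have hcont : ContinuousAt (fun y ↦ Ψ y (s' - s)) (α s) := by
      have h1 : ContinuousAt (Function.uncurry Ψ) (α s, s' - s) :=
        (hΨs.continuousOn.continuousAt ((hN.prod isOpen_Ioo).mem_nhds ⟨hsN, hdiff⟩))
      exact h1.comp (f := fun y ↦ (y, s' - s)) (by fun_prop)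
    have h𝒩' : N ∩ (fun y ↦ Ψ y (s' - s)) ⁻¹' 𝒩 ∈ 𝓝 (α s) :=
      inter_mem (hN.mem_nhds hsN) (hcont.preimage_mem_nhds
          (show 𝒩 ∈ 𝓝 (Ψ (α s) (s' - s)) by rw [hval]; exact h𝒩))
    filter_upwards [hP _ h𝒩'] with y hy x' T' hdom hflow
    obtain ⟨hle, hyN, hy𝒩⟩ := hy x' T' hdom hflow
    have hray := isRay_rayFlow hΓ hdom
    have hmem : T' - (T - s) ∈ Icc 0 T' := ⟨by linarith, by linarith [hs0.2]⟩
    obtain ⟨hc0, hcg, hci⟩ := hΨ _ hyN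
    have := (hray.mono hmem).follow hΓ hcg (fun t ht ↦ (hci t ht).2.1) hc0 hdiff
    have heq : T' - (T - s) + (s' - s) = T' - (T - s') := by ring
    rw [heq] at this
    refine ⟨by linarith [this.1], ?_⟩
    rw [this.2.2]
    exact hy𝒩
  · intro 𝒩 h𝒩
    filter_upwards [h𝒩] with y hy x' T' hdom hflow
    rw [sub_self, sub_zero, hflow]
    exact ⟨(isRay_rayFlow hΓ hdom).2.1, hy⟩

/-- Near a boundary point, short rays reach every point. -/
lemma eventually_exists_short_ray (hΓ : IsInwardField Γ) (hx₀ : x₀ ∈ (𝓡∂ (d + 1)).boundary M)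
    {𝒩 : Set (TangentBundle (𝓡∂ (d + 1)) M)} (h𝒩 : IsOpen 𝒩) (hx₀𝒩 : initVec Γ x₀ ∈ 𝒩) {η : ℝ}
    (hη : 0 < η) {O : Set (BVec d)} (hO : O ∈ 𝓝 (boundaryCoord x₀)) :
    ∀ᶠ q in 𝓝 x₀, ∃ u ∈ O ∩ bdryDom d x₀, ∃ τ < η, ∃ α, IsRay φ Γ (boundaryParam x₀ u) τ α ∧
      (α τ).proj = q ∧ ∀ t ∈ Icc 0 τ, α t ∈ 𝒩 := by
  obtain ⟨W, hW, hu₀, hWd, δ, hδ, Z, τ, hZ, hτ, hcol⟩ := exists_collar (φ := φ) hΓ hx₀ h𝒩 hx₀𝒩 hη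
  set u₀ := boundaryCoord (d := d) x₀ with hu₀'
  have hmem : W ×ˢ Ioo (-δ) δ ∈ 𝓝 (u₀, (0 : ℝ)) :=
    (hW.prod isOpen_Ioo).mem_nhds ⟨hu₀, by simpa using hδ⟩
  -- the map from the parameters to the coordinates tangent to the boundary and `σ`
  set F : BVec d × ℝ → BVec d × ℝ := fun z ↦ (bdryProj d (Z z).1, z.2) with hF
  have hZ1 : ContDiffAt ℝ ∞ (fun z ↦ (Z z).1) (u₀, 0) := (hZ.contDiffAt hmem).fst
  have hFs : HasStrictFDerivAt F (((bdryProj d).comp (fderiv ℝ (fun z ↦ (Z z).1) (u₀, 0))).prod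
      (ContinuousLinearMap.snd ℝ (BVec d) ℝ)) (u₀, 0) :=
    ((bdryProj d).hasStrictFDerivAt.comp _ (hZ1.hasStrictFDerivAt (by simp))).prodMk
      hasStrictFDerivAt_snd
  have hd := (hZ1.differentiableAt (by simp)).hasFDerivAt
  have hdu : ∀ a, fderiv ℝ (fun z ↦ (Z z).1) (u₀, 0) (a, 0) = bdryEmb d a := by
    intro a
    have h1 := HasFDerivAt.comp (f := fun u : BVec d ↦ (u, (0 : ℝ))) u₀ hd
      (((hasFDerivAt_id u₀).prodMk (hasFDerivAt_const 0 u₀)))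
    have h2 : HasFDerivAt (fun u ↦ (Z (u, 0)).1) (bdryEmb d) u₀ := by
      refine (bdryEmb d).hasFDerivAt.congr_of_eventuallyEq ?_
      filter_upwards [hW.mem_nhds hu₀] with u hu using (hcol u hu).1
    have h3 := h1.unique h2
    have := congrArg (fun A : BVec d →L[ℝ] Vec d ↦ A a) h3
    simpa using this
  have hds : ∀ b : ℝ, fderiv ℝ (fun z ↦ (Z z).1) (u₀, 0) (0, b) = 0 := by
    intro b
    have h1 := HasFDerivAt.comp_hasDerivAt (f := fun s : ℝ ↦ (u₀, s)) (0 : ℝ) hd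
      ((hasDerivAt_const 0 u₀).prodMk (hasDerivAt_id 0))
    have h2 := h1.unique (hcol u₀ hu₀).2.1
    have : ((0 : BVec d), b) = b • ((0 : BVec d), (1 : ℝ)) := by simp
    rw [this, map_smul, h2, smul_zero]
  have hdab : ∀ a (b : ℝ), fderiv ℝ (fun z ↦ (Z z).1) (u₀, 0) (a, b) = bdryEmb d a := by
    intro a b
    have : (a, b) = (a, (0 : ℝ)) + (0, b) := by simp
    rw [this, map_add, hdu, hds, add_zero]
  have hsurj : (((bdryProj d).comp (fderiv ℝ (fun z ↦ (Z z).1) (u₀, 0))).prod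
      (ContinuousLinearMap.snd ℝ (BVec d) ℝ)).range = ⊤ := by
    rw [LinearMap.range_eq_top]
    rintro ⟨a, b⟩
    refine ⟨(a, b), ?_⟩
    simp [hdab, bdryProj_bdryEmb]
  have hopen := hFs.map_nhds_eq_of_surj hsurj
  have hF0 : F (u₀, 0) = (u₀, 0) := by
    simp only [hF]
    rw [(hcol u₀ hu₀).1, bdryProj_bdryEmb]
  rw [hF0] at hopen
  have hgood : F '' ((W ∩ O) ×ˢ Ioo (-δ) δ) ∈ 𝓝 (u₀, (0 : ℝ)) := by
    rw [← hopen]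
    exact image_mem_map (prod_mem_nhds (inter_mem (hW.mem_nhds hu₀) hO)
      (Ioo_mem_nhds (by linarith) hδ))
  have hG : Tendsto (fun q : M ↦ (bdryProj d (extChartAt (𝓡∂ (d + 1)) x₀ q),
      Real.sqrt ((extChartAt (𝓡∂ (d + 1)) x₀ q) 0))) (𝓝 x₀) (𝓝 (u₀, 0)) := by
    have h1 := continuousAt_extChartAt (I := 𝓡∂ (d + 1)) x₀
    have h2 := ((bdryProj d).continuous.continuousAt.comp h1).prodMk
      (Real.continuous_sqrt.continuousAt.comp
        ((EuclideanSpace.proj (𝕜 := ℝ) (0 : Fin (d + 1)) :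
            Vec d →L[ℝ] ℝ).continuous.continuousAt.comp h1))
    have h3 : Real.sqrt ((extChartAt (𝓡∂ (d + 1)) x₀ x₀) 0) = 0 := by
      rw [(mem_boundary_iff (mem_extChartAt_source x₀)).1 hx₀, Real.sqrt_zero]
    unfold ContinuousAt at h2
    have h4 : (u₀, (0 : ℝ)) = (bdryProj d (extChartAt (𝓡∂ (d + 1)) x₀ x₀),
        Real.sqrt ((extChartAt (𝓡∂ (d + 1)) x₀ x₀) 0)) := Prod.ext rfl h3.symm
    rw [h4]
    exact h2
  filter_upwards [hG hgood, (isOpen_extChartAt_source (I := 𝓡∂ (d + 1)) x₀).mem_nhds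
    (mem_extChartAt_source x₀)] with q hq hqs
  obtain ⟨⟨u, σ⟩, ⟨⟨huW, huO⟩, hσ⟩, hFq⟩ := hq
  simp only [hF, Prod.mk.injEq] at hFq
  have hσ0 : 0 ≤ σ := by rw [hFq.2]; exact Real.sqrt_nonneg _
  obtain ⟨hc1, hc2, hc3, -, α, hα, hαe, hα𝒩, -⟩ := (hcol u huW).2.2 σ ⟨hσ0, hσ.2⟩
  refine ⟨u, ⟨huO, hWd huW⟩, τ (u, σ), hc3, α, hα, ?_, hα𝒩⟩
  have hq0 : 0 ≤ (extChartAt (𝓡∂ (d + 1)) x₀ q) 0 := by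
    have := extChartAt_target_subset_range x₀ ((extChartAt (𝓡∂ (d + 1)) x₀).map_source hqs)
    rwa [range_model] at this
  have hX : (Z (u, σ)).1 = extChartAt (𝓡∂ (d + 1)) x₀ q := by
    ext i
    refine Fin.cases ?_ (fun j ↦ ?_) i
    · rw [hc1, hFq.2, Real.sq_sqrt hq0]
    · have := congrArg (fun v : BVec d ↦ v j) hFq.1
      exact this
  rw [hαe, tChart_symm_proj, hX, (extChartAt (𝓡∂ (d + 1)) x₀).left_inv hqs]

/-! ### The vectors of `A(S)` and their limits -/

lemma mem_raysOff_iff [T2Space M] (hΓ : IsInwardField Γ) {y : TangentBundle (𝓡∂ (d + 1)) M} :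
    y ∈ raysOff φ Γ S ↔ ∃ x T, (x, T) ∈ rayDomain φ Γ ∧
        (∀ t ∈ Icc 0 T, (rayFlow φ Γ x t).proj ∉ S) ∧
      rayFlow φ Γ x T = y := by
  constructor
  · rintro ⟨x, T, α, hα, hS, hy⟩
    exact ⟨x, T, ⟨α, hα⟩, fun t ht ↦ by rw [hα.rayFlow_eq hΓ ht]; exact hS t ht, by
      rw [hα.rayFlow_eq hΓ (right_mem_Icc.2 hα.2.1), hy]⟩
  · rintro ⟨x, T, hd, hS, hy⟩
    exact ⟨x, T, _, isRay_rayFlow hΓ hd, hS, hy⟩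

lemma rayFlow_mem_raysOff [T2Space M] (hΓ : IsInwardField Γ) {x : M} {T : ℝ}
    (hd : (x, T) ∈ rayDomain φ Γ) (h : rayFlow φ Γ x T ∈ raysOff φ Γ S) {t : ℝ} (ht : t ∈ Icc 0 T) :
    rayFlow φ Γ x t ∈ raysOff φ Γ S := by
  obtain ⟨x', T', hd', hS, heq⟩ := (mem_raysOff_iff hΓ).1 h
  obtain ⟨rfl, rfl⟩ := (isRay_rayFlow hΓ hd').eq_of_apply_eq hΓ (isRay_rayFlow hΓ hd) heq
  exact (mem_raysOff_iff hΓ).2 ⟨x', t, (isRay_rayFlow hΓ hd).mem_rayDomain ht,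
    fun s hs ↦ hS s ⟨hs.1, hs.2.trans ht.2⟩, rfl⟩

lemma Splits.eq_of_proj_eq (hsp : Splits φ Γ S) {y y' : TangentBundle (𝓡∂ (d + 1)) M}
    (hy : y ∈ raysOff φ Γ S) (hy' : y' ∈ raysOff φ Γ S) (h : y.proj = y'.proj) : y = y' :=
  hsp.injOn hy hy' h

/-- Near a boundary point `z`, the vectors of `A(S)` are the last vectors of short rays that start
near `z`. -/
lemma Splits.eventually_near_boundary [T2Space M] (hsp : Splits φ Γ S) (hΓ : IsInwardField Γ)
    (hS : IsClosed S) (hSi : S ⊆ (𝓡∂ (d + 1)).interior M) {z : M}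
    (hz : z ∈ (𝓡∂ (d + 1)).boundary M) {𝒩 : Set (TangentBundle (𝓡∂ (d + 1)) M)}
        (h𝒩 : 𝒩 ∈ 𝓝 (initVec Γ z))
    {η : ℝ} (hη : 0 < η) {O : Set (BVec d)} (hO : O ∈ 𝓝 (boundaryCoord z)) :
    ∀ᶠ q in 𝓝 z, ∀ x T, (x, T) ∈ rayDomain φ Γ → rayFlow φ Γ x T ∈ raysOff φ Γ S →
      (rayFlow φ Γ x T).proj = q → rayFlow φ Γ x T ∈ 𝒩 ∧ T < η ∧
        ∃ u ∈ O ∩ bdryDom d z, x = boundaryParam z u := by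
  have hzS : z ∉ S := fun h ↦ not_interior_of_boundary hz (hSi h)
  have hopen : IsOpen (interior 𝒩 ∩ {y | y.proj ∈ Sᶜ}) :=
    isOpen_interior.inter (hS.isOpen_compl.preimage continuous_proj)
  filter_upwards [eventually_exists_short_ray (φ := φ) hΓ hz hopen
    ⟨mem_interior_iff_mem_nhds.2 h𝒩, hzS⟩ hη hO] with q hq x T hd hA hproj
  obtain ⟨u, hu, τ, hτ, α, hα, hαq, hα𝒩⟩ := hq
  have hτI := right_mem_Icc.2 hα.2.1
  have hαA : α τ ∈ raysOff φ Γ S := ⟨_, τ, α, hα, fun t ht ↦ (hα𝒩 t ht).2, rfl⟩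
  have heq : rayFlow φ Γ x T = α τ := hsp.eq_of_proj_eq hA hαA (hproj.trans hαq.symm)
  obtain ⟨rfl, rfl⟩ := (isRay_rayFlow hΓ hd).eq_of_apply_eq hΓ hα heq
  rw [heq]
  exact ⟨interior_subset (hα𝒩 _ hτI).1, hτ, u, hu, rfl⟩

/-- A ray whose last vector is a limit of vectors of `A(S)` over the interior leaves the boundary
immediately and for good. -/
lemma IsRay.interior_of_mem_closure [T2Space M] (hα : IsRay φ Γ x₀ T α) (hsp : Splits φ Γ S)
    (hΓ : IsInwardField Γ) (hS : IsClosed S) (hSi : S ⊆ (𝓡∂ (d + 1)).interior M)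
    (hcl : α T ∈ closure (raysOff φ Γ S)) (hi : (α T).proj ∈ (𝓡∂ (d + 1)).interior M) :
    ∀ t ∈ Ioc 0 T, (α t).proj ∈ (𝓡∂ (d + 1)).interior M := by
  -- the last time `s₀` at the boundary
  set B : Set ℝ := {t ∈ Icc 0 T | (α t).proj ∈ (𝓡∂ (d + 1)).boundary M} with hB
  have hBc : IsClosed B := by
    have h1 : ContinuousOn (fun t ↦ (α t).proj) (Icc 0 T) :=
      continuous_proj.comp_continuousOn hα.2.2.1.1
    exact h1.preimage_isClosed_of_isClosed isClosed_Icc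
        (ModelWithCorners.isClosed_boundary (n := ∞) (by simp))
  have hB0 : (0 : ℝ) ∈ B := ⟨left_mem_Icc.2 hα.2.1, by rw [hα.apply_zero]; exact hα.1⟩
  have hBb : BddAbove B := ⟨T, fun t ht ↦ ht.1.2⟩
  set s₀ := sSup B with hs₀
  have hs₀B : s₀ ∈ B := hBc.csSup_mem ⟨0, hB0⟩ hBb
  have hs₀0 : 0 ≤ s₀ := le_csSup hBb hB0
  have hint : ∀ t ∈ Ioc s₀ T, (α t).proj ∈ (𝓡∂ (d + 1)).interior M := by
    intro t ht
    rw [← ModelWithCorners.compl_boundary]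
    intro hb
    exact absurd (le_csSup hBb ⟨⟨hs₀0.trans ht.1.le, ht.2⟩, hb⟩) (not_le.2 ht.1)
  have hs₀T : s₀ < T := lt_of_le_of_ne hs₀B.1.2 fun h ↦ by
    have := hs₀B.2
    rw [h] at this
    exact not_interior_of_boundary this hi
  -- the vectors of the ray after that time are limits of vectors of `A(S)`
  have hmemcl : ∀ s ∈ Ioc s₀ T, ∀ 𝒰 ∈ 𝓝 (α s), ∃ x T', (x, T') ∈ rayDomain φ Γ ∧
      rayFlow φ Γ x T' ∈ raysOff φ Γ S ∧ rayFlow φ Γ x T' ∈ 𝒰 := by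
    intro s hs 𝒰 h𝒰
    obtain ⟨y, hy, hyA⟩ := ((mem_closure_iff_frequently.1 hcl).and_eventually
      (hα.backward hΓ hs₀0 hint hs 𝒰 h𝒰)).exists
    obtain ⟨x, T', hd, -, rfl⟩ := (mem_raysOff_iff hΓ).1 hy
    obtain ⟨hle, hmem⟩ := hyA x T' hd rfl
    have hI : T' - (T - s) ∈ Icc 0 T' := ⟨by linarith, by linarith [hs.2]⟩
    exact ⟨x, _, (isRay_rayFlow hΓ hd).mem_rayDomain hI, rayFlow_mem_raysOff hΓ hd hy hI, hmem⟩
  -- hence the vector at that time is the initial vector of a ray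
  have hαs₀ : α s₀ = initVec Γ (α s₀).proj := by
    by_contra hne
    obtain ⟨𝒱, 𝒩, h𝒱, h𝒩, hm𝒱, hm𝒩, hdisj⟩ := t2_separation hne
    have h1 := hsp.eventually_near_boundary (φ := φ) hΓ hS hSi hs₀B.2
        (h𝒩.mem_nhds hm𝒩) one_pos univ_mem
    obtain ⟨Q, hQ, hQo, hQm⟩ := eventually_nhds_iff.1 h1
    have h2 : ContinuousWithinAt α (Ioc s₀ T) s₀ := (hα.2.2.1.1 s₀ hs₀B.1).mono fun t ht ↦
      ⟨hs₀0.trans ht.1.le, ht.2⟩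
    have h3 : {y : TangentBundle (𝓡∂ (d + 1)) M | y.proj ∈ Q} ∩ 𝒱 ∈ 𝓝 (α s₀) :=
      inter_mem ((hQo.preimage continuous_proj).mem_nhds hQm) (h𝒱.mem_nhds hm𝒱)
    have hne' : (𝓝[Ioc s₀ T] s₀).NeBot := by
      rw [nhdsWithin_Ioc_eq_nhdsGT hs₀T]; infer_instance
    obtain ⟨s, hs, hs𝒱⟩ :=
        ((h2.eventually (eventually_mem_nhds_iff.2 h3)).and self_mem_nhdsWithin).exists
    obtain ⟨x, T', hd, hA, hmem⟩ := hmemcl s hs𝒱 _ hs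
    have h4 := (hQ _ hmem.1 x T' hd hA rfl).1
    exact hdisj.le_bot ⟨hmem.2, h4⟩
  rcases eq_or_lt_of_le hs₀0 with h0 | hpos
  · rw [h0]; exact hint
  · exact absurd hαs₀ (hα.2.2.1.ne_initVec hΓ hs₀B.2 ⟨hpos, hs₀T.le⟩)

/-- The vectors of `A(S)` near the last vector of a ray over the interior are the last vectors of
rays with nearby parameters. -/
lemma IsRay.eventually_raysOff [T2Space M] (hα : IsRay φ Γ x₀ T α) (hsp : Splits φ Γ S)
    (hΓ : IsInwardField Γ) (hS : IsClosed S) (hSi : S ⊆ (𝓡∂ (d + 1)).interior M) (hT : 0 < T)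
    (hint : ∀ t ∈ Ioc 0 T, (α t).proj ∈ (𝓡∂ (d + 1)).interior M) {O : Set (BVec d × ℝ)}
    (hO : O ∈ 𝓝 (boundaryCoord x₀, T)) :
    ∀ᶠ y in 𝓝 (α T), y ∈ raysOff φ Γ S → ∃ z ∈ O, z.1 ∈ bdryDom d x₀ ∧
      (boundaryParam x₀ z.1, z.2) ∈ rayDomain φ Γ ∧ y = rayFlow φ Γ (boundaryParam x₀ z.1) z.2 := by
  rw [nhds_prod_eq, mem_prod_iff] at hO
  obtain ⟨O₁, hO₁, O₂, hO₂, hOsub⟩ := hO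
  obtain ⟨η, hη, hηO⟩ := Metric.mem_nhds_iff.1 hO₂
  have h1 := hsp.eventually_near_boundary (φ := φ) hΓ hS hSi hα.1 univ_mem hη hO₁
  obtain ⟨Q, hQ, hQo, hQm⟩ := eventually_nhds_iff.1 h1
  have h2 : ContinuousWithinAt α (Ioc 0 T) 0 :=
    (hα.2.2.1.1 0 (left_mem_Icc.2 hα.2.1)).mono Ioc_subset_Icc_self
  have h3 : {y : TangentBundle (𝓡∂ (d + 1)) M | y.proj ∈ Q} ∈ 𝓝 (α 0) :=
    (hQo.preimage continuous_proj).mem_nhds (by rw [mem_preimage, hα.apply_zero]; exact hQm)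
  have hne' : (𝓝[Ioc 0 T] (0 : ℝ)).NeBot := by
    rw [nhdsWithin_Ioc_eq_nhdsGT hT]; infer_instance
  have h4 : ∀ᶠ s in 𝓝[Ioc 0 T] (0 : ℝ), s < η := mem_nhdsWithin_of_mem_nhds (Iio_mem_nhds hη)
  obtain ⟨s, ⟨hs, hsη⟩, hsI⟩ := (((h2.eventually (eventually_mem_nhds_iff.2 h3)).and h4).and
    self_mem_nhdsWithin).exists
  filter_upwards [hα.backward hΓ le_rfl hint hsI _ hs] with y hy hyA
  obtain ⟨x, T', hd, -, rfl⟩ := (mem_raysOff_iff hΓ).1 hyA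
  obtain ⟨hle, hmem⟩ := hy x T' hd rfl
  have hI : T' - (T - s) ∈ Icc 0 T' := ⟨by linarith, by linarith [hsI.2]⟩
  obtain ⟨-, hlt, u, hu, rfl⟩ := hQ _ hmem x _ ((isRay_rayFlow hΓ hd).mem_rayDomain hI)
    (rayFlow_mem_raysOff hΓ hd hyA hI) rfl
  refine ⟨(u, T'), hOsub ⟨hu.1, hηO ?_⟩, hu.2, hd, rfl⟩
  rw [Metric.mem_ball, Real.dist_eq, abs_lt]
  constructor <;> linarith [hsI.1, hI.1]

end RayAnalysis
section LocalInverse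

/-! ### Smooth local inverses -/

variable {E F : Type*} [NormedAddCommGroup E] [NormedSpace ℝ E] [CompleteSpace E]
  [NormedAddCommGroup F] [NormedSpace ℝ F] [CompleteSpace F]

/-- The smooth inverse function theorem, on open sets. -/
lemma exists_smooth_local_inverse {g : E → F} {O : Set E} (hO : IsOpen O) (hg : ContDiffOn ℝ ∞ g O)
    {z : E} (hz : z ∈ O) {A : E →L[ℝ] F} (hA : HasFDerivAt g A z) (hbij : Function.Bijective A) :
    ∃ h : OpenPartialHomeomorph E F, (h : E → F) = g ∧ z ∈ h.source ∧ h.source ⊆ O ∧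
      ContDiffOn ℝ ∞ h.symm h.target := by
  set A' : E ≃L[ℝ] F := ContinuousLinearEquiv.ofBijective A
    (LinearMap.ker_eq_bot.2 hbij.1) (LinearMap.range_eq_top.2 hbij.2) with hA'
  have hA'c : (A' : E →L[ℝ] F) = A := ContinuousLinearMap.ext fun v ↦ rfl
  have hgz := hg.contDiffAt (hO.mem_nhds hz)
  have hstrict : HasStrictFDerivAt g (A' : E →L[ℝ] F) z := by
    rw [hA'c]
    exact hgz.hasStrictFDerivAt' hA (by simp)
  set h₀ := hstrict.toOpenPartialHomeomorph g with hh₀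
  have hcoe : (h₀ : E → F) = g := hstrict.toOpenPartialHomeomorph_coe
  set O' := O ∩ fderiv ℝ g ⁻¹' range (fun e : E ≃L[ℝ] F ↦ (e : E →L[ℝ] F)) with hO'
  have hO'o : IsOpen O' :=
    (hg.continuousOn_fderiv_of_isOpen hO (by norm_cast)).isOpen_inter_preimage hO
      ContinuousLinearEquiv.isOpen
  have hzO' : z ∈ O' := ⟨hz, A', by rw [hA.fderiv, ← hA'c]⟩
  refine ⟨h₀.restrOpen O' hO'o, hcoe, ⟨hstrict.mem_toOpenPartialHomeomorph_source, hzO'⟩,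
    fun w hw ↦ hw.2.1, fun y hy ↦ ?_⟩
  set h := h₀.restrOpen O' hO'o with hh
  have hys := h.map_target hy
  obtain ⟨B, hB⟩ := hys.2.2
  have hgy := hg.contDiffAt (hO.mem_nhds hys.2.1)
  refine (OpenPartialHomeomorph.contDiffAt_symm h (f₀' := B) hy ?_ ?_).contDiffWithinAt
  · change HasFDerivAt g _ _
    simp only at hB
    rw [hB]
    exact (hgy.differentiableAt (by simp)).hasFDerivAt
  · change ContDiffAt ℝ ∞ g _
    exact hgy

end LocalInverse

section LocalFields

/-! ### Local fields of ray vectors -/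

set_option linter.unusedSectionVars false

variable {d : ℕ} {M : Type*} [TopologicalSpace M] [ChartedSpace (EuclideanHalfSpace (d + 1)) M]
  [IsManifold (𝓡∂ (d + 1)) ∞ M]
variable {φ : FinslerMetric d M} {Γ : (x : M) → TangentSpace (𝓡∂ (d + 1)) x} {x₀ : M} {S : Set M}
  {α β : ℝ → TangentBundle (𝓡∂ (d + 1)) M} {T : ℝ} {𝒪 : Set (TangentBundle (𝓡∂ (d + 1)) M)}

variable (φ Γ) in
/-- The vectors `Φ(t, Γ x)`, parametrized by `t` and the boundary coordinates of `x` around `x₀`. -/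
noncomputable def rayMap (x₀ : M) (z : BVec d × ℝ) : TangentBundle (𝓡∂ (d + 1)) M :=
  rayFlow φ Γ (boundaryParam x₀ z.1) z.2

variable (φ Γ) in
/-- `O` is an open set of parameters of vectors over the interior whose rays stay in `𝒪`, and
`rayMap` is smooth on `O`. -/
structure IsRegularSet (x₀ : M) (𝒪 : Set (TangentBundle (𝓡∂ (d + 1)) M)) (O : Set (BVec d × ℝ)) :
    Prop where
  isOpen : IsOpen O
  smooth : ContMDiffOn 𝓘(ℝ, BVec d × ℝ) (𝓡∂ (d + 1)).tangent ∞ (rayMap φ Γ x₀) O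
  bdry : ∀ z ∈ O, z.1 ∈ bdryDom d x₀
  pos : ∀ z ∈ O, 0 < z.2
  dom : ∀ z ∈ O, (boundaryParam x₀ z.1, z.2) ∈ rayDomain φ Γ
  interior : ∀ z ∈ O, (rayMap φ Γ x₀ z).proj ∈ (𝓡∂ (d + 1)).interior M
  stays : ∀ z ∈ O, ∀ s ∈ Icc 0 z.2, rayMap φ Γ x₀ (z.1, s) ∈ 𝒪

lemma IsRegularSet.mono {O O' : Set (BVec d × ℝ)} (h : IsRegularSet φ Γ x₀ 𝒪 O) (hO' : IsOpen O')
    (hsub : O' ⊆ O) : IsRegularSet φ Γ x₀ 𝒪 O' where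
  isOpen := hO'
  smooth := h.smooth.mono hsub
  bdry z hz := h.bdry z (hsub hz)
  pos z hz := h.pos z (hsub hz)
  dom z hz := h.dom z (hsub hz)
  interior z hz := h.interior z (hsub hz)
  stays z hz := h.stays z (hsub hz)

lemma IsRegularSet.to_univ {O : Set (BVec d × ℝ)} (h : IsRegularSet φ Γ x₀ 𝒪 O) :
    IsRegularSet φ Γ x₀ univ O :=
  ⟨h.isOpen, h.smooth, h.bdry, h.pos, h.dom, h.interior, fun _ _ _ _ ↦ mem_univ _⟩

/-- Rays that depend smoothly on the initial point up to a section of the flow continue to do so. -/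
lemma exists_isRegularSet_of_section [T2Space M] (hΓ : IsInwardField Γ) {W : Set (BVec d)}
    (hW : IsOpen W)
    (hWd : W ⊆ bdryDom d x₀) {Y : BVec d → TangentBundle (𝓡∂ (d + 1)) M} {θ : BVec d → ℝ}
    (hY : ContMDiffOn (𝓡 d) (𝓡∂ (d + 1)).tangent ∞ Y W) (hθ : ContDiffOn ℝ ∞ θ W)
    (hdom : ∀ u ∈ W, (boundaryParam x₀ u, θ u) ∈ rayDomain φ Γ ∧ rayMap φ Γ x₀ (u, θ u) = Y u ∧
      ∀ s ∈ Icc 0 (θ u), rayMap φ Γ x₀ (u, s) ∈ 𝒪)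
    {δ : ℝ} {N : Set (TangentBundle (𝓡∂ (d + 1)) M)} (hN : IsOpen N)
    {Ψ : TangentBundle (𝓡∂ (d + 1)) M → ℝ → TangentBundle (𝓡∂ (d + 1)) M}
    (hΨ : ∀ y ∈ N, Ψ y 0 = y ∧ IsGeodesicOn φ (Ψ y) (Ioo (-δ) δ) ∧ ∀ t ∈ Ioo (-δ) δ,
          Ψ y t ∈ 𝒪 ∧ (Ψ y t).proj ∈ (𝓡∂ (d + 1)).interior M ∧ (Ψ y t).2 ≠ 0)
    (hΨs : ContMDiffOn ((𝓡∂ (d + 1)).tangent.prod 𝓘(ℝ, ℝ)) (𝓡∂ (d + 1)).tangent ∞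
          (Function.uncurry Ψ) (N ×ˢ Ioo (-δ) δ))
    {u₀ : BVec d} (hu₀ : u₀ ∈ W) (hYN : Y u₀ ∈ N) {t : ℝ} (ht : t - θ u₀ ∈ Ioo (-δ) δ) :
    ∃ O, IsRegularSet φ Γ x₀ 𝒪 O ∧ (u₀, t) ∈ O := by
  set W' := W ∩ Y ⁻¹' N with hW'
  have hW'o : IsOpen W' := hY.continuousOn.isOpen_inter_preimage hW hN
  set O : Set (BVec d × ℝ) := (W' ×ˢ univ) ∩ (fun z ↦ z.2 - θ z.1) ⁻¹' Ioo (-δ) δ with hO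
  have hOo : IsOpen O := by
    refine ContinuousOn.isOpen_inter_preimage ?_ (hW'o.prod isOpen_univ) isOpen_Ioo
    exact continuousOn_snd.sub ((hθ.continuousOn.mono inter_subset_left).comp continuousOn_fst
      fun z hz ↦ hz.1)
  have hfollow : ∀ u ∈ W', ∀ τ ∈ Ioo (-δ) δ, 0 < θ u + τ ∧
      (boundaryParam x₀ u, θ u + τ) ∈ rayDomain φ Γ ∧ rayMap φ Γ x₀ (u, θ u + τ) = Ψ (Y u) τ := by
    intro u hu τ hτ
    obtain ⟨hd, hy, -⟩ := hdom u hu.1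
    obtain ⟨h0, hg, hi⟩ := hΨ _ hu.2
    exact (isRay_rayFlow hΓ hd).follow hΓ hg (fun t ht ↦ (hi t ht).2.1) (h0.trans hy.symm) hτ
  have hval : ∀ z ∈ O, rayMap φ Γ x₀ z = Ψ (Y z.1) (z.2 - θ z.1) := by
    intro z hz
    have := (hfollow z.1 hz.1.1 _ hz.2).2.2
    rwa [add_sub_cancel] at this
  refine ⟨O, ⟨hOo, ?_, fun z hz ↦ hWd hz.1.1.1, fun z hz ↦ ?_, fun z hz ↦ ?_, fun z hz ↦ ?_,
    fun z hz s hs ↦ ?_⟩, ⟨⟨⟨hu₀, hYN⟩, mem_univ _⟩, ht⟩⟩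
  · refine ContMDiffOn.congr ?_ hval
    have h1 : ContMDiffOn 𝓘(ℝ, BVec d × ℝ) ((𝓡∂ (d + 1)).tangent.prod 𝓘(ℝ, ℝ)) ∞
        (fun z : BVec d × ℝ ↦ (Y z.1, z.2 - θ z.1)) O := by
      refine ContMDiffOn.prodMk (hY.comp (contDiff_fst.contMDiff.contMDiffOn)
        fun z hz ↦ hz.1.1.1) ?_
      exact (contDiffOn_snd.sub (hθ.comp contDiffOn_fst fun z hz ↦ hz.1.1.1)).contMDiffOn
    exact hΨs.comp h1 fun z hz ↦ ⟨hz.1.1.2, hz.2⟩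
  · have := (hfollow z.1 hz.1.1 _ hz.2).1
    rwa [add_sub_cancel] at this
  · have := (hfollow z.1 hz.1.1 _ hz.2).2.1
    rwa [add_sub_cancel] at this
  · rw [hval z hz]
    exact ((hΨ _ hz.1.1.2).2.2 _ hz.2).2.1
  · rcases le_or_gt s (θ z.1) with hle | hlt
    · exact (hdom z.1 hz.1.1.1).2.2 s ⟨hs.1, hle⟩
    · have hδ := hz.2
      rw [mem_preimage, mem_Ioo] at hδ
      have hmem : s - θ z.1 ∈ Ioo (-δ) δ := ⟨by linarith, by linarith [hs.2]⟩
      have := (hfollow z.1 hz.1.1 _ hmem).2.2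
      rw [add_sub_cancel] at this
      rw [this]
      exact ((hΨ _ hz.1.1.2).2.2 _ hmem).1

lemma rayMap_boundaryCoord [T2Space M] (hΓ : IsInwardField Γ) (hα : IsRay φ Γ x₀ T α) {t : ℝ}
    (ht : t ∈ Icc 0 T) : rayMap φ Γ x₀ (boundaryCoord x₀, t) = α t := by
  rw [rayMap]
  simp only
  rw [boundaryParam_boundaryCoord hα.1, hα.rayFlow_eq hΓ ht]

/-- Short rays depend smoothly on the parameters, by means of a collar. -/
lemma IsRay.exists_isRegularSet_start [T2Space M] (hα : IsRay φ Γ x₀ T α) (hΓ : IsInwardField Γ)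
    (hT : 0 < T) (h𝒪 : IsOpen 𝒪) (hα𝒪 : ∀ t ∈ Icc 0 T, α t ∈ 𝒪) :
    ∃ s ∈ Ioc 0 T, ∃ O, IsRegularSet φ Γ x₀ 𝒪 O ∧ (boundaryCoord x₀, s) ∈ O := by
  set u₀ := boundaryCoord (d := d) x₀ with hu₀'
  obtain ⟨W, hW, hu₀, hWd, δ, hδ, Z, τ, hZ, hτ, hcol⟩ := exists_collar (φ := φ) hΓ hα.1 h𝒪
    (by rw [← hα.apply_zero]; exact hα𝒪 0 (left_mem_Icc.2 hT.le)) hT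
  have hσ : δ / 2 ∈ Ico 0 δ := ⟨by positivity, by linarith⟩
  have hσ' : δ / 2 ∈ Ioo (-δ) δ := ⟨by linarith, by linarith⟩
  have hinc : ContDiff ℝ ∞ (fun u : BVec d ↦ (u, δ / 2)) := contDiff_id.prodMk contDiff_const
  have hθ : ContDiffOn ℝ ∞ (fun u ↦ τ (u, δ / 2)) W :=
    hτ.comp hinc.contDiffOn fun u hu ↦ ⟨hu, hσ'⟩
  have hY : ContMDiffOn (𝓡 d) (𝓡∂ (d + 1)).tangent ∞
      (fun u ↦ (tChart x₀).symm (Z (u, δ / 2))) W :=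
    (contMDiffOn_tChart_symm x₀).comp
      ((hZ.comp hinc.contDiffOn fun u hu ↦ ⟨hu, hσ'⟩).contMDiffOn)
      fun u hu ↦ ((hcol u hu).2.2 _ hσ).2.1
  have hsec : ∀ u ∈ W, (boundaryParam x₀ u, τ (u, δ / 2)) ∈ rayDomain φ Γ ∧
      rayMap φ Γ x₀ (u, τ (u, δ / 2)) = (tChart x₀).symm (Z (u, δ / 2)) ∧
      ∀ s ∈ Icc 0 (τ (u, δ / 2)), rayMap φ Γ x₀ (u, s) ∈ 𝒪 := by
    intro u hu
    obtain ⟨-, -, -, -, γ, hγ, hγe, hγ𝒪, -⟩ := (hcol u hu).2.2 _ hσ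
    have hr := right_mem_Icc.2 hγ.2.1
    refine ⟨⟨γ, hγ⟩, ?_, fun s hs ↦ ?_⟩
    · rw [rayMap, ← hγe]; exact hγ.rayFlow_eq hΓ hr
    · rw [rayMap]; simp only; rw [hγ.rayFlow_eq hΓ hs]; exact hγ𝒪 s hs
  obtain ⟨-, -, hlt, hpos, γ, hγ, hγe, -, hγi⟩ := (hcol u₀ hu₀).2.2 _ hσ
  have hpos' : 0 < τ (u₀, δ / 2) := hpos (by positivity)
  have hr : τ (u₀, δ / 2) ∈ Icc 0 (τ (u₀, δ / 2)) := right_mem_Icc.2 hγ.2.1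
  have hin := hγi _ ⟨hpos', le_rfl⟩
  have hne := hγ.ne_zero hΓ hr
  have h𝒪e : γ (τ (u₀, δ / 2)) ∈ 𝒪 := by
    have := (hsec u₀ hu₀).2.2 _ hr
    rw [rayMap] at this
    simp only at this
    rwa [hγ.rayFlow_eq hΓ hr] at this
  obtain ⟨δ', hδ', N, hN, hyN, Ψ, hΨ, hΨs⟩ := exists_flowBox φ hin hne h𝒪 h𝒪e
  refine ⟨τ (u₀, δ / 2), ⟨hpos', hlt.le⟩, ?_⟩
  exact exists_isRegularSet_of_section hΓ hW hWd hY hθ hsec hN hΨ hΨs hu₀ (by rwa [← hγe])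
    (by rw [sub_self]; exact ⟨by linarith, hδ'⟩)

/-- Regularity propagates along the pieces of a ray in a flow box. -/
lemma IsRegularSet.exists_shift [T2Space M] {O : Set (BVec d × ℝ)} (hO : IsRegularSet φ Γ x₀ 𝒪 O)
    (hΓ : IsInwardField Γ) {u₀ : BVec d} {s s' : ℝ} (huO : (u₀, s) ∈ O)
    {δ : ℝ} {N : Set (TangentBundle (𝓡∂ (d + 1)) M)} (hN : IsOpen N)
    {Ψ : TangentBundle (𝓡∂ (d + 1)) M → ℝ → TangentBundle (𝓡∂ (d + 1)) M}
    (hΨ : ∀ y ∈ N, Ψ y 0 = y ∧ IsGeodesicOn φ (Ψ y) (Ioo (-δ) δ) ∧ ∀ t ∈ Ioo (-δ) δ,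
          Ψ y t ∈ 𝒪 ∧ (Ψ y t).proj ∈ (𝓡∂ (d + 1)).interior M ∧ (Ψ y t).2 ≠ 0)
    (hΨs : ContMDiffOn ((𝓡∂ (d + 1)).tangent.prod 𝓘(ℝ, ℝ)) (𝓡∂ (d + 1)).tangent ∞
          (Function.uncurry Ψ) (N ×ˢ Ioo (-δ) δ))
    (hsN : rayMap φ Γ x₀ (u₀, s) ∈ N) (hdiff : s' - s ∈ Ioo (-δ) δ) :
    ∃ O, IsRegularSet φ Γ x₀ 𝒪 O ∧ (u₀, s') ∈ O := by
  have hinc : ContDiff ℝ ∞ (fun u : BVec d ↦ (u, s)) := contDiff_id.prodMk contDiff_const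
  have hW : IsOpen ((fun u : BVec d ↦ (u, s)) ⁻¹' O) := hO.isOpen.preimage hinc.continuous
  have hY : ContMDiffOn (𝓡 d) (𝓡∂ (d + 1)).tangent ∞ (fun u ↦ rayMap φ Γ x₀ (u, s))
      ((fun u : BVec d ↦ (u, s)) ⁻¹' O) :=
    hO.smooth.comp hinc.contMDiff.contMDiffOn fun u hu ↦ hu
  have hmem : u₀ ∈ (fun u : BVec d ↦ (u, s)) ⁻¹' O := mem_preimage.2 huO
  have hsec : ∀ u ∈ (fun u : BVec d ↦ (u, s)) ⁻¹' O,
      (boundaryParam x₀ u, s) ∈ rayDomain φ Γ ∧ rayMap φ Γ x₀ (u, s) = rayMap φ Γ x₀ (u, s) ∧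
      ∀ s' ∈ Icc 0 s, rayMap φ Γ x₀ (u, s') ∈ 𝒪 := fun u hu ↦
    ⟨hO.dom (u, s) (mem_preimage.1 hu), rfl, hO.stays (u, s) (mem_preimage.1 hu)⟩
  have hbd : (fun u : BVec d ↦ (u, s)) ⁻¹' O ⊆ bdryDom d x₀ := fun u hu ↦
    hO.bdry (u, s) (mem_preimage.1 hu)
  exact exists_isRegularSet_of_section hΓ hW hbd hY
    (θ := fun _ ↦ s) contDiffOn_const hsec hN hΨ hΨs hmem hsN hdiff

/-- Along a ray that stays over the interior, the vectors depend smoothly on the parameters. -/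
lemma IsRay.exists_isRegularSet [T2Space M] (hα : IsRay φ Γ x₀ T α) (hΓ : IsInwardField Γ)
    (hint : ∀ t ∈ Ioc 0 T, (α t).proj ∈ (𝓡∂ (d + 1)).interior M) (h𝒪 : IsOpen 𝒪)
    (hα𝒪 : ∀ t ∈ Icc 0 T, α t ∈ 𝒪) {t : ℝ} (ht : t ∈ Ioc 0 T) :
    ∃ O, IsRegularSet φ Γ x₀ 𝒪 O ∧ (boundaryCoord x₀, t) ∈ O := by
  obtain ⟨s, hs, hPs⟩ := hα.exists_isRegularSet_start hΓ (ht.1.trans_le ht.2) h𝒪 hα𝒪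
  have key : ∀ r ∈ Ioc 0 T, ∃ U ∈ 𝓝[Ioc 0 T] r, ∀ s ∈ U, ∀ s' ∈ U,
      (∃ O, IsRegularSet φ Γ x₀ 𝒪 O ∧ (boundaryCoord x₀, s) ∈ O) →
      ∃ O, IsRegularSet φ Γ x₀ 𝒪 O ∧ (boundaryCoord x₀, s') ∈ O := by
    intro r hr
    have hr' : r ∈ Icc 0 T := ⟨hr.1.le, hr.2⟩
    obtain ⟨δ, hδ, N, hN, hrN, Ψ, hΨ, hΨs⟩ := exists_flowBox φ (hint r hr) (hα.ne_zero hΓ hr')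
        h𝒪 (hα𝒪 r hr')
    have hc : ContinuousWithinAt α (Ioc 0 T) r :=
      (hα.2.2.1.1 r hr').mono fun t ht ↦ ⟨ht.1.le, ht.2⟩
    refine ⟨_, inter_mem (hc.preimage_mem_nhdsWithin (hN.mem_nhds hrN))
      (inter_mem self_mem_nhdsWithin (mem_nhdsWithin_of_mem_nhds
          (Metric.ball_mem_nhds r (half_pos hδ)))),
      ?_⟩
    intro s hs s' hs' hP
    obtain ⟨O, hO, huO⟩ := hP
    have hdiff : s' - s ∈ Ioo (-δ) δ := by
      have hsr := hs.2.2
      have hsr' := hs'.2.2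
      rw [Metric.mem_ball, Real.dist_eq, abs_lt] at hsr hsr'
      constructor <;> linarith [hsr.1, hsr.2, hsr'.1, hsr'.2]
    refine hO.exists_shift hΓ huO hN hΨ hΨs ?_ hdiff
    rw [rayMap_boundaryCoord hΓ hα ⟨hs.2.1.1.le, hs.2.1.2⟩]
    exact hs.1
  exact propagate_of_preconnected (P := fun t ↦
    ∃ O, IsRegularSet φ Γ x₀ 𝒪 O ∧ (boundaryCoord x₀, t) ∈ O) isPreconnected_Ioc key hs ht hPs

variable (φ Γ) in
/-- `O` is a regular set of parameters on which the projection of `rayMap` is a diffeomorphism onto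
the open set `U`, with inverse `κ`. -/
structure IsLocalField (x₀ : M) (O : Set (BVec d × ℝ)) (U : Set M) (κ : M → BVec d × ℝ) :
    Prop where
  regular : IsRegularSet φ Γ x₀ univ O
  isOpen : IsOpen U
  map_mem : ∀ z ∈ O, (rayMap φ Γ x₀ z).proj ∈ U
  left_inv : ∀ z ∈ O, κ (rayMap φ Γ x₀ z).proj = z
  inv_mem : ∀ q ∈ U, κ q ∈ O
  right_inv : ∀ q ∈ U, (rayMap φ Γ x₀ (κ q)).proj = q
  smooth : ContMDiffOn (𝓡∂ (d + 1)) 𝓘(ℝ, BVec d × ℝ) ∞ κ U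

lemma contMDiff_proj : ContMDiff (𝓡∂ (d + 1)).tangent (𝓡∂ (d + 1)) ∞
    (fun y : TangentBundle (𝓡∂ (d + 1)) M ↦ y.proj) :=
  Bundle.contMDiff_proj (TangentSpace (𝓡∂ (d + 1)) (M := M))

lemma IsRegularSet.smooth_proj {O : Set (BVec d × ℝ)} (h : IsRegularSet φ Γ x₀ 𝒪 O) :
    ContMDiffOn 𝓘(ℝ, BVec d × ℝ) (𝓡∂ (d + 1)) ∞ (fun z ↦ (rayMap φ Γ x₀ z).proj) O :=
  contMDiff_proj.comp_contMDiffOn h.smooth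

lemma IsLocalField.mono {O : Set (BVec d × ℝ)} {U U' : Set M} {κ : M → BVec d × ℝ}
    (h : IsLocalField φ Γ x₀ O U κ) (hU' : IsOpen U') (hsub : U' ⊆ U) :
    IsLocalField φ Γ x₀ (O ∩ (fun z ↦ (rayMap φ Γ x₀ z).proj) ⁻¹' U') U' κ where
  regular := h.regular.mono
    (h.regular.smooth_proj.continuousOn.isOpen_inter_preimage h.regular.isOpen hU') inter_subset_left
  isOpen := hU'
  map_mem z hz := hz.2
  left_inv z hz := h.left_inv z hz.1
  inv_mem q hq := ⟨h.inv_mem q (hsub hq), by rw [mem_preimage, h.right_inv q (hsub hq)]; exact hq⟩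
  right_inv q hq := h.right_inv q (hsub hq)
  smooth := h.smooth.mono hsub

/-- Around a ray vector where the projection has bijective derivative there is a local field. -/
lemma IsRegularSet.exists_isLocalField {O : Set (BVec d × ℝ)} (h : IsRegularSet φ Γ x₀ 𝒪 O)
    {z : BVec d × ℝ} (hz : z ∈ O)
    {A : TangentSpace 𝓘(ℝ, BVec d × ℝ) z →L[ℝ] TangentSpace (𝓡∂ (d + 1)) (rayMap φ Γ x₀ z).proj}
    (hA : HasMFDerivAt 𝓘(ℝ, BVec d × ℝ) (𝓡∂ (d + 1)) (fun z ↦ (rayMap φ Γ x₀ z).proj) z A)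
    (hbij : Function.Bijective A) :
    ∃ O' ⊆ O, z ∈ O' ∧ ∃ U κ, IsLocalField φ Γ x₀ O' U κ := by
  set F : BVec d × ℝ → M := fun z ↦ (rayMap φ Γ x₀ z).proj with hF
  set e := extChartAt (𝓡∂ (d + 1)) (F z) with he
  set O₁ := O ∩ F ⁻¹' e.source with hO₁
  have hO₁o : IsOpen O₁ := h.smooth_proj.continuousOn.isOpen_inter_preimage h.isOpen
    (isOpen_extChartAt_source _)
  have hzO₁ : z ∈ O₁ := ⟨hz, mem_extChartAt_source _⟩
  have hg : ContDiffOn ℝ ∞ (e ∘ F) O₁ := by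
    have h1 : ContMDiffOn (𝓡∂ (d + 1)) 𝓘(ℝ, Vec d) ∞ e e.source := by
      rw [he, extChartAt_source]; exact contMDiffOn_extChartAt
    exact (h1.comp (h.smooth_proj.mono inter_subset_left) fun z hz ↦ hz.2).contDiffOn
  have hA' : HasFDerivAt (e ∘ F) (show BVec d × ℝ →L[ℝ] Vec d from A) z := by
    have := hA.2
    simp only [writtenInExtChartAt, extChartAt_model_space_eq_id, modelWithCornersSelf_coe,
      range_id] at this
    exact hasFDerivWithinAt_univ.1 this
  obtain ⟨g, hgc, hzg, hgO, hgs⟩ := exists_smooth_local_inverse hO₁o hg hzO₁ hA' hbij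
  have hgt : g.target ⊆ e.target := fun y hy ↦ by
    have h1 := g.map_target hy
    rw [← g.right_inv hy, hgc]
    exact e.map_source (hgO h1).2
  set U : Set M := e.source ∩ e ⁻¹' g.target with hU
  have hUo : IsOpen U := (continuousOn_extChartAt _).isOpen_inter_preimage
    (isOpen_extChartAt_source _) g.open_target
  refine ⟨g.source, fun w hw ↦ (hgO hw).1, hzg, U, fun q ↦ g.symm (e q),
    ⟨h.to_univ.mono g.open_source fun w hw ↦ (hgO hw).1, hUo, fun w hw ↦ ?_, fun w hw ↦ ?_,
    fun q hq ↦ ?_, fun q hq ↦ ?_, ?_⟩⟩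
  · refine ⟨(hgO hw).2, ?_⟩
    have := g.map_source hw
    rw [hgc] at this
    exact this
  · have := g.left_inv hw
    rw [hgc] at this
    exact this
  · exact g.map_target hq.2
  · have h1 := g.right_inv hq.2
    rw [hgc] at h1
    exact e.injOn (hgO (g.map_target hq.2)).2 hq.1 h1
  · have h1 : ContMDiffOn (𝓡∂ (d + 1)) 𝓘(ℝ, Vec d) ∞ e e.source := by
      rw [he, extChartAt_source]; exact contMDiffOn_extChartAt
    exact hgs.contMDiffOn.comp (h1.mono inter_subset_left) fun q hq ↦ hq.2

end LocalFields
section Nonfocal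

/-! ### Non-focal vectors belong to local fields -/

set_option linter.unusedSectionVars false

variable {d : ℕ} {M : Type*} [TopologicalSpace M] [ChartedSpace (EuclideanHalfSpace (d + 1)) M]
  [IsManifold (𝓡∂ (d + 1)) ∞ M]
variable {φ : FinslerMetric d M} {Γ : (x : M) → TangentSpace (𝓡∂ (d + 1)) x} {x₀ x₁ : M} {S : Set M}
  {α β : ℝ → TangentBundle (𝓡∂ (d + 1)) M} {T : ℝ}

/-- The change between the boundary coordinates around `x` and those around `x'`. -/
noncomputable def bdryChange (x x' : M) (u : BVec d) : BVec d :=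
  bdryProj d (extChartAt (𝓡∂ (d + 1)) x' (boundaryParam x u))

/-- The domain of `bdryChange`. -/
def bdryChangeDom (d : ℕ) {M : Type*} [TopologicalSpace M]
    [ChartedSpace (EuclideanHalfSpace (d + 1)) M] (x x' : M) : Set (BVec d) :=
  bdryDom d x ∩ boundaryParam x ⁻¹' (extChartAt (𝓡∂ (d + 1)) x').source

lemma isOpen_bdryChangeDom (x x' : M) : IsOpen (bdryChangeDom d x x') :=
  (contMDiffOn_boundaryParam x).continuousOn.isOpen_inter_preimage (isOpen_bdryDom x)
    (isOpen_extChartAt_source x')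

lemma contDiffOn_bdryChange (x x' : M) : ContDiffOn ℝ ∞ (bdryChange (d := d) x x')
    (bdryChangeDom d x x') := by
  have h1 : ContMDiffOn (𝓡∂ (d + 1)) 𝓘(ℝ, Vec d) ∞ (extChartAt (𝓡∂ (d + 1)) x')
      (extChartAt (𝓡∂ (d + 1)) x').source := by
    rw [extChartAt_source]; exact contMDiffOn_extChartAt
  have h2 := (h1.comp ((contMDiffOn_boundaryParam (d := d) x).mono inter_subset_left)
    (fun u (hu : u ∈ bdryChangeDom d x x') ↦ hu.2)).contDiffOn
  exact (bdryProj d).contDiff.comp_contDiffOn h2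

lemma bdryEmb_bdryChange {x x' : M} {u : BVec d} (hu : u ∈ bdryChangeDom d x x') :
    bdryEmb d (bdryChange x x' u) = extChartAt (𝓡∂ (d + 1)) x' (boundaryParam x u) :=
  bdryEmb_bdryProj ((mem_boundary_iff hu.2).1 (boundaryParam_mem_boundary hu.1))

lemma boundaryParam_bdryChange {x x' : M} {u : BVec d} (hu : u ∈ bdryChangeDom d x x') :
    boundaryParam x' (bdryChange x x' u) = boundaryParam x u := by
  rw [boundaryParam_eq, bdryEmb_bdryChange hu, (extChartAt (𝓡∂ (d + 1)) x').left_inv hu.2]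

lemma bdryChange_mem {x x' : M} {u : BVec d} (hu : u ∈ bdryChangeDom d x x') :
    bdryChange x x' u ∈ bdryChangeDom d x' x := by
  refine ⟨?_, ?_⟩
  · rw [bdryDom, mem_ofPred_eq, bdryEmb_bdryChange hu]
    exact (extChartAt (𝓡∂ (d + 1)) x').map_source hu.2
  · rw [mem_preimage, boundaryParam_bdryChange hu]
    exact boundaryParam_mem_source hu.1

lemma bdryChange_bdryChange {x x' : M} {u : BVec d} (hu : u ∈ bdryChangeDom d x x') :
    bdryChange x' x (bdryChange x x' u) = u := by
  rw [bdryChange, boundaryParam_bdryChange hu, extChartAt_boundaryParam hu.1, bdryProj_bdryEmb]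

lemma rayMap_bdryChange {x x' : M} {z : BVec d × ℝ} (hu : z.1 ∈ bdryChangeDom d x x') :
    rayMap φ Γ x' (bdryChange x x' z.1, z.2) = rayMap φ Γ x z := by
  rw [rayMap, rayMap]
  simp only
  rw [boundaryParam_bdryChange hu]

/-- The base points of boundary coordinates: `u` around `x₀` are the coordinates of `x`. -/
lemma boundaryCoord_mem_bdryChangeDom {u : BVec d} (hu : u ∈ bdryDom d x₀) :
    u ∈ bdryChangeDom d x₀ (boundaryParam x₀ u) ∧
      bdryChange x₀ (boundaryParam x₀ u) u = boundaryCoord (boundaryParam x₀ u) ∧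
      boundaryCoord (boundaryParam x₀ u) ∈ bdryChangeDom d (boundaryParam x₀ u) x₀ := by
  have h1 : u ∈ bdryChangeDom d x₀ (boundaryParam x₀ u) :=
    ⟨hu, mem_extChartAt_source _⟩
  have h2 : bdryChange x₀ (boundaryParam x₀ u) u = boundaryCoord (boundaryParam x₀ u) := rfl
  exact ⟨h1, h2, h2 ▸ bdryChange_mem h1⟩

/-- The vectors of a local field are not focal. -/
lemma IsLocalField.isNonfocal [T2Space M] {O : Set (BVec d × ℝ)} {U : Set M} {κ : M → BVec d × ℝ}
    (h : IsLocalField φ Γ x₀ O U κ) {z : BVec d × ℝ} (hz : z ∈ O) :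
    IsNonfocal φ Γ (rayMap φ Γ x₀ z) := by
  set x' := boundaryParam x₀ z.1 with hx'
  obtain ⟨hu1, hu2, hu3⟩ := boundaryCoord_mem_bdryChangeDom (h.regular.bdry z hz)
  rw [← hx'] at hu1 hu2 hu3
  set u' := boundaryCoord (d := d) x' with hu'
  have hk : bdryChange x' x₀ u' = z.1 := by rw [← hu2, bdryChange_bdryChange hu1]
  refine ⟨x', z.2, h.regular.dom z hz, rfl, ?_⟩
  intro f
  set k : BVec d × ℝ → BVec d × ℝ := fun w ↦ (bdryChange x' x₀ w.1, w.2) with hkdef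
  set G : Set (BVec d × ℝ) := bdryChangeDom d x' x₀ ×ˢ univ with hG
  have hGo : IsOpen G := (isOpen_bdryChangeDom x' x₀).prod isOpen_univ
  have hkc : ContDiffOn ℝ ∞ k G := ((contDiffOn_bdryChange x' x₀).comp contDiffOn_fst
    fun w hw ↦ hw.1).prodMk contDiffOn_snd
  set O' := G ∩ k ⁻¹' O with hO'
  have hO'o : IsOpen O' := hkc.continuousOn.isOpen_inter_preimage hGo h.regular.isOpen
  have hmem : (u', z.2) ∈ O' := by
    refine ⟨⟨hu3, mem_univ _⟩, ?_⟩
    simp only [hkdef, mem_preimage, hk]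
    exact hz
  have hfk : ∀ w ∈ O', f w = (rayMap φ Γ x₀ (k w)).proj := fun w hw ↦ by
    have := rayMap_bdryChange (φ := φ) (Γ := Γ) (z := w) hw.1.1
    rw [hkdef]
    simp only
    rw [this]
    rfl
  have hfs : ContMDiffOn 𝓘(ℝ, BVec d × ℝ) (𝓡∂ (d + 1)) ∞ f O' :=
    (h.regular.smooth_proj.comp (hkc.mono inter_subset_left).contMDiffOn fun w hw ↦ hw.2).congr hfk
  have hfd : MDifferentiableAt 𝓘(ℝ, BVec d × ℝ) (𝓡∂ (d + 1)) f (u', z.2) :=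
    (hfs.contMDiffAt (hO'o.mem_nhds hmem)).mdifferentiableAt (by simp)
  refine ⟨mfderiv 𝓘(ℝ, BVec d × ℝ) (𝓡∂ (d + 1)) f (u', z.2), hfd.hasMFDerivAt.hasMFDerivWithinAt,
      ?_⟩
  -- the inverse
  set κ' : M → BVec d × ℝ := fun q ↦ (bdryChange x₀ x' (κ q).1, (κ q).2) with hκ'
  have hfz : f (u', z.2) = (rayMap φ Γ x₀ z).proj := by
    rw [hfk _ hmem]
    simp only [hkdef, hk]
  have hκd : MDifferentiableAt (𝓡∂ (d + 1)) 𝓘(ℝ, BVec d × ℝ) κ' (f (u', z.2)) := by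
    rw [hfz]
    have h1 := (h.smooth.contMDiffAt (h.isOpen.mem_nhds (h.map_mem z hz)))
    have h2 : ContDiffAt ℝ ∞ (fun w : BVec d × ℝ ↦ (bdryChange x₀ x' w.1, w.2))
        (κ (rayMap φ Γ x₀ z).proj) := by
      rw [h.left_inv z hz]
      have h3 := (contDiffOn_bdryChange x₀ x').contDiffAt
          ((isOpen_bdryChangeDom x₀ x').mem_nhds hu1)
      exact (h3.comp z contDiffAt_fst).prodMk contDiffAt_snd
    exact (h2.contMDiffAt.comp _ h1).mdifferentiableAt (by simp)
  have hid : κ' ∘ f =ᶠ[𝓝 (u', z.2)] id := by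
    filter_upwards [hO'o.mem_nhds hmem] with w hw
    simp only [Function.comp_apply, hfk w hw, hκ', h.left_inv _ hw.2, id]
    rw [hkdef]
    simp only
    rw [bdryChange_bdryChange hw.1.1]
  have hcomp := HasMFDerivAt.comp (u', z.2) hκd.hasMFDerivAt hfd.hasMFDerivAt
  have hone := (hasMFDerivAt_id (I := 𝓘(ℝ, BVec d × ℝ)) (u', z.2)).congr_of_eventuallyEq hid
  have heq := hasMFDerivAt_unique hcomp hone
  have hinj : Function.Injective (mfderiv 𝓘(ℝ, BVec d × ℝ) (𝓡∂ (d + 1)) f (u', z.2)) := by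
    intro a b hab
    have ha := congrArg (fun A : BVec d × ℝ →L[ℝ] BVec d × ℝ ↦ A a) heq
    have hb := congrArg (fun A : BVec d × ℝ →L[ℝ] BVec d × ℝ ↦ A b) heq
    have ha' : mfderiv (𝓡∂ (d + 1)) 𝓘(ℝ, BVec d × ℝ) κ' (f (u', z.2))
      (mfderiv 𝓘(ℝ, BVec d × ℝ) (𝓡∂ (d + 1)) f (u', z.2) a) = a := ha
    have hb' : mfderiv (𝓡∂ (d + 1)) 𝓘(ℝ, BVec d × ℝ) κ' (f (u', z.2))
      (mfderiv 𝓘(ℝ, BVec d × ℝ) (𝓡∂ (d + 1)) f (u', z.2) b) = b := hb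
    rw [← ha', hab, hb']
  have hfin : Module.finrank ℝ (BVec d × ℝ) = Module.finrank ℝ (Vec d) := by
    simp
  set A : BVec d × ℝ →L[ℝ] Vec d := mfderiv 𝓘(ℝ, BVec d × ℝ) (𝓡∂ (d + 1)) f (u', z.2)
  exact ⟨hinj, (LinearMap.injective_iff_surjective_of_finrank_eq_finrank
      (f := (A : BVec d × ℝ →ₗ[ℝ] Vec d)) hfin).1 hinj⟩

/-- A limit of vectors of `A(S)` that is not focal belongs to a local field, and near it all limits
of vectors of `A(S)` do. -/
lemma exists_isLocalField_of_isNonfocal [T2Space M] (hsp : Splits φ Γ S) (hΓ : IsInwardField Γ)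
    (hS : IsClosed S) (hSi : S ⊆ (𝓡∂ (d + 1)).interior M) {y : TangentBundle (𝓡∂ (d + 1)) M}
    (hy : IsNonfocal φ Γ y) (hcl : y ∈ closure (raysOff φ Γ S))
    (hi : y.proj ∈ (𝓡∂ (d + 1)).interior M) :
    ∃ x₀ O U κ, IsLocalField φ Γ x₀ O U κ ∧ y.proj ∈ U ∧ rayMap φ Γ x₀ (κ y.proj) = y ∧
      ∀ᶠ w in 𝓝 y, w ∈ closure (raysOff φ Γ S) → rayMap φ Γ x₀ (κ w.proj) = w := by
  obtain ⟨x₀, T, hdom, rfl, A, hA, hbij⟩ := hy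
  set α := rayFlow φ Γ x₀ with hαdef
  have hα : IsRay φ Γ x₀ T α := isRay_rayFlow hΓ hdom
  have hint := hα.interior_of_mem_closure hsp hΓ hS hSi hcl hi
  have hT : 0 < T := by
    refine lt_of_le_of_ne hα.2.1 fun h ↦ ?_
    rw [← h, hα.apply_zero] at hi
    exact not_interior_of_boundary hα.1 hi
  obtain ⟨O, hO, hzO⟩ := hα.exists_isRegularSet hΓ hint isOpen_univ (fun _ _ ↦ mem_univ _)
    (t := T) ⟨hT, le_rfl⟩
  have hrT : rayMap φ Γ x₀ (boundaryCoord x₀, T) = α T :=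
    rayMap_boundaryCoord hΓ hα (right_mem_Icc.2 hα.2.1)
  have hA' := hA.hasMFDerivAt (mem_of_superset (hO.isOpen.mem_nhds hzO) fun z hz ↦ hO.dom z hz)
  obtain ⟨O', hO'O, hzO', U, κ, hLF⟩ := hO.exists_isLocalField hzO hA' hbij
  have hpU : (α T).proj ∈ U := by
    rw [← hrT]; exact hLF.map_mem _ hzO'
  have hκ : κ (α T).proj = (boundaryCoord x₀, T) := by
    rw [← hrT]; exact hLF.left_inv _ hzO'
  refine ⟨x₀, O', U, κ, hLF, hpU, by rw [hκ, hrT], ?_⟩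
  have h1 := hα.eventually_raysOff hsp hΓ hS hSi hT hint (hLF.regular.isOpen.mem_nhds hzO')
  filter_upwards [eventually_eventually_nhds.2 h1,
    (hLF.isOpen.preimage continuous_proj).mem_nhds hpU] with w hw hwU hwcl
  -- Both sides of the equation depend continuously on `w`, and it holds at the vectors of `A(S)`
  -- near `w`.
  by_contra hne
  have hcont : ContinuousAt (fun w : TangentBundle (𝓡∂ (d + 1)) M ↦ rayMap φ Γ x₀ (κ w.proj)) w :=
      by
    have h2 : ContinuousAt κ w.proj := hLF.smooth.continuousOn.continuousAt
        (hLF.isOpen.mem_nhds hwU)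
    have h3 : ContinuousAt (rayMap φ Γ x₀) (κ w.proj) :=
        hLF.regular.smooth.continuousOn.continuousAt
      (hLF.regular.isOpen.mem_nhds (hLF.inv_mem _ hwU))
    have h4 : ContinuousAt (fun w : TangentBundle (𝓡∂ (d + 1)) M ↦ w.proj) w :=
      continuous_proj.continuousAt
    have h5 : ContinuousAt (fun w : TangentBundle (𝓡∂ (d + 1)) M ↦ κ w.proj) w :=
      ContinuousAt.comp (g := κ) h2 h4
    exact ContinuousAt.comp (g := rayMap φ Γ x₀) h3 h5
  have h5 : ∀ᶠ w' in 𝓝 w, rayMap φ Γ x₀ (κ w'.proj) ≠ w' :=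
    (hcont.prodMk continuousAt_id).eventually (isClosed_diagonal.isOpen_compl.mem_nhds
      (show (_, w) ∈ (diagonal _)ᶜ from hne))
  obtain ⟨w', hw'A, hw'1, hw'2⟩ := ((mem_closure_iff_frequently.1 hwcl).and_eventually
    (h5.and hw)).exists
  obtain ⟨z, hz, -, -, hzw⟩ := hw'2 hw'A
  apply hw'1
  have h6 : rayMap φ Γ x₀ z = w' := hzw.symm
  rw [← h6, hLF.left_inv z hz]

/-- The points over which the vector of a local field belongs to `A(S)` form an open set. -/
lemma IsLocalField.isOpen_raysOff [T2Space M] {O : Set (BVec d × ℝ)} {U : Set M}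
    {κ : M → BVec d × ℝ}
    (h : IsLocalField φ Γ x₀ O U κ) (hsp : Splits φ Γ S) (hΓ : IsInwardField Γ)
    (hS : IsClosed S) (hSi : S ⊆ (𝓡∂ (d + 1)).interior M) :
    IsOpen {q ∈ U | rayMap φ Γ x₀ (κ q) ∈ raysOff φ Γ S} := by
  rw [isOpen_iff_mem_nhds]
  rintro q₀ ⟨hq₀U, hq₀A⟩
  set z := κ q₀ with hz
  have hzO : z ∈ O := h.inv_mem _ hq₀U
  set x' := boundaryParam x₀ z.1 with hx'
  obtain ⟨hu1, hu2, hu3⟩ := boundaryCoord_mem_bdryChangeDom (h.regular.bdry z hzO)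
  rw [← hx'] at hu1 hu2 hu3
  have hα : IsRay φ Γ x' z.2 (rayFlow φ Γ x') := isRay_rayFlow hΓ (h.regular.dom z hzO)
  have hint := hα.interior_of_mem_closure hsp hΓ hS hSi (subset_closure hq₀A)
    (h.regular.interior z hzO)
  have hoff : ∀ t ∈ Icc 0 z.2, rayFlow φ Γ x' t ∈ {y : TangentBundle
      (𝓡∂ (d + 1)) M | y.proj ∈ Sᶜ} := by
    obtain ⟨x'', T'', hd'', hS'', heq⟩ := (mem_raysOff_iff hΓ).1 hq₀A
    obtain ⟨h1, h2⟩ := (isRay_rayFlow hΓ hd'').eq_of_apply_eq hΓ hα heq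
    subst h1 h2
    exact hS''
  obtain ⟨O', hO', hmem⟩ := hα.exists_isRegularSet hΓ hint
    (hS.isOpen_compl.preimage continuous_proj) hoff (t := z.2)
    ⟨h.regular.pos z hzO, le_rfl⟩
  have hκc : ContinuousAt κ q₀ := h.smooth.continuousOn.continuousAt (h.isOpen.mem_nhds hq₀U)
  have hkc : ContinuousAt (fun w : BVec d × ℝ ↦ (bdryChange x₀ x' w.1, w.2)) z := by
    have h3 := ((contDiffOn_bdryChange x₀ x').continuousOn.continuousAt
      ((isOpen_bdryChangeDom x₀ x').mem_nhds hu1))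
    exact (ContinuousAt.comp (g := bdryChange x₀ x') (f := Prod.fst) h3 continuousAt_fst).prodMk
      continuousAt_snd
  have hev : ∀ᶠ q in 𝓝 q₀, (bdryChange x₀ x' (κ q).1, (κ q).2) ∈ O' := by
    refine (ContinuousAt.comp (g := fun w : BVec d × ℝ ↦ (bdryChange x₀ x' w.1, w.2)) hkc hκc
      ).preimage_mem_nhds ?_
    refine hO'.isOpen.mem_nhds ?_
    change (bdryChange x₀ x' z.1, z.2) ∈ O'
    rw [hu2]; exact hmem
  have hev2 : ∀ᶠ q in 𝓝 q₀, (κ q).1 ∈ bdryChangeDom d x₀ x' :=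
    hκc.fst.preimage_mem_nhds ((isOpen_bdryChangeDom x₀ x').mem_nhds hu1)
  filter_upwards [hev, hev2, h.isOpen.mem_nhds hq₀U] with q hq hq2 hqU
  refine ⟨hqU, ?_⟩
  rw [← rayMap_bdryChange hq2]
  exact (mem_raysOff_iff hΓ).2 ⟨_, _, hO'.dom _ hq, fun t ht ↦ hO'.stays _ hq t ht, rfl⟩

lemma mem_limitSet_iff {p : M} (hp : p ∈ S) {X : TangentSpace (𝓡∂ (d + 1)) p} :
    X ∈ limitSet φ Γ S p ↔ (⟨p, X⟩ : TangentBundle (𝓡∂ (d + 1)) M) ∈ closure (raysOff φ Γ S) := by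
  rw [limitSet, if_pos hp, mem_closure_iff_seq_limit]
  rfl

lemma mem_limitSet_iff_of_notMem {p : M} (hp : p ∉ S) {X : TangentSpace (𝓡∂ (d + 1)) p} :
    X ∈ limitSet φ Γ S p ↔ (⟨p, X⟩ : TangentBundle (𝓡∂ (d + 1)) M) ∈ raysOff φ Γ S := by
  rw [limitSet, if_neg hp]
  rfl

lemma continuousAt_tChart_symm (p : M) (v : Vec d) :
    ContinuousAt (fun z : M × Vec d ↦ (tChart p).symm (extChartAt (𝓡∂ (d + 1)) p z.1, z.2))
        (p, v) := by
  have h1 : ContinuousWithinAt (fun z : M × Vec d ↦ (extChartAt (𝓡∂ (d + 1)) p z.1, z.2))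
      ((extChartAt (𝓡∂ (d + 1)) p).source ×ˢ univ) (p, v) :=
    (((continuousAt_extChartAt (I := 𝓡∂ (d + 1)) p).comp (f := fun z : M × Vec d ↦ z.1)
      (x := (p, v)) continuousAt_fst).continuousWithinAt).prodMk continuousWithinAt_snd
  have h2 := ContinuousWithinAt.comp (x := (p, v))
    (f := fun z : M × Vec d ↦ (extChartAt (𝓡∂ (d + 1)) p z.1, z.2))
    (continuousOn_tChart_symm p (extChartAt (𝓡∂ (d + 1)) p p, v)
      (mem_tChart_target.2 (mem_extChartAt_target p))) h1
    (fun z hz ↦ mem_tChart_target.2 ((extChartAt (𝓡∂ (d + 1)) p).map_source hz.1))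
  exact h2.continuousAt (((isOpen_extChartAt_source p).prod isOpen_univ).mem_nhds
    ⟨mem_extChartAt_source p, mem_univ _⟩)

/-- In a chart, the norm is locally bounded below by a multiple of the Euclidean norm. -/
lemma eventually_le_toFun (φ : FinslerMetric d M) (p : M) :
    ∃ c, 0 < c ∧ ∀ᶠ q in 𝓝 p, q ∈ (extChartAt (𝓡∂ (d + 1)) p).source ∧ ∀ v : Vec d,
      c * ‖v‖ ≤ φ.toFun ((tChart p).symm (extChartAt (𝓡∂ (d + 1)) p q, v)) := by
  set g : M × Vec d → ℝ := fun z ↦ φ.toFun ((tChart p).symm (extChartAt (𝓡∂ (d + 1)) p z.1, z.2))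
    with hg
  have hcont : ∀ v : Vec d, ContinuousAt g (p, v) := fun v ↦
    ContinuousAt.comp (g := φ.toFun) φ.continuous.continuousAt (continuousAt_tChart_symm p v)
  have hne : ∀ v ∈ Metric.sphere (0 : Vec d) 1, v ≠ 0 := fun v hv h ↦ by simp [h] at hv
  have hcs : ContinuousOn (fun v ↦ g (p, v)) (Metric.sphere (0 : Vec d) 1) := fun v hv ↦ by
    have h3 : ContinuousAt (fun v : Vec d ↦ g (p, v)) v :=
      (hcont v).comp (f := fun v : Vec d ↦ (p, v)) (by fun_prop)
    exact h3.continuousWithinAt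
  obtain ⟨c, hc, hcb⟩ := (isCompact_sphere (0 : Vec d) 1).exists_forall_le' hcs (a := 0)
    (fun v hv ↦ φ.pos' _ ((tChart_symm_snd_ne_zero (z := (extChartAt (𝓡∂ (d + 1)) p p, v))
      (mem_extChartAt_target p)).2 (hne v hv)))
  have h4 := (isCompact_sphere (0 : Vec d) 1).eventually_forall_of_forall_eventually (x₀ := p)
    (P := fun q v ↦ c / 2 < g (q, v)) (fun v hv ↦ (hcont v).eventually_const_lt (by
      have := hcb v hv
      linarith))
  refine ⟨c / 2, by positivity, ?_⟩
  filter_upwards [h4, (isOpen_extChartAt_source (I := 𝓡∂ (d + 1)) p).mem_nhds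
    (mem_extChartAt_source p)] with q hq hqs
  refine ⟨hqs, fun v ↦ ?_⟩
  have hqt := (extChartAt (𝓡∂ (d + 1)) p).map_source hqs
  by_cases hv : v = 0
  · rw [hv, norm_zero, mul_zero]; exact φ.toFun_nonneg _
  · have h5 := hq (‖v‖⁻¹ • v) (by simp [norm_smul, hv])
    have h6 := toFun_tChart_symm_smul φ hqt (norm_nonneg v) (‖v‖⁻¹ • v)
    rw [smul_smul, mul_inv_cancel₀ (norm_ne_zero_iff.2 hv), one_smul] at h6
    rw [h6, mul_comm]
    exact mul_le_mul_of_nonneg_left h5.le (norm_nonneg v)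

/-- The norm is bounded on `A(S)`, because the rays have constant speed and start at the compact
boundary. -/
lemma exists_toFun_le [T2Space M] (hcompact : IsCompact ((𝓡∂ (d + 1)).boundary M))
    (hΓ : IsInwardField Γ) : ∃ C, ∀ y ∈ closure (raysOff φ Γ S), φ.toFun y ≤ C := by
  have h1 : ContinuousOn (fun x ↦ φ.toFun (initVec Γ x)) ((𝓡∂ (d + 1)).boundary M) :=
    φ.continuous.comp_continuousOn hΓ.1.continuousOn
  obtain ⟨C, hC⟩ := hcompact.exists_bound_of_continuousOn h1
  refine ⟨C, fun y hy ↦ ?_⟩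
  refine closure_minimal (s := raysOff φ Γ S) (t := {y | φ.toFun y ≤ C}) ?_
    (isClosed_le φ.continuous continuous_const) hy
  rintro _ ⟨x, T, α, hα, -, rfl⟩
  rw [mem_ofPred_eq, hα.toFun_eq hΓ (right_mem_Icc.2 hα.2.1)]
  exact (le_abs_self _).trans (hC x hα.1)

/-- The limits of vectors of `A(S)` over points close to `p` are close to limits over `p`. -/
lemma eventually_closure_subset [T2Space M] (hcompact : IsCompact ((𝓡∂ (d + 1)).boundary M))
    (hΓ : IsInwardField Γ) {p : M} {𝒱 : Set (TangentBundle (𝓡∂ (d + 1)) M)} (h𝒱 : IsOpen 𝒱)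
    (h : ∀ y ∈ closure (raysOff φ Γ S), y.proj = p → y ∈ 𝒱) :
    ∀ᶠ q in 𝓝 p, ∀ y ∈ closure (raysOff φ Γ S), y.proj = q → y ∈ 𝒱 := by
  obtain ⟨C, hC⟩ := exists_toFun_le (φ := φ) (S := S) hcompact hΓ
  obtain ⟨c, hc, hev⟩ := eventually_le_toFun φ p
  have h1 := (isCompact_closedBall (0 : Vec d) (C / c)).eventually_forall_of_forall_eventually
      (x₀ := p)
    (P := fun q v ↦ (tChart p).symm (extChartAt (𝓡∂ (d + 1)) p q, v) ∈ closure (raysOff φ Γ S) →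
      (tChart p).symm (extChartAt (𝓡∂ (d + 1)) p q, v) ∈ 𝒱) (fun v _ ↦ by
      have hcont := continuousAt_tChart_symm p v
      have hproj : ((tChart p).symm (extChartAt (𝓡∂ (d + 1)) p p, v)).proj = p := by
        rw [tChart_symm_proj, extChartAt_to_inv]
      by_cases hmem : (tChart p).symm (extChartAt (𝓡∂ (d + 1)) p p, v) ∈ closure (raysOff φ Γ S)
      · filter_upwards [hcont.preimage_mem_nhds (h𝒱.mem_nhds (h _ hmem hproj))] with z hz _
        exact hz
      · filter_upwards [hcont.preimage_mem_nhds
          (isClosed_closure.isOpen_compl.mem_nhds hmem)] with z hz hz'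
        exact absurd hz' hz)
  filter_upwards [h1, hev] with q hq hq' y hy hyq
  subst hyq
  have hys : y ∈ (tChart p).source := mem_tChart_source.2 hq'.1
  have hyeq : (tChart p).symm (extChartAt (𝓡∂ (d + 1)) p y.proj, (tChart p y).2) = y := by
    rw [← tChart_fst, Prod.mk.eta, (tChart p).left_inv hys]
  have h2 := hq'.2 (tChart p y).2
  rw [hyeq] at h2
  have h3 := hq (tChart p y).2 (by
    rw [mem_closedBall_zero_iff, le_div_iff₀ hc, mul_comm]
    exact h2.trans (hC y hy))
  rw [hyeq] at h3
  exact h3 hy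

end Nonfocal
section CleaveNeighborhood

set_option linter.unusedSectionVars false

variable {d : ℕ} {M : Type*} [TopologicalSpace M] [ChartedSpace (EuclideanHalfSpace (d + 1)) M]
  [IsManifold (𝓡∂ (d + 1)) ∞ M]
variable {φ : FinslerMetric d M} {Γ : (x : M) → TangentSpace (𝓡∂ (d + 1)) x} {S : Set M}

/-! ### The structure of `A(S)` near a cleave point -/

lemma tangentBundle_ext_snd {a : M} {v w : TangentSpace (𝓡∂ (d + 1)) a}
    (h : (⟨a, v⟩ : TangentBundle (𝓡∂ (d + 1)) M) = ⟨a, w⟩) : v = w := by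
  have := congrArg vel h
  exact this

lemma tmk_vel_of_proj {q : M} {y : TangentBundle (𝓡∂ (d + 1)) M} (h : y.proj = q) :
    tmk q (vel y) = y := by
  subst h; rfl

variable (φ Γ S) in
/-- Over `U`, all limits of vectors of `A(S)` belong to two disjoint local fields, and over the
points of `S` both fields consist of limits. -/
structure IsCleaveNhd (U : Set M) (x₁ : M) (O₁ : Set (BVec d × ℝ)) (κ₁ : M → BVec d × ℝ)
    (x₂ : M) (O₂ : Set (BVec d × ℝ)) (κ₂ : M → BVec d × ℝ) : Prop where
  left : IsLocalField φ Γ x₁ O₁ U κ₁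
  right : IsLocalField φ Γ x₂ O₂ U κ₂
  ne : ∀ q ∈ U, rayMap φ Γ x₁ (κ₁ q) ≠ rayMap φ Γ x₂ (κ₂ q)
  eq_or_eq : ∀ y ∈ closure (raysOff φ Γ S), y.proj ∈ U →
    y = rayMap φ Γ x₁ (κ₁ y.proj) ∨ y = rayMap φ Γ x₂ (κ₂ y.proj)
  left_mem : ∀ q ∈ S ∩ U, rayMap φ Γ x₁ (κ₁ q) ∈ closure (raysOff φ Γ S)
  right_mem : ∀ q ∈ S ∩ U, rayMap φ Γ x₂ (κ₂ q) ∈ closure (raysOff φ Γ S)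

lemma IsCleaveNhd.symm {U : Set M} {x₁ x₂ : M} {O₁ O₂ : Set (BVec d × ℝ)} {κ₁ κ₂ : M → BVec d × ℝ}
    (h : IsCleaveNhd φ Γ S U x₁ O₁ κ₁ x₂ O₂ κ₂) : IsCleaveNhd φ Γ S U x₂ O₂ κ₂ x₁ O₁ κ₁ where
  left := h.right
  right := h.left
  ne q hq := (h.ne q hq).symm
  eq_or_eq y hy hyU := (h.eq_or_eq y hy hyU).symm
  left_mem := h.right_mem
  right_mem := h.left_mem

lemma IsLocalField.contMDiffOn_rayMap {x₀ : M} {O : Set (BVec d × ℝ)} {U : Set M}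
    {κ : M → BVec d × ℝ}
    (h : IsLocalField φ Γ x₀ O U κ) :
    ContMDiffOn (𝓡∂ (d + 1)) (𝓡∂ (d + 1)).tangent ∞ (fun q ↦ rayMap φ Γ x₀ (κ q)) U :=
  h.regular.smooth.comp h.smooth h.inv_mem

/-- By compactness of the set of limits, the vectors of `A(S)` near a cleave point belong to the two
local fields through its limit vectors. As the points with two limit vectors are dense in `S`, both
fields consist of limits over all of `S`. -/
lemma IsCleavePair.exists_isCleaveNhd [T2Space M] (hcompact : IsCompact ((𝓡∂ (d + 1)).boundary M))
    (hsp : IsSplitLocus φ Γ S) (hΓ : IsInwardField Γ) (hSi : S ⊆ (𝓡∂ (d + 1)).interior M) {p : M}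
    {X₁ X₂ : TangentSpace (𝓡∂ (d + 1)) p} (h : IsCleavePair φ Γ S p X₁ X₂) :
    ∃ U x₁ O₁ κ₁ x₂ O₂ κ₂, IsCleaveNhd φ Γ S U x₁ O₁ κ₁ x₂ O₂ κ₂ ∧ p ∈ U ∧
      rayMap φ Γ x₁ (κ₁ p) = ⟨p, X₁⟩ ∧ rayMap φ Γ x₂ (κ₂ p) = ⟨p, X₂⟩ := by
  obtain ⟨hpS, hne, hlim, hn₁, hn₂⟩ := h
  have hS : IsClosed S := by rw [hsp.2]; exact isClosed_closure
  have hmem : ∀ X : TangentSpace (𝓡∂ (d + 1)) p, (⟨p, X⟩ : TangentBundle (𝓡∂ (d + 1)) M) ∈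
      closure (raysOff φ Γ S) ↔ X = X₁ ∨ X = X₂ := fun X ↦ by
    rw [← mem_limitSet_iff hpS, hlim]; rfl
  obtain ⟨x₁, O₁, V₁, κ₁, hF₁, hpV₁, hκ₁, hev₁⟩ := exists_isLocalField_of_isNonfocal hsp.1 hΓ hS hSi
    hn₁ ((hmem X₁).2 (Or.inl rfl)) (hSi hpS)
  obtain ⟨x₂, O₂, V₂, κ₂, hF₂, hpV₂, hκ₂, hev₂⟩ := exists_isLocalField_of_isNonfocal hsp.1 hΓ hS hSi
    hn₂ ((hmem X₂).2 (Or.inr rfl)) (hSi hpS)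
  obtain ⟨N₁, hN₁, hN₁o, hpN₁⟩ := eventually_nhds_iff.1 hev₁
  obtain ⟨N₂, hN₂, hN₂o, hpN₂⟩ := eventually_nhds_iff.1 hev₂
  have hcl := eventually_closure_subset (S := S) hcompact hΓ (p := p) (hN₁o.union hN₂o) (by
    rintro ⟨q, X⟩ hy hq
    change q = p at hq
    subst hq
    rcases (hmem X).1 hy with rfl | rfl
    · exact Or.inl hpN₁
    · exact Or.inr hpN₂)
  have hc₁ := (hF₁.contMDiffOn_rayMap.continuousOn).continuousAt (hF₁.isOpen.mem_nhds hpV₁)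
  have hc₂ := (hF₂.contMDiffOn_rayMap.continuousOn).continuousAt (hF₂.isOpen.mem_nhds hpV₂)
  have hnev : ∀ᶠ q in 𝓝 p, rayMap φ Γ x₁ (κ₁ q) ≠ rayMap φ Γ x₂ (κ₂ q) := by
    have h1 : (rayMap φ Γ x₁ (κ₁ p), rayMap φ Γ x₂ (κ₂ p)) ∈
        (diagonal (TangentBundle (𝓡∂ (d + 1)) M))ᶜ := by
      rw [mem_compl_iff, mem_diagonal_iff]
      simp only
      rw [hκ₁, hκ₂]
      exact fun h ↦ hne (tangentBundle_ext_snd h)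
    exact (hc₁.prodMk hc₂).eventually (isClosed_diagonal.isOpen_compl.mem_nhds h1)
  obtain ⟨U, hU, hUo, hpU⟩ := eventually_nhds_iff.1
    (((hcl.and hnev).and (hF₁.isOpen.mem_nhds hpV₁)).and (hF₂.isOpen.mem_nhds hpV₂))
  have hcases : ∀ y ∈ closure (raysOff φ Γ S), y.proj ∈ U →
      y = rayMap φ Γ x₁ (κ₁ y.proj) ∨ y = rayMap φ Γ x₂ (κ₂ y.proj) := by
    intro y hy hyU
    rcases (hU _ hyU).1.1.1 y hy rfl with h | h
    · exact Or.inl (hN₁ y h hy).symm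
    · exact Or.inr (hN₂ y h hy).symm
  have hF₁' := hF₁.mono hUo fun q hq ↦ (hU q hq).1.2
  have hF₂' := hF₂.mono hUo fun q hq ↦ (hU q hq).2
  -- the points with two limit vectors are dense in `S`, and at them both fields are limits
  have hboth : ∀ q ∈ S ∩ U, rayMap φ Γ x₁ (κ₁ q) ∈ closure (raysOff φ Γ S) ∧
      rayMap φ Γ x₂ (κ₂ q) ∈ closure (raysOff φ Γ S) := by
    rintro q ⟨hqS, hqU⟩
    rw [hsp.2] at hqS
    have hfr : ∃ᶠ q' in 𝓝 q, q' ∈ U ∧ (rayMap φ Γ x₁ (κ₁ q') ∈ closure (raysOff φ Γ S) ∧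
      rayMap φ Γ x₂ (κ₂ q') ∈ closure (raysOff φ Γ S)) := by
      refine ((mem_closure_iff_frequently.1 hqS).and_eventually (hUo.mem_nhds hqU)).mono ?_
      rintro q' ⟨⟨hq'S, Y, hY, Z, hZ, hYZ⟩, hq'U⟩
      refine ⟨hq'U, ?_⟩
      have hY' := (mem_limitSet_iff hq'S).1 hY
      have hZ' := (mem_limitSet_iff hq'S).1 hZ
      rcases hcases _ hY' hq'U with h1 | h1 <;> rcases hcases _ hZ' hq'U with h2 | h2
      · exact absurd (tangentBundle_ext_snd (h1.trans h2.symm)) hYZ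
      · exact ⟨h1 ▸ hY', h2 ▸ hZ'⟩
      · exact ⟨h2 ▸ hZ', h1 ▸ hY'⟩
      · exact absurd (tangentBundle_ext_snd (h1.trans h2.symm)) hYZ
    have hcont : ContinuousAt (fun q ↦ (rayMap φ Γ x₁ (κ₁ q), rayMap φ Γ x₂ (κ₂ q))) q :=
      ((hF₁'.contMDiffOn_rayMap.continuousOn).continuousAt (hUo.mem_nhds hqU)).prodMk
        ((hF₂'.contMDiffOn_rayMap.continuousOn).continuousAt (hUo.mem_nhds hqU))
    have := (isClosed_closure (s := raysOff φ Γ S)).prod (isClosed_closure (s := raysOff φ Γ S))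
      |>.mem_of_frequently_of_tendsto (hfr.mono fun q' hq' ↦ hq'.2) hcont
    exact this
  exact ⟨U, x₁, _, κ₁, x₂, _, κ₂, ⟨hF₁', hF₂', fun q hq ↦ (hU q hq).1.1.2, hcases,
    fun q hq ↦ (hboth q hq).1, fun q hq ↦ (hboth q hq).2⟩, hpU, hκ₁, hκ₂⟩

namespace IsCleaveNhd

variable {U : Set M} {x₁ x₂ : M} {O₁ O₂ : Set (BVec d × ℝ)} {κ₁ κ₂ : M → BVec d × ℝ}

lemma tmk_vel (h : IsCleaveNhd φ Γ S U x₁ O₁ κ₁ x₂ O₂ κ₂) {q : M} (hq : q ∈ U) :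
    tmk q (vel (rayMap φ Γ x₁ (κ₁ q))) = rayMap φ Γ x₁ (κ₁ q) :=
  tmk_vel_of_proj (h.left.right_inv q hq)

/-- All points of `S` near a cleave point are cleave points. -/
lemma isCleavePair [T2Space M] (h : IsCleaveNhd φ Γ S U x₁ O₁ κ₁ x₂ O₂ κ₂) {q : M}
    (hq : q ∈ S ∩ U) :
    IsCleavePair φ Γ S q (vel (rayMap φ Γ x₁ (κ₁ q))) (vel (rayMap φ Γ x₂ (κ₂ q))) := by
  have e1 : (⟨q, vel (rayMap φ Γ x₁ (κ₁ q))⟩ : TangentBundle (𝓡∂ (d + 1)) M) = _ := h.tmk_vel hq.2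
  have e2 : (⟨q, vel (rayMap φ Γ x₂ (κ₂ q))⟩ : TangentBundle (𝓡∂ (d + 1)) M) = _ :=
    h.symm.tmk_vel hq.2
  refine ⟨hq.1, fun heq ↦ h.ne q hq.2 ?_, ?_, ?_, ?_⟩
  · rw [← e1, ← e2]; exact congrArg (tmk q) heq
  · ext X
    rw [mem_limitSet_iff hq.1]
    constructor
    · intro hX
      rcases h.eq_or_eq _ hX hq.2 with h1 | h1
      · exact Or.inl (tangentBundle_ext_snd (h1.trans e1.symm))
      · exact Or.inr (tangentBundle_ext_snd (h1.trans e2.symm))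
    · rintro (rfl | rfl)
      · rw [e1]; exact h.left_mem q hq
      · rw [e2]; exact h.right_mem q hq
  · rw [e1]; exact h.left.isNonfocal (h.left.inv_mem q hq.2)
  · rw [e2]; exact h.right.isNonfocal (h.right.inv_mem q hq.2)

/-- Off `S`, one of the two fields is the field of vectors of `A(S)`. -/
lemma notMem_iff [T2Space M] (h : IsCleaveNhd φ Γ S U x₁ O₁ κ₁ x₂ O₂ κ₂) (hsp : Splits φ Γ S)
    {q : M}
    (hq : q ∈ U) : q ∉ S ↔ rayMap φ Γ x₁ (κ₁ q) ∈ raysOff φ Γ S ∨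
      rayMap φ Γ x₂ (κ₂ q) ∈ raysOff φ Γ S := by
  constructor
  · intro hqS
    obtain ⟨y, hy, hyq⟩ := hsp.surjOn hqS
    simp only at hyq
    subst hyq
    rcases h.eq_or_eq y (subset_closure hy) hq with h1 | h1
    · exact Or.inl (h1 ▸ hy)
    · exact Or.inr (h1 ▸ hy)
  · rintro (h1 | h1)
    · have : (rayMap φ Γ x₁ (κ₁ q)).proj ∈ Sᶜ := hsp.mapsTo h1
      rwa [h.left.right_inv q hq] at this
    · have : (rayMap φ Γ x₂ (κ₂ q)).proj ∈ Sᶜ := hsp.mapsTo h1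
      rwa [h.right.right_inv q hq] at this

lemma not_both (h : IsCleaveNhd φ Γ S U x₁ O₁ κ₁ x₂ O₂ κ₂) (hsp : Splits φ Γ S) {q : M}
    (hq : q ∈ U) (h1 : rayMap φ Γ x₁ (κ₁ q) ∈ raysOff φ Γ S)
    (h2 : rayMap φ Γ x₂ (κ₂ q) ∈ raysOff φ Γ S) : False :=
  h.ne q hq (hsp.eq_of_proj_eq h1 h2 ((h.left.right_inv q hq).trans (h.right.right_inv q hq).symm))

end IsCleaveNhd

end CleaveNeighborhood

section Convexity

variable {E : Type*} [NormedAddCommGroup E] [NormedSpace ℝ E]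

/-! ### Convexity of the Lagrangian and the fundamental inequality -/

namespace LocalLagrangian

variable {H D : Set E} {L : E → E → ℝ} (hL : LocalLagrangian H D L)
include hL

lemma apply_zero {x : E} (hx : x ∈ D) : L x 0 = 0 := by
  simpa using hL.homog x hx 0 le_rfl 0

lemma nonneg {x : E} (hx : x ∈ D) (v : E) : 0 ≤ L x v := by
  by_cases hv : v = 0
  · rw [hv, hL.apply_zero hx]
  · exact (hL.pos x hx v hv).le

/-- On a segment that avoids the origin, the Lagrangian is strictly convex. -/
lemma convex_segment {x v u : E} (hx : x ∈ D) (h0 : ∀ t ∈ Icc (0 : ℝ) 1, v + t • (u - v) ≠ 0)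
    (hne : u ≠ v) : momentum L (x, v) (u - v) < momentum L (x, u) (u - v) ∧
      L x v + momentum L (x, v) (u - v) < L x u := by
  set γ : ℝ → E := fun t ↦ v + t • (u - v) with hγ
  have hγd : ∀ t, HasDerivAt γ (u - v) t := fun t ↦ by
    simpa [hγ] using ((hasDerivAt_id t).smul_const (u - v)).const_add v
  have h1 : ∀ t ∈ Icc (0 : ℝ) 1, HasDerivAt (fun t ↦ L x (γ t)) (momentum L (x, γ t) (u - v)) t :=
    fun t ht ↦ (hL.hasFDerivAt_momentum hx (h0 t ht)).comp_hasDerivAt t (hγd t)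
  have h2 : ∀ t ∈ Icc (0 : ℝ) 1, HasDerivAt (fun t ↦ momentum L (x, γ t) (u - v))
      (fderiv ℝ (fderiv ℝ (L x)) (γ t) (u - v) (u - v)) t := fun t ht ↦ by
    have h3 : HasFDerivAt (fderiv ℝ (L x)) (fderiv ℝ (fderiv ℝ (L x)) (γ t)) (γ t) :=
      (hL.hasFDerivAt_hessian (z := (x, γ t)) ⟨hx, h0 t ht⟩).differentiableAt.hasFDerivAt
    simpa [momentum] using (h3.comp_hasDerivAt t (hγd t)).clm_apply (hasDerivAt_const t (u - v))
  have hγ0 : γ 0 = v := by simp [hγ]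
  have hγ1 : γ 1 = u := by simp [hγ]
  have hmono : StrictMonoOn (fun t ↦ momentum L (x, γ t) (u - v)) (Icc 0 1) := by
    refine strictMonoOn_of_deriv_pos (convex_Icc 0 1)
      (fun t ht ↦ (h2 t ht).continuousAt.continuousWithinAt) fun t ht ↦ ?_
    have ht' : t ∈ Icc (0 : ℝ) 1 := interior_subset ht
    rw [(h2 t ht').deriv]
    exact hL.convex x hx _ (h0 t ht') _ (sub_ne_zero.2 hne)
  have hlt : momentum L (x, v) (u - v) < momentum L (x, u) (u - v) := by
    have := hmono (left_mem_Icc.2 zero_le_one) (right_mem_Icc.2 zero_le_one) one_pos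
    simpa only [hγ0, hγ1] using this
  refine ⟨hlt, ?_⟩
  obtain ⟨c, hc, hceq⟩ := exists_hasDerivAt_eq_slope (fun t ↦ L x (γ t))
    (fun t ↦ momentum L (x, γ t) (u - v)) one_pos
    (fun t ht ↦ (h1 t ht).continuousAt.continuousWithinAt)
    (fun t ht ↦ h1 t (Ioo_subset_Icc_self ht))
  have := hmono (left_mem_Icc.2 zero_le_one) (Ioo_subset_Icc_self hc) hc.1
  simp only [hγ0, hγ1, sub_zero, div_one] at this hceq
  linarith

/-- If the segment from `v` to `u` meets the origin, then `u` and `v` point in opposite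
directions. -/
lemma momentum_of_segment {x v u : E} (hx : x ∈ D) (hv : v ≠ 0) {t : ℝ} (ht : t ∈ Icc (0 : ℝ) 1)
    (h0 : v + t • (u - v) = 0) : momentum L (x, v) u ≤ 0 := by
  have h1 : t • u = -((1 - t) • v) := by
    rw [eq_neg_iff_add_eq_zero, ← h0]; module
  have h2 := congrArg (momentum L (x, v)) h1
  rw [map_smul, map_neg, map_smul, hL.momentum_self hx hv, smul_eq_mul, smul_eq_mul] at h2
  have hpos := hL.pos x hx v hv
  have ht0 : 0 < t := by
    refine lt_of_le_of_ne ht.1 fun h ↦ ?_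
    rw [← h] at h0
    simp at h0
    exact hv h0
  have : t * momentum L (x, v) u ≤ 0 := by
    rw [h2]; nlinarith [ht.2]
  exact nonpos_of_mul_nonpos_right this ht0

/-- The Lagrangian lies above its tangent hyperplanes. -/
lemma lt_of_ne {x v u : E} (hx : x ∈ D) (hv : v ≠ 0) (hne : u ≠ v) :
    momentum L (x, v) u < L x u + L x v := by
  have hself := hL.momentum_self hx hv
  by_cases h : ∀ t ∈ Icc (0 : ℝ) 1, v + t • (u - v) ≠ 0
  · have := (hL.convex_segment hx h hne).2
    rw [map_sub, hself] at this
    linarith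
  · push Not at h
    obtain ⟨t, ht, h0⟩ := h
    have := hL.momentum_of_segment hx hv ht h0
    linarith [hL.pos x hx v hv, hL.nonneg hx u]

lemma momentum_le {x v : E} (hx : x ∈ D) (hv : v ≠ 0) (u : E) :
    momentum L (x, v) u ≤ L x u + L x v := by
  by_cases hne : u = v
  · rw [hne, hL.momentum_self hx hv]; linarith
  · exact (hL.lt_of_ne hx hv hne).le

/-- The momentum is a strictly monotone function of the velocity. -/
lemma momentum_sub_pos {x v u : E} (hx : x ∈ D) (hv : v ≠ 0) (hu : u ≠ 0) (hne : u ≠ v) :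
    0 < (momentum L (x, u) - momentum L (x, v)) (u - v) := by
  have h1 := hL.lt_of_ne hx hv hne
  have h2 := hL.lt_of_ne hx hu hne.symm
  have h3 := hL.momentum_self hx hv
  have h4 := hL.momentum_self hx hu
  simp only [_root_.sub_apply, map_sub]
  linarith

/-- The fundamental inequality of Finsler geometry. -/
lemma momentum_le_sqrt {x v : E} (hx : x ∈ D) (hv : v ≠ 0) (u : E) :
    momentum L (x, v) u ≤ √(2 * L x v) * √(2 * L x u) := by
  have hself := hL.momentum_self hx hv
  have hLv := hL.pos x hx v hv
  by_cases hu : u = 0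
  · rw [hu, map_zero]; positivity
  have hLu := hL.pos x hx u hu
  set a := √(2 * L x v) with ha
  set b := √(2 * L x u) with hb
  have ha0 : 0 < a := Real.sqrt_pos.2 (by linarith)
  have hb0 : 0 < b := Real.sqrt_pos.2 (by linarith)
  have ha2 : a ^ 2 = 2 * L x v := Real.sq_sqrt (by linarith)
  have hb2 : b ^ 2 = 2 * L x u := Real.sq_sqrt (by linarith)
  have h := hL.momentum_le hx hv ((a / b) • u)
  rw [map_smul, hL.homog x hx _ (by positivity), smul_eq_mul] at h
  have e1 : (a / b) ^ 2 * L x u = a ^ 2 / 2 := by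
    rw [show L x u = b ^ 2 / 2 by linarith]; field_simp
  rw [e1, show L x v = a ^ 2 / 2 by linarith, div_mul_eq_mul_div, div_le_iff₀ hb0] at h
  nlinarith

end LocalLagrangian

end Convexity

section DualForm

/-! ### The dual one form in a chart -/

set_option linter.unusedSectionVars false

variable {d : ℕ} {M : Type*} [TopologicalSpace M] [ChartedSpace (EuclideanHalfSpace (d + 1)) M]
  [IsManifold (𝓡∂ (d + 1)) ∞ M]

/-- In every chart, the dual one form is the momentum. -/
lemma dual_eq_momentum (φ : FinslerMetric d M) {a q : M}
    (hq : q ∈ (extChartAt (𝓡∂ (d + 1)) a).source)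
    {V : Vec d} (hV : V ≠ 0) (v : Vec d) :
    φ.dual (a := q) V (coordEquiv hq v) =
      momentum (chartLag φ a) (tChart a (tmk q V)) v := by
  have hxt := (extChartAt (𝓡∂ (d + 1)) a).map_source hq
  set x := extChartAt (𝓡∂ (d + 1)) a q with hx
  have hqx : (extChartAt (𝓡∂ (d + 1)) a).symm x = q := (extChartAt (𝓡∂ (d + 1)) a).left_inv hq
  have e1 : ∀ u, chartLag φ a x u = φ.toFun (tmk q (coordEquiv hq u)) ^ 2 / 2 := by
    intro u
    rw [chartLag_eq, tChart_symm_eq hq u]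
  have e0 : tChart a (tmk q V) = (x, (coordEquiv hq).symm V) := tChart_eq hq V
  set W := (coordEquiv hq).symm V with hW
  have hWV : coordEquiv hq W = V := (coordEquiv hq).apply_symm_apply V
  have hW0 : W ≠ 0 := by
    rw [hW]; simpa using hV
  set f : Vec d → ℝ := fun u ↦ φ.toFun (tmk q u) with hf
  have hfd : DifferentiableAt ℝ f V := by
    have h1 : DifferentiableAt ℝ (fun u ↦ φ.toFun ((tChart a).symm (x, u))) W := by
      have h2 : ContDiffWithinAt ℝ ∞ _ _ (x, W) := contDiffOn_toFun_tChart_symm φ a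
          (x, W) ⟨hxt, hW0⟩
      have h3 := h2.comp (s := {0}ᶜ) (f := fun u : Vec d ↦ (x, u)) W
        (contDiff_const.prodMk contDiff_id).contDiffWithinAt (fun u hu ↦ ⟨hxt, hu⟩)
      exact (h3.contDiffAt (isOpen_compl_singleton.mem_nhds hW0)).differentiableAt (by simp)
    have h4 : f = (fun u ↦ φ.toFun ((tChart a).symm (x, u))) ∘ (coordEquiv hq).symm := by
      ext u
      simp only [Function.comp_apply]
      rw [tChart_symm_eq hq]
      simp [hf]
    rw [h4]
    exact h1.comp V (coordEquiv hq).symm.differentiableAt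
  have h5 : HasFDerivAt (fun u ↦ f (coordEquiv hq u) ^ 2 / 2)
      (f V • (fderiv ℝ f V).comp (coordEquiv hq : Vec d →L[ℝ] Vec d)) W := by
    have h6 : HasFDerivAt f (fderiv ℝ f V) (coordEquiv hq W) := by rw [hWV]; exact hfd.hasFDerivAt
    have h7 : HasFDerivAt (fun u ↦ f (coordEquiv hq u)) _ W := h6.comp W (coordEquiv hq).hasFDerivAt
    have h8 := (h7.pow 2).mul_const (1 / 2 : ℝ)
    refine (h8.congr_fderiv ?_).congr_of_eventuallyEq (Eventually.of_forall fun u ↦ by simp; ring)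
    ext u
    simp [hWV]
    ring
  rw [e0, momentum]
  simp only
  have h9 : chartLag φ a x = fun u ↦ f (coordEquiv hq u) ^ 2 / 2 := funext e1
  rw [h9, h5.fderiv]
  rfl

variable (φ : FinslerMetric d M) {q : M} {V W : Vec d}

lemma dual_eq_momentum_self (hV : V ≠ 0) (v : Vec d) :
    φ.dual (a := q) V v = momentum (chartLag φ q) (extChartAt (𝓡∂ (d + 1)) q q, V) v := by
  have hq := mem_extChartAt_source (I := 𝓡∂ (d + 1)) q
  have h1 := dual_eq_momentum φ hq (V := V) hV v
  have h3 := tChart_self q V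
  have h2 : coordEquiv hq v = v := by
    rw [coordEquiv_apply]
    exact tangentCoordChange_self (mem_extChartAt_source q)
  rw [h2, h3] at h1
  exact h1

lemma chartLag_self (v : Vec d) :
    chartLag φ q (extChartAt (𝓡∂ (d + 1)) q q) v = φ.toFun (tmk q v) ^ 2 / 2 := by
  have h := chartLag_tChart φ (a := q) (y := tmk q v)
    (mem_tChart_source.2 (mem_extChartAt_source q))
  rwa [tChart_self] at h

lemma dual_self (hV : V ≠ 0) : φ.dual (a := q) V V = φ.toFun (tmk q V) ^ 2 := by
  rw [dual_eq_momentum_self φ hV, (localLagrangian φ q).momentum_self (mem_extChartAt_target q) hV,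
    chartLag_self]
  ring

/-- Strict monotonicity of the Legendre transform. It shows that the difference of the duals of two
vectors cannot vanish at both vectors. -/
lemma dual_sub_pos (hV : V ≠ 0) (hW : W ≠ 0) (hne : V ≠ W) :
    0 < (φ.dual (a := q) V - φ.dual (a := q) W) V - (φ.dual (a := q) V - φ.dual (a := q) W) W := by
  have h := (localLagrangian φ q).momentum_sub_pos (mem_extChartAt_target q) hW hV hne
  have e : (φ.dual (a := q) V - φ.dual (a := q) W) V - (φ.dual (a := q) V - φ.dual (a := q) W) W =
      (φ.dual (a := q) V V - φ.dual (a := q) W V) - (φ.dual (a := q) V W - φ.dual (a := q) W W) :=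
          rfl
  rw [e, dual_eq_momentum_self φ hV, dual_eq_momentum_self φ hV, dual_eq_momentum_self φ hW,
    dual_eq_momentum_self φ hW]
  rw [_root_.sub_apply, map_sub, map_sub] at h
  linarith

lemma dual_ne (hV : V ≠ 0) (hW : W ≠ 0) (hne : V ≠ W) :
    φ.dual (a := q) V ≠ φ.dual (a := q) W := by
  intro h
  have := dual_sub_pos φ (q := q) hV hW hne
  rw [h, sub_self] at this
  exact lt_irrefl _ (this.trans_eq (sub_self (0 : ℝ)))

/-- For vectors of the same norm, the fundamental inequality is strict. -/
lemma dual_sub_self_pos (hV : V ≠ 0) (hW : W ≠ 0) (hne : V ≠ W)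
    (heq : φ.toFun (tmk q V) = φ.toFun (tmk q W)) :
    0 < (φ.dual (a := q) V - φ.dual (a := q) W) V := by
  have h1 := (localLagrangian φ q).lt_of_ne (mem_extChartAt_target q) hW hne
  rw [chartLag_self, chartLag_self, ← heq] at h1
  have e : (φ.dual (a := q) V - φ.dual (a := q) W) V =
      φ.dual (a := q) V V - φ.dual (a := q) W V := rfl
  rw [e, dual_self φ hV, dual_eq_momentum_self φ hW]
  linarith

end DualForm

section CompactFlow

variable {E : Type*} [NormedAddCommGroup E] [NormedSpace ℝ E]

/-! ### The backward exponential map -/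

/-- A smooth vector field has a smooth local flow around every compact set. -/
lemma exists_smooth_flow_of_isCompact [CompleteSpace E] {f : E → E} {Ω : Set E} (hΩ : IsOpen Ω)
    (hf : ContDiffOn ℝ ∞ f Ω) {K : Set E} (hK : IsCompact K) (hKΩ : K ⊆ Ω) :
    ∃ δ > 0, ∃ N : Set E, IsOpen N ∧ K ⊆ N ∧ ∃ Φ : E → ℝ → E,
      (∀ x ∈ N, Φ x 0 = x ∧ ∀ t ∈ Ioo (-δ) δ, Φ x t ∈ Ω ∧ HasDerivAt (Φ x) (f (Φ x t)) t) ∧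
      ContDiffOn ℝ ∞ (Function.uncurry Φ) (N ×ˢ Ioo (-δ) δ) := by
  refine hK.induction_on (p := fun K ↦ ∃ δ > 0, ∃ N : Set E, IsOpen N ∧ K ⊆ N ∧ ∃ Φ : E → ℝ → E,
      (∀ x ∈ N, Φ x 0 = x ∧ ∀ t ∈ Ioo (-δ) δ, Φ x t ∈ Ω ∧ HasDerivAt (Φ x) (f (Φ x t)) t) ∧
      ContDiffOn ℝ ∞ (Function.uncurry Φ) (N ×ˢ Ioo (-δ) δ))
    ⟨1, one_pos, ∅, isOpen_empty, empty_subset _, fun x _ ↦ x, by simp, by simp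
        [contDiffOn_empty]⟩ ?_ ?_ ?_
  · rintro s t hst ⟨δ, hδ, N, hN, htN, h⟩
    exact ⟨δ, hδ, N, hN, hst.trans htN, h⟩
  · rintro s t ⟨δ₁, hδ₁, N₁, hN₁, hs, Φ₁, hΦ₁, hc₁⟩ ⟨δ₂, hδ₂, N₂, hN₂, ht, Φ₂, hΦ₂, hc₂⟩
    classical
    set δ := min δ₁ δ₂ with hδ
    have hδ0 : 0 < δ := lt_min hδ₁ hδ₂
    have hs₁ : Ioo (-δ) δ ⊆ Ioo (-δ₁) δ₁ :=
      Ioo_subset_Ioo (neg_le_neg (min_le_left _ _)) (min_le_left _ _)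
    have hs₂ : Ioo (-δ) δ ⊆ Ioo (-δ₂) δ₂ :=
      Ioo_subset_Ioo (neg_le_neg (min_le_right _ _)) (min_le_right _ _)
    set Φ : E → ℝ → E := fun x ↦ if x ∈ N₁ then Φ₁ x else Φ₂ x with hΦ
    have e₁ : ∀ x ∈ N₁, Φ x = Φ₁ x := fun x hx ↦ if_pos hx
    -- Where both local flows are defined, they agree by uniqueness of solutions.
    have e₂ : ∀ x ∈ N₂, EqOn (Φ x) (Φ₂ x) (Ioo (-δ) δ) := by
      intro x hx
      by_cases hx₁ : x ∈ N₁
      · rw [e₁ x hx₁]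
        refine eqOn_of_locally_lipschitz (locally_lipschitz_of_contDiffOn hΩ hf) ordConnected_Ioo
          (fun t ht ↦ ⟨((hΦ₁ x hx₁).2 t (hs₁ ht)).1, ((hΦ₁ x hx₁).2 t (hs₁ ht)).2.hasDerivWithinAt⟩)
          (fun t ht ↦ ⟨((hΦ₂ x hx).2 t (hs₂ ht)).1, ((hΦ₂ x hx).2 t (hs₂ ht)).2.hasDerivWithinAt⟩)
          (t₀ := 0) ⟨by linarith, hδ0⟩ ?_
        rw [(hΦ₁ x hx₁).1, (hΦ₂ x hx).1]
      · intro t _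
        simp [hΦ, hx₁]
    refine ⟨δ, hδ0, N₁ ∪ N₂, hN₁.union hN₂, union_subset_union hs ht, Φ, ?_, ?_⟩
    · intro x hx
      by_cases hx₁ : x ∈ N₁
      · rw [e₁ x hx₁]
        exact ⟨(hΦ₁ x hx₁).1, fun t ht ↦ (hΦ₁ x hx₁).2 t (hs₁ ht)⟩
      · have hx₂ := hx.resolve_left hx₁
        have : Φ x = Φ₂ x := if_neg hx₁
        rw [this]
        exact ⟨(hΦ₂ x hx₂).1, fun t ht ↦ (hΦ₂ x hx₂).2 t (hs₂ ht)⟩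
    · rintro ⟨x, t⟩ ⟨hx, ht⟩
      refine ContDiffAt.contDiffWithinAt ?_
      rcases hx with hx | hx
      · refine (hc₁.contDiffAt ((hN₁.prod isOpen_Ioo).mem_nhds ⟨hx,
          hs₁ ht⟩)).congr_of_eventuallyEq ?_
        filter_upwards [(hN₁.prod (isOpen_Ioo (a := -δ) (b := δ))).mem_nhds ⟨hx, ht⟩] with z hz
        simp only [Function.uncurry, e₁ _ hz.1]
      · refine (hc₂.contDiffAt ((hN₂.prod isOpen_Ioo).mem_nhds ⟨hx,
          hs₂ ht⟩)).congr_of_eventuallyEq ?_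
        filter_upwards [(hN₂.prod (isOpen_Ioo (a := -δ) (b := δ))).mem_nhds ⟨hx, ht⟩] with z hz
        exact e₂ _ hz.1 hz.2
  · intro x hx
    obtain ⟨δ, hδ, N, hN, hxN, Φ, h⟩ := exists_smooth_flow hΩ hf (hKΩ hx)
    exact ⟨N, mem_nhdsWithin_of_mem_nhds (hN.mem_nhds hxN), δ, hδ, N, hN, Subset.rfl, Φ, h⟩

end CompactFlow

section Exponential

set_option linter.unusedSectionVars false

variable {E : Type*} [NormedAddCommGroup E] [NormedSpace ℝ E] [FiniteDimensional ℝ E]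

namespace LocalLagrangian

variable {H D : Set E} {L : E → E → ℝ} (hL : LocalLagrangian H D L)
include hL

/-- The geodesic acceleration is `2`-homogeneous in the velocity. -/
lemma geodAccel_smul {x : E} (hx : x ∈ D) {c : ℝ} (hc : 0 < c) {v : E} (hv : v ≠ 0) :
    geodAccel H D L (x, c • v) = c ^ 2 • geodAccel H D L (x, v) := by
  have hcv : c • v ≠ 0 := smul_ne_zero hc.ne' hv
  have h1 := hL.hasFDerivWithinAt_momentum (z := (x, c • v)) ⟨hx, hcv⟩
  have h2 := hL.hasFDerivWithinAt_momentum (z := (x, v)) ⟨hx, hv⟩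
  set A : E × E →L[ℝ] E × E :=
    (ContinuousLinearMap.fst ℝ E E).prod (c • ContinuousLinearMap.snd ℝ E E) with hA
  have hAx : A (x, v) = (x, c • v) := by simp [hA]
  have h3 : HasFDerivWithinAt (fun z ↦ momentum L (A z))
      ((fderivWithin ℝ (momentum L) (D ×ˢ {0}ᶜ) (x, c • v)).comp A) (D ×ˢ {0}ᶜ) (x, v) := by
    rw [← hAx] at h1
    have := HasFDerivWithinAt.comp (x, v) h1 A.hasFDerivAt.hasFDerivWithinAt
      (s := D ×ˢ ({0}ᶜ : Set E)) (fun z hz ↦ ⟨hz.1, smul_ne_zero hc.ne' hz.2⟩)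
    rwa [hAx] at this
  have h4 : HasFDerivWithinAt (fun z ↦ momentum L (A z))
      (c • fderivWithin ℝ (momentum L) (D ×ˢ {0}ᶜ) (x, v)) (D ×ˢ {0}ᶜ) (x, v) :=
    (h2.const_smul c).congr (fun z hz ↦ hL.momentum_smul hz.1 hc hz.2)
      (hL.momentum_smul hx hc hv)
  have h5 := (hL.uniqueDiffOn_prod (x, v) ⟨hx, hv⟩).eq h3 h4
  have h6 : fderivWithin ℝ (momentum L) (D ×ˢ {0}ᶜ) (x, c • v) (c • v, 0) =
      c ^ 2 • fderivWithin ℝ (momentum L) (D ×ˢ {0}ᶜ) (x, v) (v, 0) := by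
    have h7 := congrArg (fun B : E × E →L[ℝ] (E →L[ℝ] ℝ) ↦ c • B (v, 0)) h5
    simp only [ContinuousLinearMap.comp_apply, _root_.smul_apply] at h7
    have h8 : A (v, 0) = (v, 0) := by simp [hA]
    rw [h8, ← map_smul, Prod.smul_mk, smul_zero, smul_smul, ← pow_two] at h7
    exact h7
  rw [geodAccel, geodAccel]
  simp only
  rw [hL.hessian_smul hx hc hv, hL.force_smul hx hc hv, h6]
  exact (congrArg _ (smul_sub _ _ _).symm).trans (map_smul _ _ _)

/-- The vector field whose flow, by rescaling, is the geodesic flow near the zero section over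
`x₀`: the parameter `r` is the length of the initial velocity. -/
noncomputable def scaledField (_ : LocalLagrangian H D L) (x₀ : E) (z : E × E × ℝ) : E × E × ℝ :=
  (z.2.1, z.2.2 • geodAccel H D L (x₀ + z.2.2 • z.1, z.2.1), 0)

/-- The domain of `scaledField`. -/
def scaledDom (_ : LocalLagrangian H D L) (x₀ : E) : Set (E × E × ℝ) :=
  {z | x₀ + z.2.2 • z.1 ∈ interior D ∧ z.2.1 ≠ 0}

lemma isOpen_scaledDom (x₀ : E) : IsOpen (hL.scaledDom x₀) := by
  have h1 : Continuous fun z : E × E × ℝ ↦ x₀ + z.2.2 • z.1 := by fun_prop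
  have h2 : Continuous fun z : E × E × ℝ ↦ z.2.1 := by fun_prop
  exact (isOpen_interior.preimage h1).inter (isOpen_compl_singleton.preimage h2)

lemma contDiffOn_scaledField (x₀ : E) :
    ContDiffOn ℝ ∞ (hL.scaledField x₀) (hL.scaledDom x₀) := by
  have h1 : ContDiff ℝ ∞ fun z : E × E × ℝ ↦ (x₀ + z.2.2 • z.1, z.2.1) := by fun_prop
  have h2 : ContDiffOn ℝ ∞ (fun z : E × E × ℝ ↦ geodAccel H D L (x₀ + z.2.2 • z.1, z.2.1))
      (hL.scaledDom x₀) :=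
    hL.contDiffOn_geodAccel.comp h1.contDiffOn fun z hz ↦ ⟨interior_subset hz.1, hz.2⟩
  have h3 : ContDiff ℝ ∞ fun z : E × E × ℝ ↦ z.2.1 := by fun_prop
  have h4 : ContDiff ℝ ∞ fun z : E × E × ℝ ↦ z.2.2 := by fun_prop
  exact h3.contDiffOn.prodMk ((h4.contDiffOn.smul h2).prodMk contDiffOn_const)

/-- A solution of the scaled equation gives a geodesic. -/
lemma hasDerivAt_of_scaled {x₀ : E} {δ : ℝ} (hδ : 0 < δ) {Z : ℝ → E × E × ℝ}
    (hZ : ∀ t ∈ Ioo (-δ) δ, Z t ∈ hL.scaledDom x₀ ∧ HasDerivAt Z (hL.scaledField x₀ (Z t)) t)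
    {η : E} {r : ℝ} (hr : 0 < r) (hZ0 : Z 0 = (0, η, r)) {t : ℝ} (ht : t ∈ Ioo (-δ) δ) :
    (x₀ + r • (Z t).1, r • (Z t).2.1) ∈ interior D ×ˢ ({0}ᶜ : Set E) ∧
    HasDerivAt (fun t ↦ (x₀ + r • (Z t).1, r • (Z t).2.1)) (r • (Z t).2.1,
      geodAccel H D L (x₀ + r • (Z t).1, r • (Z t).2.1)) t := by
  have hd1 : ∀ t ∈ Ioo (-δ) δ, HasDerivAt (fun t ↦ (Z t).1) (hL.scaledField x₀ (Z t)).1 t :=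
      fun t ht ↦
    (ContinuousLinearMap.fst ℝ E (E × ℝ)).hasFDerivAt.comp_hasDerivAt t (hZ t ht).2
  have hd2 : ∀ t ∈ Ioo (-δ) δ, HasDerivAt (fun t ↦ (Z t).2.1) (hL.scaledField x₀ (Z t)).2.1 t :=
    fun t ht ↦ ((ContinuousLinearMap.fst ℝ E ℝ).comp
      (ContinuousLinearMap.snd ℝ E (E × ℝ))).hasFDerivAt.comp_hasDerivAt t (hZ t ht).2
  have hd3 : ∀ t ∈ Ioo (-δ) δ, HasDerivAt (fun t ↦ (Z t).2.2) 0 t :=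
    fun t ht ↦ ((ContinuousLinearMap.snd ℝ E ℝ).comp
      (ContinuousLinearMap.snd ℝ E (E × ℝ))).hasFDerivAt.comp_hasDerivAt t (hZ t ht).2
  have hconst : ∀ t ∈ Ioo (-δ) δ, (Z t).2.2 = r := by
    intro t ht
    have h := isOpen_Ioo.is_const_of_deriv_eq_zero isPreconnected_Ioo
      (fun t ht ↦ (hd3 t ht).differentiableAt.differentiableWithinAt) (fun t ht ↦ (hd3 t ht).deriv)
      ht (show (0 : ℝ) ∈ Ioo (-δ) δ from ⟨by linarith, hδ⟩)
    simpa [hZ0] using h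
  obtain ⟨hm, -⟩ := hZ t ht
  rw [scaledDom, mem_ofPred_eq, hconst t ht] at hm
  refine ⟨⟨hm.1, smul_ne_zero hr.ne' hm.2⟩, ?_⟩
  have e := hL.geodAccel_smul (interior_subset hm.1) hr hm.2
  have h1 := ((hd1 t ht).const_smul r).const_add x₀
  have h2 := (hd2 t ht).const_smul r
  refine (h1.prodMk h2).congr_deriv ?_
  rw [e, pow_two, mul_smul]
  simp only [scaledField, hconst t ht]

/-- The geodesics that pass through `x₀` at time `0`, on a uniform time interval and for all small
velocities: `Z v` is the geodesic with velocity `v` at `x₀`. The point reached at the negative time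
`-τ` is a local homeomorphism at `v = 0`, with derivative `-τ` there. -/
lemma exists_exponential {x₀ : E} (hx₀ : x₀ ∈ interior D) :
    ∃ τ > 0, ∃ δ > τ, ∃ ρ > 0, ∃ Z : E → ℝ → E × E,
      (∀ v ∈ Metric.ball (0 : E) ρ \ {0}, Z v 0 = (x₀, v) ∧ ∀ t ∈ Ioo (-δ) δ,
        Z v t ∈ interior D ×ˢ ({0}ᶜ : Set E) ∧
        HasDerivAt (Z v) ((Z v t).2, geodAccel H D L (Z v t)) t) ∧
      ContDiffOn ℝ ∞ (Function.uncurry Z) ((Metric.ball (0 : E) ρ \ {0}) ×ˢ Ioo (-δ) δ) ∧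
      (Z 0 (-τ)).1 = x₀ ∧
      (∃ E' : E → E →L[ℝ] E, (∀ᶠ v in 𝓝 0, HasFDerivAt (fun v ↦ (Z v (-τ)).1) (E' v) v) ∧
        ContinuousAt E' 0 ∧ E' 0 = (-τ) • ContinuousLinearMap.id ℝ E) ∧
      ∀ ε > 0, ∀ᶠ v in 𝓝 (0 : E), v ≠ 0 → ‖(Z v (-τ)).2 - v‖ ≤ ε * ‖v‖ := by
  classical
  have : CompleteSpace E := FiniteDimensional.complete ℝ E
  have : ProperSpace E := FiniteDimensional.proper_real E
  set K : Set (E × E × ℝ) := (fun η : E ↦ ((0 : E), η, (0 : ℝ))) '' Metric.sphere 0 1 with hK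
  have hKc : IsCompact K := (isCompact_sphere (0 : E) 1).image (by fun_prop)
  have hKΩ : K ⊆ hL.scaledDom x₀ := by
    rintro _ ⟨η, hη, rfl⟩
    refine ⟨by simpa using hx₀, fun h ↦ ?_⟩
    simp only at h
    simp [h] at hη
  obtain ⟨δ, hδ, N, hN, hKN, Φ, hΦ, hΦs⟩ := exists_smooth_flow_of_isCompact (hL.isOpen_scaledDom x₀)
    (hL.contDiffOn_scaledField x₀) hKc hKΩ
  set τ := δ / 2 with hτ
  have hτ0 : 0 < τ := by positivity
  have hτδ : τ < δ := by linarith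
  have hτm : -τ ∈ Ioo (-δ) δ := ⟨by linarith, by linarith⟩
  have h0m : (0 : ℝ) ∈ Ioo (-δ) δ := ⟨by linarith, hδ⟩
  -- the geodesic with initial velocity `r • η`
  set Y : ℝ → E → ℝ → E × E := fun r η t ↦
    (x₀ + r • (Φ (0, η, r) t).1, r • (Φ (0, η, r) t).2.1) with hY
  have hYode : ∀ r > 0, ∀ η, ((0 : E), η, r) ∈ N → Y r η 0 = (x₀, r • η) ∧ ∀ t ∈ Ioo (-δ) δ,
      Y r η t ∈ interior D ×ˢ ({0}ᶜ : Set E) ∧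
        HasDerivAt (Y r η) ((Y r η t).2, geodAccel H D L (Y r η t)) t := by
    intro r hr η hη
    obtain ⟨h0, hf⟩ := hΦ _ hη
    refine ⟨by simp [hY, h0], fun t ht ↦ hL.hasDerivAt_of_scaled hδ hf hr h0 ht⟩
  have hfield : ContDiffOn ℝ ∞ (fun z : E × E ↦ (z.2, geodAccel H D L z))
      (interior D ×ˢ ({0}ᶜ : Set E)) :=
    contDiffOn_snd.prodMk (hL.contDiffOn_geodAccel.mono (prod_mono interior_subset Subset.rfl))
  have hYeq : ∀ r > 0, ∀ r' > 0, ∀ η η', ((0 : E), η, r) ∈ N → ((0 : E), η', r') ∈ N →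
      r • η = r' • η' → EqOn (Y r η) (Y r' η') (Ioo (-δ) δ) := by
    intro r hr r' hr' η η' hη hη' heq
    obtain ⟨h0, hf⟩ := hYode r hr η hη
    obtain ⟨h0', hf'⟩ := hYode r' hr' η' hη'
    exact eqOn_of_locally_lipschitz (locally_lipschitz_of_contDiffOn
      (isOpen_interior.prod isOpen_compl_singleton) hfield) ordConnected_Ioo
      (fun t ht ↦ ⟨(hf t ht).1, (hf t ht).2.hasDerivWithinAt⟩)
      (fun t ht ↦ ⟨(hf' t ht).1, (hf' t ht).2.hasDerivWithinAt⟩) h0m (by rw [h0, h0', heq])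
  -- at `r = 0` the scaled flow is the flow of a free particle
  have hzero : ∀ η, ((0 : E), η, (0 : ℝ)) ∈ N → ∀ t ∈ Ioo (-δ) δ, Φ (0, η, 0) t = (t • η, η, 0) :=
      by
    intro η hη
    obtain ⟨h0, hf⟩ := hΦ _ hη
    have hη0 : η ≠ 0 := by
      have := (hf 0 h0m).1.2
      rwa [h0] at this
    refine eqOn_of_locally_lipschitz (locally_lipschitz_of_contDiffOn (hL.isOpen_scaledDom x₀)
      (hL.contDiffOn_scaledField x₀)) ordConnected_Ioo
      (fun t ht ↦ ⟨(hf t ht).1, (hf t ht).2.hasDerivWithinAt⟩)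
      (fun t ht ↦ ⟨⟨by simpa using hx₀, hη0⟩, ?_⟩) h0m (by rw [h0]; simp)
    have h1 : HasDerivAt (fun t : ℝ ↦ t • η) η t := by simpa using (hasDerivAt_id t).smul_const η
    have h2 : hL.scaledField x₀ (t • η, η, 0) = (η, 0, 0) := by simp [scaledField]
    rw [h2]
    exact (h1.prodMk ((hasDerivAt_const t η).prodMk (hasDerivAt_const t (0 : ℝ)))).hasDerivWithinAt
  set N' : Set (E × ℝ) := {w | ((0 : E), w.1, w.2) ∈ N} with hN'
  have hι : ContDiff ℝ ∞ fun w : E × ℝ ↦ (((0 : E), w.1, w.2), -τ) := by fun_prop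
  have hN'o : IsOpen N' := hN.preimage (by fun_prop : Continuous fun w : E × ℝ ↦
      ((0 : E), w.1, w.2))
  set G : E × ℝ → E × E × ℝ := fun w ↦ Φ (0, w.1, w.2) (-τ) with hG
  have hGs : ContDiffOn ℝ ∞ G N' :=
    hΦs.comp (f := fun w : E × ℝ ↦ (((0 : E), w.1, w.2), -τ)) hι.contDiffOn fun w hw ↦ ⟨hw, hτm⟩
  have hsph : ∀ η ∈ Metric.sphere (0 : E) 1, (η, (0 : ℝ)) ∈ N' := fun η hη ↦ hKN ⟨η, hη, rfl⟩
  -- statements about small velocities follow from statements near the unit sphere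
  have hsmall : ∀ P : E → ℝ → Prop, (∀ η ∈ Metric.sphere (0 : E) 1, ∀ᶠ w in 𝓝 (η, (0 : ℝ)),
      P w.1 w.2) →
      ∀ᶠ v in 𝓝 (0 : E), v ≠ 0 → P (‖v‖⁻¹ • v) ‖v‖ := by
    intro P hP
    have h1 := (isCompact_sphere (0 : E) 1).eventually_forall_of_forall_eventually (x₀ := (0 : ℝ))
      (P := fun r η ↦ P η r) (fun η hη ↦ by
        have hs : Tendsto (fun z : ℝ × E ↦ (z.2, z.1)) (𝓝 (0, η)) (𝓝 (η, 0)) :=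
          continuous_swap.tendsto (0, η)
        exact hs.eventually (hP η hη))
    have h2 : Tendsto (fun v : E ↦ ‖v‖) (𝓝 0) (𝓝 0) := by
      simpa using (continuous_norm.tendsto (0 : E))
    filter_upwards [h2.eventually h1] with v hv hv0
    exact hv _ (by simp [norm_smul, hv0])
  have hsplit : ∀ v : E, v ≠ 0 → ‖v‖ • ‖v‖⁻¹ • v = v := fun v hv ↦ by
    rw [smul_smul, mul_inv_cancel₀ (norm_ne_zero_iff.2 hv), one_smul]
  obtain ⟨ρ, hρ, hρN⟩ := Metric.eventually_nhds_iff_ball.1 (hsmall (fun η r ↦ (η, r) ∈ N')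
    fun η hη ↦ hN'o.mem_nhds (hsph η hη))
  set Z : E → ℝ → E × E := fun v ↦ if v = 0 then fun _ ↦ (x₀, 0) else Y ‖v‖ (‖v‖⁻¹ • v) with hZ
  have hZne : ∀ v ≠ 0, Z v = Y ‖v‖ (‖v‖⁻¹ • v) := fun v hv ↦ if_neg hv
  have hnear : ∀ v₀ ∈ Metric.ball (0 : E) ρ \ {0}, ∀ᶠ v in 𝓝 v₀, ∀ t ∈ Ioo (-δ) δ,
      Z v t = Y ‖v₀‖ (‖v₀‖⁻¹ • v) t := by
    rintro v₀ ⟨hv₀, hv₀0⟩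
    have hpos : 0 < ‖v₀‖ := norm_pos_iff.2 hv₀0
    have hc : ContinuousAt (fun v : E ↦ (‖v₀‖⁻¹ • v, ‖v₀‖)) v₀ := by fun_prop
    filter_upwards [Metric.isOpen_ball.mem_nhds hv₀, isOpen_compl_singleton.mem_nhds hv₀0,
      hc.preimage_mem_nhds (hN'o.mem_nhds (hρN v₀ hv₀ hv₀0))] with v hv hv0 hvN
    rw [hZne v hv0]
    refine hYeq _ (norm_pos_iff.2 hv0) _ hpos _ _ (hρN v hv hv0) hvN ?_
    rw [hsplit v hv0, smul_smul, mul_inv_cancel₀ hpos.ne', one_smul]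
  refine ⟨τ, hτ0, δ, hτδ, ρ, hρ, Z, ?_, ?_, by simp [hZ], ?_, ?_⟩
  · rintro v ⟨hv, hv0⟩
    rw [hZne v hv0]
    obtain ⟨h0, hf⟩ := hYode _ (norm_pos_iff.2 hv0) _ (hρN v hv hv0)
    rw [hsplit v hv0] at h0
    exact ⟨h0, hf⟩
  · rintro ⟨v₀, t₀⟩ ⟨hv₀, ht₀⟩
    refine ContDiffAt.contDiffWithinAt ?_
    have h1 : ContDiffAt ℝ ∞ (fun z : E × ℝ ↦ Y ‖v₀‖ (‖v₀‖⁻¹ • z.1) z.2) (v₀, t₀) := by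
      have h2 : ContDiffAt ℝ ∞ (fun z : E × ℝ ↦ Φ (0, ‖v₀‖⁻¹ • z.1, ‖v₀‖) z.2) (v₀, t₀) := by
        have h3 : ContDiffAt ℝ ∞ (Function.uncurry Φ) ((0, ‖v₀‖⁻¹ • v₀, ‖v₀‖), t₀) :=
          hΦs.contDiffAt ((hN.prod isOpen_Ioo).mem_nhds ⟨hρN v₀ hv₀.1 hv₀.2, ht₀⟩)
        have h4 : ContDiff ℝ ∞ (fun z : E × ℝ ↦ (((0 : E), ‖v₀‖⁻¹ • z.1, ‖v₀‖), z.2)) := by fun_prop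
        exact ContDiffAt.comp (g := Function.uncurry Φ)
          (f := fun z : E × ℝ ↦ (((0 : E), ‖v₀‖⁻¹ • z.1, ‖v₀‖), z.2)) (v₀, t₀) h3 h4.contDiffAt
      have h5 : ContDiff ℝ ∞ (fun z : E × E × ℝ ↦ (x₀ + ‖v₀‖ • z.1, ‖v₀‖ • z.2.1)) := by fun_prop
      exact h5.contDiffAt.comp (v₀, t₀) h2
    refine h1.congr_of_eventuallyEq ?_
    have h6 := (hnear v₀ hv₀).prod_inl_nhds t₀
    filter_upwards [h6, (isOpen_univ.prod (isOpen_Ioo (a := -δ) (b := δ))).mem_nhds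
      (show ((v₀, t₀) : E × ℝ) ∈ univ ×ˢ Ioo (-δ) δ from ⟨mem_univ _, ht₀⟩)] with z hz hz'
    exact hz z.2 hz'.2
  · set A : E × ℝ → E →L[ℝ] E := fun w ↦ (ContinuousLinearMap.fst ℝ E (E × ℝ)).comp
      ((fderiv ℝ G w).comp (ContinuousLinearMap.inl ℝ E ℝ)) with hA
    have hAc : ContinuousOn A N' := by
      have h1 := hGs.continuousOn_fderiv_of_isOpen hN'o (by norm_cast)
      exact continuousOn_const.clm_comp (h1.clm_comp continuousOn_const)
    have hAd : ∀ w ∈ N', HasFDerivAt (fun η ↦ (G (η, w.2)).1) (A w) w.1 := by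
      intro w hw
      have h1 : HasFDerivAt G (fderiv ℝ G w) (w.1, w.2) :=
        ((hGs.contDiffAt (hN'o.mem_nhds hw)).differentiableAt (by simp)).hasFDerivAt
      have h2 : HasFDerivAt (fun η ↦ G (η, w.2))
          ((fderiv ℝ G w).comp (ContinuousLinearMap.inl ℝ E ℝ)) w.1 :=
        HasFDerivAt.comp (g := G) (f := fun η ↦ (η, w.2)) w.1 h1 (hasFDerivAt_prodMk_left w.1 w.2)
      exact HasFDerivAt.comp (g := fun z : E × E × ℝ ↦ z.1) w.1
        (ContinuousLinearMap.fst ℝ E (E × ℝ)).hasFDerivAt h2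
    have hA0 : ∀ η, (η, (0 : ℝ)) ∈ N' → A (η, 0) = (-τ) • ContinuousLinearMap.id ℝ E := by
      intro η hη
      have h1 : HasFDerivAt (fun η : E ↦ (-τ) • η) ((-τ) • ContinuousLinearMap.id ℝ E) η :=
        (hasFDerivAt_id η).const_smul (-τ)
      refine (hAd (η, 0) hη).unique (h1.congr_of_eventuallyEq ?_)
      have hc : ContinuousAt (fun v : E ↦ (v, (0 : ℝ))) η := by fun_prop
      filter_upwards [hc.preimage_mem_nhds (hN'o.mem_nhds hη)] with v hv
      simp only [hG]
      rw [hzero v hv _ hτm]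
    set E' : E → E →L[ℝ] E := fun v ↦ if v = 0 then (-τ) • ContinuousLinearMap.id ℝ E
      else A (‖v‖⁻¹ • v, ‖v‖) with hE'
    have hE'c : ContinuousAt E' 0 := by
      rw [Metric.continuousAt_iff']
      intro ε hε
      have h1 := hsmall (fun η r ↦ dist (A (η, r)) ((-τ) • ContinuousLinearMap.id ℝ E) < ε)
        (fun η hη ↦ by
          have h2 := (hAc.continuousAt (hN'o.mem_nhds (hsph η hη))).tendsto
          rw [hA0 η (hsph η hη)] at h2
          exact Metric.tendsto_nhds.1 h2 ε hε)
      filter_upwards [h1] with v hv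
      by_cases hv0 : v = 0
      · rw [hv0, dist_self]; exact hε
      · simpa [hE', hv0] using hv hv0
    refine ⟨E', ?_, hE'c, by simp [hE']⟩
    filter_upwards [Metric.ball_mem_nhds (0 : E) hρ] with v₀ hv₀
    by_cases hv₀0 : v₀ = 0
    · subst hv₀0
      have : E' 0 = (-τ) • ContinuousLinearMap.id ℝ E := by simp [hE']
      rw [this, hasFDerivAt_iff_isLittleO_nhds_zero, Asymptotics.isLittleO_iff]
      intro c hc
      have h1 := hsmall (fun η r ↦ ‖(G (η, r)).1 + τ • η‖ < c) (fun η hη ↦ by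
        have h2 : ContinuousAt (fun w : E × ℝ ↦ ‖(G w).1 + τ • w.1‖) (η, 0) :=
          ((hGs.continuousOn.continuousAt (hN'o.mem_nhds (hsph η hη))).fst.add (by fun_prop)).norm
        refine h2.eventually_lt_const ?_
        simp only [hG]
        rw [hzero η (hsph η hη) _ hτm]
        simpa using hc)
      filter_upwards [h1] with v hv
      by_cases hv0 : v = 0
      · simp [hv0]
      · have h3 := hv hv0
        rw [zero_add, hZne v hv0]
        have e : (Y ‖v‖ (‖v‖⁻¹ • v) (-τ)).1 - (Z 0 (-τ)).1 -
            ((-τ) • ContinuousLinearMap.id ℝ E) v =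
            ‖v‖ • ((G (‖v‖⁻¹ • v, ‖v‖)).1 + τ • ‖v‖⁻¹ • v) := by
          rw [smul_add, smul_comm ‖v‖ τ, hsplit v hv0]
          simp [hY, hZ, hG]
        rw [e, norm_smul, norm_norm, mul_comm]
        exact mul_le_mul_of_nonneg_right h3.le (norm_nonneg _)
    · have hpos : 0 < ‖v₀‖ := norm_pos_iff.2 hv₀0
      have h1 := hAd (‖v₀‖⁻¹ • v₀, ‖v₀‖) (hρN v₀ hv₀ hv₀0)
      have h2 : HasFDerivAt (fun v : E ↦ ‖v₀‖⁻¹ • v) (‖v₀‖⁻¹ • ContinuousLinearMap.id ℝ E) v₀ :=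
        (hasFDerivAt_id v₀).const_smul _
      have h3 := ((HasFDerivAt.comp (g := fun η ↦ (G
          (η, ‖v₀‖)).1) v₀ h1 h2).const_smul ‖v₀‖).const_add x₀
      have h4 : E' v₀ = ‖v₀‖ • (A (‖v₀‖⁻¹ • v₀, ‖v₀‖)).comp (‖v₀‖⁻¹ • ContinuousLinearMap.id ℝ E) :=
          by
        ext w
        simp [hE', hv₀0, smul_smul, hpos.ne']
      rw [h4]
      refine h3.congr_of_eventuallyEq ?_
      filter_upwards [hnear v₀ ⟨hv₀, hv₀0⟩] with v hv
      rw [hv _ hτm]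
      rfl
  · intro ε hε
    have h1 := hsmall (fun η r ↦ ‖(G (η, r)).2.1 - η‖ < ε) (fun η hη ↦ by
      have h2 : ContinuousAt (fun w : E × ℝ ↦ ‖(G w).2.1 - w.1‖) (η, 0) :=
        ((hGs.continuousOn.continuousAt (hN'o.mem_nhds (hsph η hη))).snd.fst.sub (by fun_prop)).norm
      refine h2.eventually_lt_const ?_
      simp only [hG]
      rw [hzero η (hsph η hη) _ hτm]
      simpa using hε)
    filter_upwards [h1] with v hv hv0
    rw [hZne v hv0]
    have e : (Y ‖v‖ (‖v‖⁻¹ • v) (-τ)).2 - v =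
        ‖v‖ • ((G (‖v‖⁻¹ • v, ‖v‖)).2.1 - ‖v‖⁻¹ • v) := by
      rw [smul_sub, hsplit v hv0]
    rw [e, norm_smul, norm_norm, mul_comm]
    exact mul_le_mul_of_nonneg_right (hv hv0).le (norm_nonneg _)

end LocalLagrangian

end Exponential

section Calibration

set_option linter.unusedSectionVars false

variable {E : Type*} [NormedAddCommGroup E] [NormedSpace ℝ E] [FiniteDimensional ℝ E]

/-! ### The Gauss lemma and the distance to a point -/

namespace LocalLagrangian

variable {H D : Set E} {L : E → E → ℝ} (hL : LocalLagrangian H D L) {x₀ : E} {δ : ℝ} {B : Set E}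
  {Z : E → ℝ → E × E}
include hL

lemma energy_eq {v : E} (hδ : 0 < δ) {z : ℝ → E × E} (h0 : z 0 = (x₀, v))
    (hz : ∀ t ∈ Ioo (-δ) δ, z t ∈ interior D ×ˢ ({0}ᶜ : Set E) ∧
      HasDerivAt z ((z t).2, geodAccel H D L (z t)) t) {t : ℝ} (ht : t ∈ Ioo (-δ) δ) :
    L (z t).1 (z t).2 = L x₀ v := by
  have hsub : interior D ×ˢ ({0}ᶜ : Set E) ⊆ D ×ˢ {0}ᶜ := prod_mono interior_subset Subset.rfl
  have hd : ∀ t ∈ Ioo (-δ) δ, HasDerivAt (fun s ↦ L (z s).1 (z s).2) 0 t := by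
    intro t ht
    have h1 := hL.hasDerivWithinAt_energy (hsub (hz t ht).1)
      (eventually_mem_nhdsWithin.mono fun s hs ↦ hsub (hz s hs).1)
      ((hz t ht).2.hasDerivWithinAt (s := Ioo (-δ) δ))
    exact h1.hasDerivAt (isOpen_Ioo.mem_nhds ht)
  have h := isOpen_Ioo.is_const_of_deriv_eq_zero isPreconnected_Ioo
    (fun t ht ↦ (hd t ht).differentiableAt.differentiableWithinAt) (fun t ht ↦ (hd t ht).deriv)
    ht (show (0 : ℝ) ∈ Ioo (-δ) δ from ⟨by linarith, hδ⟩)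
  simpa [h0] using h

/-- The first variation formula for the geodesics through `x₀`, which contains the Gauss lemma. -/
lemma momentum_variation (hδ : 0 < δ) (hB : IsOpen B)
    (hZ : ∀ v ∈ B, Z v 0 = (x₀, v) ∧ ∀ t ∈ Ioo (-δ) δ, Z v t ∈ interior D ×ˢ ({0}ᶜ : Set E) ∧
        HasDerivAt (Z v) ((Z v t).2, geodAccel H D L (Z v t)) t)
    (hZs : ContDiffOn ℝ ∞ (Function.uncurry Z) (B ×ˢ Ioo (-δ) δ)) {v : E} (hv : v ∈ B)
    {A : E →L[ℝ] E} {t : ℝ} (ht : t ∈ Ioo (-δ) δ) (hA : HasFDerivAt (fun v ↦ (Z v t).1) A v)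
        (w : E) :
    momentum L (Z v t) (A w) = t * momentum L (x₀, v) w := by
  have hsub : interior D ×ˢ ({0}ᶜ : Set E) ⊆ D ×ˢ {0}ᶜ := prod_mono interior_subset Subset.rfl
  have h0m : (0 : ℝ) ∈ Ioo (-δ) δ := ⟨by linarith, hδ⟩
  have hopen : IsOpen (B ×ˢ Ioo (-δ) δ) := hB.prod isOpen_Ioo
  set F := Function.uncurry Z with hF
  have hFd : ∀ z ∈ B ×ˢ Ioo (-δ) δ, HasFDerivAt F (fderiv ℝ F z) z := fun z hz ↦
    ((hZs.contDiffAt (hopen.mem_nhds hz)).differentiableAt (by simp)).hasFDerivAt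
  have hFt : ∀ z ∈ B ×ˢ Ioo (-δ) δ, fderiv ℝ F z (0, 1) =
      ((F z).2, geodAccel H D L (F z)) := by
    intro z hz
    have h1 : HasDerivAt (fun s : ℝ ↦ (z.1, s)) ((0 : E), (1 : ℝ)) z.2 :=
      (hasDerivAt_const _ _).prodMk (hasDerivAt_id _)
    have h2 : HasDerivAt (Z z.1) (fderiv ℝ F z (0, 1)) z.2 :=
      HasFDerivAt.comp_hasDerivAt (l := F) (f := fun s : ℝ ↦ (z.1, s)) z.2 (hFd z hz) h1
    exact h2.unique ((hZ z.1 hz.1).2 z.2 hz.2).2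
  have hFv : ∀ z ∈ B ×ˢ Ioo (-δ) δ, HasFDerivAt (fun v ↦ Z v z.2)
      ((fderiv ℝ F z).comp (ContinuousLinearMap.inl ℝ E ℝ)) z.1 := fun z hz ↦
    HasFDerivAt.comp (g := F) (f := fun v ↦ (v, z.2)) z.1 (hFd z hz)
        (hasFDerivAt_prodMk_left z.1 z.2)
  have hF' : ContDiffOn ℝ ∞ (fderiv ℝ F) (B ×ˢ Ioo (-δ) δ) :=
    ((contDiffOn_infty_iff_fderiv_of_isOpen hopen).1 hZs).2
  have hFdd : ∀ z ∈ B ×ˢ Ioo (-δ) δ, HasFDerivAt (fderiv ℝ F) (fderiv ℝ (fderiv ℝ F) z) z :=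
    fun z hz ↦ ((hF'.contDiffAt (hopen.mem_nhds hz)).differentiableAt (by simp)).hasFDerivAt
  -- the variation field, and the derivative of its base component
  set J : ℝ → E × E := fun t ↦ fderiv ℝ F (v, t) (w, 0) with hJ
  have hJd : ∀ t ∈ Ioo (-δ) δ, HasDerivAt (fun t ↦ (J t).1) (J t).2 t := by
    intro t ht
    have hz : (v, t) ∈ B ×ˢ Ioo (-δ) δ := ⟨hv, ht⟩
    have h1 : HasDerivAt (fun s : ℝ ↦ (v, s)) ((0 : E), (1 : ℝ)) t :=
      (hasDerivAt_const _ _).prodMk (hasDerivAt_id _)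
    have h2 : HasDerivAt (fun s ↦ fderiv ℝ F (v, s)) (fderiv ℝ (fderiv ℝ F) (v, t) (0, 1)) t :=
      HasFDerivAt.comp_hasDerivAt (l := fderiv ℝ F) (f := fun s : ℝ ↦ (v, s)) t (hFdd _ hz) h1
    have h3 : HasDerivAt J (fderiv ℝ (fderiv ℝ F) (v, t) (0, 1) (w, 0)) t := by
      simpa using h2.clm_apply (hasDerivAt_const t ((w, 0) : E × ℝ))
    have h4 : HasFDerivAt (fun z ↦ (fderiv ℝ F z (0, 1)).1)
        ((ContinuousLinearMap.fst ℝ E E).comp ((fderiv ℝ (fderiv ℝ F) (v, t)).flip (0, 1)))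
            (v, t) := by
      have h5 := (hFdd _ hz).clm_apply (hasFDerivAt_const ((0, 1) : E × ℝ) (v, t))
      have h6 := HasFDerivAt.comp (g := fun z : E × E ↦ z.1) (v, t)
        (ContinuousLinearMap.fst ℝ E E).hasFDerivAt h5
      refine h6.congr_fderiv ?_
      ext <;> simp
    have h7 : HasFDerivAt (fun z ↦ (fderiv ℝ F z (0, 1)).1)
        ((ContinuousLinearMap.snd ℝ E E).comp (fderiv ℝ F (v, t))) (v, t) := by
      refine (HasFDerivAt.comp (g := fun z : E × E ↦ z.2) (v, t)
        (ContinuousLinearMap.snd ℝ E E).hasFDerivAt (hFd _ hz)).congr_of_eventuallyEq ?_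
      filter_upwards [hopen.mem_nhds hz] with z hz
      rw [hFt z hz]; rfl
    have h8 := congrArg (fun B : E × ℝ →L[ℝ] E ↦ B (w, 0)) (h4.unique h7)
    simp only [ContinuousLinearMap.comp_apply, ContinuousLinearMap.flip_apply] at h8
    have hsym : IsSymmSndFDerivAt ℝ F (v, t) :=
      (hZs.contDiffAt (hopen.mem_nhds hz)).isSymmSndFDerivAt (by
        rw [minSmoothness_of_isRCLikeNormedField]; exact WithTop.coe_le_coe.2
            (le_top : (2 : ℕ∞) ≤ ⊤))
    have h9 := (ContinuousLinearMap.fst ℝ E E).hasFDerivAt.comp_hasDerivAt t h3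
    have h10 : (ContinuousLinearMap.fst ℝ E E) (fderiv ℝ (fderiv ℝ F) (v, t) (0, 1) (w, 0)) =
        (J t).2 := by
      rw [hsym.eq]; exact h8
    rw [h10] at h9
    exact h9
  have hJA : (J t).1 = A w := by
    have h1 := HasFDerivAt.comp (g := fun z : E × E ↦ z.1) v
        (ContinuousLinearMap.fst ℝ E E).hasFDerivAt (hFv (v, t) ⟨hv, ht⟩)
    exact congrArg (fun B : E →L[ℝ] E ↦ B w) (h1.unique hA)
  have hJ0 : (J 0).1 = 0 := by
    have h1 := HasFDerivAt.comp (g := fun z : E × E ↦ z.1) v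
        (ContinuousLinearMap.fst ℝ E E).hasFDerivAt (hFv (v, 0) ⟨hv, h0m⟩)
    have h2 : HasFDerivAt ((fun z : E × E ↦ z.1) ∘ fun v ↦ Z v 0) (0 : E →L[ℝ] E) v := by
      refine (hasFDerivAt_const x₀ v).congr_of_eventuallyEq ?_
      filter_upwards [hB.mem_nhds hv] with v' hv'
      simp [(hZ v' hv').1]
    exact congrArg (fun B : E →L[ℝ] E ↦ B w) (h1.unique h2)
  -- the energy depends on the initial velocity only
  have hen : ∀ t ∈ Ioo (-δ) δ, force H L (Z v t) (J t).1 + momentum L (Z v t) (J t).2 =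
      momentum L (x₀, v) w := by
    intro t ht
    have hm := ((hZ v hv).2 t ht).1
    have h1 : HasFDerivAt (Function.uncurry L) ((force H L (Z v t)).coprod (momentum L (Z v t)))
        (Z v t) := by
      rw [← hL.fderivWithin_eq (hsub hm)]
      exact (hL.hasFDerivWithinAt (hsub hm)).hasFDerivAt
        (mem_of_superset ((isOpen_interior.prod isOpen_compl_singleton).mem_nhds hm) hsub)
    have h2 := HasFDerivAt.comp (g := Function.uncurry L) v h1 (hFv (v, t) ⟨hv, ht⟩)
    have hx₀ : x₀ ∈ D ∧ v ≠ 0 := by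
      have := hsub ((hZ v hv).2 0 h0m).1
      rw [(hZ v hv).1] at this
      exact this
    have h3 : HasFDerivAt (Function.uncurry L ∘ fun v ↦ Z v t) (momentum L (x₀, v)) v := by
      refine (hL.hasFDerivAt_momentum hx₀.1 hx₀.2).congr_of_eventuallyEq ?_
      filter_upwards [hB.mem_nhds hv] with v' hv'
      exact hL.energy_eq hδ (hZ v' hv').1 (hZ v' hv').2 ht
    have h4 := congrArg (fun B : E →L[ℝ] ℝ ↦ B w) (h2.unique h3)
    exact h4
  have hder : ∀ t ∈ Ioo (-δ) δ, HasDerivAt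
      (fun t ↦ momentum L (Z v t) (J t).1 - t * momentum L (x₀, v) w) 0 t := by
    intro t ht
    have h1 := hL.eulerLagrange_of_ode (hsub ((hZ v hv).2 t ht).1)
      (eventually_mem_nhdsWithin.mono fun s hs ↦ hsub ((hZ v hv).2 s hs).1)
      (((hZ v hv).2 t ht).2.hasDerivWithinAt (s := Ioo (-δ) δ))
    have h2 := (h1.hasDerivAt (isOpen_Ioo.mem_nhds ht)).clm_apply (hJd t ht)
    have h3 := h2.sub ((hasDerivAt_id t).mul_const (momentum L (x₀, v) w))
    refine h3.congr_deriv ?_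
    rw [hen t ht]; simp
  have h := isOpen_Ioo.is_const_of_deriv_eq_zero isPreconnected_Ioo
    (fun t ht ↦ (hder t ht).differentiableAt.differentiableWithinAt) (fun t ht ↦ (hder t ht).deriv)
    ht h0m
  simp only [hJA, hJ0, map_zero, zero_mul, sub_zero] at h
  linarith

/-- The point `x₀` has a neighborhood covered by the geodesics `Z v` that end at `x₀`, and there
the function `f`, minus the length of the geodesic to `x₀`, has the momentum of the normalized
geodesic as derivative. By the fundamental inequality, `f` grows along any curve no faster than
length. -/
lemma exists_calibration (hx₀ : x₀ ∈ interior D) :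
    ∃ τ > 0, ∃ δ > τ, ∃ Z : E → ℝ → E × E, ∃ h : OpenPartialHomeomorph E E,
      0 ∈ h.source ∧ h 0 = x₀ ∧ h.target ⊆ interior D ∧
      HasFDerivAt h ((-τ) • ContinuousLinearMap.id ℝ E) 0 ∧
      (∀ v ∈ h.source, v ≠ 0 → Z v 0 = (x₀, v) ∧ (∀ t ∈ Ioo (-δ) δ,
          Z v t ∈ interior D ×ˢ ({0}ᶜ : Set E) ∧
          HasDerivAt (Z v) ((Z v t).2, geodAccel H D L (Z v t)) t) ∧ (Z v (-τ)).1 = h v ∧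
        HasFDerivAt (fun x ↦ -τ * √(2 * L x₀ (h.symm x)))
          ((√(2 * L x₀ v))⁻¹ • momentum L (Z v (-τ))) (h v)) ∧
      ∀ ε > 0, ∀ᶠ v in 𝓝 (0 : E), v ≠ 0 → ‖(Z v (-τ)).2 - v‖ ≤ ε * ‖v‖ := by
  have hcomplete : CompleteSpace E := FiniteDimensional.complete ℝ E
  obtain ⟨τ, hτ, δ, hδ, ρ, hρ, Z, hZ, hZs, hZ0, ⟨E', hE', hE'c, hE'0⟩, hasym⟩ :=
      hL.exists_exponential hx₀
  have hδ0 : 0 < δ := hτ.trans hδ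
  have hτm : -τ ∈ Ioo (-δ) δ := ⟨by linarith, by linarith⟩
  -- `g` is the backward exponential map at `x₀`; its derivative at `0` is `-τ`.
  set g : E → E := fun v ↦ (Z v (-τ)).1 with hg
  set e₀ : E ≃L[ℝ] E := ContinuousLinearEquiv.smulLeft (Units.mk0 (-τ) (by linarith)) with he₀
  have he₀' : (e₀ : E →L[ℝ] E) = (-τ) • ContinuousLinearMap.id ℝ E := by
    ext w; simp [he₀]
  have hstrict : HasStrictFDerivAt g (e₀ : E →L[ℝ] E) 0 := by
    have := hasStrictFDerivAt_of_hasFDerivAt_of_continuousAt hE' hE'c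
    rwa [hE'0, ← he₀'] at this
  set h₀ := hstrict.toOpenPartialHomeomorph g with hh₀
  have hcoe : (h₀ : E → E) = g := hstrict.toOpenPartialHomeomorph_coe
  have hinv : ∀ᶠ v in 𝓝 (0 : E), E' v ∈ range (fun e : E ≃L[ℝ] E ↦ (e : E →L[ℝ] E)) :=
    hE'c.preimage_mem_nhds (ContinuousLinearEquiv.isOpen.mem_nhds ⟨e₀, by rw [he₀', hE'0]⟩)
  have hcont : ContinuousAt g 0 := hE'.self_of_nhds.continuousAt
  have hgD : ∀ᶠ v in 𝓝 (0 : E), g v ∈ interior D :=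
    hcont.preimage_mem_nhds (isOpen_interior.mem_nhds (by rw [hg]; simp only; rw [hZ0]; exact hx₀))
  obtain ⟨V, hV, hVo, h0V⟩ := eventually_nhds_iff.1
    (((hE'.and hinv).and hgD).and (Metric.ball_mem_nhds (0 : E) hρ))
  set h := h₀.restrOpen V hVo with hh
  have hcoe' : (h : E → E) = g := hcoe
  have hsrc : h.source ⊆ V := fun v hv ↦ hv.2
  refine ⟨τ, hτ, δ, hδ, Z, h, ⟨hstrict.mem_toOpenPartialHomeomorph_source, h0V⟩, ?_, ?_, ?_, ?_,
      hasym⟩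
  · rw [hcoe', hg]; exact hZ0
  · intro x hx
    have := (hV _ (hsrc (h.map_target hx))).1.2
    rwa [← hcoe', h.right_inv hx] at this
  · rw [hcoe', ← hE'0]; exact hE'.self_of_nhds
  · intro v hv hv0
    have hvB : v ∈ Metric.ball (0 : E) ρ \ {0} := ⟨(hV v (hsrc hv)).2, hv0⟩
    refine ⟨(hZ v hvB).1, (hZ v hvB).2, by rw [hcoe'], ?_⟩
    obtain ⟨e, he⟩ := (hV v (hsrc hv)).1.1.2
    simp only at he
    have hgv : HasFDerivAt h (e : E →L[ℝ] E) v := by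
      rw [hcoe', he]; exact (hV v (hsrc hv)).1.1.1
    have hsymm : HasFDerivAt h.symm (e.symm : E →L[ℝ] E) (h v) := by
      refine h.hasFDerivAt_symm (h.map_source hv) ?_
      rw [h.left_inv hv]; exact hgv
    have hLpos := hL.pos x₀ (interior_subset hx₀) v hv0
    have h1 : HasFDerivAt (fun w ↦ √(2 * L x₀ w))
        ((1 / (2 * √(2 * L x₀ v))) • (2 : ℝ) • momentum L (x₀, v)) (h.symm (h v)) := by
      rw [h.left_inv hv]
      exact ((hL.hasFDerivAt_momentum (interior_subset hx₀) hv0).const_mul 2).sqrt (by positivity)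
    have h2 := (HasFDerivAt.comp (g := fun w ↦ √(2 * L x₀ w)) (h v) h1 hsymm).const_mul (-τ)
    refine h2.congr_fderiv ?_
    ext w
    -- Gauss lemma: the momentum at the end of the geodesic, on a variation of the end, is `-τ` times
    -- the momentum at `x₀` on the variation of `v`.
    have h3 := hL.momentum_variation hδ0
        (Metric.isOpen_ball.sdiff isClosed_singleton) hZ hZs hvB hτm
      (hV v (hsrc hv)).1.1.1 (e.symm w)
    rw [← he] at h3
    simp only [ContinuousLinearEquiv.coe_coe, ContinuousLinearEquiv.apply_symm_apply] at h3
    simp only [_root_.smul_apply, ContinuousLinearMap.comp_apply, ContinuousLinearEquiv.coe_coe,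
      smul_eq_mul, h3]
    field_simp

end LocalLagrangian

end Calibration

section Directions

set_option linter.unusedSectionVars false

variable {d : ℕ} {M : Type*} [TopologicalSpace M] [ChartedSpace (EuclideanHalfSpace (d + 1)) M]
  [IsManifold (𝓡∂ (d + 1)) ∞ M]
variable {φ : FinslerMetric d M}

/-! ### Minimizing geodesics to a nearby point -/

/-- The derivative of a map into `M`, read in a chart. -/
lemma hasFDerivAt_extChartAt_comp {F : Type*} [NormedAddCommGroup F] [NormedSpace ℝ F] {ψ : F → M}
    {z : F} {A : TangentSpace 𝓘(ℝ, F) z →L[ℝ] TangentSpace (𝓡∂ (d + 1)) (ψ z)}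
    (hψ : HasMFDerivAt 𝓘(ℝ, F) (𝓡∂ (d + 1)) ψ z A) {a : M}
    (hq : ψ z ∈ (extChartAt (𝓡∂ (d + 1)) a).source) :
    HasFDerivAt (fun w ↦ extChartAt (𝓡∂ (d + 1)) a (ψ w))
      (((coordEquiv hq).symm : Vec d →L[ℝ] Vec d).comp (show F →L[ℝ] Vec d from A)) z := by
  have := isManifold_one (d := d) (M := M)
  have hq' : ψ z ∈ (chartAt (EuclideanHalfSpace (d + 1)) a).source := by
    rwa [extChartAt_source] at hq
  have h1 := hasMFDerivAt_extChartAt (I := 𝓡∂ (d + 1)) hq'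
  rw [mfderiv_chartAt_eq_tangentCoordChange hq'] at h1
  have h2 := HasMFDerivAt.comp z h1 hψ
  exact h2.hasFDerivAt

/-- The norm of the velocity of a curve, as it appears in the length. -/
noncomputable def speed (φ : FinslerMetric d M) (c : ℝ → M) (t : ℝ) : ℝ :=
  φ.toFun ⟨c t, mfderivWithin 𝓘(ℝ, ℝ) (𝓡∂ (d + 1)) c (Icc 0 1) t (1 : ℝ)⟩

lemma continuousOn_speed {c : ℝ → M} (hc : ContMDiffOn 𝓘(ℝ, ℝ) (𝓡∂ (d + 1)) 1 c (Icc 0 1)) :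
    ContinuousOn (speed φ c) (Icc 0 1) := by
  have := isManifold_one (d := d) (M := M)
  have h1 := hc.continuousOn_tangentMapWithin le_rfl
    (uniqueMDiffOn_iff_uniqueDiffOn.2 (uniqueDiffOn_Icc_zero_one))
  have h2 : Continuous fun t : ℝ ↦ (⟨t, (1 : ℝ)⟩ : TangentBundle 𝓘(ℝ, ℝ) ℝ) := by
    have := (tangentBundleModelSpaceHomeomorph 𝓘(ℝ, ℝ)).symm.continuous.comp
      (continuous_id.prodMk (continuous_const (y := (1 : ℝ))))
    exact this
  exact φ.continuous.comp_continuousOn (h1.comp h2.continuousOn fun t ht ↦ ht)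

lemma hasDerivAt_extChartAt_curve {c : ℝ → M}
    (hc : ContMDiffOn 𝓘(ℝ, ℝ) (𝓡∂ (d + 1)) 1 c (Icc 0 1)) {t : ℝ} (ht : t ∈ Ioo (0 : ℝ) 1) {a : M}
    (hq : c t ∈ (extChartAt (𝓡∂ (d + 1)) a).source) :
    ∃ ζ, HasDerivAt (fun s ↦ extChartAt (𝓡∂ (d + 1)) a (c s)) ζ t ∧
      speed φ c t = √(2 * chartLag φ a (extChartAt (𝓡∂ (d + 1)) a (c t)) ζ) := by
  have hn : Icc (0 : ℝ) 1 ∈ 𝓝 t := Icc_mem_nhds ht.1 ht.2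
  have h1 : HasMFDerivAt 𝓘(ℝ, ℝ) (𝓡∂ (d + 1)) c t (mfderiv 𝓘(ℝ, ℝ) (𝓡∂ (d + 1)) c t) :=
    ((hc.contMDiffAt hn).mdifferentiableAt (by simp)).hasMFDerivAt
  have h2 := (hasFDerivAt_extChartAt_comp h1 hq).hasDerivAt
  refine ⟨_, h2, ?_⟩
  have h3 : mfderivWithin 𝓘(ℝ, ℝ) (𝓡∂ (d + 1)) c (Icc 0 1) t = mfderiv 𝓘(ℝ, ℝ) (𝓡∂ (d + 1)) c t :=
    mfderivWithin_of_mem_nhds hn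
  set V : Vec d := (mfderiv 𝓘(ℝ, ℝ) (𝓡∂ (d + 1)) c t) (1 : ℝ) with hV
  have h4 : speed φ c t = φ.toFun (tmk (c t) V) := by
    rw [speed, h3]; rfl
  have h5 := chartLag_tChart φ (a := a) (y := tmk (c t) V) (mem_tChart_source.2 hq)
  rw [tChart_eq hq] at h5
  have h6 : ((((coordEquiv hq).symm : Vec d →L[ℝ] Vec d).comp
      (show ℝ →L[ℝ] Vec d from mfderiv 𝓘(ℝ, ℝ) (𝓡∂ (d + 1)) c t)) 1) = (coordEquiv hq).symm V := rfl
  rw [h6, h4]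
  simp only at h5
  rw [h5, mul_div_cancel₀ _ two_ne_zero, Real.sqrt_sq (φ.toFun_nonneg _)]

/-- Minimality of the short geodesics that end at `p`: a curve that starts at distance `τ * l` from
`p` does not reach `p` within a shorter length. The function `lam` is the norm of the initial
velocity of the geodesic to `p`, and `f = -τ * lam` is a calibration. -/
lemma le_length_of_calibration [T2Space M] {p : M} {τ : ℝ} {lam : M → ℝ} {V : Set M} {l : ℝ}
    (hl : 0 < l) (hV : IsOpen V) (hlam : ContinuousOn lam V) (hpV : p ∈ V) (hp0 : lam p = 0)
    {K : Set M} (hK : IsCompact K) (hKV : K ⊆ V) (hlK : ∀ q ∈ V, lam q < l → q ∈ K)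
    (hKl : ∀ q ∈ K, lam q ≤ l) {c : ℝ → M}
    (hc : ContMDiffOn 𝓘(ℝ, ℝ) (𝓡∂ (d + 1)) 1 c (Icc 0 1)) (hc0l : lam (c 0) = l)
    (hc1 : c 1 = p)
    (hder : ∀ t ∈ Ioo (0 : ℝ) 1, c t ∈ V → c t ≠ p →
      ∃ D, HasDerivAt (fun t ↦ -τ * lam (c t)) D t ∧ D ≤ speed φ c t) :
    τ * l ≤ φ.length c := by
  have hcc := hc.continuousOn
  set W : Set M := V ∩ lam ⁻¹' Iio l with hW
  have hWo : IsOpen W := hlam.isOpen_inter_preimage hV isOpen_Iio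
  have hpW : p ∈ W := ⟨hpV, by rw [mem_preimage, hp0]; exact hl⟩
  -- the last time outside of `W`
  have hZc : IsCompact (Icc (0 : ℝ) 1 ∩ c ⁻¹' Wᶜ) :=
    isCompact_Icc.of_isClosed_subset
        (hcc.preimage_isClosed_of_isClosed isClosed_Icc hWo.isClosed_compl)
      inter_subset_left
  obtain ⟨s, ⟨hs01, hsW⟩, hsmax⟩ := hZc.exists_isGreatest ⟨0, left_mem_Icc.2 zero_le_one,
    fun h ↦ (show lam (c 0) < l from h.2).ne hc0l⟩
  have hs1 : s < 1 := by
    refine lt_of_le_of_ne hs01.2 fun h ↦ hsW ?_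
    rw [h, hc1]; exact hpW
  have hafter : ∀ t ∈ Ioc s 1, c t ∈ W := by
    intro t ht
    by_contra h
    exact absurd (hsmax ⟨⟨hs01.1.trans ht.1.le, ht.2⟩, h⟩) (not_le.2 ht.1)
  have hsK : c s ∈ K := by
    have h1 : Tendsto c (𝓝[>] s) (𝓝 (c s)) := by
      have := (hcc s hs01).mono (s := Ioc s 1) fun t ht ↦ ⟨hs01.1.trans ht.1.le, ht.2⟩
      rwa [ContinuousWithinAt, nhdsWithin_Ioc_eq_nhdsGT hs1] at this
    refine hK.isClosed.mem_of_tendsto h1 ?_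
    filter_upwards [Ioc_mem_nhdsGT hs1] with t ht
    exact hlK _ (hafter t ht).1 (hafter t ht).2
  have hsl : lam (c s) = l := by
    refine le_antisymm (hKl _ hsK) (not_lt.1 fun h ↦ hsW ⟨hKV hsK, h⟩)
  -- the first time at `p` after that
  have hPc : IsCompact (Icc s 1 ∩ c ⁻¹' {p}) :=
    isCompact_Icc.of_isClosed_subset
        ((hcc.mono (Icc_subset_Icc_left hs01.1)).preimage_isClosed_of_isClosed
      isClosed_Icc isClosed_singleton) inter_subset_left
  obtain ⟨T, ⟨hT, hTp⟩, hTmin⟩ := hPc.exists_isLeast ⟨1, right_mem_Icc.2 hs1.le, hc1⟩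
  have hsT : s < T := by
    refine lt_of_le_of_ne hT.1 fun h ↦ hsW ?_
    rw [h, mem_singleton_iff.1 hTp]; exact hpW
  have hsub : Icc s T ⊆ Icc 0 1 := Icc_subset_Icc hs01.1 hT.2
  have hmemV : ∀ t ∈ Icc s T, c t ∈ V := by
    intro t ht
    rcases eq_or_lt_of_le ht.1 with h | h
    · rw [← h]; exact hKV hsK
    · exact (hafter t ⟨h, ht.2.trans hT.2⟩).1
  have hsp : ContinuousOn (speed φ c) (Icc 0 1) := continuousOn_speed hc
  have hint : ∀ a ∈ Icc (0 : ℝ) 1, ∀ b ∈ Icc (0 : ℝ) 1, IntervalIntegrable (speed φ c) volume a b :=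
    fun a ha b hb ↦ (hsp.mono (uIcc_subset_Icc ha hb)).intervalIntegrable
  have hsm : s ∈ Icc (0 : ℝ) 1 := hs01
  have hTm : T ∈ Icc (0 : ℝ) 1 := hsub (right_mem_Icc.2 hsT.le)
  have hanti : AntitoneOn (fun t ↦ -τ * lam (c t) - ∫ r in s..t, speed φ c r) (Icc s T) := by
    have hd : ∀ t ∈ Ioo s T, ∃ D, HasDerivAt (fun t ↦ -τ * lam (c t)) D t ∧ D ≤ speed φ c t ∧
        HasDerivAt (fun t ↦ ∫ r in s..t, speed φ c r) (speed φ c t) t := by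
      intro t ht
      have ht01 : t ∈ Ioo (0 : ℝ) 1 := ⟨hs01.1.trans_lt ht.1, ht.2.trans_le hT.2⟩
      obtain ⟨D, hD, hDle⟩ := hder t ht01 (hmemV t (Ioo_subset_Icc_self ht)) fun h ↦
        absurd (hTmin ⟨⟨ht.1.le, ht01.2.le⟩, h⟩) (not_le.2 ht.2)
      refine ⟨D, hD, hDle, ?_⟩
      exact intervalIntegral.integral_hasDerivAt_right
        (hint s hsm t (Ioo_subset_Icc_self ht01))
        (hsp.stronglyMeasurableAtFilter_nhdsWithin measurableSet_Icc t |>.filter_mono (by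
          rw [nhdsWithin_eq_nhds.2 (Icc_mem_nhds ht01.1 ht01.2)]))
        (hsp.continuousAt (Icc_mem_nhds ht01.1 ht01.2))
    refine antitoneOn_of_deriv_nonpos (convex_Icc s T) ?_ ?_ ?_
    · refine (continuousOn_const.mul (hlam.comp (hcc.mono hsub) hmemV)).sub ?_
      have := intervalIntegral.continuousOn_primitive_interval' (hint s hsm T hTm) left_mem_uIcc
      rwa [uIcc_of_le hsT.le] at this
    · intro t ht
      rw [interior_Icc] at ht
      obtain ⟨D, h1, -, h2⟩ := hd t ht
      exact (h1.sub h2).differentiableAt.differentiableWithinAt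
    · intro t ht
      rw [interior_Icc] at ht
      obtain ⟨D, h1, hle, h2⟩ := hd t ht
      have h3 : deriv (fun t ↦ -τ * lam (c t) - ∫ r in s..t, speed φ c r) t = D - speed φ c t :=
        (h1.sub h2).deriv
      rw [h3]
      linarith
  have h1 := hanti (left_mem_Icc.2 hsT.le) (right_mem_Icc.2 hsT.le) hsT.le
  simp only [intervalIntegral.integral_same, hsl, mem_singleton_iff.1 hTp, hp0] at h1
  have h2 : ∫ r in s..T, speed φ c r ≤ ∫ r in (0 : ℝ)..1, speed φ c r := by
    refine intervalIntegral.integral_mono_interval hs01.1 hsT.le hT.2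
      (Eventually.of_forall fun r ↦ φ.toFun_nonneg _)
      (hint 0 (left_mem_Icc.2 zero_le_one) 1 (right_mem_Icc.2 zero_le_one))
  have h3 : φ.length c = ∫ r in (0 : ℝ)..1, speed φ c r := rfl
  rw [h3]
  linarith

/-- Near an interior point `p` there are unit speed minimizing geodesics to `p`, and along a
sequence that tends to `p` in the direction `ξ`, their initial velocities tend to a negative
multiple of `ξ`. -/
lemma exists_direction_field [T2Space M] {p : M} (hp : p ∈ (𝓡∂ (d + 1)).interior M) :
    ∃ dir : M → TangentBundle (𝓡∂ (d + 1)) M,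
      (∀ᶠ q in 𝓝 p, q ≠ p → tmk q (vel (dir q)) = dir q ∧ IsDirection φ q p (vel (dir q))) ∧
      ∀ (q : ℕ → M) (ε : ℕ → ℝ) (ξ : Vec d), ξ ≠ 0 → (∀ k, 0 < ε k) → Tendsto ε atTop (𝓝 0) →
        Tendsto q atTop (𝓝 p) → Tendsto (fun k ↦ (ε k)⁻¹ •
          (extChartAt (𝓡∂ (d + 1)) p (q k) - extChartAt (𝓡∂ (d + 1)) p p)) atTop (𝓝 ξ) →
        ∃ κ : ℝ, 0 < κ ∧ Tendsto (fun k ↦ dir (q k)) atTop (𝓝 (tmk p (-(κ • ξ)))) := by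
  set χ := extChartAt (𝓡∂ (d + 1)) p with hχ
  set x₀ := χ p with hx₀'
  have hL := localLagrangian φ p
  have hps := mem_extChartAt_source (I := 𝓡∂ (d + 1)) p
  have hx₀ : x₀ ∈ interior χ.target :=
    (mem_interior_target_iff (χ.map_source hps)).2 ((mem_interior_iff hps).1 hp)
  obtain ⟨τ, hτ, δ, hδ, Z, h, h0s, h00, htgt, hder0, hZ, hasym⟩ := hL.exists_calibration hx₀
  have hδ0 : 0 < δ := hτ.trans hδ
  have hτm : -τ ∈ Ioo (-δ) δ := ⟨by linarith, by linarith⟩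
  have hx₀D : x₀ ∈ χ.target := interior_subset hx₀
  set nrm : Vec d → ℝ := fun w ↦ φ.toFun (tmk p w) with hnrm
  have hsqrt : ∀ w, √(2 * chartLag φ p x₀ w) = nrm w := fun w ↦ by
    rw [chartLag_self, mul_div_cancel₀ _ two_ne_zero, Real.sqrt_sq (φ.toFun_nonneg _)]
  have hnrm_smul : ∀ r : ℝ, 0 ≤ r → ∀ w, nrm (r • w) = r * nrm w := fun r hr w ↦
    φ.toFun_tmk_smul p hr w
  have hnrm_zero : nrm 0 = 0 := φ.toFun_zero p
  have hnrm_pos : ∀ w, w ≠ 0 → 0 < nrm w := fun w hw ↦ φ.pos' _ hw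
  have htmk : ∀ w, (tChart p).symm (x₀, w) = tmk p w := fun w ↦ by
    rw [← tChart_self p w, (tChart p).left_inv (mem_tChart_source.2 hps)]
  have hfib : Continuous fun w : Vec d ↦ tmk p w := by
    have h1 : Continuous fun w : Vec d ↦ (tChart p).symm (x₀, w) :=
      (continuousOn_tChart_symm p).comp_continuous (by fun_prop) fun w ↦ mem_tChart_target.2 hx₀D
    simpa only [htmk] using h1
  have hnrm_cont : Continuous nrm := φ.continuous.comp hfib
  obtain ⟨c, hc, hev⟩ := eventually_le_toFun φ p
  have hlow : ∀ w, c * ‖w‖ ≤ nrm w := fun w ↦ by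
    have := (hev.self_of_nhds).2 w
    rwa [htmk] at this
  obtain ⟨r, hr, hrs⟩ := Metric.nhds_basis_closedBall.mem_iff.1 (h.open_source.mem_nhds h0s)
  set V : Set M := χ.source ∩ χ ⁻¹' h.target with hV
  have hVo : IsOpen V := (continuousOn_extChartAt p).isOpen_inter_preimage
    (isOpen_extChartAt_source p) h.open_target
  have hx₀t : x₀ ∈ h.target := h00 ▸ h.map_source h0s
  have hsymm0 : h.symm x₀ = 0 := by rw [← h00, h.left_inv h0s]
  have hpV : p ∈ V := ⟨hps, hx₀t⟩
  -- `wv q` is the velocity at `p` of the geodesic that starts at `q` and reaches `p` after the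
  -- time `τ`.
  set wv : M → Vec d := fun q ↦ h.symm (χ q) with hwv
  have hwc : ContinuousOn wv V := h.continuousOn_symm.comp
    ((continuousOn_extChartAt p).mono inter_subset_left) fun q hq ↦ hq.2
  have hw0 : ∀ q ∈ V, q ≠ p → wv q ≠ 0 := by
    intro q hq hne h0
    refine hne (χ.injOn hq.1 hps ?_)
    rw [← h.right_inv hq.2]
    change h (wv q) = x₀
    rw [h0, h00]
  have hhw : ∀ q ∈ V, h (wv q) = χ q := fun q hq ↦ h.right_inv hq.2
  have hws : ∀ q ∈ V, wv q ∈ h.source := fun q hq ↦ h.map_target hq.2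
  -- The velocity of this geodesic at `q`, normalized to unit length.
  set dir : M → TangentBundle (𝓡∂ (d + 1)) M := fun q ↦
    (tChart p).symm (χ q, (nrm (wv q))⁻¹ • (Z (wv q) (-τ)).2) with hdir
  have hnear : ∀ᶠ q in 𝓝 p, q ∈ V ∧ nrm (wv q) < c * r := by
    have h1 : ContinuousAt (fun q ↦ nrm (wv q)) p :=
      ContinuousAt.comp (g := nrm) hnrm_cont.continuousAt (hwc.continuousAt (hVo.mem_nhds hpV))
    have h2 : nrm (wv p) < c * r := by
      have : wv p = 0 := hsymm0
      rw [this, hnrm_zero]; positivity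
    filter_upwards [hVo.mem_nhds hpV, h1.eventually_lt_const h2] with q h3 h4 using ⟨h3, h4⟩
  refine ⟨dir, ?_, ?_⟩
  · filter_upwards [hnear] with q hq hqp
    obtain ⟨hqV, hql⟩ := hq
    have hwq := hw0 q hqV hqp
    obtain ⟨hZ0, hZode, hZτ, -⟩ := hZ _ (hws q hqV) hwq
    rw [hhw q hqV] at hZτ
    set w := wv q with hw
    set l := nrm w with hl
    have hl0 : 0 < l := hnrm_pos w hwq
    have hen := fun t (ht : t ∈ Ioo (-δ) δ) ↦ hL.energy_eq hδ0 hZ0 hZode ht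
    have hdirq : dir q = (tChart p).symm (χ q, l⁻¹ • (Z w (-τ)).2) := rfl
    have hproj : (dir q).proj = q := by
      rw [hdirq, tChart_symm_proj]; exact χ.left_inv hqV.1
    have htm : tmk q (vel (dir q)) = dir q := tmk_vel_of_proj hproj
    refine ⟨htm, ?_, ?_⟩
    · change φ.toFun (tmk q (vel (dir q))) = 1
      rw [htm, hdirq, toFun_tChart_symm_smul φ (χ.map_source hqV.1) (inv_nonneg.2 hl0.le)]
      have h1 : φ.toFun ((tChart p).symm (χ q, (Z w (-τ)).2)) ^ 2 / 2 = l ^ 2 / 2 := by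
        rw [← chartLag_eq, ← hZτ, hen _ hτm, chartLag_self]
      have h2 : φ.toFun ((tChart p).symm (χ q, (Z w (-τ)).2)) = l := by
        refine (sq_eq_sq₀ (φ.toFun_nonneg _) hl0.le).1 (by linarith)
      rw [h2, inv_mul_cancel₀ hl0.ne']
    · -- the geodesic, with unit speed
      set z : ℝ → Vec d × Vec d := fun s ↦ ((Z w (-τ + s / l)).1, l⁻¹ •
          (Z w (-τ + s / l)).2) with hz
      have htime : ∀ s ∈ Icc 0 (τ * l), -τ + s / l ∈ Ioo (-δ) δ := by
        intro s hs
        have h1 : 0 ≤ s / l := div_nonneg hs.1 hl0.le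
        have h2 : s / l ≤ τ := (div_le_iff₀ hl0).2 hs.2
        exact ⟨by linarith, by linarith⟩
      have hzt : ∀ s ∈ Icc 0 (τ * l), (z s).1 ∈ χ.target ∧ (z s).2 ≠ 0 := by
        intro s hs
        have := (hZode _ (htime s hs)).1
        exact ⟨interior_subset this.1, smul_ne_zero (inv_ne_zero hl0.ne') this.2⟩
      have hzd : ∀ s ∈ Icc 0 (τ * l), HasDerivAt z (geodField φ p (z s)) s := by
        intro s hs
        have h1 := (hZode _ (htime s hs)).2
        have h2 : HasDerivAt (fun s : ℝ ↦ -τ + s / l) (1 / l) s :=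
          ((hasDerivAt_id s).div_const l).const_add (-τ)
        have h3 := h1.scomp s h2
        have h4 := ((ContinuousLinearMap.fst ℝ (Vec d) (Vec d)).prod
          (l⁻¹ • ContinuousLinearMap.snd ℝ (Vec d) (Vec d))).hasFDerivAt.comp_hasDerivAt s h3
        have h5 : HasDerivAt z _ s := h4
        refine h5.congr_deriv ?_
        have h6 := (hZode _ (htime s hs)).1
        rw [geodField]
        simp only [hz]
        rw [hL.geodAccel_smul (interior_subset h6.1) (inv_pos.2 hl0) h6.2]
        simp [smul_smul, pow_two]
      have hsrc : ∀ s ∈ Icc 0 (τ * l), (tChart p).symm (z s) ∈ (tChart p).source := fun s hs ↦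
        (tChart p).map_target (mem_tChart_target.2 (hzt s hs).1)
      have hri : ∀ s ∈ Icc 0 (τ * l), tChart p ((tChart p).symm (z s)) = z s := fun s hs ↦
        (tChart p).right_inv (mem_tChart_target.2 (hzt s hs).1)
      refine ⟨τ * l, by positivity, fun s ↦ (tChart p).symm (z s), ?_, ?_, ?_, ?_⟩
      · refine (isGeodesicOn_iff fun s hs ↦ ?_).2 ⟨?_, fun s hs ↦ ⟨p, hsrc s hs, ?_⟩⟩
        · exact (tChart_symm_snd_ne_zero (hzt s hs).1).2 (hzt s hs).2
        · exact (continuousOn_tChart_symm p).comp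
            (fun s hs ↦ (hzd s hs).continuousAt.continuousWithinAt)
            fun s hs ↦ mem_tChart_target.2 (hzt s hs).1
        · rw [hri s hs]
          exact ((hzd s hs).hasDerivWithinAt).congr (fun s hs ↦ hri s hs) (hri s hs)
      · have h1 : z 0 = (χ q, l⁻¹ • (Z w (-τ)).2) := by simp [hz, hZτ]
        simp only
        rw [h1, ← hdirq]
        exact htm.symm
      · have h1 : (z (τ * l)).1 = x₀ := by
          simp only [hz]
          rw [mul_div_cancel_right₀ _ hl0.ne', neg_add_cancel, hZ0]
        simp only
        rw [tChart_symm_proj, h1]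
        exact χ.left_inv hps
      · intro γ hγ hγ0 hγ1
        have hball : ∀ w', nrm w' ≤ l → w' ∈ h.source := fun w' hw' ↦ hrs (by
          rw [mem_closedBall_zero_iff]
          have := (hlow w').trans (hw'.trans hql.le)
          exact le_of_mul_le_mul_left this hc)
        have hKc : IsCompact {w' | nrm w' ≤ l} := by
          refine (isCompact_closedBall (0 : Vec d) r).of_isClosed_subset
            (isClosed_le hnrm_cont continuous_const) fun w' hw' ↦ ?_
          rw [mem_closedBall_zero_iff]
          exact le_of_mul_le_mul_left ((hlow w').trans (hw'.trans hql.le)) hc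
        have hχh : ContinuousOn (fun w' ↦ χ.symm (h w')) h.source :=
          (continuousOn_extChartAt_symm p).comp h.continuousOn
            fun w' hw' ↦ interior_subset (htgt (h.map_source hw'))
        have hχw : ∀ w' ∈ h.source, χ.symm (h w') ∈ V ∧ wv (χ.symm (h w')) = w' := by
          intro w' hw'
          have h1 : h w' ∈ χ.target := interior_subset (htgt (h.map_source hw'))
          refine ⟨⟨χ.map_target h1, ?_⟩, ?_⟩
          · rw [mem_preimage, χ.right_inv h1]; exact h.map_source hw'
          · simp only [hwv]
            rw [χ.right_inv h1, h.left_inv hw']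
        -- The geodesic is minimizing: a curve from `q` to `p` is at least as long as the growth of
        -- `-τ * nrm (wv _)` along it, which is `τ * l`.
        refine le_length_of_calibration (V := V) (lam := fun q ↦ nrm (wv q))
          (K := (fun w' ↦ χ.symm (h w')) '' {w' | nrm w' ≤ l}) (τ := τ) hl0 hVo
          (hnrm_cont.comp_continuousOn hwc) hpV ?_ (hKc.image_of_continuousOn
              (hχh.mono hball)) ?_ ?_ ?_ hγ
          (by rw [hγ0]) hγ1 ?_
        · have : wv p = 0 := hsymm0
          simp only [this, hnrm_zero]
        · rintro _ ⟨w', hw', rfl⟩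
          exact (hχw w' (hball w' hw')).1
        · intro q' hq' hlt
          refine ⟨wv q', hlt.le, ?_⟩
          simp only
          rw [hhw q' hq', χ.left_inv hq'.1]
        · rintro _ ⟨w', hw', rfl⟩
          simp only
          rw [(hχw w' (hball w' hw')).2]
          exact hw'
        · intro t ht htV htp
          obtain ⟨ζ, hζ, hsp⟩ := hasDerivAt_extChartAt_curve (φ := φ) hγ ht htV.1
          have hwt := hw0 _ htV htp
          obtain ⟨hY0, hYode, hYτ, hYf⟩ := hZ _ (hws _ htV) hwt
          rw [hhw _ htV] at hYf hYτ
          have h1 := hYf.comp_hasDerivAt t hζ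
          have h2 : HasDerivAt (fun t ↦ -τ * nrm (wv (γ t)))
              (((√(2 * chartLag φ p x₀ (wv (γ t))))⁻¹ • momentum (chartLag φ p)
                  (Z (wv (γ t)) (-τ))) ζ)
              t := by
            refine h1.congr_of_eventuallyEq (Eventually.of_forall fun s ↦ ?_)
            simp only [Function.comp_apply]
            rw [hsqrt]
          refine ⟨_, h2, ?_⟩
          have h3 := (hYode _ hτm).1
          have h4 := hL.momentum_le_sqrt (interior_subset h3.1) h3.2 ζ
          rw [hL.energy_eq hδ0 hY0 hYode hτm, hsqrt, hYτ] at h4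
          rw [hsqrt, hsp, _root_.smul_apply, smul_eq_mul, inv_mul_le_iff₀ (hnrm_pos _ hwt)]
          have e : ((χ (γ t), (Z (wv (γ t)) (-τ)).2) : Vec d × Vec d) = Z (wv (γ t)) (-τ) :=
            Prod.ext hYτ.symm rfl
          rw [e] at h4
          exact h4
  · intro q ε ξ hξ hε hε0 hq hlim
    have hqV : ∀ᶠ k in atTop, q k ∈ V := hq.eventually (hVo.mem_nhds hpV)
    -- To first order, `wv q` is `-τ⁻¹` times the displacement from `p` to `q`.
    have hder : HasFDerivAt h.symm ((-τ)⁻¹ • ContinuousLinearMap.id ℝ (Vec d)) x₀ := by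
      set e₀ : Vec d ≃L[ℝ] Vec d := ContinuousLinearEquiv.smulLeft
          (Units.mk0 (-τ) (by linarith)) with he₀
      have h1 : (e₀ : Vec d →L[ℝ] Vec d) = (-τ) • ContinuousLinearMap.id ℝ (Vec d) := by
        ext w; simp [he₀]
      have h2 : (e₀.symm : Vec d →L[ℝ] Vec d) = (-τ)⁻¹ • ContinuousLinearMap.id ℝ (Vec d) := by
        ext1 w
        refine e₀.injective ?_
        simp [he₀, smul_smul, hτ.ne']
      rw [← h2]
      refine h.hasFDerivAt_symm hx₀t ?_
      rw [hsymm0, h1]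
      exact hder0
    have hdiff : Tendsto (fun k ↦ χ (q k) - x₀) atTop (𝓝 0) := by
      rw [← sub_self x₀]
      exact ((continuousAt_extChartAt (I := 𝓡∂ (d + 1)) p).tendsto.comp hq).sub_const x₀
    set η : Vec d := (-τ)⁻¹ • ξ with hη
    have hη0 : η ≠ 0 := smul_ne_zero (inv_ne_zero (by linarith)) hξ
    have hw : Tendsto (fun k ↦ (ε k)⁻¹ • wv (q k)) atTop (𝓝 η) := by
      have h1 := (hder.hasFDerivWithinAt (s := univ)).lim (l := atTop) (c := fun k ↦ (ε k)⁻¹)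
        (d := fun k ↦ χ (q k) - x₀) hdiff (Eventually.of_forall fun k ↦ mem_univ _) hlim
      refine h1.congr fun k ↦ ?_
      rw [add_sub_cancel, hsymm0, sub_zero]
    have hwz : Tendsto (fun k ↦ wv (q k)) atTop (𝓝 0) := by
      have h1 := hε0.smul hw
      rw [zero_smul] at h1
      refine h1.congr fun k ↦ ?_
      rw [smul_smul, mul_inv_cancel₀ (hε k).ne', one_smul]
    have hwne : ∀ᶠ k in atTop, wv (q k) ≠ 0 := by
      filter_upwards [hw.eventually_ne hη0] with k hk h0
      rw [h0, smul_zero] at hk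
      exact hk rfl
    have ho : (fun k ↦ (Z (wv (q k)) (-τ)).2 - wv (q k)) =o[atTop] fun k ↦ wv (q k) := by
      rw [Asymptotics.isLittleO_iff]
      intro ε' hε'
      filter_upwards [hwz.eventually (hasym ε' hε'), hwne] with k h1 h2 using h1 h2
    have hO : (fun k ↦ wv (q k)) =O[atTop] ε := by
      have h1 : (fun k ↦ ε k • (ε k)⁻¹ • wv (q k)) =O[atTop] fun k ↦ ε k • (1 : ℝ) :=
        (Asymptotics.isBigO_refl ε atTop).smul (hw.isBigO_one ℝ)
      refine h1.congr (fun k ↦ ?_) fun k ↦ by simp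
      rw [smul_smul, mul_inv_cancel₀ (hε k).ne', one_smul]
    have h2 := (ho.trans_isBigO hO).tendsto_inv_smul_nhds_zero
    have h3 : Tendsto (fun k ↦ (ε k)⁻¹ • (Z (wv (q k)) (-τ)).2) atTop (𝓝 η) := by
      have := h2.add hw
      rw [zero_add] at this
      refine this.congr fun k ↦ ?_
      rw [← smul_add, sub_add_cancel]
    have h4 : Tendsto (fun k ↦ (nrm ((ε k)⁻¹ • wv (q k)))⁻¹ • (ε k)⁻¹ • (Z (wv (q k)) (-τ)).2) atTop
        (𝓝 ((nrm η)⁻¹ • η)) :=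
      (((hnrm_cont.tendsto η).comp hw).inv₀ (hnrm_pos η hη0).ne').smul h3
    have h5 : Tendsto (fun k ↦ (nrm (wv (q k)))⁻¹ • (Z (wv (q k)) (-τ)).2) atTop
        (𝓝 ((nrm η)⁻¹ • η)) := by
      refine h4.congr fun k ↦ ?_
      rw [hnrm_smul _ (inv_nonneg.2 (hε k).le), smul_smul, mul_inv, inv_inv,
        mul_right_comm, mul_inv_cancel₀ (hε k).ne', one_mul]
    refine ⟨(nrm η)⁻¹ * τ⁻¹, mul_pos (inv_pos.2 (hnrm_pos η hη0)) (inv_pos.2 hτ), ?_⟩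
    have h6 : -(((nrm η)⁻¹ * τ⁻¹) • ξ) = (nrm η)⁻¹ • η := by
      rw [hη, smul_smul, ← neg_smul, inv_neg, mul_neg]
    rw [h6]
    exact (continuousAt_tChart_symm p ((nrm η)⁻¹ • η)).tendsto.comp (hq.prodMk_nhds h5) |>.trans
      (by rw [htmk])

end Directions

section Balance

set_option linter.unusedSectionVars false

variable {d : ℕ} {M : Type*} [TopologicalSpace M] [ChartedSpace (EuclideanHalfSpace (d + 1)) M]
  [IsManifold (𝓡∂ (d + 1)) ∞ M]
variable {φ : FinslerMetric d M} {Γ : (x : M) → TangentSpace (𝓡∂ (d + 1)) x} {S : Set M} {p : M}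
  {R : M → TangentBundle (𝓡∂ (d + 1)) M} {X X₂ : Vec d}

/-! ### The first order form of the balance condition -/

/-- The balance condition at `p`, as a one-sided first order estimate on the set of points to which
the field `R` contributes a limit vector. -/
lemma IsBalanced.eventually_le [T2Space M] [FirstCountableTopology M] (hbal : IsBalanced φ Γ S)
    (hp : p ∈ S) (hi : p ∈ (𝓡∂ (d + 1)).interior M)
    (hX : (⟨p, X⟩ : TangentBundle (𝓡∂ (d + 1)) M) ∈ closure (raysOff φ Γ S))
    (hX₂ : (⟨p, X₂⟩ : TangentBundle (𝓡∂ (d + 1)) M) ∈ closure (raysOff φ Γ S))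
    (hR : ContinuousAt R p) (hRp : R p = tmk p X) (hproj : ∀ᶠ q in 𝓝 p, (R q).proj = q)
    {ε : ℝ} (hε : 0 < ε) :
    ∀ᶠ q in 𝓝 p, (vel (R q) : TangentSpace (𝓡∂ (d + 1)) q) ∈ limitSet φ Γ S q →
      (φ.dual (a := p) X - φ.dual (a := p) X₂)
        (extChartAt (𝓡∂ (d + 1)) p q - extChartAt (𝓡∂ (d + 1)) p p) ≤
      ε * ‖extChartAt (𝓡∂ (d + 1)) p q - extChartAt (𝓡∂ (d + 1)) p p‖ := by
  set W : Vec d →L[ℝ] ℝ := φ.dual (a := p) X - φ.dual (a := p) X₂ with hW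
  obtain ⟨dir, hdir, hlim⟩ := exists_direction_field (φ := φ) hi
  by_contra hcon
  rw [not_eventually] at hcon
  have hfr : ∃ᶠ q in 𝓝 p, ((vel (R q) : TangentSpace (𝓡∂ (d + 1)) q) ∈ limitSet φ Γ S q ∧
      ε * ‖extChartAt (𝓡∂ (d + 1)) p q - extChartAt (𝓡∂ (d + 1)) p p‖ <
        W (extChartAt (𝓡∂ (d + 1)) p q - extChartAt (𝓡∂ (d + 1)) p p)) ∧
      ((q ≠ p → tmk q (vel (dir q)) = dir q ∧ IsDirection φ q p (vel (dir q))) ∧ (R q).proj = q) :=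
          by
    refine (hcon.and_eventually (hdir.and hproj)).mono ?_
    rintro q ⟨h1, h2⟩
    rw [Classical.not_imp] at h1
    exact ⟨⟨h1.1, not_le.1 h1.2⟩, h2⟩
  -- A sequence of points that violates the estimate, with a limit direction `ξ`.
  obtain ⟨q, hq, hqk⟩ := exists_seq_forall_of_frequently hfr
  set χ := extChartAt (𝓡∂ (d + 1)) p with hχ
  have hne : ∀ k, χ (q k) - χ p ≠ 0 := by
    intro k h0
    have := (hqk k).1.2
    rw [h0, norm_zero, mul_zero, map_zero] at this
    exact lt_irrefl _ this
  have hqp : ∀ k, q k ≠ p := fun k h ↦ hne k (by rw [h, sub_self])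
  set u : ℕ → Vec d := fun k ↦ ‖χ (q k) - χ p‖⁻¹ • (χ (q k) - χ p) with hu
  have husph : ∀ k, u k ∈ Metric.sphere (0 : Vec d) 1 := fun k ↦ by
    simp [hu, norm_smul, hne k]
  have hWu : ∀ k, ε ≤ W (u k) := by
    intro k
    have h1 := (hqk k).1.2
    have h2 : 0 < ‖χ (q k) - χ p‖ := norm_pos_iff.2 (hne k)
    simp only [hu]
    rw [map_smul, smul_eq_mul, ← div_eq_inv_mul, le_div_iff₀ h2]
    exact h1.le
  obtain ⟨ξ, hξ, n, hn, hξlim⟩ := (isCompact_sphere (0 : Vec d) 1).tendsto_subseq husph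
  have hξ0 : ξ ≠ 0 := by rintro rfl; simp at hξ
  have hqn : Tendsto (fun k ↦ q (n k)) atTop (𝓝 p) := hq.comp hn.tendsto_atTop
  have hε0 : Tendsto (fun k ↦ ‖χ (q (n k)) - χ p‖) atTop (𝓝 0) := by
    have h1 := (((continuousAt_extChartAt (I := 𝓡∂ (d + 1)) p).tendsto.comp hqn).sub_const
        (χ p)).norm
    rw [sub_self, norm_zero] at h1
    exact h1
  obtain ⟨κ, hκ, hdlim⟩ := hlim (fun k ↦ q (n k)) (fun k ↦ ‖χ (q (n k)) - χ p‖) ξ hξ0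
    (fun k ↦ norm_pos_iff.2 (hne _)) hε0 hqn hξlim
  -- The minimizing geodesics to `p` start in directions that tend to `-κ ξ`, and there the balance
  -- condition makes the dual of `X` maximal.
  have hgr := hbal p hp (fun k ↦ q (n k)) (fun k ↦ vel (dir (q (n k)))) (fun k ↦ vel (R (q (n k))))
    (-(κ • ξ) : Vec d) X hqn (fun k ↦ ((hqk (n k)).2.1 (hqp _)).2) (fun k ↦ (hqk (n k)).1.1)
    (by
      refine Tendsto.congr (fun k ↦ ?_) hdlim
      exact ((hqk (n k)).2.1 (hqp _)).1.symm)
    (by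
      have h1 : Tendsto (fun k ↦ R (q (n k))) atTop (𝓝 (tmk p X)) := by
        rw [← hRp]; exact hR.tendsto.comp hqn
      refine Tendsto.congr (fun k ↦ ?_) h1
      exact (tmk_vel_of_proj (hqk (n k)).2.2).symm)
    ((mem_limitSet_iff hp).2 hX)
  have h1 : φ.dual (a := p) X₂ (-(κ • ξ) : Vec d) ≤ φ.dual (a := p) X (-(κ • ξ) : Vec d) :=
    hgr.2 ⟨X₂, (mem_limitSet_iff hp).2 hX₂, rfl⟩
  have h2 : 0 ≤ W (-(κ • ξ)) := sub_nonneg.2 h1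
  rw [map_neg, map_smul, smul_eq_mul] at h2
  have h3 : ε ≤ W ξ := ge_of_tendsto ((W.continuous.tendsto ξ).comp hξlim)
    (Eventually.of_forall fun k ↦ hWu _)
  nlinarith [mul_pos hκ (hε.trans_le h3)]

/-- The balance condition for a parametrized neighborhood of `p`, in an arbitrary chart. -/
lemma IsBalanced.eventually_le_param [T2Space M] [FirstCountableTopology M]
    (hbal : IsBalanced φ Γ S)
    {F : Type*} [NormedAddCommGroup F] [NormedSpace ℝ F] {ψ : F → M} {z : F} {a : M}
    (hp : ψ z ∈ S) (hi : ψ z ∈ (𝓡∂ (d + 1)).interior M)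
    (ha : ψ z ∈ (extChartAt (𝓡∂ (d + 1)) a).source)
    {R₁ R₂ : M → TangentBundle (𝓡∂ (d + 1)) M}
    (hX : R₁ (ψ z) ∈ closure (raysOff φ Γ S)) (hX₂ : R₂ (ψ z) ∈ closure (raysOff φ Γ S))
    (hR₁0 : (R₁ (ψ z)).2 ≠ 0) (hR₂0 : (R₂ (ψ z)).2 ≠ 0)
    (hR₁ : ContinuousAt R₁ (ψ z)) (hproj : ∀ᶠ q in 𝓝 (ψ z), (R₁ q).proj = q)
    (hproj₂ : (R₂ (ψ z)).proj = ψ z)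
    (hψ : MDifferentiableAt 𝓘(ℝ, F) (𝓡∂ (d + 1)) ψ z) {ε : ℝ} (hε : 0 < ε) :
    ∀ᶠ z' in 𝓝 z, (vel (R₁ (ψ z')) : TangentSpace (𝓡∂ (d + 1)) (ψ z')) ∈ limitSet φ Γ S (ψ z') →
      (momentum (chartLag φ a) (tChart a (R₁ (ψ z))) - momentum (chartLag φ a)
          (tChart a (R₂ (ψ z))))
        (fderiv ℝ (fun w ↦ extChartAt (𝓡∂ (d + 1)) a (ψ w)) z (z' - z)) ≤ ε * ‖z' - z‖ := by
  set p := ψ z with hpdef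
  have e₁ : tmk p (vel (R₁ p)) = R₁ p := tmk_vel_of_proj hproj.self_of_nhds
  have e₂ : tmk p (vel (R₂ p)) = R₂ p := tmk_vel_of_proj hproj₂
  set W : Vec d →L[ℝ] ℝ := φ.dual (a := p) (vel (R₁ p)) - φ.dual (a := p) (vel (R₂ p)) with hW
  set A : F →L[ℝ] Vec d := mfderiv 𝓘(ℝ, F) (𝓡∂ (d + 1)) ψ z with hA
  have hB := hasFDerivAt_extChartAt_comp hψ.hasMFDerivAt ha
  have hWA : ∀ v, (momentum (chartLag φ a) (tChart a (R₁ p)) - momentum (chartLag φ a)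
      (tChart a (R₂ p)))
      (fderiv ℝ (fun w ↦ extChartAt (𝓡∂ (d + 1)) a (ψ w)) z v) = W (A v) := by
    intro v
    have h1 : fderiv ℝ (fun w ↦ extChartAt (𝓡∂ (d + 1)) a (ψ w)) z v = (coordEquiv ha).symm (A v) :=
        by
      rw [hB.fderiv]; rfl
    have h2 := dual_eq_momentum φ ha (V := vel (R₁ p)) hR₁0 ((coordEquiv ha).symm (A v))
    have h3 := dual_eq_momentum φ ha (V := vel (R₂ p)) hR₂0 ((coordEquiv ha).symm (A v))
    rw [(coordEquiv ha).apply_symm_apply] at h2 h3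
    rw [e₁] at h2
    rw [e₂] at h3
    rw [h1, _root_.sub_apply, ← h2, ← h3]
    rfl
  have hps := mem_extChartAt_source (I := 𝓡∂ (d + 1)) p
  have hD : HasFDerivAt (fun w ↦ extChartAt (𝓡∂ (d + 1)) p (ψ w)) A z := by
    have h1 := hasFDerivAt_extChartAt_comp hψ.hasMFDerivAt hps
    refine h1.congr_fderiv ?_
    ext1 v
    exact tangentCoordChange_self (mem_extChartAt_source p)
  -- `ε'` and `δ` divide the error between the estimate at `p` and the linearization of `ψ`.
  set ε' := ε / (2 * (‖A‖ + 1)) with hε'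
  have hε'0 : 0 < ε' := by positivity
  have h1 := hbal.eventually_le hp hi (X := vel (R₁ p)) (X₂ := vel (R₂ p)) (by
      change tmk p (vel (R₁ p)) ∈ _
      rw [e₁]; exact hX) (by
      change tmk p (vel (R₂ p)) ∈ _
      rw [e₂]; exact hX₂) hR₁ e₁.symm hproj hε'0
  have h2 := hψ.continuousAt.eventually h1
  set δ : ℝ := min 1 (ε / (2 * (‖W‖ + 1))) with hδ
  have hδ0 : 0 < δ := by positivity
  have h3 := (hasFDerivAt_iff_isLittleO.1 hD).def hδ0
  filter_upwards [h2, h3] with z' h4 h5 h6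
  have h7 := h4 h6
  rw [hWA]
  set Δ := extChartAt (𝓡∂ (d + 1)) p (ψ z') - extChartAt (𝓡∂ (d + 1)) p (ψ z) with hΔ
  have h8 : A (z' - z) = Δ - (Δ - A (z' - z)) := by abel
  have h9 : ‖Δ‖ ≤ (‖A‖ + 1) * ‖z' - z‖ := by
    have h10 : Δ = (Δ - A (z' - z)) + A (z' - z) := by abel
    calc ‖Δ‖ ≤ ‖Δ - A (z' - z)‖ + ‖A (z' - z)‖ := by
          conv_lhs => rw [h10]
          exact norm_add_le _ _
      _ ≤ 1 * ‖z' - z‖ + ‖A‖ * ‖z' - z‖ := add_le_add (h5.trans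
          (mul_le_mul_of_nonneg_right (min_le_left _ _) (norm_nonneg _))) (A.le_opNorm _)
      _ = _ := by ring
  have h11 : ε' * ‖Δ‖ ≤ ε / 2 * ‖z' - z‖ := by
    calc ε' * ‖Δ‖ ≤ ε' * ((‖A‖ + 1) * ‖z' - z‖) := mul_le_mul_of_nonneg_left h9 hε'0.le
      _ = ε / 2 * ‖z' - z‖ := by rw [hε']; field_simp
  have h12 : -W (Δ - A (z' - z)) ≤ ε / 2 * ‖z' - z‖ := by
    calc -W (Δ - A (z' - z)) ≤ ‖W (Δ - A (z' - z))‖ := neg_le_abs _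
      _ ≤ ‖W‖ * ‖Δ - A (z' - z)‖ := W.le_opNorm _
      _ ≤ (‖W‖ + 1) * (ε / (2 * (‖W‖ + 1)) * ‖z' - z‖) := by
          refine mul_le_mul (by linarith) (h5.trans (mul_le_mul_of_nonneg_right (min_le_right _ _)
            (norm_nonneg _))) (norm_nonneg _) (by positivity)
      _ = ε / 2 * ‖z' - z‖ := by field_simp
  have h13 : W Δ ≤ ε' * ‖Δ‖ := h7
  rw [h8, map_sub]
  linarith

end Balance

section GraphLemma

set_option linter.unusedSectionVars false

/-! ### A closed set between two open sets, with tangent hyperplanes, is a smooth graph -/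

variable {E : Type*} [NormedAddCommGroup E] [NormedSpace ℝ E]

/-- `A` and `B` are disjoint open sets, `A` is closed downwards along vertical lines in `O`, and at
each point `z` of `O` outside of `A` and `B` the points near `z` outside of `B` lie, up to first
order, in the half space `W z ≤ 0`, those outside of `A` in the half space `W z ≥ 0`. -/
structure IsSeparated (O A B : Set (E × ℝ)) (W : E × ℝ → (E × ℝ →L[ℝ] ℝ)) : Prop where
  isOpen : IsOpen O
  smooth : ContDiffOn ℝ ∞ W O
  isOpen_left : IsOpen A
  isOpen_right : IsOpen B
  disjoint : Disjoint A B
  down : ∀ u t t', (u, t) ∈ A → (u, t') ∈ O → t' ≤ t → (u, t') ∈ A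
  le : ∀ z ∈ O \ (A ∪ B), ∀ ε : ℝ, 0 < ε → ∀ᶠ z' in 𝓝 z, z' ∉ B → W z (z' - z) ≤ ε * ‖z' - z‖
  ge : ∀ z ∈ O \ (A ∪ B), ∀ ε : ℝ, 0 < ε → ∀ᶠ z' in 𝓝 z, z' ∉ A → -(ε * ‖z' - z‖) ≤ W z (z' - z)

namespace IsSeparated

variable {O A B : Set (E × ℝ)} {W : E × ℝ → (E × ℝ →L[ℝ] ℝ)} {u : E} {s : ℝ}

lemma tendsto_vertical (u : E) (s : ℝ) {c : ℝ} :
    Tendsto (fun η : ℝ ↦ (u, s + c * η)) (𝓝[>] 0) (𝓝 (u, s)) := by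
  have : ContinuousAt (fun η : ℝ ↦ (u, s + c * η)) 0 := by fun_prop
  have h2 := this.tendsto
  simp only [mul_zero, add_zero] at h2
  exact h2.mono_left nhdsWithin_le_nhds

/-- The points slightly above a point of the remaining set lie outside of `A`, as `A` is closed
downwards. -/
lemma nonneg (h : IsSeparated O A B W) (hz : (u, s) ∈ O \ (A ∪ B)) : 0 ≤ W (u, s) (0, 1) := by
  by_contra! hneg
  have h1 := (tendsto_vertical u s (c := 1)).eventually
    (h.ge _ hz (-W (u, s) (0, 1) / 2) (by linarith))
  obtain ⟨η, hη, hη0⟩ := (h1.and self_mem_nhdsWithin).exists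
  have hη0' : 0 < η := hη0
  have hmem : (u, s + 1 * η) ∈ A := by
    by_contra hA
    have h2 := hη hA
    have e : ((u, s + 1 * η) - (u, s) : E × ℝ) = η • ((0 : E), (1 : ℝ)) := by
      ext <;> simp
    rw [e, map_smul, norm_smul] at h2
    simp only [Prod.norm_mk, norm_zero, norm_one, Real.norm_eq_abs, abs_of_pos hη0',
        smul_eq_mul] at h2
    norm_num at h2
    nlinarith
  exact hz.2 (Or.inl (h.down _ _ _ hmem hz.1 (by linarith)))

/-- Where the covector is not vertical, the vertical line crosses from `A` to `B`. -/
lemma eventually_below_above (h : IsSeparated O A B W) (hz : (u, s) ∈ O \ (A ∪ B))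
    (hW : W (u, s) (0, 1) ≠ 0) :
    ∀ᶠ η in 𝓝[>] (0 : ℝ), (u, s + (-1) * η) ∈ A ∧ (u, s + 1 * η) ∈ B := by
  have hpos : 0 < W (u, s) (0, 1) := lt_of_le_of_ne (h.nonneg hz) hW.symm
  filter_upwards [(tendsto_vertical u s (c := 1)).eventually
      (h.le _ hz (W (u, s) (0, 1) / 2) (by linarith)),
    (tendsto_vertical u s (c := -1)).eventually
      (h.ge _ hz (W (u, s) (0, 1) / 2) (by linarith)), self_mem_nhdsWithin] with η h1 h2 hη
  have hη0' : 0 < η := hη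
  constructor
  · by_contra hA
    have h3 := h2 hA
    have e : ((u, s + (-1) * η) - (u, s) : E × ℝ) = (-η) • ((0 : E), (1 : ℝ)) := by
      ext <;> simp
    rw [e, map_smul, norm_smul] at h3
    simp only [Prod.norm_mk, norm_zero, norm_one, Real.norm_eq_abs, abs_neg, abs_of_pos hη0',
      smul_eq_mul] at h3
    norm_num at h3
    nlinarith
  · by_contra hB
    have h3 := h1 hB
    have e : ((u, s + 1 * η) - (u, s) : E × ℝ) = η • ((0 : E), (1 : ℝ)) := by
      ext <;> simp
    rw [e, map_smul, norm_smul] at h3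
    simp only [Prod.norm_mk, norm_zero, norm_one, Real.norm_eq_abs, abs_of_pos hη0',
      smul_eq_mul] at h3
    norm_num at h3
    nlinarith

lemma not_lt_of_mem (h : IsSeparated O A B W) {s' : ℝ} (hz : (u, s) ∈ O \ (A ∪ B))
    (hz' : (u, s') ∈ O \ (A ∪ B)) (hW : W (u, s') (0, 1) ≠ 0) : ¬ s < s' := by
  intro hlt
  have hsmall : ∀ᶠ η in 𝓝[>] (0 : ℝ), η < s' - s :=
    nhdsWithin_le_nhds (eventually_lt_nhds (by linarith))
  obtain ⟨η, ⟨hη, -⟩, hη'⟩ := ((h.eventually_below_above hz' hW).and hsmall).exists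
  exact hz.2 (Or.inl (h.down _ _ _ hη hz.1 (by linarith)))

/-- Nearby vertical lines meet the remaining set as well. -/
lemma eventually_exists (h : IsSeparated O A B W) (hz : (u, s) ∈ O \ (A ∪ B))
    (hW : W (u, s) (0, 1) ≠ 0) {η₀ : ℝ} (hη₀ : 0 < η₀) :
    ∀ᶠ u' in 𝓝 u, ∃ t ∈ Ioo (s - η₀) (s + η₀), (u', t) ∈ O \ (A ∪ B) := by
  obtain ⟨r, hr, hball⟩ := Metric.isOpen_iff.1 h.isOpen _ hz.1
  have hsmall : ∀ᶠ η in 𝓝[>] (0 : ℝ), η < min η₀ r :=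
    nhdsWithin_le_nhds (eventually_lt_nhds (lt_min hη₀ hr))
  obtain ⟨η, ⟨⟨hA, hB⟩, hη⟩, hη0⟩ :=
    (((h.eventually_below_above hz hW).and hsmall).and self_mem_nhdsWithin).exists
  have hη0' : 0 < η := hη0
  have hη₁ := hη.trans_le (min_le_left _ _)
  have hη₂ := hη.trans_le (min_le_right _ _)
  have cont : ∀ t : ℝ, Continuous fun u' : E ↦ (u', t) := fun t ↦ by fun_prop
  filter_upwards [(cont _).continuousAt.eventually (h.isOpen_left.mem_nhds hA),
    (cont _).continuousAt.eventually (h.isOpen_right.mem_nhds hB),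
    Metric.ball_mem_nhds u hr] with u' hA' hB' hu'
  have hc : Continuous fun t : ℝ ↦ (u', t) := by fun_prop
  -- Otherwise a segment would be covered by the disjoint open sets `A` and `B` and meet both.
  by_contra! hcon
  have hsub : Icc (s - η) (s + η) ⊆ ((fun t : ℝ ↦ (u', t)) ⁻¹' A) ∪ ((fun t : ℝ ↦ (u', t)) ⁻¹' B) :=
      by
    intro t ht
    by_contra hn
    refine hcon t ⟨by linarith [ht.1], by linarith [ht.2]⟩ ⟨hball ?_, hn⟩
    rw [Metric.mem_ball, Prod.dist_eq]
    refine max_lt hu' ?_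
    rw [Real.dist_eq]
    exact (abs_le.2 ⟨by linarith [ht.1], by linarith [ht.2]⟩ : |t - s| ≤ η).trans_lt hη₂
  obtain ⟨t, -, htA, htB⟩ := isPreconnected_Icc _ _ (h.isOpen_left.preimage hc)
    (h.isOpen_right.preimage hc) hsub
    ⟨s - η, left_mem_Icc.2 (by linarith), by
      have : s - η = s + (-1) * η := by ring
      rw [this]; exact hA'⟩
    ⟨s + η, right_mem_Icc.2 (by linarith), by
      have : s + η = s + 1 * η := by ring
      rw [this]; exact hB'⟩
  exact disjoint_left.1 h.disjoint htA htB

/-- A vertical line meets the remaining set at most once. -/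
lemma eq_of_mem (h : IsSeparated O A B W) {s' : ℝ} (hz : (u, s) ∈ O \ (A ∪ B))
    (hz' : (u, s') ∈ O \ (A ∪ B)) (hW : W (u, s) (0, 1) ≠ 0) (hW' : W (u, s') (0, 1) ≠ 0) :
    s = s' :=
  le_antisymm (not_lt.1 (h.not_lt_of_mem hz' hz hW)) (not_lt.1 (h.not_lt_of_mem hz hz' hW'))

/-- The tangent hyperplane to the graph. -/
lemma hasFDerivAt_graph (h : IsSeparated O A B W) {g : E → ℝ} (hz : (u, g u) ∈ O \ (A ∪ B))
    (hW : W (u, g u) (0, 1) ≠ 0) (hev : ∀ᶠ u' in 𝓝 u, (u', g u') ∈ O \ (A ∪ B))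
    (hg : ContinuousAt g u) :
    HasFDerivAt g (-(W (u, g u) (0, 1))⁻¹ •
      (W (u, g u)).comp (ContinuousLinearMap.inl ℝ E ℝ)) u := by
  set w := W (u, g u) (0, 1) with hw
  have hpos : 0 < w := lt_of_le_of_ne (h.nonneg hz) hW.symm
  set L : E →L[ℝ] ℝ := -w⁻¹ • (W (u, g u)).comp (ContinuousLinearMap.inl ℝ E ℝ) with hL
  have hLv : ∀ v, L v = -w⁻¹ * W (u, g u) (v, 0) := fun v ↦ rfl
  rw [hasFDerivAt_iff_isLittleO, Asymptotics.isLittleO_iff]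
  intro c hc
  -- The bound `w / 2` lets the term in the error `R` be absorbed on the left in `key`.
  set ε := min (w / 2) (w * c / (2 * (1 + ‖L‖))) with hε
  have hL0 : 0 ≤ ‖L‖ := norm_nonneg _
  have hεpos : 0 < ε := lt_min (by positivity) (by positivity)
  have hgraph : ContinuousAt (fun u' ↦ (u', g u')) u := continuousAt_id.prodMk hg
  filter_upwards [hev, hgraph.eventually (h.le _ hz ε hεpos),
    hgraph.eventually (h.ge _ hz ε hεpos)] with u' hu' h1 h2
  have h1' := h1 fun hB ↦ hu'.2 (Or.inr hB)
  have h2' := h2 fun hA ↦ hu'.2 (Or.inl hA)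
  have e : ((u', g u') - (u, g u) : E × ℝ) = (u' - u, 0) + (g u' - g u) • ((0 : E), (1 : ℝ)) := by
    ext <;> simp
  have hn : ‖((u', g u') - (u, g u) : E × ℝ)‖ ≤ ‖u' - u‖ + |g u' - g u| := by
    rw [Prod.mk_sub_mk, Prod.norm_mk]
    exact max_le (by linarith [abs_nonneg (g u' - g u)]) (by
      rw [Real.norm_eq_abs]; linarith [norm_nonneg (u' - u)])
  set R := g u' - g u - L (u' - u) with hR
  have hWv : W (u, g u) ((u', g u') - (u, g u)) = w * R := by
    rw [e, map_add, map_smul, hR, hLv, smul_eq_mul, ← hw]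
    field_simp
    ring
  rw [hWv] at h1' h2'
  have habs : w * |R| ≤ ε * (‖u' - u‖ + |g u' - g u|) := by
    rw [← abs_of_pos hpos, ← abs_mul]
    refine (abs_le.2 ⟨h2', h1'⟩).trans ?_
    exact mul_le_mul_of_nonneg_left hn hεpos.le
  have hdg : |g u' - g u| ≤ ‖L‖ * ‖u' - u‖ + |R| := by
    have : g u' - g u = L (u' - u) + R := by rw [hR]; ring
    rw [this]
    exact (abs_add_le _ _).trans (by gcongr; exact L.le_opNorm _)
  have hε1 : ε ≤ w / 2 := min_le_left _ _
  have hε2 : ε * (2 * (1 + ‖L‖)) ≤ w * c :=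
    (le_div_iff₀ (by positivity)).1 (min_le_right _ _)
  have hu0 := norm_nonneg (u' - u)
  have key : w * |R| ≤ ε * ((1 + ‖L‖) * ‖u' - u‖) + w / 2 * |R| := by
    calc w * |R| ≤ ε * (‖u' - u‖ + (‖L‖ * ‖u' - u‖ + |R|)) :=
          habs.trans (by gcongr)
      _ = ε * ((1 + ‖L‖) * ‖u' - u‖) + ε * |R| := by ring
      _ ≤ _ := by gcongr
  have key2 : w * |R| ≤ w * (c * ‖u' - u‖) := by
    have := mul_le_mul_of_nonneg_right hε2 hu0
    nlinarith
  rw [Real.norm_eq_abs]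
  exact le_of_mul_le_mul_left key2 hpos

/-- Differentiating the relation between a graph and its tangent hyperplanes shows that the graph
is as smooth as the hyperplanes. -/
lemma contDiffOn_of_hasFDerivAt {g : E → ℝ} {V : Set E} (hV : IsOpen V) (hWs : ContDiffOn ℝ ∞ W O)
    (hmem : ∀ u ∈ V, (u, g u) ∈ O) (hne : ∀ u ∈ V, W (u, g u) (0, 1) ≠ 0)
    (hg : ∀ u ∈ V, HasFDerivAt g (-(W (u, g u) (0, 1))⁻¹ •
      (W (u, g u)).comp (ContinuousLinearMap.inl ℝ E ℝ)) u) : ContDiffOn ℝ ∞ g V := by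
  rw [contDiffOn_infty]
  intro n
  induction n with
  | zero =>
    exact contDiffOn_zero.2 fun u hu ↦ (hg u hu).continuousAt.continuousWithinAt
  | succ n ih =>
    rw [Nat.cast_add, Nat.cast_one, contDiffOn_succ_iff_fderiv_of_isOpen hV]
    refine ⟨fun u hu ↦ (hg u hu).differentiableAt.differentiableWithinAt, by simp, ?_⟩
    have hWg : ContDiffOn ℝ n (fun u ↦ W (u, g u)) V :=
      (hWs.of_le (by exact_mod_cast le_top)).comp (contDiffOn_id.prodMk ih) hmem
    have h1 : ContDiffOn ℝ n (fun u ↦ -(W (u, g u) (0, 1))⁻¹) V :=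
      ((hWg.clm_apply contDiffOn_const).inv hne).neg
    have h2 : ContDiffOn ℝ n (fun u ↦ (W (u, g u)).comp (ContinuousLinearMap.inl ℝ E ℝ)) V :=
      hWg.clm_comp contDiffOn_const
    exact (h1.smul h2).congr fun u hu ↦ (hg u hu).fderiv

/-- The remaining set is a smooth graph near each of its points where its tangent hyperplane is
not vertical. -/
lemma exists_graph (h : IsSeparated O A B W) (h0 : (0 : E × ℝ) ∈ O \ (A ∪ B))
    (hW : W 0 (0, 1) ≠ 0) :
    ∃ (V : Set E) (δ : ℝ) (g : E → ℝ), IsOpen V ∧ 0 ∈ V ∧ 0 < δ ∧ V ×ˢ Ioo (-δ) δ ⊆ O ∧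
      ContDiffOn ℝ ∞ g V ∧ MapsTo g V (Ioo (-δ) δ) ∧
      (∀ u ∈ V, ∀ t ∈ Ioo (-δ) δ, (u, t) ∉ A ∪ B ↔ t = g u) ∧
      ∀ u ∈ V, ∃ L : E →L[ℝ] ℝ, HasFDerivAt g L u ∧ ∀ v, W (u, g u) (v, L v) = 0 := by
  have hWc : ContinuousOn (fun z ↦ W z (0, 1)) O :=
      h.smooth.continuousOn.clm_apply continuousOn_const
  have hO' : O ∩ (fun z ↦ W z (0, 1)) ⁻¹' {0}ᶜ ∈ 𝓝 (0 : E × ℝ) :=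
    (hWc.isOpen_inter_preimage h.isOpen isOpen_compl_singleton).mem_nhds ⟨h0.1, hW⟩
  rw [show (0 : E × ℝ) = (0, 0) from rfl] at hO' h0 hW
  rw [nhds_prod_eq, mem_prod_iff] at hO'
  obtain ⟨V₁, hV₁, I, hI, hsub⟩ := hO'
  obtain ⟨δ, hδ, hδI⟩ := Metric.mem_nhds_iff.1 hI
  rw [Real.ball_eq_Ioo, zero_sub, zero_add] at hδI
  obtain ⟨V, hVsub, hVo, h0V⟩ := mem_nhds_iff.1 (inter_mem hV₁ (h.eventually_exists h0 hW hδ))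
  have hbox : ∀ u ∈ V, ∀ t ∈ Ioo (-δ) δ, (u, t) ∈ O ∧ W (u, t) (0, 1) ≠ 0 := fun u hu t ht ↦
    hsub ⟨(hVsub hu).1, hδI ht⟩
  have hex : ∀ u ∈ V, ∃ t, t ∈ Ioo (-δ) δ ∧ (u, t) ∈ O \ (A ∪ B) := fun u hu ↦ by
    obtain ⟨t, ht, ht'⟩ := (hVsub hu).2
    rw [zero_sub, zero_add] at ht
    exact ⟨t, ht, ht'⟩
  choose! g hgI hg using hex
  -- Continuity of `g`: nearby lines meet the set at nearly the same height, and only once.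
  have hgc : ∀ u ∈ V, ContinuousAt g u := by
    intro u hu
    rw [Metric.continuousAt_iff']
    intro ε hε
    have hI' : ∃ r > 0, Ioo (g u - r) (g u + r) ⊆ Ioo (-δ) δ := by
      obtain ⟨r, hr, hr'⟩ := Metric.isOpen_iff.1 isOpen_Ioo _ (hgI u hu)
      exact ⟨r, hr, by rwa [Real.ball_eq_Ioo] at hr'⟩
    obtain ⟨r, hr, hr'⟩ := hI'
    filter_upwards [hVo.mem_nhds hu, h.eventually_exists (hg u hu) (hbox u hu _ (hgI u hu)).2
      (lt_min hε hr)] with u' hu' hex'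
    obtain ⟨t, ht, htS⟩ := hex'
    have h1 := min_le_left ε r
    have h2 := min_le_right ε r
    have htI : t ∈ Ioo (-δ) δ := hr' ⟨by linarith [ht.1], by linarith [ht.2]⟩
    have : g u' = t := h.eq_of_mem (hg u' hu') htS (hbox u' hu' _ (hgI u' hu')).2
        (hbox u' hu' _ htI).2
    rw [this, Real.dist_eq, abs_lt]
    constructor <;> linarith [ht.1, ht.2]
  have hgd : ∀ u ∈ V, HasFDerivAt g (-(W (u, g u) (0, 1))⁻¹ •
      (W (u, g u)).comp (ContinuousLinearMap.inl ℝ E ℝ)) u := fun u hu ↦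
    h.hasFDerivAt_graph (hg u hu) (hbox u hu _ (hgI u hu)).2
      (by filter_upwards [hVo.mem_nhds hu] with u' hu' using hg u' hu') (hgc u hu)
  refine ⟨V, δ, g, hVo, h0V, hδ, fun z hz ↦ (hbox z.1 hz.1 z.2 hz.2).1,
    contDiffOn_of_hasFDerivAt hVo h.smooth (fun u hu ↦ (hg u hu).1)
      (fun u hu ↦ (hbox u hu _ (hgI u hu)).2) hgd, hgI, fun u hu t ht ↦ ⟨fun hn ↦ ?_, ?_⟩,
    fun u hu ↦ ⟨_, hgd u hu, fun v ↦ ?_⟩⟩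
  · exact h.eq_of_mem ⟨(hbox u hu t ht).1, hn⟩ (hg u hu) (hbox u hu t ht).2
      (hbox u hu _ (hgI u hu)).2
  · rintro rfl
    exact (hg u hu).2
  · have hne := (hbox u hu _ (hgI u hu)).2
    set c : ℝ := (-(W (u, g u) (0, 1))⁻¹ • (W (u, g u)).comp
        (ContinuousLinearMap.inl ℝ E ℝ)) v with hc
    have hc' : c = -(W (u, g u) (0, 1))⁻¹ * W (u, g u) (v, 0) := rfl
    have e : ((v, c) : E × ℝ) = (v, 0) + c • ((0 : E), (1 : ℝ)) := by ext <;> simp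
    rw [e, map_add, map_smul, smul_eq_mul, hc']
    field_simp
    ring

end IsSeparated

end GraphLemma

section FlowCoordinates

set_option linter.unusedSectionVars false

variable {d : ℕ} {M : Type*} [TopologicalSpace M] [ChartedSpace (EuclideanHalfSpace (d + 1)) M]
  [IsManifold (𝓡∂ (d + 1)) ∞ M]
variable {φ : FinslerMetric d M} {Γ : (x : M) → TangentSpace (𝓡∂ (d + 1)) x} {x₀ : M} {S : Set M}

/-! ### Coordinates along the integral curves of a local field -/

/-- The geodesic vector field is the vertical coordinate field, and the projection maps it to the
vector itself. -/
lemma IsRegularSet.hasMFDerivAt_vertical [T2Space M] {𝒪 : Set (TangentBundle (𝓡∂ (d + 1)) M)}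
    {O : Set (BVec d × ℝ)} (h : IsRegularSet φ Γ x₀ 𝒪 O) (hΓ : IsInwardField Γ)
    {z : BVec d × ℝ} (hz : z ∈ O)
    {A : TangentSpace 𝓘(ℝ, BVec d × ℝ) z →L[ℝ] TangentSpace (𝓡∂ (d + 1)) (rayMap φ Γ x₀ z).proj}
    (hA : HasMFDerivAt 𝓘(ℝ, BVec d × ℝ) (𝓡∂ (d + 1)) (fun z ↦ (rayMap φ Γ x₀ z).proj) z A) :
    (show BVec d × ℝ →L[ℝ] Vec d from A) (0, 1) = vel (rayMap φ Γ x₀ z) := by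
  have hq := mem_extChartAt_source (I := 𝓡∂ (d + 1)) (rayMap φ Γ x₀ z).proj
  have h1 := hasFDerivAt_extChartAt_comp hA hq
  have hline : HasDerivAt (fun t : ℝ ↦ (z.1, t)) ((0 : BVec d), (1 : ℝ)) z.2 :=
    (hasDerivAt_const z.2 z.1).prodMk (hasDerivAt_id z.2)
  have h2 := HasFDerivAt.comp_hasDerivAt (f := fun t : ℝ ↦ (z.1, t)) z.2 h1 hline
  have hR := isRay_rayFlow hΓ (h.dom z hz)
  have h3 := (hR.2.2.1.2 z.2 (right_mem_Icc.2 (h.pos z hz).le)).1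
  have h4 := (uniqueDiffOn_Icc (h.pos z hz) z.2 (right_mem_Icc.2 (h.pos z hz).le)).eq_deriv _
    h2.hasDerivWithinAt h3
  have h5 : (coordEquiv hq).symm ((show BVec d × ℝ →L[ℝ] Vec d from A) (0, 1)) =
      (coordEquiv hq).symm (vel (rayMap φ Γ x₀ z)) := h4
  exact (coordEquiv hq).symm.injective h5

namespace IsLocalField

variable {O : Set (BVec d × ℝ)} {U : Set M} {κ : M → BVec d × ℝ}

lemma mdifferentiableAt_proj (h : IsLocalField φ Γ x₀ O U κ) {z : BVec d × ℝ} (hz : z ∈ O) :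
    MDifferentiableAt 𝓘(ℝ, BVec d × ℝ) (𝓡∂ (d + 1)) (fun z ↦ (rayMap φ Γ x₀ z).proj) z :=
  (h.regular.smooth_proj.contMDiffAt (h.regular.isOpen.mem_nhds hz)).mdifferentiableAt (by simp)

/-- The projection of `rayMap` as a homeomorphism. -/
noncomputable def toHomeomorph (h : IsLocalField φ Γ x₀ O U κ) :
    OpenPartialHomeomorph (BVec d × ℝ) M where
  toFun z := (rayMap φ Γ x₀ z).proj
  invFun := κ
  source := O
  target := U
  map_source' := h.map_mem
  map_target' := h.inv_mem
  left_inv' := h.left_inv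
  right_inv' := h.right_inv
  open_source := h.regular.isOpen
  open_target := h.isOpen
  continuousOn_toFun := h.regular.smooth_proj.continuousOn
  continuousOn_invFun := h.smooth.continuousOn

/-- Following the rays of a local field from a transversal hypersurface gives coordinates. -/
lemma exists_flowCoordinates [T2Space M] (h : IsLocalField φ Γ x₀ O U κ) (hΓ : IsInwardField Γ)
    {σ : BVec d → M} {W : Set (BVec d)} (hW : IsOpen W) (h0W : 0 ∈ W)
    (hσ : ContMDiffOn (𝓡 d) (𝓡∂ (d + 1)) ∞ σ W) (hσU : σ 0 ∈ U)
    (hinj : Function.Injective (mfderiv (𝓡 d) (𝓡∂ (d + 1)) σ 0))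
    (htrans : (vel (rayMap φ Γ x₀ (κ (σ 0))) : TangentSpace (𝓡∂ (d + 1)) (σ 0)) ∉
      range (mfderiv (𝓡 d) (𝓡∂ (d + 1)) σ 0)) :
    ∃ H : OpenPartialHomeomorph (BVec d × ℝ) M, 0 ∈ H.source ∧ H.target ⊆ U ∧
      ContMDiffOn 𝓘(ℝ, BVec d × ℝ) (𝓡∂ (d + 1)) ∞ H H.source ∧
      ContMDiffOn (𝓡∂ (d + 1)) 𝓘(ℝ, BVec d × ℝ) ∞ H.symm H.target ∧
      ∀ z ∈ H.source, z.1 ∈ W ∧ σ z.1 ∈ U ∧ κ (σ z.1) + (0, z.2) ∈ O ∧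
        H z = (rayMap φ Γ x₀ (κ (σ z.1) + (0, z.2))).proj := by
  set W' := W ∩ σ ⁻¹' U with hW'
  have hW'o : IsOpen W' := hσ.continuousOn.isOpen_inter_preimage hW h.isOpen
  have hκσ : ContDiffOn ℝ ∞ (fun u ↦ κ (σ u)) W' :=
    (h.smooth.comp (hσ.mono inter_subset_left) fun u hu ↦ hu.2).contDiffOn
  set g : BVec d × ℝ → BVec d × ℝ := fun z ↦ κ (σ z.1) + (0, z.2) with hg
  have hgs : ContDiffOn ℝ ∞ g (W' ×ˢ univ) :=
    (hκσ.comp contDiffOn_fst fun z hz ↦ hz.1).add (contDiffOn_const.prodMk contDiffOn_snd)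
  set Ω := (W' ×ˢ univ) ∩ g ⁻¹' O with hΩ
  have hΩo : IsOpen Ω :=
    hgs.continuousOn.isOpen_inter_preimage (hW'o.prod isOpen_univ) h.regular.isOpen
  have hg0 : g 0 = κ (σ 0) := by simp [hg]
  have h0Ω : (0 : BVec d × ℝ) ∈ Ω :=
    ⟨⟨⟨h0W, hσU⟩, mem_univ _⟩, by rw [mem_preimage, hg0]; exact h.inv_mem _ hσU⟩
  set D := fderiv ℝ (fun u ↦ κ (σ u)) 0 with hD
  have hDd : HasFDerivAt (fun u ↦ κ (σ u)) D 0 :=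
    ((hκσ.contDiffAt (hW'o.mem_nhds ⟨h0W, hσU⟩)).differentiableAt (by simp)).hasFDerivAt
  set G : BVec d × ℝ →L[ℝ] BVec d × ℝ := D.comp (ContinuousLinearMap.fst ℝ (BVec d) ℝ) +
    (ContinuousLinearMap.inr ℝ (BVec d) ℝ).comp (ContinuousLinearMap.snd ℝ (BVec d) ℝ) with hG
  have hGd : HasFDerivAt g G 0 := by
    refine HasFDerivAt.add ?_ ?_
    · exact HasFDerivAt.comp (g := fun u ↦ κ (σ u)) (f := Prod.fst) (0 : BVec d × ℝ) hDd
        (ContinuousLinearMap.fst ℝ (BVec d) ℝ).hasFDerivAt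
    · exact ((ContinuousLinearMap.inr ℝ (BVec d) ℝ).comp
        (ContinuousLinearMap.snd ℝ (BVec d) ℝ)).hasFDerivAt
  -- the derivative of the projection sends `G (v, s)` to `dσ v + s Y`
  have hP := (h.mdifferentiableAt_proj (h.inv_mem _ hσU)).hasMFDerivAt
  set A : BVec d × ℝ →L[ℝ] Vec d := mfderiv 𝓘(ℝ, BVec d × ℝ) (𝓡∂ (d + 1))
    (fun z ↦ (rayMap φ Γ x₀ z).proj) (κ (σ 0)) with hA
  have hAv : A (0, 1) = vel (rayMap φ Γ x₀ (κ (σ 0))) :=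
    h.regular.hasMFDerivAt_vertical hΓ (h.inv_mem _ hσU) hP
  set B : BVec d →L[ℝ] Vec d := mfderiv (𝓡 d) (𝓡∂ (d + 1)) σ 0 with hB
  have hAD : A.comp D = B := by
    have h1 := HasMFDerivAt.comp (0 : BVec d) hP hDd.hasMFDerivAt
    have h2 : σ =ᶠ[𝓝 0] (fun z ↦ (rayMap φ Γ x₀ z).proj) ∘ fun u ↦ κ (σ u) := by
      filter_upwards [hW'o.mem_nhds ⟨h0W, hσU⟩] with u hu
      exact (h.right_inv _ hu.2).symm
    exact (h1.congr_of_eventuallyEq h2).mfderiv.symm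
  have hinjG : Function.Injective G := by
    rw [injective_iff_map_eq_zero]
    rintro ⟨v, s⟩ hvs
    have h1 : D v + (0, s) = 0 := hvs
    have h2 : B v + s • vel (rayMap φ Γ x₀ (κ (σ 0))) = 0 := by
      have h3 := congrArg A h1
      have e : ((0 : BVec d), s) = s • ((0 : BVec d), (1 : ℝ)) := by ext <;> simp
      rw [e, map_add, map_smul, map_zero, hAv] at h3
      rwa [← hAD]
    have hs : s = 0 := by
      by_contra hs
      refine htrans ⟨(-s⁻¹) • v, ?_⟩
      change B ((-s⁻¹) • v) = _
      rw [map_smul, eq_neg_of_add_eq_zero_left h2, smul_neg, neg_smul, neg_neg, smul_smul,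
        inv_mul_cancel₀ hs, one_smul]
    subst hs
    rw [zero_smul, add_zero] at h2
    have hv : v = 0 := hinj (h2.trans (map_zero B).symm)
    rw [hv]; rfl
  have hbij : Function.Bijective G :=
    ⟨hinjG, (LinearMap.injective_iff_surjective (f := (G : BVec d × ℝ →ₗ[ℝ] BVec d × ℝ))).1 hinjG⟩
  obtain ⟨K, hKg, h0K, hKΩ, hKs⟩ := exists_smooth_local_inverse hΩo
    (hgs.mono inter_subset_left) h0Ω hGd hbij
  have hcoe : ∀ z, (K.trans h.toHomeomorph) z = (rayMap φ Γ x₀ (g z)).proj := fun z ↦ by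
    rw [OpenPartialHomeomorph.coe_trans, Function.comp_apply, hKg]; rfl
  refine ⟨K.trans h.toHomeomorph, ?_, ?_, ?_, ?_, ?_⟩
  · rw [OpenPartialHomeomorph.trans_source]
    exact ⟨h0K, by rw [mem_preimage, hKg]; exact h0Ω.2⟩
  · rw [OpenPartialHomeomorph.trans_target]; exact inter_subset_left
  · refine ContMDiffOn.congr ?_ fun z _ ↦ hcoe z
    rw [OpenPartialHomeomorph.trans_source]
    exact h.regular.smooth_proj.comp ((hgs.mono fun z hz ↦ (hKΩ hz.1).1).contMDiffOn)
      fun z hz ↦ (hKΩ hz.1).2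
  · rw [OpenPartialHomeomorph.trans_target]
    have h1 : ContMDiffOn (𝓡∂ (d + 1)) 𝓘(ℝ, BVec d × ℝ) ∞ (fun q ↦ K.symm (κ q))
        (h.toHomeomorph.target ∩ h.toHomeomorph.symm ⁻¹' K.target) :=
      hKs.contMDiffOn.comp (h.smooth.mono inter_subset_left) fun q hq ↦ hq.2
    exact h1
  · intro z hz
    rw [OpenPartialHomeomorph.trans_source] at hz
    have h1 := hKΩ hz.1
    exact ⟨h1.1.1.1, h1.1.1.2, h1.2, hcoe z⟩

end IsLocalField

end FlowCoordinates

section FlowGraph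

set_option linter.unusedSectionVars false

variable {d : ℕ} {M : Type*} [TopologicalSpace M] [ChartedSpace (EuclideanHalfSpace (d + 1)) M]
  [IsManifold (𝓡∂ (d + 1)) ∞ M]
variable {φ : FinslerMetric d M} {Γ : (x : M) → TangentSpace (𝓡∂ (d + 1)) x} {S : Set M}

/-! ### The balanced condition makes `S` a graph -/

/-- In the coordinates `H : W × (-δ, δ) → M`, the set `C` is the graph of the smooth function
`g`. -/
structure IsGraphIn (C : Set M) (W : Set (BVec d)) (δ : ℝ)
    (H : OpenPartialHomeomorph (BVec d × ℝ) M) (g : BVec d → ℝ) : Prop where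
  isOpen : IsOpen W
  source_eq : H.source = W ×ˢ Ioo (-δ) δ
  smooth : ContMDiffOn 𝓘(ℝ, BVec d × ℝ) (𝓡∂ (d + 1)) ∞ H H.source
  smooth_symm : ContMDiffOn (𝓡∂ (d + 1)) 𝓘(ℝ, BVec d × ℝ) ∞ H.symm H.target
  smooth_graph : ContDiffOn ℝ ∞ g W
  mapsTo : MapsTo g W (Ioo (-δ) δ)
  inter_target : C ∩ H.target = (fun u ↦ H (u, g u)) '' W

/-- The difference of the duals of two fields, pulled back by `H`. -/
noncomputable def pulledCovector (φ : FinslerMetric d M) (a : M)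
    (R₁ R₂ : M → TangentBundle (𝓡∂ (d + 1)) M) (H : BVec d × ℝ → M) (z : BVec d × ℝ) :
    BVec d × ℝ →L[ℝ] ℝ :=
  (momentum (chartLag φ a) (tChart a (R₁ (H z))) - momentum (chartLag φ a)
      (tChart a (R₂ (H z)))).comp
    (fderiv ℝ (fun w ↦ extChartAt (𝓡∂ (d + 1)) a (H w)) z)

/-- In terms of tangent vectors,
    the pulled back covector is the difference of the duals at the image
of the vector. -/
lemma pulledCovector_apply {a : M} {R₁ R₂ : M → TangentBundle (𝓡∂ (d + 1)) M} {H : BVec d × ℝ → M}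
    {z : BVec d × ℝ} (ha : H z ∈ (extChartAt (𝓡∂ (d + 1)) a).source)
    (h₁ : (R₁ (H z)).proj = H z) (h₂ : (R₂ (H z)).proj = H z)
    (hR₁ : (R₁ (H z)).2 ≠ 0) (hR₂ : (R₂ (H z)).2 ≠ 0)
    {A : TangentSpace 𝓘(ℝ, BVec d × ℝ) z →L[ℝ] TangentSpace (𝓡∂ (d + 1)) (H z)}
    (hA : HasMFDerivAt 𝓘(ℝ, BVec d × ℝ) (𝓡∂ (d + 1)) H z A) (v : BVec d × ℝ) :
    pulledCovector φ a R₁ R₂ H z v =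
      (φ.dual (a := H z) (vel (R₁ (H z))) - φ.dual (a := H z) (vel (R₂ (H z))))
        ((show BVec d × ℝ →L[ℝ] Vec d from A) v) := by
  have e₁ : tmk (H z) (vel (R₁ (H z))) = R₁ (H z) := tmk_vel_of_proj h₁
  have e₂ : tmk (H z) (vel (R₂ (H z))) = R₂ (H z) := tmk_vel_of_proj h₂
  have hd := (hasFDerivAt_extChartAt_comp hA ha).fderiv
  set w : Vec d := (show BVec d × ℝ →L[ℝ] Vec d from A) v with hw
  have h3 : fderiv ℝ (fun w ↦ extChartAt (𝓡∂ (d + 1)) a (H w)) z v = (coordEquiv ha).symm w := by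
    rw [hd]; rfl
  have k₁ := dual_eq_momentum φ ha (V := vel (R₁ (H z))) hR₁ ((coordEquiv ha).symm w)
  have k₂ := dual_eq_momentum φ ha (V := vel (R₂ (H z))) hR₂ ((coordEquiv ha).symm w)
  rw [e₁, ContinuousLinearEquiv.apply_symm_apply] at k₁
  rw [e₂, ContinuousLinearEquiv.apply_symm_apply] at k₂
  rw [pulledCovector, ContinuousLinearMap.comp_apply, h3, _root_.sub_apply, ← k₁, ← k₂]
  rfl

lemma contDiffOn_pulledCovector {a : M} {R₁ R₂ : M → TangentBundle (𝓡∂ (d + 1)) M}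
    {H : BVec d × ℝ → M} {O : Set (BVec d × ℝ)} {U : Set M} (hO : IsOpen O)
    (hH : ContMDiffOn 𝓘(ℝ, BVec d × ℝ) (𝓡∂ (d + 1)) ∞ H O) (hOU : MapsTo H O U)
    (ha : MapsTo H O (extChartAt (𝓡∂ (d + 1)) a).source)
    (h₁ : ∀ q ∈ U, (R₁ q).proj = q) (h₂ : ∀ q ∈ U, (R₂ q).proj = q)
    (hR₁ : ∀ q ∈ U, (R₁ q).2 ≠ 0) (hR₂ : ∀ q ∈ U, (R₂ q).2 ≠ 0)
    (hs₁ : ContMDiffOn (𝓡∂ (d + 1)) (𝓡∂ (d + 1)).tangent ∞ R₁ U)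
    (hs₂ : ContMDiffOn (𝓡∂ (d + 1)) (𝓡∂ (d + 1)).tangent ∞ R₂ U) :
    ContDiffOn ℝ ∞ (pulledCovector φ a R₁ R₂ H) O := by
  have key : ∀ R : M → TangentBundle (𝓡∂ (d + 1)) M, (∀ q ∈ U, (R q).proj = q) →
      (∀ q ∈ U, (R q).2 ≠ 0) → ContMDiffOn (𝓡∂ (d + 1)) (𝓡∂ (d + 1)).tangent ∞ R U →
      ContDiffOn ℝ ∞ (fun z ↦ momentum (chartLag φ a) (tChart a (R (H z)))) O := by
    intro R h hR hs
    have hsrc : ∀ z ∈ O, R (H z) ∈ (tChart a).source := fun z hz ↦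
      mem_tChart_source.2 (by rw [h _ (hOU hz)]; exact ha hz)
    have h1 : ContDiffOn ℝ ∞ (fun z ↦ tChart a (R (H z))) O :=
      ((contMDiffOn_tChart a).comp (hs.comp hH hOU) hsrc).contDiffOn
    refine (localLagrangian φ a).contDiffOn_momentum.comp h1 fun z hz ↦ ?_
    exact ⟨(mem_tChart_target.1 ((tChart a).map_source (hsrc z hz))),
      (tChart_snd_ne_zero (hsrc z hz)).2 (hR _ (hOU hz))⟩
  have hchart : ContDiffOn ℝ ∞ (fun w ↦ extChartAt (𝓡∂ (d + 1)) a (H w)) O := by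
    have h1 : ContMDiffOn (𝓡∂ (d + 1)) 𝓘(ℝ, Vec d) ∞ (extChartAt (𝓡∂ (d + 1)) a)
        (extChartAt (𝓡∂ (d + 1)) a).source := by
      rw [extChartAt_source]; exact contMDiffOn_extChartAt
    exact (h1.comp hH ha).contDiffOn
  exact ((key R₁ h₁ hR₁ hs₁).sub (key R₂ h₂ hR₂ hs₂)).clm_comp
    (hchart.fderiv_of_isOpen hO (by norm_cast))

end FlowGraph

section FlowGraphExistence

set_option linter.unusedSectionVars false

variable {d : ℕ} {M : Type*} [TopologicalSpace M] [ChartedSpace (EuclideanHalfSpace (d + 1)) M]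
  [IsManifold (𝓡∂ (d + 1)) ∞ M]
variable {φ : FinslerMetric d M} {Γ : (x : M) → TangentSpace (𝓡∂ (d + 1)) x} {S : Set M}

lemma IsLocalField.ne_zero [T2Space M] {x₀ : M} {O : Set (BVec d × ℝ)} {U : Set M}
    {κ : M → BVec d × ℝ} (h : IsLocalField φ Γ x₀ O U κ) (hΓ : IsInwardField Γ) {q : M}
    (hq : q ∈ U) : (rayMap φ Γ x₀ (κ q)).2 ≠ 0 :=
  (isRay_rayFlow hΓ (h.regular.dom _ (h.inv_mem q hq))).ne_zero hΓ
    (right_mem_Icc.2 (h.regular.pos _ (h.inv_mem q hq)).le)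

namespace IsCleaveNhd

variable {U : Set M} {x₁ x₂ : M} {O₁ O₂ : Set (BVec d × ℝ)} {κ₁ κ₂ : M → BVec d × ℝ}

lemma mem_limitSet [T2Space M] (h : IsCleaveNhd φ Γ S U x₁ O₁ κ₁ x₂ O₂ κ₂) (hsp : Splits φ Γ S)
    {q : M}
    (hq : q ∈ U) (hq₂ : rayMap φ Γ x₂ (κ₂ q) ∉ raysOff φ Γ S) :
    (vel (rayMap φ Γ x₁ (κ₁ q)) : TangentSpace (𝓡∂ (d + 1)) q) ∈ limitSet φ Γ S q := by
  by_cases hqS : q ∈ S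
  · rw [(h.isCleavePair ⟨hqS, hq⟩).2.2.1]
    exact Or.inl rfl
  · refine (mem_limitSet_iff_of_notMem hqS).2 ?_
    have e : (⟨q, vel (rayMap φ Γ x₁ (κ₁ q))⟩ : TangentBundle (𝓡∂ (d + 1)) M) = _ := h.tmk_vel hq
    rw [e]
    exact ((h.notMem_iff hsp hq).1 hqS).resolve_right hq₂

/-- The balanced condition, in coordinates: off the points reached by the second field, the
difference of the covectors is nonpositive to first order. -/
lemma eventually_le [T2Space M] [FirstCountableTopology M]
    (h : IsCleaveNhd φ Γ S U x₁ O₁ κ₁ x₂ O₂ κ₂) (hbal : IsBalanced φ Γ S) (hsp : Splits φ Γ S)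
    (hΓ : IsInwardField Γ) (hSi : S ⊆ (𝓡∂ (d + 1)).interior M) {a : M}
    {H : BVec d × ℝ → M} {O : Set (BVec d × ℝ)} (hO : IsOpen O)
    (hH : ContMDiffOn 𝓘(ℝ, BVec d × ℝ) (𝓡∂ (d + 1)) ∞ H O) (hOU : MapsTo H O U)
    (ha : MapsTo H O (extChartAt (𝓡∂ (d + 1)) a).source) {z : BVec d × ℝ} (hz : z ∈ O)
    (hzS : H z ∈ S) {ε : ℝ} (hε : 0 < ε) :
    ∀ᶠ z' in 𝓝 z, rayMap φ Γ x₂ (κ₂ (H z')) ∉ raysOff φ Γ S →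
      pulledCovector φ a (fun q ↦ rayMap φ Γ x₁ (κ₁ q)) (fun q ↦ rayMap φ Γ x₂ (κ₂ q)) H z
          (z' - z) ≤
        ε * ‖z' - z‖ := by
  have hzU := hOU hz
  have hnhd := h.left.isOpen.mem_nhds hzU
  have hev := hbal.eventually_le_param (ψ := H) (z := z) (a := a) hzS (hSi hzS) (ha hz)
    (R₁ := fun q ↦ rayMap φ Γ x₁ (κ₁ q)) (R₂ := fun q ↦ rayMap φ Γ x₂ (κ₂ q))
    (h.left_mem _ ⟨hzS, hzU⟩) (h.right_mem _ ⟨hzS, hzU⟩) (h.left.ne_zero hΓ hzU)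
    (h.right.ne_zero hΓ hzU) (h.left.contMDiffOn_rayMap.continuousOn.continuousAt hnhd)
    (by filter_upwards [hnhd] with q hq using h.left.right_inv q hq)
    (h.right.right_inv _ hzU)
    ((hH.contMDiffAt (hO.mem_nhds hz)).mdifferentiableAt (by simp)) hε
  filter_upwards [hev, hO.mem_nhds hz] with z' h1 h2 h3
  exact h1 (h.mem_limitSet hsp (hOU h2) h3)

/-- In flow coordinates the vectors of `A(S)` from the two fields occupy separated sets. -/
lemma isSeparated [T2Space M] [FirstCountableTopology M]
    (h : IsCleaveNhd φ Γ S U x₁ O₁ κ₁ x₂ O₂ κ₂) (hbal : IsBalanced φ Γ S) (hsp : Splits φ Γ S)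
    (hΓ : IsInwardField Γ) (hS : IsClosed S) (hSi : S ⊆ (𝓡∂ (d + 1)).interior M) {a : M}
    {H : BVec d × ℝ → M} {O : Set (BVec d × ℝ)} (hO : IsOpen O)
    (hH : ContMDiffOn 𝓘(ℝ, BVec d × ℝ) (𝓡∂ (d + 1)) ∞ H O) (hOU : MapsTo H O U)
    (ha : MapsTo H O (extChartAt (𝓡∂ (d + 1)) a).source) {k : BVec d → BVec d × ℝ}
    (hk : ∀ z ∈ O, k z.1 + (0, z.2) ∈ O₁ ∧ H z = (rayMap φ Γ x₁ (k z.1 + (0, z.2))).proj) :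
    IsSeparated O {z ∈ O | rayMap φ Γ x₁ (κ₁ (H z)) ∈ raysOff φ Γ S}
      {z ∈ O | rayMap φ Γ x₂ (κ₂ (H z)) ∈ raysOff φ Γ S}
      (pulledCovector φ a (fun q ↦ rayMap φ Γ x₁ (κ₁ q)) (fun q ↦ rayMap φ Γ x₂ (κ₂ q)) H) := by
  have hmemS : ∀ z ∈ O \ ({z ∈ O | rayMap φ Γ x₁ (κ₁ (H z)) ∈ raysOff φ Γ S} ∪
      {z ∈ O | rayMap φ Γ x₂ (κ₂ (H z)) ∈ raysOff φ Γ S}), H z ∈ S := by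
    rintro z ⟨hz, hn⟩
    by_contra hzS
    rcases (h.notMem_iff hsp (hOU hz)).1 hzS with h1 | h1
    · exact hn (Or.inl ⟨hz, h1⟩)
    · exact hn (Or.inr ⟨hz, h1⟩)
  refine ⟨hO, ?_, ?_, ?_, ?_, ?_, ?_, ?_⟩
  · exact contDiffOn_pulledCovector hO hH hOU ha h.left.right_inv h.right.right_inv
      (fun q hq ↦ h.left.ne_zero hΓ hq) (fun q hq ↦ h.right.ne_zero hΓ hq)
      h.left.contMDiffOn_rayMap h.right.contMDiffOn_rayMap
  · have h1 := hH.continuousOn.isOpen_inter_preimage hO (h.left.isOpen_raysOff hsp hΓ hS hSi)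
    convert h1 using 1
    ext z
    exact ⟨fun hz ↦ ⟨hz.1, hOU hz.1, hz.2⟩, fun hz ↦ ⟨hz.1, hz.2.2⟩⟩
  · have h1 := hH.continuousOn.isOpen_inter_preimage hO (h.right.isOpen_raysOff hsp hΓ hS hSi)
    convert h1 using 1
    ext z
    exact ⟨fun hz ↦ ⟨hz.1, hOU hz.1, hz.2⟩, fun hz ↦ ⟨hz.1, hz.2.2⟩⟩
  · exact disjoint_left.2 fun z h1 h2 ↦ h.not_both hsp (hOU h1.1) h1.2 h2.2
  · -- earlier vectors of a ray of `A(S)` belong to `A(S)`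
    rintro u t t' ⟨hz, hA⟩ hz' htt'
    have hκ : ∀ s, (u, s) ∈ O → rayMap φ Γ x₁ (κ₁ (H (u, s))) =
        rayFlow φ Γ (boundaryParam x₁ (k u).1) ((k u).2 + s) := fun s hs ↦ by
      obtain ⟨h1, h2⟩ := hk _ hs
      rw [h2, h.left.left_inv _ h1, rayMap, Prod.fst_add, Prod.snd_add, add_zero]
    refine ⟨hz', ?_⟩
    rw [hκ t hz] at hA
    rw [hκ t' hz']
    have hd := h.left.regular.dom _ (hk _ hz).1
    have hp := h.left.regular.pos _ (hk _ hz').1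
    rw [Prod.fst_add, Prod.snd_add, add_zero] at hd
    rw [Prod.snd_add] at hp
    exact rayFlow_mem_raysOff hΓ hd hA ⟨hp.le, by linarith⟩
  -- The two one-sided estimates are the balance condition, for each order of the two fields.
  · intro z hz ε hε
    filter_upwards [h.eventually_le hbal hsp hΓ hSi hO hH hOU ha hz.1 (hmemS z hz) hε,
      hO.mem_nhds hz.1] with z' h1 h2 h3
    exact h1 fun hR ↦ h3 ⟨h2, hR⟩
  · intro z hz ε hε
    filter_upwards [h.symm.eventually_le hbal hsp hΓ hSi hO hH hOU ha hz.1 (hmemS z hz) hε,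
      hO.mem_nhds hz.1] with z' h1 h2 h3
    have h4 := h1 fun hR ↦ h3 ⟨h2, hR⟩
    have h5 : pulledCovector φ a (fun q ↦ rayMap φ Γ x₂ (κ₂ q)) (fun q ↦ rayMap φ Γ x₁ (κ₁ q)) H z
        (z' - z) = -pulledCovector φ a (fun q ↦ rayMap φ Γ x₁ (κ₁ q))
          (fun q ↦ rayMap φ Γ x₂ (κ₂ q)) H z (z' - z) := by
      rw [pulledCovector, pulledCovector, ContinuousLinearMap.comp_apply,
        ContinuousLinearMap.comp_apply, _root_.sub_apply, _root_.sub_apply, neg_sub]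
    linarith

end IsCleaveNhd

end FlowGraphExistence

section FlowGraphResult

set_option linter.unusedSectionVars false

variable {d : ℕ} {M : Type*} [TopologicalSpace M] [ChartedSpace (EuclideanHalfSpace (d + 1)) M]
  [IsManifold (𝓡∂ (d + 1)) ∞ M]
variable {φ : FinslerMetric d M} {Γ : (x : M) → TangentSpace (𝓡∂ (d + 1)) x} {S : Set M}

/-- In flow coordinates the vertical lines are integral curves of the field. -/
lemma IsLocalField.hasMFDerivAt_flow [T2Space M] {x₀ : M} {O₀ O : Set (BVec d × ℝ)} {U : Set M}
    {κ : M → BVec d × ℝ} (h : IsLocalField φ Γ x₀ O₀ U κ) (hΓ : IsInwardField Γ)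
    {H : BVec d × ℝ → M} (hO : IsOpen O) {k : BVec d → BVec d × ℝ}
    (hk : ∀ z ∈ O, k z.1 + (0, z.2) ∈ O₀ ∧ H z = (rayMap φ Γ x₀ (k z.1 + (0, z.2))).proj)
    {u : BVec d} {t : ℝ} (hz : (u, t) ∈ O) :
    HasMFDerivAt 𝓘(ℝ, ℝ) (𝓡∂ (d + 1)) (fun t ↦ H (u, t)) t ((1 : ℝ →L[ℝ] ℝ).smulRight
      (vel (rayMap φ Γ x₀ (κ (H (u, t)))) : TangentSpace (𝓡∂ (d + 1)) (H (u, t)))) := by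
  obtain ⟨hz₀, hHz⟩ := hk _ hz
  simp only at hz₀ hHz
  have hP := (h.mdifferentiableAt_proj hz₀).hasMFDerivAt
  set A := mfderiv 𝓘(ℝ, BVec d × ℝ) (𝓡∂ (d + 1)) (fun z ↦ (rayMap φ Γ x₀ z).proj)
    (k u + (0, t)) with hA
  have hAv := h.regular.hasMFDerivAt_vertical hΓ hz₀ hP
  have hline : HasFDerivAt (fun s : ℝ ↦ k u + (0, s)) (ContinuousLinearMap.inr ℝ (BVec d) ℝ) t :=
    (ContinuousLinearMap.inr ℝ (BVec d) ℝ).hasFDerivAt.const_add (k u)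
  have h1 := HasMFDerivAt.comp t hP hline.hasMFDerivAt
  have hev : (fun t ↦ H (u, t)) =ᶠ[𝓝 t]
      (fun z ↦ (rayMap φ Γ x₀ z).proj) ∘ fun s : ℝ ↦ k u + (0, s) := by
    have hc : Continuous fun s : ℝ ↦ (u, s) := by fun_prop
    filter_upwards [hc.continuousAt.preimage_mem_nhds (hO.mem_nhds hz)] with s hs
    exact (hk _ hs).2
  have h2 := h1.congr_of_eventuallyEq hev
  have h3 : rayMap φ Γ x₀ (κ (H (u, t))) = rayMap φ Γ x₀ (k u + (0, t)) := by
    rw [hHz, h.left_inv _ hz₀]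
  have h4 : (show ℝ →L[ℝ] Vec d from A.comp (ContinuousLinearMap.inr ℝ (BVec d) ℝ)) =
      (1 : ℝ →L[ℝ] ℝ).smulRight (vel (rayMap φ Γ x₀ (κ (H (u, t)))) : Vec d) := by
    refine ContinuousLinearMap.ext_ring ?_
    rw [h3, ContinuousLinearMap.smulRight_apply]
    exact hAv.trans (one_smul ℝ _).symm
  exact Eq.mp (congrArg (fun L : ℝ →L[ℝ] Vec d ↦
    HasMFDerivAt 𝓘(ℝ, ℝ) (𝓡∂ (d + 1)) (fun t ↦ H (u, t)) t L) h4) h2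

/-- Near a cleave point `σ 0`, with coordinates along the rays of the first field from a
transversal hypersurface `σ`, the set `S` is a smooth graph tangent to the kernel of the difference
of the duals. -/
lemma IsCleaveNhd.exists_graph [T2Space M] [FirstCountableTopology M]
    {U : Set M} {x₁ x₂ : M} {O₁ O₂ : Set (BVec d × ℝ)} {κ₁ κ₂ : M → BVec d × ℝ}
    (h : IsCleaveNhd φ Γ S U x₁ O₁ κ₁ x₂ O₂ κ₂) (hbal : IsBalanced φ Γ S) (hsp : Splits φ Γ S)
    (hΓ : IsInwardField Γ) (hS : IsClosed S) (hSi : S ⊆ (𝓡∂ (d + 1)).interior M)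
    {σ : BVec d → M} {W : Set (BVec d)} (hW : IsOpen W) (h0W : 0 ∈ W)
    (hσ : ContMDiffOn (𝓡 d) (𝓡∂ (d + 1)) ∞ σ W) (hσU : σ 0 ∈ U) (hσS : σ 0 ∈ S)
    (hinj : Function.Injective (mfderiv (𝓡 d) (𝓡∂ (d + 1)) σ 0))
    (htrans : (vel (rayMap φ Γ x₁ (κ₁ (σ 0))) : TangentSpace (𝓡∂ (d + 1)) (σ 0)) ∉
      range (mfderiv (𝓡 d) (𝓡∂ (d + 1)) σ 0))
    (hne : (φ.dual (a := σ 0) (vel (rayMap φ Γ x₁ (κ₁ (σ 0)))) -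
      φ.dual (a := σ 0) (vel (rayMap φ Γ x₂ (κ₂ (σ 0))))) (vel (rayMap φ Γ x₁ (κ₁ (σ 0)))) ≠ 0) :
    ∃ (V : Set (BVec d)) (δ : ℝ) (H : OpenPartialHomeomorph (BVec d × ℝ) M) (g : BVec d → ℝ),
      IsGraphIn S V δ H g ∧ 0 ∈ V ∧ 0 < δ ∧ H.target ⊆ U ∧ (∀ u ∈ V, H (u, 0) = σ u) ∧
      (∀ u ∈ V, IsMIntegralCurveOn (I := 𝓡∂ (d + 1)) (fun t ↦ H (u, t))
        (fun q ↦ vel (rayMap φ Γ x₁ (κ₁ q))) (Ioo (-δ) δ)) ∧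
      ∀ u ∈ V, ∀ v : BVec d, (φ.dual (a := H (u, g u)) (vel (rayMap φ Γ x₁ (κ₁ (H (u, g u))))) -
        φ.dual (a := H (u, g u)) (vel (rayMap φ Γ x₂ (κ₂ (H (u, g u))))))
          (mfderiv (𝓡 d) (𝓡∂ (d + 1)) (fun u ↦ H (u, g u)) u v) = 0 := by
  obtain ⟨H, h0H, hHU, hHs, hHs', hHσ⟩ := h.left.exists_flowCoordinates hΓ hW h0W hσ hσU hinj htrans
  set a := σ 0 with ha
  have hH0 : H 0 = a := by
    rw [(hHσ 0 h0H).2.2.2]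
    have e : κ₁ (σ (0 : BVec d × ℝ).1) + (0, (0 : BVec d × ℝ).2) = κ₁ a := add_zero _
    rw [e, h.left.right_inv _ hσU]
  set O := H.source ∩ H ⁻¹' (extChartAt (𝓡∂ (d + 1)) a).source with hO
  have hOo : IsOpen O := H.continuousOn.isOpen_inter_preimage H.open_source
      (isOpen_extChartAt_source _)
  have hHO : ContMDiffOn 𝓘(ℝ, BVec d × ℝ) (𝓡∂ (d + 1)) ∞ H O := hHs.mono inter_subset_left
  have hOU : MapsTo H O U := fun z hz ↦ hHU (H.map_source hz.1)
  have hOa : MapsTo H O (extChartAt (𝓡∂ (d + 1)) a).source := fun z hz ↦ hz.2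
  have hk : ∀ z ∈ O, κ₁ (σ z.1) + (0, z.2) ∈ O₁ ∧
      H z = (rayMap φ Γ x₁ (κ₁ (σ z.1) + (0, z.2))).proj := fun z hz ↦ (hHσ z hz.1).2.2
  have hflow : ∀ u t, (u, t) ∈ O → _ := fun u t hut ↦ h.left.hasMFDerivAt_flow hΓ hOo
    (k := fun u ↦ κ₁ (σ u)) hk hut
  have hsep := h.isSeparated hbal hsp hΓ hS hSi hOo hHO hOU hOa (k := fun u ↦ κ₁ (σ u)) hk
  set A := {z ∈ O | rayMap φ Γ x₁ (κ₁ (H z)) ∈ raysOff φ Γ S} with hA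
  set B := {z ∈ O | rayMap φ Γ x₂ (κ₂ (H z)) ∈ raysOff φ Γ S} with hB
  -- The points of `S` are those not reached by either field.
  have hS_iff : ∀ z ∈ O, H z ∈ S ↔ z ∉ A ∪ B := by
    intro z hz
    rw [← not_iff_not, not_not, h.notMem_iff hsp (hOU hz)]
    exact ⟨fun h' ↦ h'.imp (fun h1 ↦ ⟨hz, h1⟩) fun h1 ↦ ⟨hz, h1⟩,
      fun h' ↦ h'.imp (fun h1 ↦ h1.2) fun h1 ↦ h1.2⟩
  have hdiff : ∀ z ∈ O, HasMFDerivAt 𝓘(ℝ, BVec d × ℝ) (𝓡∂ (d + 1)) H z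
      (mfderiv 𝓘(ℝ, BVec d × ℝ) (𝓡∂ (d + 1)) H z) := fun z hz ↦
    ((hHO.contMDiffAt (hOo.mem_nhds hz)).mdifferentiableAt (by simp)).hasMFDerivAt
  have h0O : (0 : BVec d × ℝ) ∈ O :=
    ⟨h0H, by rw [mem_preimage, hH0]; exact mem_extChartAt_source _⟩
  have hcov : ∀ z ∈ O, ∀ v, _ := fun z hz v ↦ pulledCovector_apply (φ := φ) (a := a)
    (R₁ := fun q ↦ rayMap φ Γ x₁ (κ₁ q)) (R₂ := fun q ↦ rayMap φ Γ x₂ (κ₂ q)) (H := H) (z := z)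
    hz.2 (h.left.right_inv _ (hOU hz)) (h.right.right_inv _ (hOU hz))
    (h.left.ne_zero hΓ (hOU hz)) (h.right.ne_zero hΓ (hOU hz)) (hdiff z hz) v
  have hne0 : pulledCovector φ a (fun q ↦ rayMap φ Γ x₁ (κ₁ q)) (fun q ↦ rayMap φ Γ x₂ (κ₂ q)) H 0
      (0, 1) ≠ 0 := by
    have hvert : (show BVec d × ℝ →L[ℝ] Vec d from mfderiv 𝓘(ℝ, BVec d × ℝ) (𝓡∂ (d + 1)) H 0)
        (0, 1) = vel (rayMap φ Γ x₁ (κ₁ (H 0))) := by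
      have hline : HasFDerivAt (fun s : ℝ ↦ ((0 : BVec d), s))
        (ContinuousLinearMap.inr ℝ (BVec d) ℝ) 0 :=
        (ContinuousLinearMap.inr ℝ (BVec d) ℝ).hasFDerivAt
      have h1 := HasMFDerivAt.comp (f := fun s : ℝ ↦ ((0 : BVec d), s)) (g := H) (0 : ℝ)
        (hdiff 0 h0O) hline.hasMFDerivAt
      have h2 := hasMFDerivAt_unique h1 (hflow 0 0 h0O)
      have h3 := congrArg (fun L : ℝ →L[ℝ] Vec d ↦ L 1) h2
      exact h3.trans (one_smul ℝ _)
    rw [hcov 0 h0O, hvert, hH0]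
    exact hne
  obtain ⟨V, δ, g, hV, h0V, hδ, hbox, hg, hgI, hgr, htan⟩ := hsep.exists_graph
    ⟨h0O, (hS_iff 0 h0O).1 (by rw [hH0]; exact hσS)⟩ hne0
  have hboxo : IsOpen (V ×ˢ Ioo (-δ) δ) := hV.prod isOpen_Ioo
  set K := H.restrOpen (V ×ˢ Ioo (-δ) δ) hboxo with hK
  have hKs : K.source = V ×ˢ Ioo (-δ) δ := by
    rw [hK, OpenPartialHomeomorph.restrOpen_source]
    exact inter_eq_right.2 fun z hz ↦ (hbox hz).1
  have hKH : ∀ z, K z = H z := fun z ↦ rfl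
  have hKt : K.target ⊆ H.target := fun q hq ↦ by
    rw [← K.right_inv hq, hKH]
    have h1 := K.map_target hq
    rw [hKs] at h1
    exact H.map_source (hbox h1).1
  have hgO : ∀ u ∈ V, (u, g u) ∈ O := fun u hu ↦ hbox ⟨hu, hgI hu⟩
  refine ⟨V, δ, K, g, ⟨hV, hKs, ?_, hHs'.mono hKt, hg, hgI, ?_⟩, h0V, hδ, hKt.trans hHU, ?_, ?_, ?_⟩
  · rw [hKs]
    exact hHO.mono hbox
  · ext q
    constructor
    · rintro ⟨hqS, hq⟩
      have h1 := K.map_target hq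
      rw [hKs] at h1
      have h2 : H (K.symm q) = q := K.right_inv hq
      rw [← h2] at hqS
      have h3 := (hgr _ h1.1 _ h1.2).1 ((hS_iff _ (hbox h1)).1 hqS)
      refine ⟨(K.symm q).1, h1.1, ?_⟩
      change H ((K.symm q).1, g (K.symm q).1) = q
      rw [← h3]
      exact h2
    · rintro ⟨u, hu, rfl⟩
      have hmem : (u, g u) ∈ K.source := by rw [hKs]; exact ⟨hu, hgI hu⟩
      exact ⟨(hS_iff _ (hgO u hu)).2 ((hgr u hu _ (hgI hu)).2 rfl), K.map_source hmem⟩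
  · intro u hu
    have hu0 : (u, (0 : ℝ)) ∈ O := hbox ⟨hu, by constructor <;> linarith⟩
    have h1 := hHσ _ hu0.1
    rw [hKH, h1.2.2.2]
    have e : κ₁ (σ u) + (0, (0 : ℝ)) = κ₁ (σ u) := add_zero _
    simp only
    rw [e, h.left.right_inv _ h1.2.1]
  · intro u hu t ht
    exact (hflow u t (hbox ⟨hu, ht⟩)).hasMFDerivWithinAt
  · intro u hu v
    obtain ⟨L, hL, hLv⟩ := htan u hu
    have hLg : HasFDerivAt (fun u ↦ (u, g u)) ((ContinuousLinearMap.id ℝ (BVec d)).prod L) u :=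
      (hasFDerivAt_id u).prodMk hL
    have h1 := HasMFDerivAt.comp (f := fun u ↦ (u, g u)) (g := H) u (hdiff _ (hgO u hu))
      hLg.hasMFDerivAt
    have h2 : mfderiv (𝓡 d) (𝓡∂ (d + 1)) (fun u ↦ H (u, g u)) u = _ := h1.mfderiv
    have h3 := hLv v
    rw [hcov _ (hgO u hu)] at h3
    change (φ.dual (a := H (u, g u)) (vel (rayMap φ Γ x₁ (κ₁ (H (u, g u))))) -
        φ.dual (a := H (u, g u)) (vel (rayMap φ Γ x₂ (κ₂ (H (u, g u))))))
          (mfderiv (𝓡 d) (𝓡∂ (d + 1)) (fun u ↦ H (u, g u)) u v) = 0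
    rw [h2]
    exact h3

end FlowGraphResult

section GraphCharts

set_option linter.unusedSectionVars false

variable {d : ℕ} {M : Type*} [TopologicalSpace M] [ChartedSpace (EuclideanHalfSpace (d + 1)) M]
  [IsManifold (𝓡∂ (d + 1)) ∞ M]

/-! ### A set that is locally a graph is an embedded hypersurface -/

namespace IsGraphIn

variable {C : Set M} {V V' : Set (BVec d)} {δ δ' : ℝ} {H H' : OpenPartialHomeomorph (BVec d × ℝ) M}
  {g g' : BVec d → ℝ}

lemma mem_source (h : IsGraphIn C V δ H g) {u : BVec d} (hu : u ∈ V) : (u, g u) ∈ H.source := by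
  rw [h.source_eq]; exact ⟨hu, h.mapsTo hu⟩

lemma mem_target (h : IsGraphIn C V δ H g) {u : BVec d} (hu : u ∈ V) : H (u, g u) ∈ H.target :=
  H.map_source (h.mem_source hu)

lemma mem (h : IsGraphIn C V δ H g) {u : BVec d} (hu : u ∈ V) : H (u, g u) ∈ C := by
  have : H (u, g u) ∈ C ∩ H.target := by rw [h.inter_target]; exact ⟨u, hu, rfl⟩
  exact this.1

lemma symm_eq (h : IsGraphIn C V δ H g) {q : M} (hq : q ∈ C) (hqt : q ∈ H.target) :
    (H.symm q).1 ∈ V ∧ H ((H.symm q).1, g (H.symm q).1) = q := by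
  have h1 : q ∈ C ∩ H.target := ⟨hq, hqt⟩
  rw [h.inter_target] at h1
  obtain ⟨u, hu, rfl⟩ := h1
  simp only [H.left_inv (h.mem_source hu)]
  exact ⟨hu, trivial⟩

lemma contMDiffOn_graph (h : IsGraphIn C V δ H g) :
    ContMDiffOn (𝓡 d) (𝓡∂ (d + 1)) ∞ (fun u ↦ H (u, g u)) V :=
  h.smooth.comp (contDiffOn_id.prodMk h.smooth_graph).contMDiffOn fun _ hu ↦ h.mem_source hu

open Classical in
/-- The chart of `C` that projects the graph along the vertical lines. -/
noncomputable def chart (h : IsGraphIn C V δ H g) (p : C) : OpenPartialHomeomorph C (BVec d) where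
  toFun q := (H.symm q).1
  invFun u := if hu : u ∈ V then ⟨H (u, g u), h.mem hu⟩ else p
  source := Subtype.val ⁻¹' H.target
  target := V
  map_source' q hq := (h.symm_eq q.2 hq).1
  map_target' u hu := by
    rw [dif_pos hu]; exact h.mem_target hu
  left_inv' q hq := by
    rw [dif_pos (h.symm_eq q.2 hq).1]
    exact Subtype.ext (h.symm_eq q.2 hq).2
  right_inv' u hu := by
    rw [dif_pos hu]
    simp only [H.left_inv (h.mem_source hu)]
  open_source := H.open_target.preimage continuous_subtype_val
  open_target := h.isOpen
  continuousOn_toFun := by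
    have h1 : ContinuousOn (fun q : C ↦ H.symm q) (Subtype.val ⁻¹' H.target) :=
      H.continuousOn_symm.comp continuous_subtype_val.continuousOn fun q hq ↦ hq
    exact continuous_fst.comp_continuousOn h1
  continuousOn_invFun := by
    refine Topology.IsInducing.subtypeVal.continuousOn_iff.2 ?_
    refine h.contMDiffOn_graph.continuousOn.congr fun u hu ↦ ?_
    rw [Function.comp_apply, dif_pos hu]

lemma chart_apply (h : IsGraphIn C V δ H g) (p q : C) : h.chart p q = (H.symm q).1 := rfl

lemma chart_symm_apply (h : IsGraphIn C V δ H g) (p : C) {u : BVec d} (hu : u ∈ V) :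
    ((h.chart p).symm u : M) = H (u, g u) := by
  exact congrArg Subtype.val (dif_pos hu)

lemma contDiffOn_transition (h : IsGraphIn C V δ H g) (h' : IsGraphIn C V' δ' H' g') (p p' : C) :
    ContDiffOn ℝ ∞ ((h.chart p).symm ≫ₕ h'.chart p') ((h.chart p).symm ≫ₕ h'.chart p').source := by
  rw [OpenPartialHomeomorph.trans_source]
  have hsub : ∀ u ∈ (h.chart p).symm.source ∩ (h.chart p).symm ⁻¹' (h'.chart p').source,
      u ∈ V ∧ H (u, g u) ∈ H'.target := by
    rintro u ⟨hu, hu'⟩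
    have hu'' : ((h.chart p).symm u : M) ∈ H'.target := hu'
    rw [h.chart_symm_apply p hu] at hu''
    exact ⟨hu, hu''⟩
  have h1 : ContDiffOn ℝ ∞ (fun u ↦ H'.symm (H (u, g u)))
      ((h.chart p).symm.source ∩ (h.chart p).symm ⁻¹' (h'.chart p').source) :=
    (h'.smooth_symm.comp (h.contMDiffOn_graph.mono fun u hu ↦ (hsub u hu).1)
      fun u hu ↦ (hsub u hu).2).contDiffOn
  refine (contDiff_fst.comp_contDiffOn h1).congr fun u hu ↦ ?_
  rw [OpenPartialHomeomorph.coe_trans, Function.comp_apply, chart_apply,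
    h.chart_symm_apply p (hsub u hu).1]
  rfl

lemma mfderiv_graph_injective (h : IsGraphIn C V δ H g) {u : BVec d} (hu : u ∈ V) :
    Function.Injective (mfderiv (𝓡 d) (𝓡∂ (d + 1)) (fun u ↦ H (u, g u)) u) := by
  have h1 : MDifferentiableAt (𝓡 d) (𝓡∂ (d + 1)) (fun u ↦ H (u, g u)) u :=
    (h.contMDiffOn_graph.contMDiffAt (h.isOpen.mem_nhds hu)).mdifferentiableAt (by simp)
  have h2 : MDifferentiableAt (𝓡∂ (d + 1)) (𝓡 d) (fun q ↦ (H.symm q).1) (H (u, g u)) := by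
    have h3 := h.smooth_symm.contMDiffAt (H.open_target.mem_nhds (h.mem_target hu))
    exact (contDiff_fst.contMDiff.contMDiffAt.comp _ h3).mdifferentiableAt (by simp)
  have h3 : (fun q ↦ (H.symm q).1) ∘ (fun u ↦ H (u, g u)) =ᶠ[𝓝 u] id := by
    filter_upwards [h.isOpen.mem_nhds hu] with u' hu'
    rw [Function.comp_apply, H.left_inv (h.mem_source hu')]; rfl
  have h4 := HasMFDerivAt.comp u h2.hasMFDerivAt h1.hasMFDerivAt
  have h5 := (hasMFDerivAt_id (I := 𝓡 d) u).congr_of_eventuallyEq h3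
  have h6 := hasMFDerivAt_unique h4 h5
  intro v w hvw
  have hv := congrArg (fun A : BVec d →L[ℝ] BVec d ↦ A v) h6
  have hw := congrArg (fun A : BVec d →L[ℝ] BVec d ↦ A w) h6
  exact hv.symm.trans ((congrArg _ hvw).trans hw)

end IsGraphIn

section Atlas

variable {C : Set M} {V : C → Set (BVec d)} {δ : C → ℝ}
  {H : C → OpenPartialHomeomorph (BVec d × ℝ) M} {g : C → BVec d → ℝ}

/-- The atlas of graph charts. -/
@[reducible]
noncomputable def graphChartedSpace (hG : ∀ p, IsGraphIn C (V p) (δ p) (H p) (g p))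
    (hp : ∀ p : C, (p : M) ∈ (H p).target) : ChartedSpace (EuclideanSpace ℝ (Fin d)) C where
  atlas := range fun p ↦ (hG p).chart p
  chartAt p := (hG p).chart p
  mem_chart_source p := hp p
  chart_mem_atlas p := ⟨p, rfl⟩

lemma isManifold_graph (hG : ∀ p, IsGraphIn C (V p) (δ p) (H p) (g p))
    (hp : ∀ p : C, (p : M) ∈ (H p).target) :
    letI := graphChartedSpace hG hp
    IsManifold (𝓡 d) ∞ C := by
  let _ := graphChartedSpace hG hp
  refine isManifold_of_contDiffOn (𝓡 d) ∞ C ?_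
  rintro _ _ ⟨p, rfl⟩ ⟨p', rfl⟩
  have := (hG p).contDiffOn_transition (hG p') p p'
  simpa using this

/-- Near `p`, the inclusion factors through the graph parametrization and a chart. -/
lemma exists_hasMFDerivAt_val (hG : ∀ p, IsGraphIn C (V p) (δ p) (H p) (g p))
    (hp : ∀ p : C, (p : M) ∈ (H p).target) (p : C) :
    letI := graphChartedSpace hG hp
    ContMDiffAt (𝓡 d) (𝓡∂ (d + 1)) ∞ (Subtype.val : C → M) p ∧ ∃ u ∈ V p, H p (u, g p u) = p ∧
      ∃ c : BVec d →L[ℝ] BVec d, Function.Injective c ∧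
        (show BVec d →L[ℝ] Vec d from mfderiv (𝓡 d) (𝓡∂ (d + 1)) (Subtype.val : C → M) p) =
        (show BVec d →L[ℝ] Vec d from
          mfderiv (𝓡 d) (𝓡∂ (d + 1)) (fun u ↦ H p (u, g p u)) u).comp c := by
  let _ := graphChartedSpace hG hp
  have hM := isManifold_graph hG hp
  have hM1 : IsManifold (𝓡 d) 1 C := IsManifold.of_le (n := ∞) (by norm_cast)
  have hu := (hG p).symm_eq p.2 (hp p)
  set u := ((H p).symm p).1 with hu'
  have hc : extChartAt (𝓡 d) p p = u := rfl
  have hval : (Subtype.val : C → M) =ᶠ[𝓝 p]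
      (fun u ↦ H p (u, g p u)) ∘ extChartAt (𝓡 d) p := by
    filter_upwards [extChartAt_source_mem_nhds (I := 𝓡 d) p] with q hq
    rw [extChartAt_source] at hq
    exact ((hG p).symm_eq q.2 hq).2.symm
  have hgs : ContMDiffAt (𝓡 d) (𝓡∂ (d + 1)) ∞ (fun u ↦ H p (u, g p u)) (extChartAt (𝓡 d) p p) :=
    (hG p).contMDiffOn_graph.contMDiffAt ((hG p).isOpen.mem_nhds hu.1)
  have hcs : ContMDiffAt (𝓡 d) (𝓡 d) ∞ (extChartAt (𝓡 d) p) p := contMDiffAt_extChartAt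
  refine ⟨(hgs.comp p hcs).congr_of_eventuallyEq hval, u, hu.1, hu.2,
    mfderiv (𝓡 d) (𝓡 d) (extChartAt (𝓡 d) p) p, ?_, ?_⟩
  · exact (isInvertible_mfderiv_extChartAt (mem_extChartAt_source p)).injective
  · have h1 := HasMFDerivAt.comp p (hgs.mdifferentiableAt (by simp)).hasMFDerivAt
      (hcs.mdifferentiableAt (by simp)).hasMFDerivAt
    exact (h1.congr_of_eventuallyEq hval).mfderiv

end Atlas

end GraphCharts

section CleaveGraph

set_option linter.unusedSectionVars false

variable {d : ℕ} {M : Type*} [TopologicalSpace M] [ChartedSpace (EuclideanHalfSpace (d + 1)) M]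
  [IsManifold (𝓡∂ (d + 1)) ∞ M]
variable {φ : FinslerMetric d M} {Γ : (x : M) → TangentSpace (𝓡∂ (d + 1)) x} {S : Set M}

/-! ### The hypersurface of cleave points -/

lemma IsLocalField.mfderiv_proj_injective {x₀ : M} {O : Set (BVec d × ℝ)} {U : Set M}
    {κ : M → BVec d × ℝ} (h : IsLocalField φ Γ x₀ O U κ) {z : BVec d × ℝ} (hz : z ∈ O) :
    Function.Injective
      (mfderiv 𝓘(ℝ, BVec d × ℝ) (𝓡∂ (d + 1)) (fun z ↦ (rayMap φ Γ x₀ z).proj) z) := by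
  have h1 := h.mdifferentiableAt_proj hz
  have h2 : MDifferentiableAt (𝓡∂ (d + 1)) 𝓘(ℝ, BVec d × ℝ) κ (rayMap φ Γ x₀ z).proj :=
    (h.smooth.contMDiffAt (h.isOpen.mem_nhds (h.map_mem z hz))).mdifferentiableAt (by simp)
  have h3 : κ ∘ (fun z ↦ (rayMap φ Γ x₀ z).proj) =ᶠ[𝓝 z] id := by
    filter_upwards [h.regular.isOpen.mem_nhds hz] with w hw using h.left_inv w hw
  have h4 := HasMFDerivAt.comp z h2.hasMFDerivAt h1.hasMFDerivAt
  have h5 := (hasMFDerivAt_id (I := 𝓘(ℝ, BVec d × ℝ)) z).congr_of_eventuallyEq h3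
  have h6 := hasMFDerivAt_unique h4 h5
  intro v w hvw
  have hv := congrArg (fun A : BVec d × ℝ →L[ℝ] BVec d × ℝ ↦ A v) h6
  have hw := congrArg (fun A : BVec d × ℝ →L[ℝ] BVec d × ℝ ↦ A w) h6
  exact hv.symm.trans ((congrArg _ hvw).trans hw)

/-- Following the rays of a local field for a constant time gives transversal hypersurfaces. -/
lemma IsLocalField.exists_transversal [T2Space M] {x₀ : M} {O : Set (BVec d × ℝ)} {U : Set M}
    {κ : M → BVec d × ℝ} (h : IsLocalField φ Γ x₀ O U κ) (hΓ : IsInwardField Γ) {p : M}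
    (hp : p ∈ U) :
    ∃ (σ : BVec d → M) (W : Set (BVec d)), IsOpen W ∧ 0 ∈ W ∧ ContMDiffOn (𝓡 d) (𝓡∂ (d + 1)) ∞ σ W ∧
      σ 0 = p ∧ Function.Injective (mfderiv (𝓡 d) (𝓡∂ (d + 1)) σ 0) ∧
      (vel (rayMap φ Γ x₀ (κ (σ 0))) : TangentSpace (𝓡∂ (d + 1)) (σ 0)) ∉
        range (mfderiv (𝓡 d) (𝓡∂ (d + 1)) σ 0) := by
  set ι : BVec d → BVec d × ℝ := fun u ↦ κ p + ContinuousLinearMap.inl ℝ (BVec d) ℝ u with hι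
  have hιs : ContDiff ℝ ∞ ι := contDiff_const.add (ContinuousLinearMap.inl ℝ (BVec d) ℝ).contDiff
  have hι0 : ι 0 = κ p := by rw [hι]; simp only [map_zero, add_zero]
  set σ : BVec d → M := fun u ↦ (rayMap φ Γ x₀ (ι u)).proj with hσ
  have hσ0 : σ 0 = p := by rw [hσ]; simp only [hι0]; exact h.right_inv p hp
  have h0 : ι 0 ∈ O := by rw [hι0]; exact h.inv_mem p hp
  have hP := (h.mdifferentiableAt_proj h0).hasMFDerivAt
  have hinj := h.mfderiv_proj_injective h0
  have hv := h.regular.hasMFDerivAt_vertical hΓ h0 hP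
  set A : BVec d × ℝ →L[ℝ] Vec d :=
    mfderiv 𝓘(ℝ, BVec d × ℝ) (𝓡∂ (d + 1)) (fun z ↦ (rayMap φ Γ x₀ z).proj) (ι 0) with hA
  have hιd : HasFDerivAt ι (ContinuousLinearMap.inl ℝ (BVec d) ℝ) 0 :=
    (ContinuousLinearMap.inl ℝ (BVec d) ℝ).hasFDerivAt.const_add _
  have hσd : (show BVec d →L[ℝ] Vec d from mfderiv (𝓡 d) (𝓡∂ (d + 1)) σ 0) =
      A.comp (ContinuousLinearMap.inl ℝ (BVec d) ℝ) :=
    (HasMFDerivAt.comp (0 : BVec d) hP hιd.hasMFDerivAt).mfderiv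
  have hσv : ∀ v : BVec d, (show BVec d →L[ℝ] Vec d from mfderiv (𝓡 d) (𝓡∂ (d + 1)) σ 0) v =
      A (v, 0) := fun v ↦ by rw [hσd]; rfl
  refine ⟨σ, ι ⁻¹' O, h.regular.isOpen.preimage hιs.continuous, h0,
    h.regular.smooth_proj.comp hιs.contMDiff.contMDiffOn fun u hu ↦ hu, hσ0, ?_, ?_⟩
  · intro v w hvw
    have h1 : A (v, 0) = A (w, 0) := (hσv v).symm.trans (Eq.trans hvw (hσv w))
    exact congrArg Prod.fst (hinj h1)
  · rintro ⟨v, hvv⟩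
    have h1 : A (v, 0) = vel (rayMap φ Γ x₀ (κ (σ 0))) := (hσv v).symm.trans hvv
    rw [hσ0, ← hι0, ← hv] at h1
    exact zero_ne_one (congrArg Prod.snd (hinj h1))

lemma IsCleavePair.symm {p : M} {X₁ X₂ : TangentSpace (𝓡∂ (d + 1)) p}
    (h : IsCleavePair φ Γ S p X₁ X₂) : IsCleavePair φ Γ S p X₂ X₁ :=
  ⟨h.1, h.2.1.symm, h.2.2.1.trans (pair_comm _ _), h.2.2.2.2, h.2.2.2.1⟩

lemma IsCleavePair.eq_or_eq {p : M} {X₁ X₂ Y₁ Y₂ : TangentSpace (𝓡∂ (d + 1)) p}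
    (h : IsCleavePair φ Γ S p X₁ X₂) (h' : IsCleavePair φ Γ S p Y₁ Y₂) :
    X₁ = Y₁ ∧ X₂ = Y₂ ∨ X₁ = Y₂ ∧ X₂ = Y₁ :=
  pair_eq_pair_iff.1 (h.2.2.1.symm.trans h'.2.2.1)

lemma IsNonfocal.ne_zero [T2Space M] (hΓ : IsInwardField Γ) {p : M}
    {X : TangentSpace (𝓡∂ (d + 1)) p}
    (h : IsNonfocal φ Γ ⟨p, X⟩) : X ≠ 0 := by
  obtain ⟨x, T, hd, hX, -⟩ := h
  have hR := isRay_rayFlow hΓ hd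
  have h1 := hR.ne_zero hΓ (right_mem_Icc.2 hR.2.1)
  rw [hX] at h1
  exact h1

lemma IsNonfocal.toFun_eq_one [T2Space M] (hΓ : IsInwardField Γ)
    (hone : ∀ x ∈ (𝓡∂ (d + 1)).boundary M, φ.toFun ⟨x, Γ x⟩ = 1) {y : TangentBundle (𝓡∂ (d + 1)) M}
    (h : IsNonfocal φ Γ y) : φ.toFun y = 1 := by
  obtain ⟨x, T, hd, hX, -⟩ := h
  have hR := isRay_rayFlow hΓ hd
  have h1 := hR.toFun_eq hΓ (right_mem_Icc.2 hR.2.1)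
  rw [hX] at h1
  exact h1.trans (hone x hR.1)

lemma IsCleavePair.dual_sub_ne_zero_or [T2Space M] (hΓ : IsInwardField Γ) {p : M}
    {X₁ X₂ : TangentSpace (𝓡∂ (d + 1)) p} (h : IsCleavePair φ Γ S p X₁ X₂) :
    (φ.dual X₁ - φ.dual X₂) X₁ ≠ 0 ∨ (φ.dual X₁ - φ.dual X₂) X₂ ≠ 0 := by
  by_contra! hcon
  have := dual_sub_pos φ (q := p) (V := X₁) (W := X₂) (h.2.2.2.1.ne_zero hΓ)
      (h.2.2.2.2.ne_zero hΓ) h.2.1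
  exact lt_irrefl (0 : ℝ) (this.trans_eq (by
    refine (congrArg₂ (· - ·) hcon.1 hcon.2).trans (sub_self 0)))

lemma IsCleavePair.dual_sub_self_ne_zero [T2Space M] (hΓ : IsInwardField Γ)
    (hone : ∀ x ∈ (𝓡∂ (d + 1)).boundary M, φ.toFun ⟨x, Γ x⟩ = 1) {p : M}
    {X₁ X₂ : TangentSpace (𝓡∂ (d + 1)) p} (h : IsCleavePair φ Γ S p X₁ X₂) :
    (φ.dual X₁ - φ.dual X₂) X₁ ≠ 0 :=
  (dual_sub_self_pos φ (q := p) (V := X₁) (W := X₂) (h.2.2.2.1.ne_zero hΓ)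
      (h.2.2.2.2.ne_zero hΓ) h.2.1
    ((h.2.2.2.1.toFun_eq_one hΓ hone).trans (h.2.2.2.2.toFun_eq_one hΓ hone).symm)).ne'

lemma dual_sub_swap_apply {p : M} (X₁ X₂ v : TangentSpace (𝓡∂ (d + 1)) p) :
    (φ.dual X₂ - φ.dual X₁) v = -(φ.dual X₁ - φ.dual X₂) v := by
  have : φ.dual X₂ - φ.dual X₁ = -(φ.dual X₁ - φ.dual X₂) := (neg_sub _ _).symm
  rw [this]
  rfl

lemma IsCleaveNhd.cleaveSet_inter [T2Space M] {U : Set M} {x₁ x₂ : M} {O₁ O₂ : Set (BVec d × ℝ)}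
    {κ₁ κ₂ : M → BVec d × ℝ} (h : IsCleaveNhd φ Γ S U x₁ O₁ κ₁ x₂ O₂ κ₂) {T : Set M} (hT : T ⊆ U) :
    cleaveSet φ Γ S ∩ T = S ∩ T := by
  ext q
  refine and_congr_left fun hq ↦ ⟨?_, fun hqS ↦ ⟨_, _, h.isCleavePair ⟨hqS, hT hq⟩⟩⟩
  rintro ⟨X₁, X₂, hX⟩
  exact hX.1

/-- Around each cleave point the cleave set is a graph, tangent to the kernel of the difference of
the duals of the two limit vectors. -/
lemma IsCleavePair.exists_graph [T2Space M] [FirstCountableTopology M]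
    (hcompact : IsCompact ((𝓡∂ (d + 1)).boundary M)) (hsp : IsSplitLocus φ Γ S)
    (hbal : IsBalanced φ Γ S) (hΓ : IsInwardField Γ) (hSi : S ⊆ (𝓡∂ (d + 1)).interior M) {p : M}
    {X₁ X₂ : TangentSpace (𝓡∂ (d + 1)) p} (h : IsCleavePair φ Γ S p X₁ X₂) :
    ∃ (V : Set (BVec d)) (δ : ℝ) (H : OpenPartialHomeomorph (BVec d × ℝ) M) (g : BVec d → ℝ),
      IsGraphIn (cleaveSet φ Γ S) V δ H g ∧ p ∈ H.target ∧
      ∀ u ∈ V, ∀ Y₁ Y₂ : TangentSpace (𝓡∂ (d + 1)) (H (u, g u)),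
        IsCleavePair φ Γ S (H (u, g u)) Y₁ Y₂ → ∀ v : BVec d,
        (φ.dual Y₁ - φ.dual Y₂) (mfderiv (𝓡 d) (𝓡∂ (d + 1)) (fun u ↦ H (u, g u)) u v) = 0 := by
  wlog hne : (φ.dual X₁ - φ.dual X₂) X₁ ≠ 0 generalizing X₁ X₂
  · refine this h.symm ?_
    rw [dual_sub_swap_apply]
    exact neg_ne_zero.2 ((h.dual_sub_ne_zero_or hΓ).resolve_left hne)
  obtain ⟨U, x₁, O₁, κ₁, x₂, O₂, κ₂, hU, hpU, h1, h2⟩ := h.exists_isCleaveNhd hcompact hsp hΓ hSi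
  obtain ⟨σ, W, hW, h0W, hσ, rfl, hinj, htrans⟩ := hU.left.exists_transversal hΓ hpU
  have hS : IsClosed S := by rw [hsp.2]; exact isClosed_closure
  have hv1 : vel (rayMap φ Γ x₁ (κ₁ (σ 0))) = X₁ := congrArg vel h1
  have hv2 : vel (rayMap φ Γ x₂ (κ₂ (σ 0))) = X₂ := congrArg vel h2
  obtain ⟨V, δ, H, g, hG, h0V, hδ, hHU, hH0, -, htan⟩ :=
      hU.exists_graph hbal hsp.1 hΓ hS hSi hW h0W hσ
    hpU h.1 hinj htrans (by rw [hv1, hv2]; exact hne)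
  have hGC : IsGraphIn (cleaveSet φ Γ S) V δ H g :=
    { hG with inter_target := (hU.cleaveSet_inter hHU).trans hG.inter_target }
  refine ⟨V, δ, H, g, hGC, ?_, ?_⟩
  · rw [← hH0 0 h0V]
    refine H.map_source ?_
    rw [hG.source_eq]
    exact ⟨h0V, by constructor <;> linarith⟩
  · intro u hu Y₁ Y₂ hY v
    have hq : H (u, g u) ∈ S ∩ U := ⟨hG.mem hu, hHU (hG.mem_target hu)⟩
    rcases hY.eq_or_eq (hU.isCleavePair hq) with ⟨rfl, rfl⟩ | ⟨rfl, rfl⟩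
    · exact htan u hu v
    · exact (dual_sub_swap_apply (φ := φ) (p := H (u, g u)) _ _ _).trans
        (neg_eq_zero.2 (htan u hu v))

end CleaveGraph

section Conclusion

set_option linter.unusedSectionVars false

variable {d : ℕ} {M : Type*} [TopologicalSpace M] [ChartedSpace (EuclideanHalfSpace (d + 1)) M]
  [IsManifold (𝓡∂ (d + 1)) ∞ M]
variable {φ : FinslerMetric d M} {Γ : (x : M) → TangentSpace (𝓡∂ (d + 1)) x} {S : Set M}

/-- An injective linear map into the kernel of a non-zero linear form, from a space of one dimension
less, is onto the kernel. -/
lemma range_eq_ker_of_injective {A : BVec d →L[ℝ] Vec d} (hA : Function.Injective A)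
    {ℓ : Vec d →L[ℝ] ℝ} (hℓ : ℓ ≠ 0) (hAℓ : ∀ v, ℓ (A v) = 0) (w : Vec d) :
    w ∈ range A ↔ ℓ w = 0 := by
  have h1 : LinearMap.range (A : BVec d →ₗ[ℝ] Vec d) ≤ LinearMap.ker (ℓ : Vec d →ₗ[ℝ] ℝ) := by
    rintro _ ⟨v, rfl⟩
    exact hAℓ v
  have h2 : Module.finrank ℝ (LinearMap.range (A : BVec d →ₗ[ℝ] Vec d)) = d := by
    rw [LinearMap.finrank_range_of_inj hA, finrank_euclideanSpace_fin]
  have h3 := Module.Dual.finrank_ker_add_one_of_ne_zero (f := (ℓ : Vec d →ₗ[ℝ] ℝ))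
    (fun h ↦ hℓ (ContinuousLinearMap.ext fun v ↦ congrArg (fun f : Vec d →ₗ[ℝ] ℝ ↦ f v) h))
  rw [finrank_euclideanSpace_fin] at h3
  have h4 := Submodule.eq_of_le_of_finrank_eq h1 (h2.trans (by omega))
  have h5 : w ∈ LinearMap.range (A : BVec d →ₗ[ℝ] Vec d) ↔ w ∈ LinearMap.ker (ℓ : Vec d →ₗ[ℝ] ℝ) :=
      by
    rw [h4]
  exact h5

/-- The cleave set is an embedded hypersurface. -/
lemma exists_chartedSpace_cleaveSet [T2Space M] [FirstCountableTopology M]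
    (hcompact : IsCompact ((𝓡∂ (d + 1)).boundary M)) (hsp : IsSplitLocus φ Γ S)
    (hbal : IsBalanced φ Γ S) (hΓ : IsInwardField Γ) (hSi : S ⊆ (𝓡∂ (d + 1)).interior M) :
    ∃ _ : ChartedSpace (EuclideanSpace ℝ (Fin d)) (cleaveSet φ Γ S),
      IsManifold (𝓡 d) ∞ (cleaveSet φ Γ S) ∧
      ContMDiff (𝓡 d) (𝓡∂ (d + 1)) ∞ (Subtype.val : cleaveSet φ Γ S → M) ∧
      ∀ (p : cleaveSet φ Γ S) (X₁ X₂ : TangentSpace (𝓡∂ (d + 1)) (p : M)),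
        IsCleavePair φ Γ S p X₁ X₂ →
        Function.Injective (mfderiv (𝓡 d) (𝓡∂ (d + 1)) (Subtype.val : cleaveSet φ Γ S → M) p) ∧
        ∀ v : TangentSpace (𝓡∂ (d + 1)) (p : M),
          (v ∈ range (mfderiv (𝓡 d) (𝓡∂ (d + 1)) (Subtype.val : cleaveSet φ Γ S → M) p) ↔
          (φ.dual X₁ - φ.dual X₂) v = 0) := by
  have hex : ∀ p : cleaveSet φ Γ S, ∃ (V : Set (BVec d)) (δ : ℝ)
      (H : OpenPartialHomeomorph (BVec d × ℝ) M) (g : BVec d → ℝ),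
      IsGraphIn (cleaveSet φ Γ S) V δ H g ∧ (p : M) ∈ H.target ∧
      ∀ u ∈ V, ∀ Y₁ Y₂ : TangentSpace (𝓡∂ (d + 1)) (H (u, g u)),
        IsCleavePair φ Γ S (H (u, g u)) Y₁ Y₂ → ∀ v : BVec d,
        (φ.dual Y₁ - φ.dual Y₂) (mfderiv (𝓡 d) (𝓡∂ (d + 1)) (fun u ↦ H (u, g u)) u v) = 0 := by
    rintro ⟨p, X₁, X₂, hX⟩
    exact hX.exists_graph hcompact hsp hbal hΓ hSi
  choose V δ H g hG hp htan using hex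
  refine ⟨graphChartedSpace hG hp, isManifold_graph hG hp,
    fun p ↦ (exists_hasMFDerivAt_val hG hp p).1, fun p X₁ X₂ hX ↦ ?_⟩
  let _ := graphChartedSpace hG hp
  obtain ⟨-, u, hu, hup, c, hc, hval⟩ := exists_hasMFDerivAt_val hG hp p
  set B : BVec d →L[ℝ] Vec d := mfderiv (𝓡 d) (𝓡∂ (d + 1)) (fun u ↦ H p (u, g p u)) u with hB
  set A : BVec d →L[ℝ] Vec d := mfderiv (𝓡 d) (𝓡∂ (d + 1)) (Subtype.val : cleaveSet φ Γ S → M) p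
    with hA
  have hAB : A = B.comp c := hval
  have hBinj : Function.Injective B := (hG p).mfderiv_graph_injective hu
  have hinj : Function.Injective A := by
    rw [hAB]; exact hBinj.comp hc
  have htan' : ∀ (q : M), H p (u, g p u) = q → ∀ X₁ X₂ : TangentSpace (𝓡∂ (d + 1)) q,
      IsCleavePair φ Γ S q X₁ X₂ → ∀ v : BVec d,
      (show Vec d →L[ℝ] ℝ from φ.dual X₁ - φ.dual X₂) (B v) = 0 := by
    rintro q rfl X₁ X₂ hX v
    exact htan p u hu X₁ X₂ hX v
  have hne : (show Vec d →L[ℝ] ℝ from φ.dual X₁ - φ.dual X₂) ≠ 0 := fun h0 ↦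
    dual_ne φ (q := p) (V := X₁) (W := X₂) (hX.2.2.2.1.ne_zero hΓ) (hX.2.2.2.2.ne_zero hΓ) hX.2.1
      (sub_eq_zero.1 h0)
  exact ⟨hinj, fun v ↦ range_eq_ker_of_injective hinj hne
    (fun v ↦ by rw [hAB]; exact htan' p hup X₁ X₂ hX (c v)) v⟩

end Conclusion

end BalancedSplit

theorem mainTheorem7 {d : ℕ} {M : Type*} [TopologicalSpace M] [T2Space M]
    [SecondCountableTopology M] [ChartedSpace (EuclideanHalfSpace (d + 1)) M]
    [IsManifold (𝓡∂ (d + 1)) ∞ M]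
    (φ : BalancedSplit.FinslerMetric d M)
    (hcompact : IsCompact ((𝓡∂ (d + 1)).boundary M))
    (Γ : (x : M) → TangentSpace (𝓡∂ (d + 1)) x) (hΓ : BalancedSplit.IsInwardField Γ)
    (S : Set M) (hS : S ⊆ (𝓡∂ (d + 1)).interior M)
    (hsplit : BalancedSplit.IsSplitLocus φ Γ S) (hbal : BalancedSplit.IsBalanced φ Γ S) :
    -- the cleave set is an embedded smooth hypersurface tangent to `ker (X̂₁ - X̂₂)`
    (∃ _ : ChartedSpace (EuclideanSpace ℝ (Fin d)) (BalancedSplit.cleaveSet φ Γ S),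
      IsManifold (𝓡 d) ∞ (BalancedSplit.cleaveSet φ Γ S) ∧
      ContMDiff (𝓡 d) (𝓡∂ (d + 1)) ∞ (Subtype.val : BalancedSplit.cleaveSet φ Γ S → M) ∧
      ∀ (p : BalancedSplit.cleaveSet φ Γ S) (X₁ X₂ : TangentSpace (𝓡∂ (d + 1)) (p : M)),
        BalancedSplit.IsCleavePair φ Γ S p X₁ X₂ →
        Function.Injective (mfderiv (𝓡 d) (𝓡∂ (d + 1))
          (Subtype.val : BalancedSplit.cleaveSet φ Γ S → M) p) ∧
        ∀ v : TangentSpace (𝓡∂ (d + 1)) (p : M),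
          (v ∈ range (mfderiv (𝓡 d) (𝓡∂ (d + 1))
            (Subtype.val : BalancedSplit.cleaveSet φ Γ S → M) p) ↔
          (φ.dual X₁ - φ.dual X₂) v = 0)) ∧
    -- local description
    ∀ (p : M) (X₁ X₂ : TangentSpace (𝓡∂ (d + 1)) p), BalancedSplit.IsCleavePair φ Γ S p X₁ X₂ →
      ((φ.dual X₁ - φ.dual X₂) X₁ ≠ 0 ∨ (φ.dual X₁ - φ.dual X₂) X₂ ≠ 0) ∧
      ((∀ x ∈ (𝓡∂ (d + 1)).boundary M, φ.toFun ⟨x, Γ x⟩ = 1) →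
        (φ.dual X₁ - φ.dual X₂) X₁ ≠ 0 ∧ (φ.dual X₁ - φ.dual X₂) X₂ ≠ 0) ∧
      ∃ (U : Set M) (Y₁ Y₂ : (q : M) → TangentSpace (𝓡∂ (d + 1)) q),
        IsOpen U ∧ p ∈ U ∧ Y₁ p = X₁ ∧ Y₂ p = X₂ ∧
        ContMDiffOn (𝓡∂ (d + 1)) (𝓡∂ (d + 1)).tangent ∞
          (fun q ↦ (⟨q, Y₁ q⟩ : TangentBundle (𝓡∂ (d + 1)) M)) U ∧
        ContMDiffOn (𝓡∂ (d + 1)) (𝓡∂ (d + 1)).tangent ∞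
          (fun q ↦ (⟨q, Y₂ q⟩ : TangentBundle (𝓡∂ (d + 1)) M)) U ∧
        (∀ q ∈ U, BalancedSplit.IsNonfocal φ Γ ⟨q, Y₁ q⟩ ∧
          BalancedSplit.IsNonfocal φ Γ ⟨q, Y₂ q⟩ ∧ φ.dual (Y₁ q) ≠ φ.dual (Y₂ q)) ∧
        (∀ q ∈ S ∩ U, BalancedSplit.IsCleavePair φ Γ S q (Y₁ q) (Y₂ q)) ∧
        ((φ.dual X₁ - φ.dual X₂) X₁ ≠ 0 →
          ∀ (σ : EuclideanSpace ℝ (Fin d) → M) (W : Set (EuclideanSpace ℝ (Fin d))),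
            IsOpen W → 0 ∈ W → ContMDiffOn (𝓡 d) (𝓡∂ (d + 1)) ∞ σ W → σ 0 = p →
            Function.Injective (mfderiv (𝓡 d) (𝓡∂ (d + 1)) σ 0) →
            Y₁ (σ 0) ∉ range (mfderiv (𝓡 d) (𝓡∂ (d + 1)) σ 0) →
            BalancedSplit.IsFlowGraph (BalancedSplit.cleaveSet φ Γ S) U Y₁ σ) := by
  refine ⟨BalancedSplit.exists_chartedSpace_cleaveSet hcompact hsplit hbal hΓ hS,
    fun p X₁ X₂ hX ↦ ⟨hX.dual_sub_ne_zero_or hΓ, fun hone ↦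
      ⟨hX.dual_sub_self_ne_zero hΓ hone, ?_⟩, ?_⟩⟩
  · have h1 := hX.symm.dual_sub_self_ne_zero hΓ hone
    rw [BalancedSplit.dual_sub_swap_apply] at h1
    exact neg_ne_zero.1 h1
  obtain ⟨U, x₁, O₁, κ₁, x₂, O₂, κ₂, hU, hpU, h1, h2⟩ :=
    hX.exists_isCleaveNhd hcompact hsplit hΓ hS
  have hSc : IsClosed S := by rw [hsplit.2]; exact isClosed_closure
  have hv1 : BalancedSplit.vel (BalancedSplit.rayMap φ Γ x₁ (κ₁ p)) = X₁ :=
    congrArg BalancedSplit.vel h1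
  have hv2 : BalancedSplit.vel (BalancedSplit.rayMap φ Γ x₂ (κ₂ p)) = X₂ :=
    congrArg BalancedSplit.vel h2
  refine ⟨U, fun q ↦ BalancedSplit.vel (BalancedSplit.rayMap φ Γ x₁ (κ₁ q)),
    fun q ↦ BalancedSplit.vel (BalancedSplit.rayMap φ Γ x₂ (κ₂ q)), hU.left.isOpen, hpU, hv1, hv2,
    hU.left.contMDiffOn_rayMap.congr fun q hq ↦ hU.tmk_vel hq,
    hU.right.contMDiffOn_rayMap.congr fun q hq ↦ hU.symm.tmk_vel hq, fun q hq ↦ ?_,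
    fun q hq ↦ hU.isCleavePair hq, ?_⟩
  · have e₁ := hU.tmk_vel hq
    have e₂ := hU.symm.tmk_vel hq
    have n₁ : BalancedSplit.IsNonfocal φ Γ
        (BalancedSplit.tmk q (BalancedSplit.vel (BalancedSplit.rayMap φ Γ x₁ (κ₁ q)))) := by
      rw [e₁]; exact hU.left.isNonfocal (hU.left.inv_mem q hq)
    have n₂ : BalancedSplit.IsNonfocal φ Γ
        (BalancedSplit.tmk q (BalancedSplit.vel (BalancedSplit.rayMap φ Γ x₂ (κ₂ q)))) := by
      rw [e₂]; exact hU.right.isNonfocal (hU.right.inv_mem q hq)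
    refine ⟨n₁, n₂, BalancedSplit.dual_ne φ (q := q) (n₁.ne_zero hΓ) (n₂.ne_zero hΓ) fun h ↦ ?_⟩
    exact hU.ne q hq (e₁.symm.trans ((congrArg (BalancedSplit.tmk q) h).trans e₂))
  · rintro hne σ W hW h0W hσ rfl hinj htrans
    obtain ⟨V, δ, H, g, hG, h0V, hδ, hHU, hH0, hflow, -⟩ := hU.exists_graph hbal hsplit.1 hΓ hSc hS
      hW h0W hσ hpU hX.1 hinj htrans (by rw [hv1, hv2]; exact hne)
    exact ⟨V, δ, H, g, hG.isOpen, h0V, hδ, hG.source_eq, hHU, hG.smooth, hG.smooth_symm, hH0, hflow,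
      hG.smooth_graph, hG.mapsTo, (hU.cleaveSet_inter hHU).trans hG.inter_target⟩
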